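/- Let $(M,c)$ be an oriented smooth four-dimensional manifold with a conformal structure $c=\{\sigma g\}$, $\sigma>0$, of signature $(2,2)$, and let $V\subset(M,c)$ be a (smooth, immersed) lightlike hypersurface, i.e. a three-dimensional hypersurface whose tangent subspaces are tangent to the isotropic cones of $c$. To a point $x\in V$ we attach frames $\{A_0,\dots,A_5\}$ of the six-dimensional space carrying the normal conformal connection $d$, with $A_0=x$, with scalar products $(A_0,A_5)=(A_1,A_4)=-1$, $(A_2,A_3)=1$ and all others zero, positively oriented and such that $A_1,A_2,A_3$ lie in the tangent subspace of $V$. Then $A_0A_1$ is the isotropic line of $T_x(V)$, and $A_0A_1A_2$, $A_0A_1A_3$ are the $\alpha$- and $\beta$-planes of $T_x(V)$. Write $dA_a=\omega_a^bA_b$, $\omega^i=\omega_0^i$, so that $\omega^4=0$ on $V$, and let $C_{ijkl}$ be the components of the tensor of conformal curvature ($C^i_{jkl}\,\omega^k\wedge\omega^l$ being the curvature forms), $a_0=C_{1212}$, $a_1=C_{1214}$, $b_0=C_{1313}$, $b_1=C_{1314}$. A point $A_B-sA_0$ ($s\in\mathbb C$) of the line $A_0A_B$ of a family of lines is called singular if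 the dimension of the tangent subspace of the family drops there. A frame field is of second order if $A_1$ is the harmonic pole of $A_0$ with respect to the two singular points of the line $A_0A_1$ (real, complex conjugate or coincident; in the last case the pole is the double point); then $\omega_1^3=h_{22}\omega^2$, $\omega_1^2=h_{33}\omega^3$, and there are functions $h_{222},h_{223},h_{233},h_{333}$ with $$dh_{22}+h_{22}(\omega_0^0-2\omega_2^2-\omega_1^1)+2a_0\omega^1=h_{222}\omega^2+h_{223}\omega^3,$$ $$\omega_1^0=h_{22}h_{33}\omega^1-(h_{223}+2a_1)\omega^2-(h_{233}+2b_1)\omega^3,$$ $$dh_{33}+h_{33}(\omega_0^0+2\omega_2^2-\omega_1^1)+2b_0\omega^1=h_{233}\omega^2+h_{333}\omega^3.$$ A field of second-order frames is called canonical if $h_{222}=h_{223}=h_{233}=h_{333}=0$ and if $A_4$ is the harmonic pole of $A_0$ with respect to the two singular points of the line $A_0A_4$ of the isotropic congruence formed by these lines. Let $$D=4(3h_{22}b_0+h_{33}a_0)(h_{22}b_0+3h_{33}a_0).$$ **Theorem 6.** If $D\neq0$ at all points of $V$, then $V$ carries a canonical frame bundle, intrinsically determined by $(M,c)$ and $V$: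 (i) near each point of $V$ there is a smooth field of canonical frames (the conditions holding in all local coordinates and for all metrics of $c$); (ii) the rescalings $A_0,\dots,A_5\mapsto kA_0,\,aA_1,\,bA_2,\,b^{-1}A_3,\,a^{-1}A_4,\,k^{-1}A_5$ with smooth nowhere zero $k,a,b$ take canonical frame fields to canonical frame fields, and any two canonical frame fields on the same open subset of $V$ differ by such a rescaling. Hence the vertices $A_0,\dots,A_5$ are uniquely determined as points, and so are the screen subspace $A_0A_2A_3$ and the normalizing line $A_0A_4$ (an invariant normalization of $V$); (iii) the canonical frames at $x\in V$ are determined by the fourth-order differential neighborhood of $x$: if for two such hypersurfaces $V\subset(M,c)$, $V'\subset(M',c')$ with $D\ne0$, in suitable positively oriented local coordinates, the parametrizations agree at the given points together with their derivatives of orders at most $4$, and metrics $g\in c$, $g'\in c'$ agree there together with their derivatives of orders at most $3$ (the metric itself belonging to the first-order neighborhood), then the canonical frames at these points, written in these coordinates and metrics, are the same. -/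

import Mathlib

open scoped Manifold ContDiff Matrix

universe u v

namespace CO22

noncomputable section

/-! ### Oriented conformal structures of signature (2,2) -/

/-- The matrix of scalar products `(A_i, A_j)` of an isotropic frame; it has signature `(2,2)`. -/
def isotropicGram : Matrix (Fin 4) (Fin 4) ℝ :=
  !![0, 0, 0, -1; 0, 0, 1, 0; 0, 1, 0, 0; -1, 0, 0, 0]

/-- A gauge: a local chart of `M` together with the components of a metric in that chart. -/
structure Gauge (M : Type u) [TopologicalSpace M] where
  chart : OpenPartialHomeomorph M (Fin 4 → ℝ)
  metric : (Fin 4 → ℝ) → Matrix (Fin 4) (Fin 4) ℝ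

/-- Partial derivative `∂_k F` of a function of four variables. -/
def pd (k : Fin 4) (F : (Fin 4 → ℝ) → ℝ) (x : Fin 4 → ℝ) : ℝ :=
  fderiv ℝ F x (Pi.single k 1)

section Gauges
variable {M : Type u} [TopologicalSpace M]

/-- The change of coordinates `x' ↦ x` from the chart of `γ'` to the chart of `γ`. -/
def coordChange (γ γ' : Gauge M) (x' : Fin 4 → ℝ) : Fin 4 → ℝ :=
  γ.chart (γ'.chart.symm x')

/-- The points `x'` of the coordinate domain of `γ'` that are also covered by `γ`. -/
def overlap (γ γ' : Gauge M) : Set (Fin 4 → ℝ) :=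
  (γ'.chart.symm.trans γ.chart).source

/-- The Jacobian matrix `∂x^i / ∂x'^a`. -/
def jacobian (γ γ' : Gauge M) (x' : Fin 4 → ℝ) : Matrix (Fin 4) (Fin 4) ℝ :=
  Matrix.of fun i a => pd a (fun y => coordChange γ γ' y i) x'

/-- On the overlap, the metric of `γ'` is `s²` times the metric of `γ`, with `s > 0` smooth. -/
def IsConformalFactor (γ γ' : Gauge M) (s : (Fin 4 → ℝ) → ℝ) : Prop :=
  ContDiffOn ℝ ∞ s (overlap γ γ') ∧
  ∀ x' ∈ overlap γ γ', 0 < s x' ∧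
    γ'.metric x' = (s x') ^ 2 •
      ((jacobian γ γ' x')ᵀ * γ.metric (coordChange γ γ' x') * jacobian γ γ' x')

end Gauges

/-- An oriented conformal structure `c = CO(2,2)` on a four-dimensional manifold, given by an atlas
of gauges, any two of which differ by a positive conformal factor and an orientation preserving
change of coordinates. (The atlas may be all the metrics `σ g` in all positive charts.) -/
structure ConformalStructure (M : Type u) [TopologicalSpace M] [ChartedSpace (Fin 4 → ℝ) M] where
  gauges : Set (Gauge M)
  chart_mem : ∀ γ ∈ gauges, γ.chart ∈ IsManifold.maximalAtlas 𝓘(ℝ, Fin 4 → ℝ) ∞ M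
  smooth : ∀ γ ∈ gauges, ∀ i j, ContDiffOn ℝ ∞ (fun x => γ.metric x i j) γ.chart.target
  signature : ∀ γ ∈ gauges, ∀ x ∈ γ.chart.target,
    ∃ P : Matrix (Fin 4) (Fin 4) ℝ, P.det ≠ 0 ∧ Pᵀ * γ.metric x * P = isotropicGram
  cover : ∀ x : M, ∃ γ ∈ gauges, x ∈ γ.chart.source
  conformal : ∀ γ ∈ gauges, ∀ γ' ∈ gauges, ∃ s, IsConformalFactor γ γ' s
  oriented : ∀ γ ∈ gauges, ∀ γ' ∈ gauges, ∀ x' ∈ overlap γ γ', 0 < (jacobian γ γ' x').det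

/-! ### The normal conformal connection in a gauge

The space with projectivization `P_x^5` is written in the basis `X, ∂_1, …, ∂_4, Y` defined by a
gauge: `X` is the point `x`, `(X, Y) = -1`, `(∂_i, ∂_j) = g_ij`, and the other scalar products
vanish. Coordinates are numbered `0, 1, …, 5`. -/

section Local
variable (G : (Fin 4 → ℝ) → Matrix (Fin 4) (Fin 4) ℝ)

/-- Christoffel symbols `Γ^i_{jk}`. -/
def christoffel (x : Fin 4 → ℝ) (i j k : Fin 4) : ℝ :=
  (1 / 2) * ∑ l, (G x)⁻¹ i l *
    (pd j (fun y => G y l k) x + pd k (fun y => G y l j) x - pd l (fun y => G y j k) x)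

/-- Riemann tensor `R^i_{jkl}`, where `R(∂_k, ∂_l) ∂_j = R^i_{jkl} ∂_i`. -/
def riemann (x : Fin 4 → ℝ) (i j k l : Fin 4) : ℝ :=
  pd k (fun y => christoffel G y i l j) x - pd l (fun y => christoffel G y i k j) x
    + ∑ m, (christoffel G x i k m * christoffel G x m l j
      - christoffel G x i l m * christoffel G x m k j)

/-- Ricci tensor. -/
def ricci (x : Fin 4 → ℝ) : Matrix (Fin 4) (Fin 4) ℝ :=
  Matrix.of fun j l => ∑ i, riemann G x i j i l

/-- Scalar curvature. -/
def scalarCurvature (x : Fin 4 → ℝ) : ℝ := ∑ j, ∑ l, (G x)⁻¹ j l * ricci G x j l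

/-- Schouten tensor in dimension four. -/
def schouten (x : Fin 4 → ℝ) : Matrix (Fin 4) (Fin 4) ℝ :=
  (1 / 2 : ℝ) • (ricci G x - (scalarCurvature G x / 6) • G x)

/-- The vector `r₀ X + m^i ∂_i + r₅ Y`. -/
def tvec (r₀ : ℝ) (m : Fin 4 → ℝ) (r₅ : ℝ) : Fin 6 → ℝ :=
  ![r₀, m 0, m 1, m 2, m 3, r₅]

/-- The matrix with the given columns. -/
def ofCols (X : Fin 6 → ℝ) (E : Fin 4 → Fin 6 → ℝ) (Y : Fin 6 → ℝ) :
    Matrix (Fin 6) (Fin 6) ℝ :=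
  Matrix.of fun a b => (![X, E 0, E 1, E 2, E 3, Y] b) a

/-- Gram matrix of the basis `X, ∂_1, …, ∂_4, Y`. -/
def gramOf (g : Matrix (Fin 4) (Fin 4) ℝ) : Matrix (Fin 6) (Fin 6) ℝ :=
  ofCols (tvec 0 0 (-1)) (fun j => tvec 0 (fun i => g i j) 0) (tvec (-1) 0 0)

/-- The normal conformal connection form: for the displacement `w`,
`dX = w^i ∂_i`, `d∂_j = -P_{jk} w^k X + Γ^i_{jk} w^k ∂_i + g_{jk} w^k Y`,
`dY = -g^{ij} P_{jk} w^k ∂_i`. Column `b` is the differential of the basis vector number `b`. -/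
def connection (x w : Fin 4 → ℝ) : Matrix (Fin 6) (Fin 6) ℝ :=
  ofCols (tvec 0 w 0)
    (fun j => tvec (-(schouten G x *ᵥ w) j) (fun i => ∑ k, christoffel G x i j k * w k)
      ((G x *ᵥ w) j))
    (tvec 0 (-((G x)⁻¹ *ᵥ (schouten G x *ᵥ w))) 0)

/-- The curvature `dΘ + Θ ∧ Θ` of the connection, evaluated on two vectors. -/
def curvature (x w w' : Fin 4 → ℝ) : Matrix (Fin 6) (Fin 6) ℝ :=
  Matrix.of fun a b =>
    fderiv ℝ (fun y => connection G y w' a b) x w - fderiv ℝ (fun y => connection G y w a b) x w'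
      + (connection G x w * connection G x w' - connection G x w' * connection G x w) a b

end Local

/-- The change of basis of the six-dimensional space between two gauges. Its columns are the basis
vectors of `γ'` written in the basis of `γ`:
`X' = s X`, `∂'_a = s J^i_a ∂_i + (∂'_a s) X`,
`Y' = s⁻¹ Y + J^i_a g'^{ab} (∂'_b s) ∂_i + (1/2) s⁻¹ g'^{ab} (∂'_a s) (∂'_b s) X`. -/
def gaugeChange {M : Type u} [TopologicalSpace M] (γ γ' : Gauge M) (s : (Fin 4 → ℝ) → ℝ)
    (x' : Fin 4 → ℝ) : Matrix (Fin 6) (Fin 6) ℝ :=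
  let ds : Fin 4 → ℝ := fun a => pd a s x'
  let grad : Fin 4 → ℝ := (γ'.metric x')⁻¹ *ᵥ ds
  ofCols (tvec (s x') 0 0)
    (fun a => tvec (ds a) (fun i => s x' * jacobian γ γ' x' i a) 0)
    (tvec ((1 / 2) * (s x')⁻¹ * (grad ⬝ᵥ ds)) (jacobian γ γ' x' *ᵥ grad) (s x')⁻¹)

/-! ### Lightlike hypersurfaces and their moving frames -/

section Hypersurface
variable {M : Type u} [TopologicalSpace M] [ChartedSpace (Fin 4 → ℝ) M]
variable {N : Type v} [TopologicalSpace N] [ChartedSpace (Fin 3 → ℝ) N]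

/-- The differential of a real function on the hypersurface. -/
def differential (h : N → ℝ) (p : N) (w : TangentSpace 𝓘(ℝ, Fin 3 → ℝ) p) : ℝ :=
  mfderiv 𝓘(ℝ, Fin 3 → ℝ) 𝓘(ℝ, ℝ) h p w

/-- The components, in the chart of `γ`, of the image of a tangent vector under `df`. -/
def velocity (γ : Gauge M) (f : N → M) (p : N) (w : TangentSpace 𝓘(ℝ, Fin 3 → ℝ) p) :
    Fin 4 → ℝ :=
  fun i => differential (fun q => γ.chart (f q) i) p w

/-- An immersed hypersurface `f : N → M` is lightlike if its tangent subspaces are tangent to the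
isotropic cones, that is, if the induced metric is degenerate at every point. -/
structure IsLightlikeHypersurface (c : ConformalStructure M) (f : N → M) : Prop where
  smooth : ContMDiff 𝓘(ℝ, Fin 3 → ℝ) 𝓘(ℝ, Fin 4 → ℝ) ∞ f
  immersion : ∀ p, Function.Injective (mfderiv 𝓘(ℝ, Fin 3 → ℝ) 𝓘(ℝ, Fin 4 → ℝ) f p)
  lightlike : ∀ γ ∈ c.gauges, ∀ p, f p ∈ γ.chart.source →
    ∃ w : TangentSpace 𝓘(ℝ, Fin 3 → ℝ) p, w ≠ 0 ∧
      ∀ w' : TangentSpace 𝓘(ℝ, Fin 3 → ℝ) p,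
        velocity γ f p w ⬝ᵥ (γ.metric (γ.chart (f p)) *ᵥ velocity γ f p w') = 0

/-- The `i`-th (`i = 0, …, 3`) of the four middle indices among `0, …, 5`. -/
def mid (i : Fin 4) : Fin 6 := i.succ.castSucc

/-- The family of all fields of frames `{A_0, …, A_5}` along `f` over a subset `O`: in each gauge,
a matrix-valued function whose column number `a` is the vector `A_a`; the matrices in different
gauges represent the same vectors; `A_0` is the point `x`; the scalar products are
`(A_0, A_5) = -1`, `(A_2, A_3) = 1`, `(A_1, A_4) = -1`, all others being zero; the frame of the
tangent space formed by the images of `A_1, …, A_4` is positively oriented. -/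
structure IsFrameField (c : ConformalStructure M) (f : N → M) (O : Set N)
    (A : Gauge M → N → Matrix (Fin 6) (Fin 6) ℝ) : Prop where
  smooth : ∀ γ ∈ c.gauges, ∀ a b,
    ContMDiffOn 𝓘(ℝ, Fin 3 → ℝ) 𝓘(ℝ, ℝ) ∞ (fun p => A γ p a b) (O ∩ f ⁻¹' γ.chart.source)
  gauge_change : ∀ γ ∈ c.gauges, ∀ γ' ∈ c.gauges, ∀ s, IsConformalFactor γ γ' s →
    ∀ p ∈ O, f p ∈ γ.chart.source → f p ∈ γ'.chart.source →
      A γ p = gaugeChange γ γ' s (γ'.chart (f p)) * A γ' p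
  vertex : ∀ γ ∈ c.gauges, ∀ p ∈ O, f p ∈ γ.chart.source → ∀ a, a ≠ 0 → A γ p a 0 = 0
  gram : ∀ γ ∈ c.gauges, ∀ p ∈ O, f p ∈ γ.chart.source →
    (A γ p)ᵀ * gramOf (γ.metric (γ.chart (f p))) * A γ p = gramOf isotropicGram
  oriented : ∀ γ ∈ c.gauges, ∀ p ∈ O, f p ∈ γ.chart.source →
    0 < (Matrix.of fun i j : Fin 4 => A γ p (mid i) (mid j)).det

/-- The forms `ω_a^b` of infinitesimal displacement, `dA_a = ω_a^b A_b`, evaluated on the tangent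
vector `w` of the hypersurface (`d` is the normal conformal connection). -/
def omega (γ : Gauge M) (f : N → M) (A : Gauge M → N → Matrix (Fin 6) (Fin 6) ℝ) (p : N)
    (a b : Fin 6) (w : TangentSpace 𝓘(ℝ, Fin 3 → ℝ) p) : ℝ :=
  ((A γ p)⁻¹ * (Matrix.of (fun i j => differential (fun q => A γ q i j) p w)
    + connection γ.metric (γ.chart (f p)) (velocity γ f p w) * A γ p)) b a

/-- The tangent vector `ε_k`, `k = 1, …, 4`, dual to the forms `ω^i = ω_0^i`, in the chart of `γ`. -/
def dualVector (γ : Gauge M) (A : Gauge M → N → Matrix (Fin 6) (Fin 6) ℝ) (p : N)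
    (k : Fin 4) : Fin 4 → ℝ :=
  fun i => A γ p (mid i) (mid k) / A γ p 0 0

/-- Component `C_{ijkl} = g_{im} C^m_{jkl}` of the tensor of conformal curvature in the frame `A`,
where the curvature of the connection has the middle block `C^m_{jkl} ω^k ∧ ω^l`, with summation
over all `k, l`. The arguments are numbered from `0`: `C_{1212}` is `weyl … 0 1 0 1`. -/
def weyl (γ : Gauge M) (f : N → M) (A : Gauge M → N → Matrix (Fin 6) (Fin 6) ℝ) (p : N)
    (i j k l : Fin 4) : ℝ :=
  ∑ m, isotropicGram i m * ((1 / 2) *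
    ((A γ p)⁻¹ * curvature γ.metric (γ.chart (f p)) (dualVector γ A p k) (dualVector γ A p l)
      * A γ p) (mid m) (mid j))

/-- First-order frames of the hypersurface: `ω^4 = 0`, i.e. `A_1, A_2, A_3` lie in the tangent
subspace. (Then `A_0 A_1` is its isotropic line, `A_0 A_1 A_2` its α-plane and `A_0 A_1 A_3` its
β-plane.) -/
def IsFirstOrder (c : ConformalStructure M) (f : N → M) (O : Set N)
    (A : Gauge M → N → Matrix (Fin 6) (Fin 6) ℝ) : Prop :=
  IsFrameField c f O A ∧
  ∀ γ ∈ c.gauges, ∀ p ∈ O, f p ∈ γ.chart.source → ∀ w, omega γ f A p 0 4 w = 0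

/-- The (real or complex) point `A_B - s A_0` of the line `A_0 A_B` is singular: as the line moves,
the tangent subspace at this point, spanned by `A_0`, `A_B` and all the
`d(A_B - s A_0) ≡ (ω_B^a - s ω_0^a) A_a (mod A_0)`, has dimension less than `d`. -/
def IsSingularPoint (γ : Gauge M) (f : N → M) (A : Gauge M → N → Matrix (Fin 6) (Fin 6) ℝ)
    (p : N) (B : Fin 6) (d : ℕ) (s : ℂ) : Prop :=
  Module.finrank ℂ (Submodule.span ℂ
    (({Pi.single 0 1, Pi.single B 1} : Set (Fin 6 → ℂ)) ∪
      Set.range fun (w : TangentSpace 𝓘(ℝ, Fin 3 → ℝ) p) (a : Fin 6) =>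
        (omega γ f A p B a w : ℂ) - s * (omega γ f A p 0 a w : ℂ))) < d

/-- The point `A_B - t A_0` is the fourth harmonic to `A_0` (`t = ∞`) with respect to
`A_B - s₁ A_0` and `A_B - s₂ A_0`: the cross-ratio `(t - s₁) / (t - s₂)` is `-1`. For `s₁ = s₂`
the harmonic pole is this double point. -/
def IsFourthHarmonic (t s₁ s₂ : ℂ) : Prop := t - s₁ = -(t - s₂)

/-- The line `A_0 A_B` bears two singular points (real, complex or coincident), and the vertex
`A_B` is the harmonic pole of `A_0` with respect to them. -/
def IsHarmonicVertex (γ : Gauge M) (f : N → M) (A : Gauge M → N → Matrix (Fin 6) (Fin 6) ℝ)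
    (p : N) (B : Fin 6) (d : ℕ) : Prop :=
  ∃ s₁ s₂ : ℂ, (∀ s, IsSingularPoint γ f A p B d s ↔ s = s₁ ∨ s = s₂) ∧ IsFourthHarmonic 0 s₁ s₂

/-- Second-order frames: the vertex `A_1` is the harmonic pole of `A_0` with respect to the
singular points of the isotropic geodesic `A_0 A_1` (whose tangent subspace `T_X(V)` has dimension
four, as a linear subspace, at nonsingular points). -/
def IsSecondOrder (c : ConformalStructure M) (f : N → M) (O : Set N)
    (A : Gauge M → N → Matrix (Fin 6) (Fin 6) ℝ) : Prop :=
  IsFirstOrder c f O A ∧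
  ∀ γ ∈ c.gauges, ∀ p ∈ O, f p ∈ γ.chart.source → IsHarmonicVertex γ f A p 1 4

/-- The functions `λ_22, λ_23, λ_33` are the coefficients in
`ω_1^3 = λ_22 ω^2 + λ_23 ω^3`, `ω_1^2 = λ_23 ω^2 + λ_33 ω^3`. -/
def HasSecondCoeffs (c : ConformalStructure M) (f : N → M) (O : Set N)
    (A : Gauge M → N → Matrix (Fin 6) (Fin 6) ℝ) (l22 l23 l33 : N → ℝ) : Prop :=
  ∀ γ ∈ c.gauges, ∀ p ∈ O, f p ∈ γ.chart.source → ∀ w,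
    omega γ f A p 1 3 w = l22 p * omega γ f A p 0 2 w + l23 p * omega γ f A p 0 3 w ∧
    omega γ f A p 1 2 w = l23 p * omega γ f A p 0 2 w + l33 p * omega γ f A p 0 3 w

/-- The functions `h_abc` are the third-order coefficients of the frame field, in which
`h_22 = λ_22`, `h_33 = λ_33`:
`dh_22 + h_22 (ω_0^0 - 2 ω_2^2 - ω_1^1) + 2 a_0 ω^1 = h_222 ω^2 + h_223 ω^3`,
`ω_1^0 = h_22 h_33 ω^1 - (h_223 + 2 a_1) ω^2 - (h_233 + 2 b_1) ω^3`,
`dh_33 + h_33 (ω_0^0 + 2 ω_2^2 - ω_1^1) + 2 b_0 ω^1 = h_233 ω^2 + h_333 ω^3`,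
where `a_0 = C_1212`, `a_1 = C_1214`, `b_0 = C_1313`, `b_1 = C_1314`. -/
def HasThirdCoeffs (c : ConformalStructure M) (f : N → M) (O : Set N)
    (A : Gauge M → N → Matrix (Fin 6) (Fin 6) ℝ) (h22 h33 h222 h223 h233 h333 : N → ℝ) : Prop :=
  ∀ γ ∈ c.gauges, ∀ p ∈ O, f p ∈ γ.chart.source → ∀ w,
    let Ω := fun a b => omega γ f A p a b w
    differential h22 p w + h22 p * (Ω 0 0 - 2 * Ω 2 2 - Ω 1 1) + 2 * weyl γ f A p 0 1 0 1 * Ω 0 1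
      = h222 p * Ω 0 2 + h223 p * Ω 0 3 ∧
    Ω 1 0 = h22 p * h33 p * Ω 0 1 - (h223 p + 2 * weyl γ f A p 0 1 0 3) * Ω 0 2
      - (h233 p + 2 * weyl γ f A p 0 2 0 3) * Ω 0 3 ∧
    differential h33 p w + h33 p * (Ω 0 0 + 2 * Ω 2 2 - Ω 1 1) + 2 * weyl γ f A p 0 2 0 2 * Ω 0 1
      = h233 p * Ω 0 2 + h333 p * Ω 0 3

/-- The determinant `D` of the coefficients of the fiber forms `π_2^0, π_2^1, π_3^0, π_3^1` in the
variations of `h_222, h_223, h_233, h_333`. -/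
def detD (h22 h33 a0 b0 : ℝ) : ℝ :=
  Matrix.det !![3 * h22, 2 * a0, 0, -3 * h22 ^ 2;
                0, h22 * h33, -h22, 2 * a0;
                -h33, 2 * b0, 0, h22 * h33;
                0, -3 * h33 ^ 2, 3 * h33, 2 * b0]

theorem detD_eq (h22 h33 a0 b0 : ℝ) :
    detD h22 h33 a0 b0 = 4 * (3 * h22 * b0 + h33 * a0) * (h22 * b0 + 3 * h33 * a0) := by
  simp [detD, Matrix.det_succ_row_zero, Fin.sum_univ_succ, Fin.succAbove]
  ring

/-- `D ≠ 0` at every point of the hypersurface, with respect to every field of second-order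
frames. -/
def DNonvanishing (c : ConformalStructure M) (f : N → M) : Prop :=
  ∀ (O : Set N) (A : Gauge M → N → Matrix (Fin 6) (Fin 6) ℝ) (l22 l23 l33 : N → ℝ),
    IsOpen O → IsSecondOrder c f O A → HasSecondCoeffs c f O A l22 l23 l33 →
      ∀ γ ∈ c.gauges, ∀ p ∈ O, f p ∈ γ.chart.source →
        detD (l22 p) (l33 p) (weyl γ f A p 0 1 0 1) (weyl γ f A p 0 2 0 2) ≠ 0

/-- Third-order frames: second-order frames in which all the `h_abc` vanish. -/
def IsThirdOrder (c : ConformalStructure M) (f : N → M) (O : Set N)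
    (A : Gauge M → N → Matrix (Fin 6) (Fin 6) ℝ) : Prop :=
  IsSecondOrder c f O A ∧
  ∃ l22 l23 l33 : N → ℝ, HasSecondCoeffs c f O A l22 l23 l33 ∧
    HasThirdCoeffs c f O A l22 l33 0 0 0 0

/-- Canonical frames: third-order frames in which the vertex `A_4` is the harmonic pole of `A_0`
with respect to the singular points of the ray `A_0 A_4` of the isotropic congruence formed by
these straight lines (a three-parameter family of lines, whose tangent subspace has dimension five,
as a linear subspace, at nonsingular points). -/
def IsCanonical (c : ConformalStructure M) (f : N → M) (O : Set N)
    (A : Gauge M → N → Matrix (Fin 6) (Fin 6) ℝ) : Prop :=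
  IsThirdOrder c f O A ∧
  ∀ γ ∈ c.gauges, ∀ p ∈ O, f p ∈ γ.chart.source → IsHarmonicVertex γ f A p 4 5

/-- A smooth nowhere vanishing function on `O`. -/
def IsScale (O : Set N) (k : N → ℝ) : Prop :=
  ContMDiffOn 𝓘(ℝ, Fin 3 → ℝ) 𝓘(ℝ, ℝ) ∞ k O ∧ ∀ p ∈ O, k p ≠ 0

/-- The data of fourth order at two points coincide in the given gauges: in suitable local
coordinates on the hypersurfaces, the two immersions have the same partial derivatives of orders at
most `4`, and the metrics (which belong to the first-order neighborhood of the conformal structure)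
the same partial derivatives of orders at most `3`. -/
def SameFourthOrder {M' : Type u} [TopologicalSpace M'] {N' : Type v} [TopologicalSpace N']
    [ChartedSpace (Fin 3 → ℝ) N'] (γ : Gauge M) (f : N → M) (p : N)
    (γ' : Gauge M') (f' : N' → M') (p' : N') : Prop :=
  (∃ ψ ∈ IsManifold.maximalAtlas 𝓘(ℝ, Fin 3 → ℝ) ∞ N,
    ∃ ψ' ∈ IsManifold.maximalAtlas 𝓘(ℝ, Fin 3 → ℝ) ∞ N',
      p ∈ ψ.source ∧ p' ∈ ψ'.source ∧ ψ p = ψ' p' ∧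
      ∀ n : ℕ, n ≤ 4 →
        iteratedFDeriv ℝ n (fun y => γ.chart (f (ψ.symm y))) (ψ p) =
          iteratedFDeriv ℝ n (fun y => γ'.chart (f' (ψ'.symm y))) (ψ' p')) ∧
  ∀ i j, ∀ n : ℕ, n ≤ 3 →
    iteratedFDeriv ℝ n (fun x => γ.metric x i j) (γ.chart (f p)) =
      iteratedFDeriv ℝ n (fun x => γ'.metric x i j) (γ'.chart (f' p'))

end Hypersurface

/-- The rescaling `A_0 ↦ k A_0`, `A_1 ↦ a A_1`, `A_2 ↦ b A_2`, `A_3 ↦ b⁻¹ A_3`, `A_4 ↦ a⁻¹ A_4`,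
`A_5 ↦ k⁻¹ A_5` of the vertices of a frame, which leaves them fixed as points. -/
def rescaling (k a b : ℝ) : Matrix (Fin 6) (Fin 6) ℝ :=
  Matrix.diagonal ![k, a, b, b⁻¹, a⁻¹, k⁻¹]

end

end CO22

open CO22

set_option linter.unusedSectionVars false
set_option linter.unusedSimpArgs false

/-! The proof is Cartan's method of moving frames, carried out in coordinates. A frame along the
hypersurface is a matrix field `B`, and its forms of infinitesimal displacement are `pull
(connection G) F B`, that is B⁻¹(dB + ΘB). These forms do not depend on the gauge. The normal
conformal connection is the only metric, torsion-free connection form with trace-free curvature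
(`IsNormalConn.eq_connection`), and these properties survive a change of metric and coordinates
(`connection_gaugeChange`, `omega_gauge`). Hence every condition on a frame field may be checked in
one gauge and one chart, and a frame built there extends to all gauges by the cocycle relation
`gaugeChange_comp`.

Two first-order frames at a point differ by an isometry preserving the point and the tangent
subspace. Positive orientation forbids it to exchange the α- and β-planes, so it is triangular
(`triangular_of_gram`), that is, up to a rescaling, some `unipotent p x₀ x₁ y₀ y₁ t`
(`eq_unipotent`). The six parameters are fixed in three stages. The singular points of A_0A_1 are
the roots of (λ_23 - s)² = λ_22 λ_33, so harmonicity of A_1 means λ_23 = 0, and p translates λ_23.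
When λ_23 = 0 and p = 0, the coefficients h_222, h_223, h_233, h_333 change by an affine law in (x₀,
x₁, y₀, y₁) free of derivatives (`unipotent_third`). Its matrix `fiberMatrix` has determinant D, so
D ≠ 0 leaves exactly one choice for which they vanish. Finally the singular points of A_0A_4 are the
eigenvalues of a 2×2 matrix, harmonicity of A_4 says that its trace vanishes, and t shifts this
trace by 2t (`unipotent_trace`). Solving these equations gives smooth existence; their unique
solvability gives uniqueness up to rescalings; and rescalings multiply each normalized quantity by a
nonzero factor.

The curvature components a_0, b_0 enter this system as derivatives of λ_22, λ_33 along the isotropic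
direction. The structure equations (`third_structure`) identify the two descriptions, and they also
give the formula for ω_1^0.

For the dependence on fourth-order data, a first-order frame is written by explicit formulas from
constant seed vectors. The 4-jet of the immersion and the 3-jet of the metric determine its 3-jet,
and each of the three stages costs one order, so the canonical frame itself is determined
(`canonicalFrame_eq`). The Schouten tensor never enters the entries used. -/

namespace CO22

/-- The entrywise directional derivative of a matrix-valued function. -/
noncomputable def matDeriv {n : ℕ} {ι κ : Type*} (A : (Fin n → ℝ) → Matrix ι κ ℝ)
    (y w : Fin n → ℝ) : Matrix ι κ ℝ :=
  Matrix.of fun i j => fderiv ℝ (fun z => A z i j) y w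

/-- Entrywise smoothness of a matrix-valued function on a set. -/
def MatSmoothOn {n : ℕ} {ι κ : Type*} (A : (Fin n → ℝ) → Matrix ι κ ℝ)
    (U : Set (Fin n → ℝ)) : Prop :=
  ∀ i j, ContDiffOn ℝ ∞ (fun z => A z i j) U

/-! ### Differentiation of matrix-valued functions on open sets -/

section Calculus
variable {n : ℕ} {ι κ μ : Type*} {U : Set (Fin n → ℝ)}

theorem diffAt_of_smoothOn {E F : Type*} [NormedAddCommGroup E] [NormedSpace ℝ E]
    [NormedAddCommGroup F] [NormedSpace ℝ F] {U : Set E} (hU : IsOpen U) {u : E → F}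
    (hu : ContDiffOn ℝ ∞ u U) {y : E} (hy : y ∈ U) : DifferentiableAt ℝ u y :=
  (hu.contDiffAt (hU.mem_nhds hy)).differentiableAt (by simp)

theorem smoothOn_fderiv_apply {E F : Type*} [NormedAddCommGroup E] [NormedSpace ℝ E]
    [NormedAddCommGroup F] [NormedSpace ℝ F] {U : Set E} (hU : IsOpen U) {u : E → F}
    (hu : ContDiffOn ℝ ∞ u U) (w : E) : ContDiffOn ℝ ∞ (fun z => fderiv ℝ u z w) U :=
  (hu.fderiv_of_isOpen hU (by simp)).clm_apply contDiffOn_const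

theorem fderiv_eq_of_eqOn {E F : Type*} [NormedAddCommGroup E] [NormedSpace ℝ E]
    [NormedAddCommGroup F] [NormedSpace ℝ F] {U : Set E} (hU : IsOpen U) {u v : E → F}
    (h : ∀ z ∈ U, u z = v z) {y : E} (hy : y ∈ U) : fderiv ℝ u y = fderiv ℝ v y :=
  Filter.EventuallyEq.fderiv_eq (Filter.eventuallyEq_of_mem (hU.mem_nhds hy) h)

theorem fderiv_fderiv_comm {E : Type*} [NormedAddCommGroup E] [NormedSpace ℝ E]
    {U : Set E} (hU : IsOpen U) {u : E → ℝ}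
    (hu : ContDiffOn ℝ ∞ u U) {y : E} (hy : y ∈ U) (w w' : E) :
    fderiv ℝ (fun z => fderiv ℝ u z w) y w' = fderiv ℝ (fun z => fderiv ℝ u z w') y w := by
  have hd : DifferentiableAt ℝ (fderiv ℝ u) y :=
    diffAt_of_smoothOn hU (hu.fderiv_of_isOpen hU (by simp)) hy
  have hs : IsSymmSndFDerivAt ℝ u y :=
    (hu.contDiffAt (hU.mem_nhds hy)).isSymmSndFDerivAt
      (by simpa using WithTop.coe_le_coe.2 (le_top : (2 : ℕ∞) ≤ ⊤))
  rw [fderiv_clm_apply hd (differentiableAt_const _), fderiv_clm_apply hd (differentiableAt_const _)]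
  simpa using hs w' w

theorem fderiv_sum_mul {E κ : Type*} [NormedAddCommGroup E] [NormedSpace ℝ E] [Fintype κ]
    {a b : κ → E → ℝ} {y : E} (ha : ∀ k, DifferentiableAt ℝ (a k) y)
    (hb : ∀ k, DifferentiableAt ℝ (b k) y) (w : E) :
    fderiv ℝ (fun z => ∑ k, a k z * b k z) y w
      = ∑ k, (fderiv ℝ (a k) y w * b k y + a k y * fderiv ℝ (b k) y w) := by
  rw [fderiv_fun_sum fun k _ => (ha k).fun_mul (hb k), sum_apply]
  refine Finset.sum_congr rfl fun k _ => ?_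
  rw [fderiv_fun_mul (ha k) (hb k)]
  simp
  ring

theorem MatSmoothOn.mul [Fintype κ] {A : (Fin n → ℝ) → Matrix ι κ ℝ}
    {B : (Fin n → ℝ) → Matrix κ μ ℝ} (hA : MatSmoothOn A U) (hB : MatSmoothOn B U) :
    MatSmoothOn (fun z => A z * B z) U := by
  intro i j
  simp only [Matrix.mul_apply]
  exact ContDiffOn.sum fun k _ => (hA i k).mul (hB k j)

theorem MatSmoothOn.add {A B : (Fin n → ℝ) → Matrix ι κ ℝ} (hA : MatSmoothOn A U)
    (hB : MatSmoothOn B U) : MatSmoothOn (fun z => A z + B z) U :=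
  fun i j => (hA i j).add (hB i j)

theorem MatSmoothOn.transpose {A : (Fin n → ℝ) → Matrix ι κ ℝ} (hA : MatSmoothOn A U) :
    MatSmoothOn (fun z => (A z)ᵀ) U := fun i j => hA j i

theorem MatSmoothOn.mono {A : (Fin n → ℝ) → Matrix ι κ ℝ} {V : Set (Fin n → ℝ)}
    (hA : MatSmoothOn A U) (h : V ⊆ U) : MatSmoothOn A V := fun i j => (hA i j).mono h

theorem MatSmoothOn.det [Fintype ι] [DecidableEq ι] {A : (Fin n → ℝ) → Matrix ι ι ℝ}
    (hA : MatSmoothOn A U) : ContDiffOn ℝ ∞ (fun z => (A z).det) U := by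
  simp only [Matrix.det_apply']
  exact ContDiffOn.sum fun σ _ => contDiffOn_const.mul (contDiffOn_prod fun i _ => hA _ _)

theorem MatSmoothOn.inv [Fintype ι] [DecidableEq ι] {A : (Fin n → ℝ) → Matrix ι ι ℝ}
    (hA : MatSmoothOn A U) (h : ∀ z ∈ U, (A z).det ≠ 0) : MatSmoothOn (fun z => (A z)⁻¹) U := by
  intro i j
  -- Cramer's rule writes each entry of the inverse as a quotient of determinants.
  have : ∀ z, (A z)⁻¹ i j = ((A z).det)⁻¹ * ((A z).updateRow j (Pi.single i 1)).det := by
    intro z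
    rw [Matrix.inv_def, Matrix.smul_apply, Matrix.adjugate_apply, Ring.inverse_eq_inv', smul_eq_mul]
  simp only [this]
  refine (hA.det.inv h).mul (MatSmoothOn.det fun a b => ?_)
  by_cases hb : a = j
  · subst hb; simpa using contDiffOn_const
  · simpa [Matrix.updateRow_ne hb] using hA a b

theorem MatSmoothOn.matDeriv (hU : IsOpen U) {A : (Fin n → ℝ) → Matrix ι κ ℝ}
    (hA : MatSmoothOn A U) (w : Fin n → ℝ) : MatSmoothOn (fun z => matDeriv A z w) U :=
  fun i j => smoothOn_fderiv_apply hU (hA i j) w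

theorem matDeriv_congr (hU : IsOpen U) {A B : (Fin n → ℝ) → Matrix ι κ ℝ}
    (h : ∀ z ∈ U, A z = B z) {y : Fin n → ℝ} (hy : y ∈ U) (w : Fin n → ℝ) :
    matDeriv A y w = matDeriv B y w := by
  ext i j
  simp only [matDeriv, Matrix.of_apply]
  rw [fderiv_eq_of_eqOn hU (fun z hz => by rw [h z hz]) hy]

theorem matDeriv_const (A : Matrix ι κ ℝ) (y w : Fin n → ℝ) :
    matDeriv (fun _ => A) y w = 0 := by
  ext i j
  simp [matDeriv]

theorem matDeriv_mul [Fintype κ] (hU : IsOpen U) {A : (Fin n → ℝ) → Matrix ι κ ℝ}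
    {B : (Fin n → ℝ) → Matrix κ μ ℝ} (hA : MatSmoothOn A U) (hB : MatSmoothOn B U)
    {y : Fin n → ℝ} (hy : y ∈ U) (w : Fin n → ℝ) :
    matDeriv (fun z => A z * B z) y w = matDeriv A y w * B y + A y * matDeriv B y w := by
  ext i j
  simp only [matDeriv, Matrix.of_apply, Matrix.mul_apply, Matrix.add_apply]
  refine (fderiv_sum_mul (fun k => diffAt_of_smoothOn hU (hA i k) hy)
    (fun k => diffAt_of_smoothOn hU (hB k j) hy) w).trans ?_
  rw [Finset.sum_add_distrib]

theorem matDeriv_add (hU : IsOpen U) {A B : (Fin n → ℝ) → Matrix ι κ ℝ}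
    (hA : MatSmoothOn A U) (hB : MatSmoothOn B U) {y : Fin n → ℝ} (hy : y ∈ U) (w : Fin n → ℝ) :
    matDeriv (fun z => A z + B z) y w = matDeriv A y w + matDeriv B y w := by
  ext i j
  simp only [matDeriv, Matrix.of_apply, Matrix.add_apply]
  rw [fderiv_fun_add (diffAt_of_smoothOn hU (hA i j) hy) (diffAt_of_smoothOn hU (hB i j) hy)]
  simp

theorem matDeriv_transpose (A : (Fin n → ℝ) → Matrix ι κ ℝ) (y w : Fin n → ℝ) :
    matDeriv (fun z => (A z)ᵀ) y w = (matDeriv A y w)ᵀ := rfl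

theorem matDeriv_comm (hU : IsOpen U) {A : (Fin n → ℝ) → Matrix ι κ ℝ}
    (hA : MatSmoothOn A U) {y : Fin n → ℝ} (hy : y ∈ U) (w w' : Fin n → ℝ) :
    matDeriv (fun z => matDeriv A z w) y w' = matDeriv (fun z => matDeriv A z w') y w := by
  ext i j
  exact fderiv_fderiv_comm hU (hA i j) hy w w'

theorem matDeriv_sum_basis (A : (Fin n → ℝ) → Matrix ι κ ℝ) (y w : Fin n → ℝ) :
    matDeriv A y w = ∑ k, w k • matDeriv A y (Pi.single k 1) := by
  ext i j
  simp only [matDeriv, Matrix.sum_apply, Matrix.smul_apply, Matrix.of_apply, smul_eq_mul]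
  conv_lhs => rw [pi_eq_sum_univ' w, map_sum]
  refine Finset.sum_congr rfl fun k _ => ?_
  rw [map_smul, smul_eq_mul]

end Calculus

/-! ### Pullback and gauge transformation of connection forms -/

/-- The derivative of a map in the direction of a vector, componentwise. -/
noncomputable def vel {n m : ℕ} (F : (Fin n → ℝ) → Fin m → ℝ) (y w : Fin n → ℝ) : Fin m → ℝ :=
  fun i => fderiv ℝ (fun z => F z i) y w

/-- The curvature of a connection form. -/
noncomputable def formCurv {n : ℕ} (Θ : (Fin n → ℝ) → (Fin n → ℝ) → Matrix (Fin 6) (Fin 6) ℝ)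
    (x w w' : Fin n → ℝ) : Matrix (Fin 6) (Fin 6) ℝ :=
  matDeriv (fun y => Θ y w') x w - matDeriv (fun y => Θ y w) x w'
    + (Θ x w * Θ x w' - Θ x w' * Θ x w)

theorem curvature_eq_formCurv (G : (Fin 4 → ℝ) → Matrix (Fin 4) (Fin 4) ℝ) (x w w' : Fin 4 → ℝ) :
    curvature G x w w' = formCurv (connection G) x w w' := rfl

/-- The connection form written in the moving frame `A` along the map `F`. -/
noncomputable def pull {n m : ℕ} (Θ : (Fin m → ℝ) → (Fin m → ℝ) → Matrix (Fin 6) (Fin 6) ℝ)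
    (F : (Fin n → ℝ) → Fin m → ℝ) (A : (Fin n → ℝ) → Matrix (Fin 6) (Fin 6) ℝ)
    (y w : Fin n → ℝ) : Matrix (Fin 6) (Fin 6) ℝ :=
  (A y)⁻¹ * (matDeriv A y w + Θ (F y) (vel F y w) * A y)

section Pull
variable {n m : ℕ} {Θ : (Fin m → ℝ) → (Fin m → ℝ) → Matrix (Fin 6) (Fin 6) ℝ}
  {F : (Fin n → ℝ) → Fin m → ℝ} {A : (Fin n → ℝ) → Matrix (Fin 6) (Fin 6) ℝ}
  {U : Set (Fin n → ℝ)} {V : Set (Fin m → ℝ)}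

theorem smoothOn_comp {g : (Fin m → ℝ) → ℝ} (hg : ContDiffOn ℝ ∞ g V)
    (hF : ∀ i, ContDiffOn ℝ ∞ (fun z => F z i) U) (hm : Set.MapsTo F U V) :
    ContDiffOn ℝ ∞ (fun z => g (F z)) U :=
  hg.comp (contDiffOn_pi.2 hF) hm

theorem fderiv_comp_vel (hU : IsOpen U) (hV : IsOpen V) {g : (Fin m → ℝ) → ℝ}
    (hg : ContDiffOn ℝ ∞ g V) (hF : ∀ i, ContDiffOn ℝ ∞ (fun z => F z i) U)
    (hm : Set.MapsTo F U V) {y : Fin n → ℝ} (hy : y ∈ U) (w : Fin n → ℝ) :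
    fderiv ℝ (fun z => g (F z)) y w = fderiv ℝ g (F y) (vel F y w) := by
  have hFd : DifferentiableAt ℝ F y := diffAt_of_smoothOn hU (contDiffOn_pi.2 hF) hy
  have := fderiv_comp y (diffAt_of_smoothOn hV hg (hm hy)) hFd
  have h2 : vel F y w = fderiv ℝ F y w := by
    ext i
    exact congrArg (fun L => L w) (fderiv_apply hFd i)
  rw [h2]
  change fderiv ℝ (g ∘ F) y w = _
  rw [this]; rfl

theorem fderiv_sum_basis {f : (Fin m → ℝ) → ℝ} (x w : Fin m → ℝ) :
    fderiv ℝ f x w = ∑ k, w k * fderiv ℝ f x (Pi.single k 1) := by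
  conv_lhs => rw [pi_eq_sum_univ' w, map_sum]
  refine Finset.sum_congr rfl fun k _ => ?_
  rw [map_smul, smul_eq_mul]

variable (hlin : ∀ x w, Θ x w = ∑ k, w k • Θ x (Pi.single k 1))
  (hΘ : ∀ k, MatSmoothOn (fun x => Θ x (Pi.single k 1)) V)
include hlin hΘ

theorem pulled_smooth (hU : IsOpen U) (hF : ∀ i, ContDiffOn ℝ ∞ (fun z => F z i) U)
    (hm : Set.MapsTo F U V) (w : Fin n → ℝ) :
    MatSmoothOn (fun z => Θ (F z) (vel F z w)) U := by
  intro i j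
  have : ∀ z, Θ (F z) (vel F z w) i j
      = ∑ k, fderiv ℝ (fun y => F y k) z w * Θ (F z) (Pi.single k 1) i j := by
    intro z; rw [hlin]; simp [Matrix.sum_apply, vel]
  simp only [this]
  exact ContDiffOn.sum fun k _ =>
    (smoothOn_fderiv_apply hU (hF k) w).mul (smoothOn_comp (hΘ k i j) hF hm)

/-- The sum with second derivatives of `F` is symmetric in `w`, `w'`. It is separated from the rest
because it cancels in the curvature. -/
theorem matDeriv_pulled (hU : IsOpen U) (hV : IsOpen V)
    (hF : ∀ i, ContDiffOn ℝ ∞ (fun z => F z i) U)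
    (hm : Set.MapsTo F U V) {y : Fin n → ℝ} (hy : y ∈ U) (w w' : Fin n → ℝ) :
    matDeriv (fun z => Θ (F z) (vel F z w')) y w =
      (∑ k, fderiv ℝ (fun z => fderiv ℝ (fun y => F y k) z w') y w • Θ (F y) (Pi.single k 1))
        + matDeriv (fun x => Θ x (vel F y w')) (F y) (vel F y w) := by
  ext i j
  have e1 : ∀ z, Θ (F z) (vel F z w') i j
      = ∑ k, fderiv ℝ (fun y => F y k) z w' * Θ (F z) (Pi.single k 1) i j := by
    intro z; rw [hlin]; simp [Matrix.sum_apply, vel]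
  have e2 : ∀ x, Θ x (vel F y w') i j = ∑ k, vel F y w' k * Θ x (Pi.single k 1) i j := by
    intro x; rw [hlin]; simp [Matrix.sum_apply]
  simp only [matDeriv, Matrix.add_apply, Matrix.of_apply, e1, e2, Matrix.sum_apply,
    Matrix.smul_apply, smul_eq_mul]
  have d1 : ∀ k, DifferentiableAt ℝ (fun z => fderiv ℝ (fun y => F y k) z w') y := fun k =>
    diffAt_of_smoothOn hU (smoothOn_fderiv_apply hU (hF k) w') hy
  have d2 : ∀ k, DifferentiableAt ℝ (fun z => Θ (F z) (Pi.single k 1) i j) y := fun k =>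
    diffAt_of_smoothOn hU (smoothOn_comp (hΘ k i j) hF hm) hy
  have d3 : ∀ k, DifferentiableAt ℝ (fun x => Θ x (Pi.single k 1) i j) (F y) := fun k =>
    diffAt_of_smoothOn hV (hΘ k i j) (hm hy)
  refine (fderiv_sum_mul d1 d2 w).trans ?_
  rw [Finset.sum_add_distrib]
  congr 1
  refine Eq.trans ?_ (fderiv_sum_mul (fun k => differentiableAt_const (vel F y w' k)) d3 _).symm
  refine Finset.sum_congr rfl fun k _ => ?_
  rw [fderiv_comp_vel hU hV (hΘ k i j) hF hm hy w]
  simp [vel]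

theorem pull_smooth (hU : IsOpen U) (hF : ∀ i, ContDiffOn ℝ ∞ (fun z => F z i) U)
    (hm : Set.MapsTo F U V) (hA : MatSmoothOn A U) (hdet : ∀ y ∈ U, (A y).det ≠ 0)
    (w : Fin n → ℝ) : MatSmoothOn (fun y => pull Θ F A y w) U :=
  (hA.inv hdet).mul ((hA.matDeriv hU w).add ((pulled_smooth hlin hΘ hU hF hm w).mul hA))

/-- Curvature is tensorial: the defining relation A·ω = dA + (F^*Θ)A is differentiated and
antisymmetrized, and the second derivatives of `A` and of `F` drop out. This is the source of all
structure equations. -/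
theorem formCurv_pull (hU : IsOpen U) (hV : IsOpen V)
    (hF : ∀ i, ContDiffOn ℝ ∞ (fun z => F z i) U)
    (hm : Set.MapsTo F U V) (hA : MatSmoothOn A U) (hdet : ∀ y ∈ U, (A y).det ≠ 0)
    {y : Fin n → ℝ} (hy : y ∈ U) (w w' : Fin n → ℝ) :
    formCurv (pull Θ F A) y w w'
      = (A y)⁻¹ * formCurv Θ (F y) (vel F y w) (vel F y w') * A y := by
  have hu : IsUnit (A y).det := isUnit_iff_ne_zero.2 (hdet y hy)
  have key : ∀ v, ∀ z ∈ U, A z * pull Θ F A z v = matDeriv A z v + Θ (F z) (vel F z v) * A z := by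
    intro v z hz
    rw [pull, Matrix.mul_nonsing_inv_cancel_left _ _ (isUnit_iff_ne_zero.2 (hdet z hz))]
  have hp := pull_smooth hlin hΘ hU hF hm hA hdet
  have hΦ := pulled_smooth hlin hΘ hU hF hm
  have D : ∀ v v', matDeriv A y v' * pull Θ F A y v + A y * matDeriv (fun z => pull Θ F A z v) y v'
      = matDeriv (fun z => matDeriv A z v) y v' +
        (matDeriv (fun z => Θ (F z) (vel F z v)) y v' * A y
          + Θ (F y) (vel F y v) * matDeriv A y v') := by
    intro v v'
    rw [← matDeriv_mul hU hA (hp v) hy, matDeriv_congr hU (key v) hy,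
      matDeriv_add hU (hA.matDeriv hU v) ((hΦ v).mul hA) hy, matDeriv_mul hU (hΦ v) hA hy]
  have hA1 : ∀ v, matDeriv A y v = A y * pull Θ F A y v - Θ (F y) (vel F y v) * A y := by
    intro v; rw [key v y hy]; abel
  have hd : matDeriv (fun z => Θ (F z) (vel F z w')) y w
      - matDeriv (fun z => Θ (F z) (vel F z w)) y w'
      = matDeriv (fun x => Θ x (vel F y w')) (F y) (vel F y w)
        - matDeriv (fun x => Θ x (vel F y w)) (F y) (vel F y w') := by
    rw [matDeriv_pulled hlin hΘ hU hV hF hm hy, matDeriv_pulled hlin hΘ hU hV hF hm hy]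
    simp only [fun k => fderiv_fderiv_comm hU (hF k) hy w w']
    abel
  -- The two orders of differentiation are subtracted; the mixed second derivatives of `A` agree.
  have e := congrArg₂ (· - ·) (D w' w) (D w w')
  rw [matDeriv_comm hU hA hy w w'] at e
  have main : A y * formCurv (pull Θ F A) y w w'
      = formCurv Θ (F y) (vel F y w) (vel F y w') * A y := by
    unfold formCurv
    rw [← hd]
    rw [hA1 w, hA1 w'] at e
    simp only [mul_add, mul_sub, add_mul, sub_mul, ← mul_assoc] at e ⊢
    rw [← sub_eq_zero] at e ⊢
    rw [← e]
    abel
  rw [mul_assoc, ← main, Matrix.nonsing_inv_mul_cancel_left _ _ hu]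

end Pull

/-! ### The block decomposition 1 + 4 + 1 of six-dimensional vectors and matrices -/

section Blocks

theorem sum_six (f : Fin 6 → ℝ) : ∑ a, f a = f 0 + ∑ i, f (mid i) + f 5 := by
  rw [Fin.sum_univ_succ, Fin.sum_univ_castSucc]
  rw [add_assoc]; rfl

/-- Splits six indices into three blocks, so that the four middle ones are treated uniformly by a
variable. -/
theorem forall_six {p : Fin 6 → Prop} (h0 : p 0) (hm : ∀ i, p (mid i)) (h5 : p 5) : ∀ a, p a := by
  intro a
  fin_cases a
  exacts [h0, hm 0, hm 1, hm 2, hm 3, h5]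

theorem mul_six (M N : Matrix (Fin 6) (Fin 6) ℝ) (a b : Fin 6) :
    (M * N) a b = M a 0 * N 0 b + ∑ i, M a (mid i) * N (mid i) b + M a 5 * N 5 b := by
  rw [Matrix.mul_apply, sum_six]

@[simp] theorem tvec_zero (r : ℝ) (m : Fin 4 → ℝ) (s : ℝ) : tvec r m s 0 = r := rfl
@[simp] theorem tvec_mid (r : ℝ) (m : Fin 4 → ℝ) (s : ℝ) (i : Fin 4) : tvec r m s (mid i) = m i := by
  fin_cases i <;> rfl
@[simp] theorem tvec_five (r : ℝ) (m : Fin 4 → ℝ) (s : ℝ) : tvec r m s 5 = s := rfl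

@[simp] theorem ofCols_zero (X : Fin 6 → ℝ) (E : Fin 4 → Fin 6 → ℝ) (Y : Fin 6 → ℝ) (a : Fin 6) :
    ofCols X E Y a 0 = X a := rfl
@[simp] theorem ofCols_mid (X : Fin 6 → ℝ) (E : Fin 4 → Fin 6 → ℝ) (Y : Fin 6 → ℝ) (a : Fin 6)
    (j : Fin 4) : ofCols X E Y a (mid j) = E j a := by
  fin_cases j <;> rfl
@[simp] theorem ofCols_five (X : Fin 6 → ℝ) (E : Fin 4 → Fin 6 → ℝ) (Y : Fin 6 → ℝ) (a : Fin 6) :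
    ofCols X E Y a 5 = Y a := rfl

theorem mid_injective : Function.Injective mid :=
  (Fin.castSucc_injective 5).comp (Fin.succ_injective 4)

@[simp] theorem mid_inj {i j : Fin 4} : mid i = mid j ↔ i = j := mid_injective.eq_iff
@[simp] theorem mid_ne_zero (i : Fin 4) : mid i ≠ 0 := by revert i; decide
@[simp] theorem zero_ne_mid (i : Fin 4) : 0 ≠ mid i := by revert i; decide
@[simp] theorem mid_ne_five (i : Fin 4) : mid i ≠ 5 := by revert i; decide
@[simp] theorem five_ne_mid (i : Fin 4) : 5 ≠ mid i := by revert i; decide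

end Blocks

/-! ### The Levi-Civita connection of a metric on an open set -/

variable {G : (Fin 4 → ℝ) → Matrix (Fin 4) (Fin 4) ℝ} {V : Set (Fin 4 → ℝ)}

/-- The components of a nondegenerate metric on an open set. -/
structure IsMetricOn (G : (Fin 4 → ℝ) → Matrix (Fin 4) (Fin 4) ℝ) (V : Set (Fin 4 → ℝ)) :
    Prop where
  isOpen : IsOpen V
  smooth : MatSmoothOn G V
  symm : ∀ x ∈ V, ∀ i j, G x i j = G x j i
  det_ne : ∀ x ∈ V, (G x).det ≠ 0

namespace IsMetricOn
variable (hG : IsMetricOn G V)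
include hG

theorem inv_mul {x} (hx : x ∈ V) : (G x)⁻¹ * G x = 1 :=
  Matrix.nonsing_inv_mul _ (isUnit_iff_ne_zero.2 (hG.det_ne x hx))

theorem mul_inv {x} (hx : x ∈ V) : G x * (G x)⁻¹ = 1 :=
  Matrix.mul_nonsing_inv _ (isUnit_iff_ne_zero.2 (hG.det_ne x hx))

theorem transpose {x} (hx : x ∈ V) : (G x)ᵀ = G x := by
  ext i j; exact hG.symm x hx j i

theorem inv_symm {x} (hx : x ∈ V) (i j) : (G x)⁻¹ i j = (G x)⁻¹ j i := by
  have : ((G x)⁻¹)ᵀ = (G x)⁻¹ := by rw [Matrix.transpose_nonsing_inv, hG.transpose hx]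
  exact congrFun (congrFun this j) i

theorem pd_symm {x} (hx : x ∈ V) (k i j) : pd k (fun y => G y i j) x = pd k (fun y => G y j i) x := by
  unfold pd
  rw [fderiv_eq_of_eqOn hG.isOpen (fun z hz => hG.symm z hz i j) hx]

theorem christoffel_symm {x} (hx : x ∈ V) (i j k) : christoffel G x i j k = christoffel G x i k j := by
  unfold christoffel
  congr 1
  refine Finset.sum_congr rfl fun l _ => ?_
  rw [hG.pd_symm hx l j k]
  ring

theorem christoffel_lower {x} (hx : x ∈ V) (a j k) :
    ∑ i, G x a i * christoffel G x i j k =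
      (1 / 2) * (pd j (fun y => G y a k) x + pd k (fun y => G y a j) x - pd a (fun y => G y j k) x) := by
  unfold christoffel
  have : ∀ T : Fin 4 → ℝ, ∑ i, G x a i * (1 / 2 * ∑ l, (G x)⁻¹ i l * T l) = 1 / 2 * T a := by
    intro T
    have h := congrFun (congrArg (fun M => M *ᵥ T) (hG.mul_inv hx)) a
    simp only [Matrix.one_mulVec, ← Matrix.mulVec_mulVec] at h
    rw [← h, Matrix.mulVec, dotProduct, Finset.mul_sum]
    refine Finset.sum_congr rfl fun i _ => ?_
    rw [Matrix.mulVec, dotProduct]; ring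
  exact this _

theorem eq_of_lower_eq {x} (hx : x ∈ V) {T T' : Fin 4 → ℝ}
    (h : ∀ a, ∑ i, G x a i * T i = ∑ i, G x a i * T' i) : T = T' := by
  have : G x *ᵥ T = G x *ᵥ T' := funext h
  have h2 := congrArg (fun v => (G x)⁻¹ *ᵥ v) this
  simpa [Matrix.mulVec_mulVec, hG.inv_mul hx] using h2

theorem christoffel_metric {x} (hx : x ∈ V) (k i j) :
    ∑ m, G x i m * christoffel G x m j k + ∑ m, G x j m * christoffel G x m i k
      = pd k (fun y => G y i j) x := by
  rw [hG.christoffel_lower hx, hG.christoffel_lower hx, hG.pd_symm hx k j i]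
  ring

/-- Koszul's argument: the metricity relation is taken for three cyclic placements of the indices,
and symmetry in the lower indices isolates one lowered component. -/
theorem christoffel_unique {x} (hx : x ∈ V) (T : Fin 4 → Fin 4 → Fin 4 → ℝ)
    (hs : ∀ i j k, T i j k = T i k j)
    (hm : ∀ i j k, ∑ m, G x i m * T m j k + ∑ m, G x j m * T m i k = pd k (fun y => G y i j) x)
    (i j k) : T i j k = christoffel G x i j k := by
  refine congrFun (hG.eq_of_lower_eq hx (T := fun i => T i j k)
    (T' := fun i => christoffel G x i j k) fun a => ?_) i
  rw [hG.christoffel_lower hx]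
  have hs' : ∀ a b c, ∑ m, G x a m * T m b c = ∑ m, G x a m * T m c b := fun a b c =>
    Finset.sum_congr rfl fun m _ => by rw [hs m b c]
  have h1 := hm a j k
  have h2 := hm a k j
  have h3 := hm j k a
  rw [hs' j a k] at h1
  rw [hs' a k j, hs' k a j] at h2
  rw [hs' j k a, hs' k j a] at h3
  have h4 := hs' k j a
  have h5 := hs' j k a
  linarith

theorem christoffel_smooth (i j k) : ContDiffOn ℝ ∞ (fun x => christoffel G x i j k) V := by
  unfold christoffel
  refine contDiffOn_const.mul (ContDiffOn.sum fun l _ => ((hG.smooth.inv hG.det_ne) i l).mul ?_)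
  have h : ∀ k a b, ContDiffOn ℝ ∞ (fun x => pd k (fun y => G y a b) x) V := fun k a b =>
    smoothOn_fderiv_apply hG.isOpen (hG.smooth a b) _
  exact ((h _ _ _).add (h _ _ _)).sub (h _ _ _)

theorem riemann_smooth (i j k l) : ContDiffOn ℝ ∞ (fun x => riemann G x i j k l) V := by
  have h := hG.christoffel_smooth
  have h' : ∀ k a b c, ContDiffOn ℝ ∞ (fun x => pd k (fun y => christoffel G y a b c) x) V :=
    fun k a b c => smoothOn_fderiv_apply hG.isOpen (h a b c) _
  unfold riemann
  exact ((h' _ _ _ _).sub (h' _ _ _ _)).add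
    (ContDiffOn.sum fun m _ => ((h _ _ _).mul (h _ _ _)).sub ((h _ _ _).mul (h _ _ _)))

theorem ricci_smooth : MatSmoothOn (ricci G) V := fun j l => by
  simp only [ricci, Matrix.of_apply]
  exact ContDiffOn.sum fun i _ => hG.riemann_smooth i j i l

theorem schouten_smooth : MatSmoothOn (schouten G) V := fun j l => by
  simp only [schouten, Matrix.smul_apply, Matrix.sub_apply, smul_eq_mul]
  refine contDiffOn_const.mul ((hG.ricci_smooth j l).sub (ContDiffOn.mul ?_ (hG.smooth j l)))
  simp only [scalarCurvature]
  exact (ContDiffOn.sum fun i _ => ContDiffOn.sum fun k _ =>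
    ((hG.smooth.inv hG.det_ne) i k).mul (hG.ricci_smooth i k)).div_const _

theorem riemann_bianchi {x} (hx : x ∈ V) (i j k l) :
    riemann G x i j k l + riemann G x i k l j + riemann G x i l j k = 0 := by
  have hp : ∀ m a b c, pd m (fun y => christoffel G y a b c) x
      = pd m (fun y => christoffel G y a c b) x := by
    intro m a b c
    unfold pd
    rw [fderiv_eq_of_eqOn hG.isOpen (fun z hz => hG.christoffel_symm hz a b c) hx]
  unfold riemann
  rw [hp k i l j, hp l i j k, hp j i k l]
  simp only [fun m => hG.christoffel_symm hx m l j, fun m => hG.christoffel_symm hx m k j,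
    fun m => hG.christoffel_symm hx m l k]
  simp only [Finset.sum_sub_distrib]
  ring

end IsMetricOn

theorem riemann_swap (x) (i j k l) : riemann G x i j k l = - riemann G x i j l k := by
  unfold riemann
  simp only [Finset.sum_sub_distrib]
  ring

/-! ### Normal connection forms -/

/-- A connection form with prescribed Christoffel symbols and prescribed tensor `P`. -/
noncomputable def connWith (G : (Fin 4 → ℝ) → Matrix (Fin 4) (Fin 4) ℝ)
    (T : (Fin 4 → ℝ) → Fin 4 → Fin 4 → Fin 4 → ℝ) (P : (Fin 4 → ℝ) → Matrix (Fin 4) (Fin 4) ℝ)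
    (x w : Fin 4 → ℝ) : Matrix (Fin 6) (Fin 6) ℝ :=
  ofCols (tvec 0 w 0)
    (fun j => tvec (-(P x *ᵥ w) j) (fun i => ∑ k, T x i j k * w k) ((G x *ᵥ w) j))
    (tvec 0 (-((G x)⁻¹ *ᵥ (P x *ᵥ w))) 0)

theorem connection_eq_connWith :
    connection G = connWith G (christoffel G) (schouten G) := rfl

theorem connWith_linear {T : (Fin 4 → ℝ) → Fin 4 → Fin 4 → Fin 4 → ℝ}
    {P : (Fin 4 → ℝ) → Matrix (Fin 4) (Fin 4) ℝ} (x w : Fin 4 → ℝ) :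
    connWith G T P x w = ∑ k, w k • connWith G T P x (Pi.single k 1) := by
  have e : ∀ (M : Matrix (Fin 4) (Fin 4) ℝ) i, (M *ᵥ w) i = ∑ k, w k * (M *ᵥ Pi.single k 1) i := by
    intro M i
    simp [Matrix.mulVec, dotProduct, Pi.single_apply, mul_comm]
  ext a b
  simp only [Matrix.sum_apply, Matrix.smul_apply, smul_eq_mul]
  revert b
  refine forall_six ?_ (fun j => ?_) ?_ <;> revert a <;> refine forall_six ?_ (fun i => ?_) ?_ <;>
    simp only [connWith, ofCols_zero, ofCols_mid, ofCols_five, tvec_zero, tvec_mid, tvec_five,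
      Pi.neg_apply, mul_zero, Finset.sum_const_zero, mul_neg, Finset.sum_neg_distrib,
      Matrix.mulVec_mulVec, ← e]
  · simp [Pi.single_apply]
  · simp [Pi.single_apply, mul_comm]

theorem connWith_smooth (hG : IsMetricOn G V) {T : (Fin 4 → ℝ) → Fin 4 → Fin 4 → Fin 4 → ℝ}
    {P : (Fin 4 → ℝ) → Matrix (Fin 4) (Fin 4) ℝ}
    (hT : ∀ i j k, ContDiffOn ℝ ∞ (fun x => T x i j k) V) (hP : MatSmoothOn P V) (w : Fin 4 → ℝ) :
    MatSmoothOn (fun x => connWith G T P x w) V := by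
  have hi := hG.smooth.inv hG.det_ne
  intro a b
  revert b
  refine forall_six ?_ (fun j => ?_) ?_ <;> revert a <;> refine forall_six ?_ (fun i => ?_) ?_ <;>
    simp only [connWith, ofCols_zero, ofCols_mid, ofCols_five, tvec_zero, tvec_mid, tvec_five,
      Pi.neg_apply, Matrix.mulVec, dotProduct]
  all_goals try exact contDiffOn_const
  · exact (ContDiffOn.sum fun k _ => (hP j k).mul contDiffOn_const).neg
  · exact ContDiffOn.sum fun k _ => (hT i j k).mul contDiffOn_const
  · exact ContDiffOn.sum fun k _ => (hG.smooth j k).mul contDiffOn_const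
  · exact (ContDiffOn.sum fun k _ => (hi i k).mul
      (ContDiffOn.sum fun l _ => (hP k l).mul contDiffOn_const)).neg

/-- The entries of `connWith` on a coordinate vector. -/
theorem connWith_single {T : (Fin 4 → ℝ) → Fin 4 → Fin 4 → Fin 4 → ℝ}
    {P : (Fin 4 → ℝ) → Matrix (Fin 4) (Fin 4) ℝ} (x : Fin 4 → ℝ) (k : Fin 4) :
    (∀ a, connWith G T P x (Pi.single k 1) a 0 = tvec 0 (Pi.single k 1) 0 a) ∧
    (∀ j, connWith G T P x (Pi.single k 1) 0 (mid j) = - P x j k) ∧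
    (∀ i j, connWith G T P x (Pi.single k 1) (mid i) (mid j) = T x i j k) ∧
    (∀ j, connWith G T P x (Pi.single k 1) 5 (mid j) = G x j k) ∧
    (∀ i, connWith G T P x (Pi.single k 1) (mid i) 5 = - ((G x)⁻¹ * P x) i k) ∧
    connWith G T P x (Pi.single k 1) 0 5 = 0 ∧ connWith G T P x (Pi.single k 1) 5 5 = 0 := by
  refine ⟨fun a => rfl, ?_, ?_, ?_, ?_, rfl, rfl⟩ <;> intros <;>
    simp [connWith, Pi.single_apply]
  rfl

/-- The entries are, in turn, the skew part of `P`, the torsion of `T`, zero, and the curvature of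
`T` corrected by the metric and `P`. They are needed for arbitrary `T` and `P`, because the
uniqueness proof meets them before these are known to be the Christoffel symbols and the Schouten
tensor. -/
theorem formCurv_connWith (hG : IsMetricOn G V) {T : (Fin 4 → ℝ) → Fin 4 → Fin 4 → Fin 4 → ℝ}
    {P : (Fin 4 → ℝ) → Matrix (Fin 4) (Fin 4) ℝ} {x : Fin 4 → ℝ} (hx : x ∈ V) (k l : Fin 4) :
    (formCurv (connWith G T P) x (Pi.single k 1) (Pi.single l 1) 0 0 = P x k l - P x l k) ∧
    (∀ i, formCurv (connWith G T P) x (Pi.single k 1) (Pi.single l 1) (mid i) 0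
      = T x i l k - T x i k l) ∧
    (formCurv (connWith G T P) x (Pi.single k 1) (Pi.single l 1) 5 0 = 0) ∧
    (∀ i j, formCurv (connWith G T P) x (Pi.single k 1) (Pi.single l 1) (mid i) (mid j)
      = (pd k (fun y => T y i j l) x - pd l (fun y => T y i j k) x
        + ∑ m, (T x i m k * T x m j l - T x i m l * T x m j k))
        - (1 : Matrix (Fin 4) (Fin 4) ℝ) i k * P x j l + (1 : Matrix (Fin 4) (Fin 4) ℝ) i l * P x j k
        - ((G x)⁻¹ * P x) i k * G x j l + ((G x)⁻¹ * P x) i l * G x j k) := by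
  have E := connWith_single (G := G) (T := T) (P := P)
  refine ⟨?_, fun i => ?_, ?_, fun i j => ?_⟩ <;>
    simp only [formCurv, Matrix.add_apply, Matrix.sub_apply, mul_six, matDeriv, Matrix.of_apply,
      (E _ _).1, (E _ _).2.1, (E _ _).2.2.1, (E _ _).2.2.2.1, (E _ _).2.2.2.2.1,
      (E _ _).2.2.2.2.2.1, (E _ _).2.2.2.2.2.2, tvec_zero, tvec_mid, tvec_five]
  · simp [Pi.single_apply]; ring
  · simp [Pi.single_apply]
  · simp [Pi.single_apply, hG.symm x hx k l]
  · simp only [pd, Finset.sum_sub_distrib, Pi.single_apply, Matrix.one_apply]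
    ring

/-- Algebraic properties of the curvature of a torsion-free normal connection form. -/
structure CurvLike (C : (Fin 4 → ℝ) → (Fin 4 → ℝ) → Matrix (Fin 6) (Fin 6) ℝ) : Prop where
  bilin : ∀ w w', C w w' = ∑ k, ∑ l, (w k * w' l) • C (Pi.single k 1) (Pi.single l 1)
  swap : ∀ w w', C w w' = - C w' w
  col_zero : ∀ w w' a, C w w' a 0 = 0
  row_five : ∀ w w' a, C w w' 5 a = 0
  bianchi : ∀ u v w i, ∑ j, C u v (mid i) (mid j) * w j + ∑ j, C v w (mid i) (mid j) * u j
    + ∑ j, C w u (mid i) (mid j) * v j = 0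
  ricci : ∀ w j, ∑ i, C (Pi.single i 1) w (mid i) (mid j) = 0

/-- The defining properties of the normal conformal connection of a metric. -/
structure IsNormalConn (G : (Fin 4 → ℝ) → Matrix (Fin 4) (Fin 4) ℝ) (V : Set (Fin 4 → ℝ))
    (Θ : (Fin 4 → ℝ) → (Fin 4 → ℝ) → Matrix (Fin 6) (Fin 6) ℝ) : Prop where
  linear : ∀ x w, Θ x w = ∑ k, w k • Θ x (Pi.single k 1)
  smooth : ∀ k, MatSmoothOn (fun x => Θ x (Pi.single k 1)) V
  col_zero : ∀ x ∈ V, ∀ w a, Θ x w a 0 = tvec 0 w 0 a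
  metric : ∀ x ∈ V, ∀ w, (Θ x w)ᵀ * gramOf (G x) + gramOf (G x) * Θ x w
    = matDeriv (fun y => gramOf (G y)) x w
  torsion : ∀ x ∈ V, ∀ w w' a, formCurv Θ x w w' a 0 = 0
  ricci : ∀ x ∈ V, ∀ w j, ∑ i, formCurv Θ x (Pi.single i 1) w (mid i) (mid j) = 0

@[simp] theorem gramOf_zero_right (g : Matrix (Fin 4) (Fin 4) ℝ) (a) :
    gramOf g a 0 = tvec 0 0 (-1) a := rfl
@[simp] theorem gramOf_five_right (g : Matrix (Fin 4) (Fin 4) ℝ) (a) :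
    gramOf g a 5 = tvec (-1) 0 0 a := rfl
@[simp] theorem gramOf_mid_right (g : Matrix (Fin 4) (Fin 4) ℝ) (a) (j) :
    gramOf g a (mid j) = tvec 0 (fun i => g i j) 0 a := by simp [gramOf]

theorem gramOf_mul_gramOf {g g' : Matrix (Fin 4) (Fin 4) ℝ} (h : g * g' = 1) :
    gramOf g * gramOf g' = 1 := by
  ext a b
  revert b
  refine forall_six ?_ (fun j => ?_) ?_ <;> revert a <;> refine forall_six ?_ (fun i => ?_) ?_ <;>
    rw [mul_six] <;> simp [Matrix.one_apply]
  have := congrFun (congrFun h i) j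
  simpa [Matrix.mul_apply, Matrix.one_apply] using this

theorem gramOf_det_ne {g : Matrix (Fin 4) (Fin 4) ℝ} (h : g.det ≠ 0) : (gramOf g).det ≠ 0 := by
  have := gramOf_mul_gramOf (Matrix.mul_nonsing_inv g (isUnit_iff_ne_zero.2 h))
  have h2 := congrArg Matrix.det this
  rw [Matrix.det_mul, Matrix.det_one] at h2
  exact left_ne_zero_of_mul_eq_one h2

/-! ### Metricity, curvature and uniqueness of the normal conformal connection -/

section Normal
variable (hG : IsMetricOn G V)

theorem matDeriv_gramOf {x : Fin 4 → ℝ} (w : Fin 4 → ℝ) :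
    (∀ a, matDeriv (fun y => gramOf (G y)) x w a 0 = 0) ∧
    (∀ a, matDeriv (fun y => gramOf (G y)) x w a 5 = 0) ∧
    (∀ j, matDeriv (fun y => gramOf (G y)) x w 0 (mid j) = 0) ∧
    (∀ j, matDeriv (fun y => gramOf (G y)) x w 5 (mid j) = 0) ∧
    (∀ i j, matDeriv (fun y => gramOf (G y)) x w (mid i) (mid j)
      = fderiv ℝ (fun y => G y i j) x w) := by
  simp [matDeriv]

include hG

theorem gramOf_smooth : MatSmoothOn (fun y => gramOf (G y)) V := by
  intro a b
  revert b
  refine forall_six ?_ (fun j => ?_) ?_ <;> revert a <;> refine forall_six ?_ (fun i => ?_) ?_ <;>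
    simp [contDiffOn_const, hG.smooth _ _]

/-- The covariant constancy of the scalar product makes the curvature skew-symmetric. -/
theorem formCurv_skew {Θ : (Fin 4 → ℝ) → (Fin 4 → ℝ) → Matrix (Fin 6) (Fin 6) ℝ}
    (hs : ∀ w, MatSmoothOn (fun x => Θ x w) V)
    (hm : ∀ x ∈ V, ∀ w, (Θ x w)ᵀ * gramOf (G x) + gramOf (G x) * Θ x w
      = matDeriv (fun y => gramOf (G y)) x w) {x : Fin 4 → ℝ} (hx : x ∈ V) (w w' : Fin 4 → ℝ) :
    (formCurv Θ x w w')ᵀ * gramOf (G x) + gramOf (G x) * formCurv Θ x w w' = 0 := by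
  have hS := gramOf_smooth hG
  have D : ∀ v v', (matDeriv (fun y => Θ y v) x v')ᵀ * gramOf (G x)
      + (Θ x v)ᵀ * matDeriv (fun y => gramOf (G y)) x v'
      + (matDeriv (fun y => gramOf (G y)) x v' * Θ x v
      + gramOf (G x) * matDeriv (fun y => Θ y v) x v')
      = matDeriv (fun z => matDeriv (fun y => gramOf (G y)) z v) x v' := by
    intro v v'
    rw [← matDeriv_congr hG.isOpen (fun z hz => hm z hz v) hx,
      matDeriv_add hG.isOpen ((hs v).transpose.mul hS) (hS.mul (hs v)) hx,
      matDeriv_mul hG.isOpen (hs v).transpose hS hx, matDeriv_mul hG.isOpen hS (hs v) hx]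
    rfl
  have e := congrArg₂ (· - ·) (D w' w) (D w w')
  rw [matDeriv_comm hG.isOpen hS hx w w', ← hm x hx, ← hm x hx] at e
  simp only [formCurv, Matrix.transpose_add, Matrix.transpose_sub, Matrix.transpose_mul]
  simp only [mul_add, mul_sub, add_mul, sub_mul, ← mul_assoc] at e ⊢
  rw [← sub_eq_zero] at e
  rw [← e]
  abel

/-- A check by blocks. The middle block is the compatibility of the Christoffel symbols with the
metric; the blocks touching `X` and `Y` hold because the coefficients of `dX`, `dY` are those of
`d∂_j` with an index raised or lowered. -/
theorem connection_metric {x : Fin 4 → ℝ} (hx : x ∈ V) (w : Fin 4 → ℝ) :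
    (connection G x w)ᵀ * gramOf (G x) + gramOf (G x) * connection G x w
      = matDeriv (fun y => gramOf (G y)) x w := by
  have hinv : ∀ v j, ∑ i, G x i j * ((G x)⁻¹ *ᵥ v) i = v j := by
    intro v j
    have := congrFun (congrArg (fun M => M *ᵥ v) (hG.mul_inv hx)) j
    simp only [Matrix.one_mulVec, ← Matrix.mulVec_mulVec] at this
    rw [← this, Matrix.mulVec, dotProduct]
    exact Finset.sum_congr rfl fun i _ => by rw [hG.symm x hx i j]
  have hinv' : ∀ v j, ∑ i, G x j i * ((G x)⁻¹ *ᵥ v) i = v j := by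
    intro v j
    rw [← hinv v j]
    exact Finset.sum_congr rfl fun i _ => by rw [hG.symm x hx i j]
  obtain ⟨m0, m5, m0', m5', mm⟩ := matDeriv_gramOf (G := G) (x := x) w
  ext a b
  revert b
  refine forall_six ?_ (fun j => ?_) ?_ <;> revert a <;> refine forall_six ?_ (fun i => ?_) ?_ <;>
    simp only [m0, m5, m0', m5', mm, Matrix.add_apply, mul_six, Matrix.transpose_apply] <;>
    simp [connection, -Matrix.mulVec_mulVec]
  · simp [Matrix.mulVec, dotProduct]
  · simp only [Matrix.mulVec, dotProduct, ← sub_eq_add_neg, sub_eq_zero]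
    exact Finset.sum_congr rfl fun i _ => by rw [hG.symm x hx i j, mul_comm]
  -- The middle block: both sides are expanded over the coordinate directions and compared by
  -- `christoffel_metric`.
  · rw [fderiv_sum_basis]
    simp only [Finset.sum_mul, Finset.mul_sum]
    rw [Finset.sum_comm, Finset.sum_comm (f := fun m k => G x i m * _), ← Finset.sum_add_distrib]
    refine Finset.sum_congr rfl fun k _ => ?_
    have := hG.christoffel_metric hx k i j
    rw [pd] at this
    rw [← this, mul_add, Finset.mul_sum, Finset.mul_sum, add_comm]
    congr 1
    · exact Finset.sum_congr rfl fun m _ => by ring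
    · exact Finset.sum_congr rfl fun m _ => by rw [hG.symm x hx m j]; ring
  · rw [← hinv (schouten G x *ᵥ w) j, ← sub_eq_zero]
    simp [mul_comm]
  · rw [hinv']; ring

omit hG in
theorem IsMetricOn.trace_inv_mul (hG : IsMetricOn G V) {x : Fin 4 → ℝ} (hx : x ∈ V)
    (P : Matrix (Fin 4) (Fin 4) ℝ) (k l : Fin 4) : ∑ i, ((G x)⁻¹ * P) i k * G x i l = P l k := by
  have : (G x * ((G x)⁻¹ * P)) l k = P l k := by rw [← mul_assoc, hG.mul_inv hx, one_mul]
  rw [← this, Matrix.mul_apply]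
  exact Finset.sum_congr rfl fun i _ => by rw [hG.symm x hx i l, mul_comm]

theorem mid_connection {P : (Fin 4 → ℝ) → Matrix (Fin 4) (Fin 4) ℝ}
    {x : Fin 4 → ℝ} (hx : x ∈ V) (k l i j : Fin 4) :
    formCurv (connWith G (christoffel G) P) x (Pi.single k 1) (Pi.single l 1) (mid i) (mid j)
      = riemann G x i j k l
        - (1 : Matrix (Fin 4) (Fin 4) ℝ) i k * P x j l + (1 : Matrix (Fin 4) (Fin 4) ℝ) i l * P x j k
        - ((G x)⁻¹ * P x) i k * G x j l + ((G x)⁻¹ * P x) i l * G x j k := by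
  rw [((formCurv_connWith hG hx k l).2.2.2) i j]
  have hp : ∀ m a b c, pd m (fun y => christoffel G y a b c) x
      = pd m (fun y => christoffel G y a c b) x := by
    intro m a b c
    unfold pd
    rw [fderiv_eq_of_eqOn hG.isOpen (fun z hz => hG.christoffel_symm hz a b c) hx]
  unfold riemann
  rw [hp k i l j, hp l i k j]
  simp only [fun m => hG.christoffel_symm hx i m k, fun m => hG.christoffel_symm hx i m l,
    fun m => hG.christoffel_symm hx m j k, fun m => hG.christoffel_symm hx m j l]

/-- The coefficient 2 is n - 2 for n = 4. Vanishing of this trace is the normality condition that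
will determine `P`. -/
theorem ricci_trace_connWith {P : (Fin 4 → ℝ) → Matrix (Fin 4) (Fin 4) ℝ}
    {x : Fin 4 → ℝ} (hx : x ∈ V) (l j : Fin 4) :
    ∑ i, formCurv (connWith G (christoffel G) P) x (Pi.single i 1) (Pi.single l 1) (mid i) (mid j)
      = ricci G x j l - 2 * P x j l - ((G x)⁻¹ * P x).trace * G x j l := by
  simp only [mid_connection hG hx, Finset.sum_add_distrib, Finset.sum_sub_distrib]
  have h1 : ∑ i, ((G x)⁻¹ * P x) i l * G x j i = P x j l := by
    rw [← hG.trace_inv_mul hx (P x) l j]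
    exact Finset.sum_congr rfl fun i _ => by rw [hG.symm x hx i j]
  rw [h1]
  simp only [ricci, Matrix.of_apply, Matrix.one_apply, Matrix.trace, Matrix.diag, Finset.sum_mul]
  simp
  ring

theorem scalarCurvature_eq {x : Fin 4 → ℝ} (hx : x ∈ V) :
    scalarCurvature G x = ((G x)⁻¹ * ricci G x).trace := by
  simp only [scalarCurvature, Matrix.trace, Matrix.diag, Matrix.mul_apply]
  rw [Finset.sum_comm]
  exact Finset.sum_congr rfl fun i _ => Finset.sum_congr rfl fun j _ => by
    rw [hG.inv_symm hx]

theorem trace_schouten {x : Fin 4 → ℝ} (hx : x ∈ V) :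
    ((G x)⁻¹ * schouten G x).trace = scalarCurvature G x / 6 := by
  rw [schouten, Matrix.mul_smul, Matrix.trace_smul, mul_sub, Matrix.trace_sub, Matrix.mul_smul,
    Matrix.trace_smul, ← scalarCurvature_eq hG hx, hG.inv_mul hx, Matrix.trace_one]
  simp
  ring

/-- Contracting the hypothesis gives the scalar curvature as 2(n - 1) = 6 times the trace of `P`;
substituting back leaves an explicit formula for `P`. -/
theorem eq_schouten_of_ricci {x : Fin 4 → ℝ} (hx : x ∈ V) {P : Matrix (Fin 4) (Fin 4) ℝ}
    (h : ∀ l j, ricci G x j l - 2 * P j l - ((G x)⁻¹ * P).trace * G x j l = 0) :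
    P = schouten G x := by
  have hm : ricci G x = (2 : ℝ) • P + ((G x)⁻¹ * P).trace • G x := by
    ext j l
    have := h l j
    simp only [Matrix.add_apply, Matrix.smul_apply, smul_eq_mul]
    linarith
  have ht : scalarCurvature G x = 6 * ((G x)⁻¹ * P).trace := by
    rw [scalarCurvature_eq hG hx]
    conv_lhs => rw [hm]
    rw [mul_add, Matrix.mul_smul, Matrix.mul_smul, Matrix.trace_add, Matrix.trace_smul,
      Matrix.trace_smul, hG.inv_mul hx, Matrix.trace_one]
    simp
    ring
  ext j l
  have := h l j
  simp only [schouten, Matrix.smul_apply, Matrix.sub_apply, smul_eq_mul, ht]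
  linarith

theorem connection_smooth (w : Fin 4 → ℝ) : MatSmoothOn (fun x => connection G x w) V :=
  connWith_smooth hG hG.christoffel_smooth hG.schouten_smooth w

/-- The middle block of the curvature is skew for the metric, hence trace-free, and the terms with
the Schouten tensor cancel in the trace. This cancellation does not use the symmetry of the Schouten
tensor, which is itself deduced from this lemma. -/
theorem riemann_trace {x : Fin 4 → ℝ} (hx : x ∈ V) (k l : Fin 4) :
    ∑ i, riemann G x i i k l = 0 := by
  have hs := formCurv_skew hG (connection_smooth hG) (fun x hx => connection_metric hG hx) hx
    (Pi.single k 1) (Pi.single l 1)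
  set C := formCurv (connection G) x (Pi.single k 1) (Pi.single l 1) with hC
  let c : Matrix (Fin 4) (Fin 4) ℝ := Matrix.of fun i j => C (mid i) (mid j)
  have hc : cᵀ * G x + G x * c = 0 := by
    ext a b
    have := congrFun (congrFun hs (mid a)) (mid b)
    simp only [Matrix.add_apply, mul_six, Matrix.transpose_apply] at this
    simpa [Matrix.mul_apply, c] using this
  have ht : c.trace = 0 := by
    have e : cᵀ = - (G x * c * (G x)⁻¹) := by
      have := congrArg (fun M => M * (G x)⁻¹) (eq_neg_of_add_eq_zero_left hc)
      simpa [mul_assoc, hG.mul_inv hx] using this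
    have := congrArg Matrix.trace e
    rw [Matrix.trace_transpose, Matrix.trace_neg, Matrix.trace_mul_comm, ← mul_assoc,
      hG.inv_mul hx, one_mul] at this
    linarith
  have : c.trace = ∑ i, riemann G x i i k l := by
    simp only [Matrix.trace, Matrix.diag, c, Matrix.of_apply, hC, connection_eq_connWith,
      mid_connection hG hx, Finset.sum_add_distrib, Finset.sum_sub_distrib, hG.trace_inv_mul hx]
    simp [Matrix.one_apply]
  rw [← this, ht]

/-- Contraction of the cyclic identity, in which the trace over the first two indices vanishes. -/
theorem ricci_symm {x : Fin 4 → ℝ} (hx : x ∈ V) (j l : Fin 4) : ricci G x j l = ricci G x l j := by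
  have h : ∑ i, (riemann G x i j i l + riemann G x i i l j + riemann G x i l j i) = 0 :=
    Finset.sum_eq_zero fun i _ => hG.riemann_bianchi hx i j i l
  rw [Finset.sum_add_distrib, Finset.sum_add_distrib, riemann_trace hG hx] at h
  have h2 : ∑ i, riemann G x i l j i = - ∑ i, riemann G x i l i j := by
    rw [← Finset.sum_neg_distrib]
    exact Finset.sum_congr rfl fun i _ => riemann_swap x i l j i
  simp only [ricci, Matrix.of_apply]
  linarith

theorem schouten_symm {x : Fin 4 → ℝ} (hx : x ∈ V) (j l : Fin 4) :
    schouten G x j l = schouten G x l j := by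
  simp only [schouten, Matrix.smul_apply, Matrix.sub_apply, smul_eq_mul, ricci_symm hG hx j l,
    hG.symm x hx j l]

theorem formCurv_bilin {Θ : (Fin 4 → ℝ) → (Fin 4 → ℝ) → Matrix (Fin 6) (Fin 6) ℝ}
    (hlin : ∀ x w, Θ x w = ∑ k, w k • Θ x (Pi.single k 1))
    (hs : ∀ k, MatSmoothOn (fun x => Θ x (Pi.single k 1)) V) {x : Fin 4 → ℝ} (hx : x ∈ V)
    (w w' : Fin 4 → ℝ) :
    formCurv Θ x w w' = ∑ k, ∑ l, (w k * w' l) • formCurv Θ x (Pi.single k 1) (Pi.single l 1) := by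
  have d : ∀ v v', matDeriv (fun y => Θ y v) x v'
      = ∑ k, ∑ l, (v' k * v l) • matDeriv (fun y => Θ y (Pi.single l 1)) x (Pi.single k 1) := by
    intro v v'
    rw [matDeriv_sum_basis]
    refine Finset.sum_congr rfl fun k _ => ?_
    ext i j
    have e : ∀ y, Θ y v i j = ∑ l, v l * Θ y (Pi.single l 1) i j := by
      intro y; rw [hlin]; simp [Matrix.sum_apply]
    simp only [matDeriv, Matrix.smul_apply, Matrix.of_apply, Matrix.sum_apply, e, smul_eq_mul]
    rw [fderiv_sum_mul (fun l => differentiableAt_const (v l))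
      (fun l => diffAt_of_smoothOn hG.isOpen (hs l i j) hx), Finset.mul_sum]
    exact Finset.sum_congr rfl fun l _ => by simp; ring
  have c : ∀ v v' : Fin 4 → ℝ, ∑ k, ∑ l, (v k * v' l) • (Θ x (Pi.single k 1) * Θ x (Pi.single l 1))
      = Θ x v * Θ x v' := by
    intro v v'
    rw [hlin x v, hlin x v', Finset.sum_mul_sum]
    exact Finset.sum_congr rfl fun k _ => Finset.sum_congr rfl fun l _ => by
      rw [smul_mul_smul_comm]
  simp only [formCurv, smul_add, smul_sub, Finset.sum_add_distrib, Finset.sum_sub_distrib, c]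
  rw [d w' w, d w w']
  congr 1
  · refine congrArg₂ (· - ·) rfl ?_
    rw [Finset.sum_comm]
    exact Finset.sum_congr rfl fun k _ => Finset.sum_congr rfl fun l _ => by rw [mul_comm (w _)]
  · refine congrArg₂ (· - ·) rfl ?_
    rw [Finset.sum_comm, ← c w' w]
    exact Finset.sum_congr rfl fun k _ => Finset.sum_congr rfl fun l _ => by rw [mul_comm (w' k)]

omit hG in
theorem formCurv_swap (Θ : (Fin 4 → ℝ) → (Fin 4 → ℝ) → Matrix (Fin 6) (Fin 6) ℝ) (x w w') :
    formCurv Θ x w w' = - formCurv Θ x w' w := by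
  simp only [formCurv]; abel

theorem connection_skew {x : Fin 4 → ℝ} (hx : x ∈ V) (w w' : Fin 4 → ℝ) :
    (curvature G x w w')ᵀ * gramOf (G x) + gramOf (G x) * curvature G x w w' = 0 :=
  formCurv_skew hG (connection_smooth hG) (fun _ hx => connection_metric hG hx) hx w w'

omit hG in
theorem row_five_of_skew {g : Matrix (Fin 4) (Fin 4) ℝ} {C : Matrix (Fin 6) (Fin 6) ℝ}
    (h : Cᵀ * gramOf g + gramOf g * C = 0) (h0 : ∀ a, C a 0 = 0) (a : Fin 6) : C 5 a = 0 := by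
  have := congrFun (congrFun h 0) a
  simp only [Matrix.add_apply, mul_six, Matrix.transpose_apply, h0] at this
  simpa using this

/-- The first column vanishes by the symmetry of the Schouten tensor and of the Christoffel symbols,
and the last row then vanishes by skew-symmetry. In the cyclic identity the Schouten terms cancel by
symmetry; the trace condition is what the choice of the Schouten tensor achieves. -/
theorem connection_curvLike {x : Fin 4 → ℝ} (hx : x ∈ V) : CurvLike (curvature G x) := by
  have hb : ∀ w w', curvature G x w w' = ∑ k, ∑ l, (w k * w' l) •
      curvature G x (Pi.single k 1) (Pi.single l 1) :=
    formCurv_bilin hG (connWith_linear) (fun k => connection_smooth hG _) hx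
  have c0 : ∀ w w' a, curvature G x w w' a 0 = 0 := by
    have h0 : ∀ k l a, curvature G x (Pi.single k 1) (Pi.single l 1) a 0 = 0 := by
      intro k l
      obtain ⟨h0, hm, h5, -⟩ := formCurv_connWith (T := christoffel G) (P := schouten G) hG hx k l
      refine forall_six (h0.trans ?_) (fun i => (hm i).trans ?_) h5
      · rw [schouten_symm hG hx]; ring
      · rw [hG.christoffel_symm hx]; ring
    intro w w' a
    rw [hb]
    simp [Matrix.sum_apply, h0]
  refine ⟨hb, fun w w' => formCurv_swap _ _ _ _, c0,
    fun w w' => row_five_of_skew (connection_skew hG hx w w') (c0 w w'), ?_, ?_⟩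
  · intro u v w i
    have hB : ∀ j k l, curvature G x (Pi.single k 1) (Pi.single l 1) (mid i) (mid j)
        + curvature G x (Pi.single l 1) (Pi.single j 1) (mid i) (mid k)
        + curvature G x (Pi.single j 1) (Pi.single k 1) (mid i) (mid l) = 0 := by
      intro j k l
      simp only [curvature_eq_formCurv, connection_eq_connWith, mid_connection hG hx]
      have := hG.riemann_bianchi hx i j k l
      rw [schouten_symm hG hx l k, schouten_symm hG hx l j, schouten_symm hG hx k j,
        hG.symm x hx l k, hG.symm x hx l j, hG.symm x hx k j]
      linear_combination this
    have e : ∀ u v w : Fin 4 → ℝ, ∑ j, curvature G x u v (mid i) (mid j) * w j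
        = ∑ j, ∑ k, ∑ l, w j * u k * v l *
          curvature G x (Pi.single k 1) (Pi.single l 1) (mid i) (mid j) := by
      intro u v w
      refine Finset.sum_congr rfl fun j _ => ?_
      rw [hb]
      simp only [Matrix.sum_apply, Matrix.smul_apply, smul_eq_mul, Finset.sum_mul]
      exact Finset.sum_congr rfl fun k _ => Finset.sum_congr rfl fun l _ => by ring
    rw [e, e, e]
    have r1 : ∑ j, ∑ k, ∑ l, u j * v k * w l *
          curvature G x (Pi.single k 1) (Pi.single l 1) (mid i) (mid j)
        = ∑ j, ∑ k, ∑ l, w j * u k * v l *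
          curvature G x (Pi.single l 1) (Pi.single j 1) (mid i) (mid k) := by
      rw [Finset.sum_congr rfl fun j _ => Finset.sum_comm, Finset.sum_comm]
      exact Finset.sum_congr rfl fun j _ => Finset.sum_congr rfl fun k _ =>
        Finset.sum_congr rfl fun l _ => by ring
    have r2 : ∑ j, ∑ k, ∑ l, v j * w k * u l *
          curvature G x (Pi.single k 1) (Pi.single l 1) (mid i) (mid j)
        = ∑ j, ∑ k, ∑ l, w j * u k * v l *
          curvature G x (Pi.single j 1) (Pi.single k 1) (mid i) (mid l) := by
      rw [Finset.sum_comm]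
      refine Finset.sum_congr rfl fun j _ => ?_
      rw [Finset.sum_comm]
      exact Finset.sum_congr rfl fun k _ =>
        Finset.sum_congr rfl fun l _ => by ring
    rw [r1, r2]
    simp only [← Finset.sum_add_distrib, ← mul_add, hB, mul_zero, Finset.sum_const_zero]
  · intro w j
    have h0 : ∀ l, ∑ i, curvature G x (Pi.single i 1) (Pi.single l 1) (mid i) (mid j) = 0 := by
      intro l
      have := ricci_trace_connWith hG (P := schouten G) hx l j
      refine this.trans ?_
      rw [trace_schouten hG hx]
      simp only [schouten, Matrix.smul_apply, Matrix.sub_apply, smul_eq_mul]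
      ring
    have e : ∀ i, curvature G x (Pi.single i 1) w (mid i) (mid j)
        = ∑ l, w l * curvature G x (Pi.single i 1) (Pi.single l 1) (mid i) (mid j) := by
      intro i
      rw [hb]
      simp only [Matrix.sum_apply, Matrix.smul_apply, smul_eq_mul]
      rw [Finset.sum_eq_single i (fun b _ hb => by simp [hb]) (by simp)]
      simp
    simp only [e]
    rw [Finset.sum_comm]
    simp only [← Finset.mul_sum, h0, mul_zero, Finset.sum_const_zero]

/-- The normal conformal connection is determined by its defining properties. -/
theorem IsNormalConn.eq_connection {Θ : (Fin 4 → ℝ) → (Fin 4 → ℝ) → Matrix (Fin 6) (Fin 6) ℝ}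
    (h : IsNormalConn G V Θ) {x : Fin 4 → ℝ} (hx : x ∈ V) (w : Fin 4 → ℝ) :
    Θ x w = connection G x w := by
  let T : (Fin 4 → ℝ) → Fin 4 → Fin 4 → Fin 4 → ℝ := fun x i j k => Θ x (Pi.single k 1) (mid i) (mid j)
  let P : (Fin 4 → ℝ) → Matrix (Fin 4) (Fin 4) ℝ := fun x => Matrix.of fun j k =>
    - Θ x (Pi.single k 1) 0 (mid j)
  have met : ∀ x ∈ V, ∀ k, ∀ a b, ((Θ x (Pi.single k 1))ᵀ * gramOf (G x)) a b
      + (gramOf (G x) * Θ x (Pi.single k 1)) a b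
      = matDeriv (fun y => gramOf (G y)) x (Pi.single k 1) a b := fun x hx k a b =>
    congrFun (congrFun (h.metric x hx (Pi.single k 1)) a) b
  -- The prescribed first column and metricity force the block shape. At this stage `T` and `P` are
  -- only names for the two blocks that remain free.
  have shape : ∀ x ∈ V, ∀ w, Θ x w = connWith G T P x w := by
    intro x hx w
    rw [h.linear, connWith_linear]
    refine Finset.sum_congr rfl fun k _ => ?_
    congr 1
    obtain ⟨E0, E1, E2, E3, E4, E5, E6⟩ := connWith_single (G := G) (T := T) (P := P) x k
    have col := h.col_zero x hx (Pi.single k 1)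
    obtain ⟨m0, m5, m0', m5', mm⟩ := matDeriv_gramOf (G := G) (x := x) (Pi.single k 1)
    have M := met x hx k
    simp only [mul_six, Matrix.transpose_apply] at M
    ext a b
    revert b
    refine forall_six ?_ (fun j => ?_) ?_ <;> revert a <;> refine forall_six ?_ (fun i => ?_) ?_
    · rw [E0, col]
    · rw [E0, col]
    · rw [E0, col]
    · rw [E1]; simp [P]
    · rw [E2]
    · rw [E3]
      have := M 0 (mid j)
      rw [m0'] at this
      simp [col, Pi.single_apply] at this
      rw [hG.symm x hx]; linarith
    · rw [E5]
      have := M 5 5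
      rw [m5] at this
      simp at this
      linarith
    · rw [E4]
      have key : (fun i => Θ x (Pi.single k 1) (mid i) 5) = fun i => -((G x)⁻¹ * P x) i k := by
        refine hG.eq_of_lower_eq hx fun a => ?_
        have := M (mid a) 5
        rw [m5] at this
        simp at this
        have h2 := hG.trace_inv_mul hx (P x) k a
        simp only [mul_neg, Finset.sum_neg_distrib]
        rw [Finset.sum_congr rfl fun i _ => show G x a i * ((G x)⁻¹ * P x) i k
          = ((G x)⁻¹ * P x) i k * G x i a by rw [hG.symm x hx a i, mul_comm], h2]
        simp only [P, Matrix.of_apply]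
        linarith
      exact congrFun key i
    · rw [E6]
      have := M 0 5
      rw [m5] at this
      simp [col] at this
      exact this
  have curv : ∀ x ∈ V, ∀ w w', formCurv Θ x w w' = formCurv (connWith G T P) x w w' := by
    intro x hx w w'
    simp only [formCurv, shape x hx]
    rw [matDeriv_congr hG.isOpen (fun z hz => shape z hz w') hx,
      matDeriv_congr hG.isOpen (fun z hz => shape z hz w) hx]
  -- Vanishing torsion makes `T` symmetric, and metricity then makes it the Levi-Civita connection.
  have hT : ∀ x ∈ V, ∀ i j k, T x i j k = christoffel G x i j k := by
    intro x hx
    refine hG.christoffel_unique hx _ (fun i j k => ?_) fun i j k => ?_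
    · have := h.torsion x hx (Pi.single k 1) (Pi.single j 1) (mid i)
      rw [curv x hx, (formCurv_connWith hG hx k j).2.1] at this
      linarith
    · have := met x hx k (mid i) (mid j)
      simp only [mul_six, Matrix.transpose_apply, (matDeriv_gramOf _).2.2.2.2] at this
      simp at this
      rw [pd, ← this, add_comm]
      congr 1
      exact Finset.sum_congr rfl fun m _ => by rw [hG.symm x hx j m, mul_comm]
  have hPc : ∀ x ∈ V, ∀ w, connWith G T P x w = connWith G (christoffel G) P x w := by
    intro x hx w
    simp only [connWith, hT x hx]
  -- The trace condition on the curvature is a linear equation for `P` with a single solution.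
  have hP : ∀ x ∈ V, P x = schouten G x := by
    intro x hx
    refine eq_schouten_of_ricci hG hx fun l j => ?_
    rw [← ricci_trace_connWith hG hx]
    rw [← h.ricci x hx (Pi.single l 1) j]
    refine Finset.sum_congr rfl fun i _ => ?_
    rw [curv x hx]
    simp only [formCurv, hPc x hx]
    rw [matDeriv_congr hG.isOpen (fun z hz => hPc z hz (Pi.single l 1)) hx,
      matDeriv_congr hG.isOpen (fun z hz => hPc z hz (Pi.single i 1)) hx]
  rw [shape x hx, hPc x hx, connection_eq_connWith]
  simp only [connWith, hP x hx]

end Normal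

theorem CurvLike.linear_left {C : (Fin 4 → ℝ) → (Fin 4 → ℝ) → Matrix (Fin 6) (Fin 6) ℝ}
    (h : CurvLike C) (J : Matrix (Fin 4) (Fin 4) ℝ) (w v : Fin 4 → ℝ) :
    C (J *ᵥ w) v = ∑ k, w k • C (J *ᵥ Pi.single k 1) v := by
  let L : (Fin 4 → ℝ) →ₗ[ℝ] Matrix (Fin 6) (Fin 6) ℝ :=
    { toFun := fun w => C w v
      map_add' := fun a b => by
        rw [h.bilin, h.bilin a, h.bilin b]
        simp only [Pi.add_apply, add_mul, add_smul, Finset.sum_add_distrib]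
      map_smul' := fun r a => by
        rw [h.bilin, h.bilin a]
        simp only [Pi.smul_apply, smul_eq_mul, mul_assoc, Finset.smul_sum, smul_smul,
          RingHom.id_apply] }
  have := map_sum (L ∘ₗ Matrix.mulVecLin J) (fun k => w k • (Pi.single k 1 : Fin 4 → ℝ)) Finset.univ
  rw [← pi_eq_sum_univ' w] at this
  simp only [LinearMap.comp_apply, map_smul, Matrix.mulVecLin_apply] at this
  exact this

/-- Conjugation of a curvature-like tensor by a change of basis preserving the first vertex. -/
theorem CurvLike.conj {C : (Fin 4 → ℝ) → (Fin 4 → ℝ) → Matrix (Fin 6) (Fin 6) ℝ} (h : CurvLike C)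
    {K : Matrix (Fin 6) (Fin 6) ℝ} {J : Matrix (Fin 4) (Fin 4) ℝ} {s : ℝ} (hK : K.det ≠ 0)
    (hs : s ≠ 0) (hJ : J.det ≠ 0)
    (h0 : ∀ a, K a 0 = tvec s 0 0 a) (h5 : ∀ j, K 5 (mid j) = 0)
    (hm : ∀ i j, K (mid i) (mid j) = s * J i j) :
    CurvLike (fun w w' => K⁻¹ * C (J *ᵥ w) (J *ᵥ w') * K) := by
  have hu : IsUnit K.det := isUnit_iff_ne_zero.2 hK
  have hKZ : ∀ w w', K * (K⁻¹ * C (J *ᵥ w) (J *ᵥ w') * K) = C (J *ᵥ w) (J *ᵥ w') * K := by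
    intro w w'
    rw [mul_assoc, Matrix.mul_nonsing_inv_cancel_left _ _ hu]
  have h55 : K 5 5 ≠ 0 := by
    intro h
    apply hK
    refine Matrix.det_eq_zero_of_row_eq_zero 5 (forall_six ?_ h5 h)
    rw [h0]; rfl
  have c0 : ∀ w w' a, (K⁻¹ * C (J *ᵥ w) (J *ᵥ w') * K) a 0 = 0 := by
    intro w w' a
    rw [mul_assoc, Matrix.mul_apply]
    refine Finset.sum_eq_zero fun c _ => ?_
    rw [mul_six]
    simp [h0, h.col_zero]
  have r5 : ∀ w w' a, (K⁻¹ * C (J *ᵥ w) (J *ᵥ w') * K) 5 a = 0 := by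
    intro w w' a
    have := congrFun (congrFun (hKZ w w') 5) a
    rw [mul_six K, mul_six (C (J *ᵥ w) (J *ᵥ w')) K] at this
    simp only [h0, h5, h.row_five] at this
    simpa [h55] using this
  -- Since the matrix `K` is block triangular, its middle block `s • J` alone conjugates the middle
  -- block of `C`, and the scale `s` cancels.
  have hmid : ∀ w w' i j, ∑ m, J i m * (K⁻¹ * C (J *ᵥ w) (J *ᵥ w') * K) (mid m) (mid j)
      = ∑ m, C (J *ᵥ w) (J *ᵥ w') (mid i) (mid m) * J m j := by
    intro w w' i j
    have := congrFun (congrFun (hKZ w w') (mid i)) (mid j)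
    rw [mul_six K, mul_six (C (J *ᵥ w) (J *ᵥ w')) K] at this
    simp only [h0, h5, h.col_zero, r5, hm, tvec_mid, Pi.zero_apply, zero_mul, mul_zero, add_zero,
      zero_add] at this
    refine mul_left_cancel₀ hs ?_
    rw [Finset.mul_sum, Finset.mul_sum]
    calc _ = ∑ m, s * J i m * (K⁻¹ * C (J *ᵥ w) (J *ᵥ w') * K) (mid m) (mid j) :=
          Finset.sum_congr rfl fun m _ => by ring
      _ = _ := this
      _ = _ := Finset.sum_congr rfl fun m _ => by ring
  have hl : ∀ w v, C (J *ᵥ w) v = ∑ k, w k • C (J *ᵥ Pi.single k 1) v := h.linear_left J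
  have hr : ∀ w v, C v (J *ᵥ w) = ∑ k, w k • C v (J *ᵥ Pi.single k 1) := by
    intro w v
    rw [h.swap, hl, ← Finset.sum_neg_distrib]
    exact Finset.sum_congr rfl fun k _ => by rw [h.swap v, smul_neg]
  refine ⟨fun w w' => ?_, fun w w' => ?_, c0, r5, fun u v w i => ?_, fun w j => ?_⟩
  · rw [hl, Finset.mul_sum, Finset.sum_mul]
    refine Finset.sum_congr rfl fun k _ => ?_
    rw [hr, Finset.smul_sum, Finset.mul_sum, Finset.sum_mul]
    refine Finset.sum_congr rfl fun l _ => ?_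
    rw [smul_smul, Matrix.mul_smul, Matrix.smul_mul]
  · rw [h.swap, mul_neg, neg_mul]
  · set Z : (Fin 4 → ℝ) → (Fin 4 → ℝ) → Matrix (Fin 6) (Fin 6) ℝ :=
      fun w w' => K⁻¹ * C (J *ᵥ w) (J *ᵥ w') * K with hZ
    have hz : ∀ u v w i, ∑ m, J i m * ∑ j, Z u v (mid m) (mid j) * w j
        = ∑ m, C (J *ᵥ u) (J *ᵥ v) (mid i) (mid m) * (J *ᵥ w) m := by
      intro u v w i
      simp only [Matrix.mulVec, dotProduct, Finset.mul_sum]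
      rw [Finset.sum_comm, Finset.sum_comm (f := fun m j => _ * (J m j * w j))]
      refine Finset.sum_congr rfl fun j _ => ?_
      simp only [← mul_assoc]
      rw [← Finset.sum_mul, ← Finset.sum_mul]
      exact congrArg (· * w j) (hmid u v i j)
    have ht : J *ᵥ (fun i => ∑ j, Z u v (mid i) (mid j) * w j + ∑ j, Z v w (mid i) (mid j) * u j
        + ∑ j, Z w u (mid i) (mid j) * v j) = 0 := by
      ext i
      simp only [Matrix.mulVec, dotProduct, mul_add, Finset.sum_add_distrib, hz]
      exact h.bianchi _ _ _ i
    exact congrFun (Matrix.eq_zero_of_mulVec_eq_zero hJ ht) i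
  · have hz : ∀ i, (K⁻¹ * C (J *ᵥ Pi.single i 1) (J *ᵥ w) * K) (mid i) (mid j)
        = ∑ a, J⁻¹ i a * ∑ m, C (J *ᵥ Pi.single i 1) (J *ᵥ w) (mid a) (mid m) * J m j := by
      intro i
      have e : J⁻¹ *ᵥ (J *ᵥ fun m => (K⁻¹ * C (J *ᵥ Pi.single i 1) (J *ᵥ w) * K) (mid m) (mid j))
          = J⁻¹ *ᵥ fun a => ∑ m, C (J *ᵥ Pi.single i 1) (J *ᵥ w) (mid a) (mid m) * J m j := by
        congr 1
        ext a
        exact hmid _ _ a j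
      rw [Matrix.mulVec_mulVec, Matrix.nonsing_inv_mul _ (isUnit_iff_ne_zero.2 hJ),
        Matrix.one_mulVec] at e
      exact congrFun e i
    have hJc : ∀ i a m, C (J *ᵥ Pi.single i 1) (J *ᵥ w) (mid a) (mid m)
        = ∑ b, J b i * C (Pi.single b 1) (J *ᵥ w) (mid a) (mid m) := by
      intro i a m
      have := h.linear_left 1 (J *ᵥ Pi.single i 1) (J *ᵥ w)
      simp only [Matrix.one_mulVec] at this
      rw [this, Matrix.sum_apply]
      simp
    have hinv : ∀ a b, ∑ i, J⁻¹ i a * J b i = if b = a then 1 else 0 := by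
      intro a b
      have := congrFun (congrFun (Matrix.mul_nonsing_inv _ (isUnit_iff_ne_zero.2 hJ)) b) a
      rw [Matrix.mul_apply, Matrix.one_apply] at this
      rw [← this]
      exact Finset.sum_congr rfl fun i _ => mul_comm _ _
    -- The `J⁻¹` from the conjugation and the `J` in the first argument meet in the contracted
    -- index, so the trace of the conjugate reduces to the trace of `C`.
    calc ∑ i, (K⁻¹ * C (J *ᵥ Pi.single i 1) (J *ᵥ w) * K) (mid i) (mid j)
        = ∑ i, ∑ a, ∑ m, ∑ b, (J⁻¹ i a * J b i) *
            (C (Pi.single b 1) (J *ᵥ w) (mid a) (mid m) * J m j) := by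
          refine Finset.sum_congr rfl fun i _ => ?_
          rw [hz]
          refine Finset.sum_congr rfl fun a _ => ?_
          rw [Finset.mul_sum]
          refine Finset.sum_congr rfl fun m _ => ?_
          rw [hJc, Finset.sum_mul, Finset.mul_sum]
          exact Finset.sum_congr rfl fun b _ => by ring
      _ = ∑ a, ∑ m, ∑ b, (∑ i, J⁻¹ i a * J b i) *
            (C (Pi.single b 1) (J *ᵥ w) (mid a) (mid m) * J m j) := by
          rw [Finset.sum_comm]
          refine Finset.sum_congr rfl fun a _ => ?_
          rw [Finset.sum_comm]
          refine Finset.sum_congr rfl fun m _ => ?_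
          rw [Finset.sum_comm]
          exact Finset.sum_congr rfl fun b _ => by rw [Finset.sum_mul]
      _ = ∑ m, (∑ a, C (Pi.single a 1) (J *ᵥ w) (mid a) (mid m)) * J m j := by
          simp only [hinv]
          rw [Finset.sum_comm]
          refine Finset.sum_congr rfl fun m _ => ?_
          rw [Finset.sum_mul]
          simp
      _ = 0 := by simp [h.ricci]

section PullMetric
variable {n : ℕ} {G : (Fin 4 → ℝ) → Matrix (Fin 4) (Fin 4) ℝ} {V : Set (Fin 4 → ℝ)}
  {F : (Fin n → ℝ) → Fin 4 → ℝ} {A : (Fin n → ℝ) → Matrix (Fin 6) (Fin 6) ℝ}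
  {U : Set (Fin n → ℝ)}

/-- Invariance of the scalar product turns the derivative of the frame's Gram matrix into this
expression. For a frame with constant Gram matrix the form is therefore skew; for a change of gauge
this is metricity for the new metric. -/
theorem pull_metric (hG : IsMetricOn G V) (hU : IsOpen U)
    (hF : ∀ i, ContDiffOn ℝ ∞ (fun z => F z i) U)
    (hm : Set.MapsTo F U V) (hA : MatSmoothOn A U) (hdet : ∀ y ∈ U, (A y).det ≠ 0)
    {y : Fin n → ℝ} (hy : y ∈ U) (w : Fin n → ℝ) :
    (pull (connection G) F A y w)ᵀ * ((A y)ᵀ * gramOf (G (F y)) * A y)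
      + ((A y)ᵀ * gramOf (G (F y)) * A y) * pull (connection G) F A y w
      = matDeriv (fun z => (A z)ᵀ * gramOf (G (F z)) * A z) y w := by
  have hS : MatSmoothOn (fun z => gramOf (G (F z))) U := fun i j =>
    smoothOn_comp (gramOf_smooth hG i j) hF hm
  have hdS : matDeriv (fun z => gramOf (G (F z))) y w
      = (connection G (F y) (vel F y w))ᵀ * gramOf (G (F y))
        + gramOf (G (F y)) * connection G (F y) (vel F y w) := by
    rw [connection_metric hG (hm hy)]
    ext i j
    exact fderiv_comp_vel hU hG.isOpen (gramOf_smooth hG i j) hF hm hy w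
  have key : A y * pull (connection G) F A y w
      = matDeriv A y w + connection G (F y) (vel F y w) * A y := by
    rw [pull, Matrix.mul_nonsing_inv_cancel_left _ _ (isUnit_iff_ne_zero.2 (hdet y hy))]
  have key' := congrArg Matrix.transpose key
  rw [Matrix.transpose_mul, Matrix.transpose_add, Matrix.transpose_mul] at key'
  rw [matDeriv_mul hU (hA.transpose.mul hS) hA hy, matDeriv_mul hU hA.transpose hS hy, hdS,
    matDeriv_transpose]
  rw [mul_assoc _ (A y), key, ← mul_assoc (pull _ _ _ _ _)ᵀ, ← mul_assoc (pull _ _ _ _ _)ᵀ, key']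
  simp only [mul_add, add_mul, ← mul_assoc]
  abel

end PullMetric

theorem isotropicGram_transpose : isotropicGramᵀ = isotropicGram := by
  ext i j; fin_cases i <;> fin_cases j <;> rfl

theorem isotropicGram_det : isotropicGram.det = 1 := by
  simp [isotropicGram, Matrix.det_succ_row_zero, Fin.sum_univ_succ, Fin.succAbove]
  norm_num

theorem gram_pair (g : Matrix (Fin 4) (Fin 4) ℝ) (K L : Matrix (Fin 6) (Fin 6) ℝ) (a b : Fin 6) :
    (Kᵀ * gramOf g * L) a b = - (K 0 a * L 5 b) - K 5 a * L 0 b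
      + (fun i => K (mid i) a) ⬝ᵥ (g *ᵥ fun j => L (mid j) b) := by
  rw [mul_assoc, mul_six]
  simp only [mul_six, Matrix.transpose_apply]
  simp [dotProduct, Matrix.mulVec]
  ring

theorem pull_linear {n m : ℕ} {Θ : (Fin m → ℝ) → (Fin m → ℝ) → Matrix (Fin 6) (Fin 6) ℝ}
    {F : (Fin n → ℝ) → Fin m → ℝ} {A : (Fin n → ℝ) → Matrix (Fin 6) (Fin 6) ℝ}
    (hlin : ∀ x w, Θ x w = ∑ k, w k • Θ x (Pi.single k 1)) (y w : Fin n → ℝ) :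
    pull Θ F A y w = ∑ k, w k • pull Θ F A y (Pi.single k 1) := by
  have h : Θ (F y) (vel F y w) = ∑ k, w k • Θ (F y) (vel F y (Pi.single k 1)) := by
    rw [hlin]
    have e : ∀ j, Θ (F y) (vel F y (Pi.single j 1))
        = ∑ k, vel F y (Pi.single j 1) k • Θ (F y) (Pi.single k 1) := fun j => hlin _ _
    simp only [e, Finset.smul_sum, smul_smul]
    rw [Finset.sum_comm]
    refine Finset.sum_congr rfl fun k _ => ?_
    rw [← Finset.sum_smul, vel, fderiv_sum_basis]
    rfl
  have h2 : matDeriv A y w + Θ (F y) (vel F y w) * A y = ∑ k, w k •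
      (matDeriv A y (Pi.single k 1) + Θ (F y) (vel F y (Pi.single k 1)) * A y) := by
    rw [matDeriv_sum_basis, h, Finset.sum_mul, ← Finset.sum_add_distrib]
    exact Finset.sum_congr rfl fun k _ => by rw [smul_add, smul_mul_assoc]
  rw [pull, h2, Finset.mul_sum]
  exact Finset.sum_congr rfl fun k _ => by rw [mul_smul_comm]; rfl

theorem connection_linear (G : (Fin 4 → ℝ) → Matrix (Fin 4) (Fin 4) ℝ) (x w : Fin 4 → ℝ) :
    connection G x w = ∑ k, w k • connection G x (Pi.single k 1) := connWith_linear x w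

/-! ### Changes of gauge and conformal covariance of the normal connection -/

section Gauge
variable {M : Type u} [TopologicalSpace M] [ChartedSpace (Fin 4 → ℝ) M]
variable {c : ConformalStructure M}

theorem ConformalStructure.isMetricOn (c : ConformalStructure M) {γ : Gauge M} (hγ : γ ∈ c.gauges) :
    IsMetricOn γ.metric γ.chart.target := by
  refine ⟨γ.chart.open_target, c.smooth γ hγ, fun x hx i j => ?_, fun x hx h0 => ?_⟩
  · obtain ⟨P, hP, h⟩ := c.signature γ hγ x hx
    have hu := isUnit_iff_ne_zero.2 hP
    have hu' : IsUnit (Pᵀ).det := by rwa [Matrix.det_transpose]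
    have h2 : Pᵀ * (γ.metric x)ᵀ * P = Pᵀ * γ.metric x * P := by
      have := congrArg Matrix.transpose h
      rw [isotropicGram_transpose, ← h] at this
      simpa [Matrix.transpose_mul, mul_assoc] using this
    have h3 := congrArg (fun X => (Pᵀ)⁻¹ * (X * P⁻¹)) h2
    simp only [Matrix.mul_nonsing_inv_cancel_right _ _ hu,
      Matrix.nonsing_inv_mul_cancel_left _ _ hu'] at h3
    exact congrFun (congrFun h3 j) i
  · obtain ⟨P, hP, h⟩ := c.signature γ hγ x hx
    have := congrArg Matrix.det h
    rw [Matrix.det_mul, Matrix.det_mul, h0, isotropicGram_det] at this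
    simp at this

omit [ChartedSpace (Fin 4 → ℝ) M] in
theorem overlap_open (γ γ' : Gauge M) : IsOpen (overlap γ γ') :=
  (γ'.chart.symm.trans γ.chart).open_source

omit [ChartedSpace (Fin 4 → ℝ) M] in
theorem mem_overlap {γ γ' : Gauge M} {x : Fin 4 → ℝ} :
    x ∈ overlap γ γ' ↔ x ∈ γ'.chart.target ∧ γ'.chart.symm x ∈ γ.chart.source := by
  simp [overlap]

omit [ChartedSpace (Fin 4 → ℝ) M] in
theorem chart_mem_overlap {γ γ' : Gauge M} {q : M} (h : q ∈ γ.chart.source)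
    (h' : q ∈ γ'.chart.source) : γ'.chart q ∈ overlap γ γ' :=
  mem_overlap.2 ⟨γ'.chart.map_source h', by rwa [γ'.chart.left_inv h']⟩

omit [ChartedSpace (Fin 4 → ℝ) M] in
theorem coordChange_mapsTo (γ γ' : Gauge M) :
    Set.MapsTo (coordChange γ γ') (overlap γ γ') γ.chart.target := fun _ hx =>
  γ.chart.map_source (mem_overlap.1 hx).2

theorem coordChange_smooth {γ γ' : Gauge M} (hγ : γ ∈ c.gauges) (hγ' : γ' ∈ c.gauges) (i : Fin 4) :
    ContDiffOn ℝ ∞ (fun x => coordChange γ γ' x i) (overlap γ γ') := by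
  have h1 := contMDiffOn_of_mem_maximalAtlas (c.chart_mem γ hγ)
  have h2 := contMDiffOn_symm_of_mem_maximalAtlas (c.chart_mem γ' hγ')
  have h3 : ContMDiffOn 𝓘(ℝ, Fin 4 → ℝ) 𝓘(ℝ, Fin 4 → ℝ) ∞ (coordChange γ γ') (overlap γ γ') :=
    h1.comp (h2.mono fun x hx => (mem_overlap.1 hx).1) fun x hx => (mem_overlap.1 hx).2
  exact contDiffOn_pi.1 (contMDiffOn_iff_contDiffOn.1 h3) i

omit [ChartedSpace (Fin 4 → ℝ) M] in
theorem vel_coordChange (γ γ' : Gauge M) (x w : Fin 4 → ℝ) :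
    vel (coordChange γ γ') x w = jacobian γ γ' x *ᵥ w := by
  ext i
  rw [vel, fderiv_sum_basis]
  exact Finset.sum_congr rfl fun k _ => mul_comm _ _

theorem jacobian_smooth {γ γ' : Gauge M} (hγ : γ ∈ c.gauges) (hγ' : γ' ∈ c.gauges) :
    MatSmoothOn (jacobian γ γ') (overlap γ γ') := fun i _ =>
  smoothOn_fderiv_apply (overlap_open γ γ') (coordChange_smooth hγ hγ' i) _

omit [ChartedSpace (Fin 4 → ℝ) M] in
theorem gaugeChange_entries (γ γ' : Gauge M) (s : (Fin 4 → ℝ) → ℝ) (x : Fin 4 → ℝ) :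
    (∀ a, gaugeChange γ γ' s x a 0 = tvec (s x) 0 0 a) ∧
    (∀ a j, gaugeChange γ γ' s x a (mid j)
      = tvec (pd j s x) (fun i => s x * jacobian γ γ' x i j) 0 a) ∧
    (∀ a, gaugeChange γ γ' s x a 5 =
      tvec ((1 / 2) * (s x)⁻¹ * (((γ'.metric x)⁻¹ *ᵥ fun a => pd a s x) ⬝ᵥ fun a => pd a s x))
        (jacobian γ γ' x *ᵥ ((γ'.metric x)⁻¹ *ᵥ fun a => pd a s x)) (s x)⁻¹ a) := by
  refine ⟨fun a => rfl, fun a j => ?_, fun a => rfl⟩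
  rw [gaugeChange, ofCols_mid]

section Pair
variable {γ γ' : Gauge M} (hγ : γ ∈ c.gauges) (hγ' : γ' ∈ c.gauges) {s : (Fin 4 → ℝ) → ℝ}
  (hs : IsConformalFactor γ γ' s)
include hγ hγ'

omit hγ in
theorem isMetricOn_overlap : IsMetricOn γ'.metric (overlap γ γ') := by
  have h := c.isMetricOn hγ'
  have hsub : overlap γ γ' ⊆ γ'.chart.target := fun x hx => (mem_overlap.1 hx).1
  exact ⟨overlap_open _ _, h.smooth.mono hsub, fun x hx => h.symm x (hsub hx),
    fun x hx => h.det_ne x (hsub hx)⟩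

include hs

omit [ChartedSpace (Fin 4 → ℝ) M] hγ hγ' in
theorem conformal_pairing {x : Fin 4 → ℝ} (hx : x ∈ overlap γ γ') (ξ η : Fin 4 → ℝ) :
    s x ^ 2 * ((jacobian γ γ' x *ᵥ ξ) ⬝ᵥ (γ.metric (coordChange γ γ' x) *ᵥ (jacobian γ γ' x *ᵥ η)))
      = ξ ⬝ᵥ (γ'.metric x *ᵥ η) := by
  rw [(hs.2 x hx).2, Matrix.smul_mulVec, dotProduct_smul, smul_eq_mul, ← Matrix.mulVec_mulVec,
    ← Matrix.mulVec_mulVec, Matrix.dotProduct_mulVec ξ, Matrix.vecMul_transpose]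

/-- With r the gradient of s for the new metric, every product of columns reduces to the conformal
relation between the metrics. The multiple of `X` in `Y'` is what makes `Y'` isotropic. -/
theorem gaugeChange_gram {x : Fin 4 → ℝ} (hx : x ∈ overlap γ γ') :
    (gaugeChange γ γ' s x)ᵀ * gramOf (γ.metric (coordChange γ γ' x)) * gaugeChange γ γ' s x
      = gramOf (γ'.metric x) := by
  obtain ⟨e0, em, e5⟩ := gaugeChange_entries γ γ' s x
  have hG' := isMetricOn_overlap (γ := γ) hγ'
  have hsx := (hs.2 x hx).1.ne'
  have hp := conformal_pairing hs hx
  set J := jacobian γ γ' x with hJ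
  set d : Fin 4 → ℝ := fun a => pd a s x with hd
  set r : Fin 4 → ℝ := (γ'.metric x)⁻¹ *ᵥ d with hr
  have hgr : γ'.metric x *ᵥ r = d := by
    rw [hr, Matrix.mulVec_mulVec, hG'.mul_inv hx, Matrix.one_mulVec]
  have hcol : ∀ j, (fun i => gaugeChange γ γ' s x (mid i) (mid j)) = s x • (J *ᵥ Pi.single j 1) := by
    intro j; ext i; rw [em]; simp
  have hcol5 : (fun i => gaugeChange γ γ' s x (mid i) 5) = J *ᵥ r := by
    ext i; rw [e5]; simp
  have hcol0 : (fun i => gaugeChange γ γ' s x (mid i) 0) = 0 := by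
    ext i; rw [e0]; simp
  have h1 : ∀ j, (s x • (J *ᵥ Pi.single j 1)) ⬝ᵥ (γ.metric (coordChange γ γ' x) *ᵥ (J *ᵥ r))
      = (s x)⁻¹ * d j := by
    intro j
    have := hp (Pi.single j 1) r
    rw [hgr, single_dotProduct, one_mul] at this
    rw [smul_dotProduct, smul_eq_mul, ← this]
    field_simp
  have h2 : ∀ j, (J *ᵥ r) ⬝ᵥ (γ.metric (coordChange γ γ' x) *ᵥ (s x • (J *ᵥ Pi.single j 1)))
      = (s x)⁻¹ * d j := by
    intro j
    rw [← h1, Matrix.dotProduct_mulVec, ← Matrix.mulVec_transpose,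
      (c.isMetricOn hγ).transpose (coordChange_mapsTo γ γ' hx), dotProduct_comm]
  have h3 : ∀ i j, (s x • (J *ᵥ Pi.single i 1)) ⬝ᵥ
      (γ.metric (coordChange γ γ' x) *ᵥ (s x • (J *ᵥ Pi.single j 1))) = γ'.metric x i j := by
    intro i j
    have := hp (Pi.single i 1) (Pi.single j 1)
    rw [single_dotProduct, one_mul] at this
    rw [Matrix.mulVec_smul, dotProduct_smul, smul_dotProduct, smul_smul, smul_eq_mul, ← sq, this]
    simp
  have h4 : (J *ᵥ r) ⬝ᵥ (γ.metric (coordChange γ γ' x) *ᵥ (J *ᵥ r)) = ((s x)⁻¹) ^ 2 * (r ⬝ᵥ d) := by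
    have := hp r r
    rw [hgr] at this
    rw [← this]
    field_simp
  ext a b
  rw [gram_pair]
  revert b
  refine forall_six ?_ (fun j => ?_) ?_ <;> revert a <;> refine forall_six ?_ (fun i => ?_) ?_ <;>
    simp only [hcol, hcol5, hcol0, h1, h2, h3, h4, Matrix.mulVec_zero, zero_dotProduct,
      dotProduct_zero] <;>
    simp only [e0, em, e5, tvec_zero, tvec_mid, tvec_five, gramOf_zero_right, gramOf_mid_right,
      gramOf_five_right, Pi.zero_apply] <;> field_simp <;> simp
  · simp only [hd]; ring
  · simp only [hd]; ring
  · right; norm_num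

theorem gaugeChange_det {x : Fin 4 → ℝ} (hx : x ∈ overlap γ γ') :
    (gaugeChange γ γ' s x).det ≠ 0 := by
  intro h
  have := congrArg Matrix.det (gaugeChange_gram hγ hγ' hs hx)
  rw [Matrix.det_mul, h, mul_zero] at this
  exact gramOf_det_ne ((isMetricOn_overlap (γ := γ) hγ').det_ne x hx) this.symm

theorem gaugeChange_smooth : MatSmoothOn (gaugeChange γ γ' s) (overlap γ γ') := by
  have hds : ∀ j, ContDiffOn ℝ ∞ (fun x => pd j s x) (overlap γ γ') := fun j =>
    smoothOn_fderiv_apply (overlap_open γ γ') hs.1 _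
  have hJ := jacobian_smooth hγ hγ'
  have hG' := isMetricOn_overlap (γ := γ) hγ'
  have hi := hG'.smooth.inv hG'.det_ne
  have hr : ∀ i, ContDiffOn ℝ ∞ (fun x => ((γ'.metric x)⁻¹ *ᵥ fun a => pd a s x) i)
      (overlap γ γ') := fun i => by
    simp only [Matrix.mulVec, dotProduct]
    exact ContDiffOn.sum fun k _ => (hi i k).mul (hds k)
  have hsi : ContDiffOn ℝ ∞ (fun x => (s x)⁻¹) (overlap γ γ') :=
    hs.1.inv fun x hx => (hs.2 x hx).1.ne'
  intro a b
  revert b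
  refine forall_six ?_ (fun j => ?_) ?_ <;> revert a <;> refine forall_six ?_ (fun i => ?_) ?_ <;>
    simp only [(gaugeChange_entries γ γ' s _).1, (gaugeChange_entries γ γ' s _).2.1,
      (gaugeChange_entries γ γ' s _).2.2, tvec_zero, tvec_mid, tvec_five]
  all_goals try exact contDiffOn_const
  · exact hs.1
  · exact hds j
  · exact hs.1.mul (hJ i j)
  · refine (contDiffOn_const.mul hsi).mul ?_
    exact ContDiffOn.sum fun k _ => (hr k).mul (hds k)
  · change ContDiffOn ℝ ∞ (fun z => ∑ k, jacobian γ γ' z i k *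
      ((γ'.metric z)⁻¹ *ᵥ fun a => pd a s z) k) _
    exact ContDiffOn.sum fun k _ => (hJ i k).mul (hr k)
  · exact hsi

/-- Conformal covariance of the normal conformal connection. -/
theorem connection_gaugeChange {x : Fin 4 → ℝ} (hx : x ∈ overlap γ γ') (w : Fin 4 → ℝ) :
    pull (connection γ.metric) (coordChange γ γ') (gaugeChange γ γ' s) x w
      = connection γ'.metric x w := by
  have hG := c.isMetricOn hγ
  have hG' := isMetricOn_overlap (γ := γ) hγ'
  have hU := overlap_open γ γ'
  have hF := coordChange_smooth hγ hγ'
  have hm := coordChange_mapsTo γ γ'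
  have hA := gaugeChange_smooth hγ hγ' hs
  have hdet : ∀ x ∈ overlap γ γ', (gaugeChange γ γ' s x).det ≠ 0 := fun x hx =>
    gaugeChange_det hγ hγ' hs hx
  have hcv : ∀ x ∈ overlap γ γ', CurvLike (formCurv (pull (connection γ.metric) (coordChange γ γ')
      (gaugeChange γ γ' s)) x) := by
    intro x hx
    have e : formCurv (pull (connection γ.metric) (coordChange γ γ') (gaugeChange γ γ' s)) x
        = fun w w' => (gaugeChange γ γ' s x)⁻¹ * curvature γ.metric (coordChange γ γ' x)
          (jacobian γ γ' x *ᵥ w) (jacobian γ γ' x *ᵥ w') * gaugeChange γ γ' s x := by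
      funext w w'
      rw [formCurv_pull (connection_linear _) (fun k => connection_smooth hG _) hU hG.isOpen hF hm hA hdet
        hx, vel_coordChange, vel_coordChange, curvature_eq_formCurv]
    rw [e]
    refine (connection_curvLike hG (hm hx)).conj (s := s x) (hdet x hx) (hs.2 x hx).1.ne'
      (c.oriented γ hγ γ' hγ' x hx).ne' (fun a => rfl) (fun j => ?_) (fun i j => ?_)
    · rw [(gaugeChange_entries γ γ' s x).2.1]; rfl
    · rw [(gaugeChange_entries γ γ' s x).2.1, tvec_mid]
  -- By uniqueness it suffices that the transformed form has the defining properties of the normal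
  -- connection of the new metric. The torsion and trace conditions come from the tensorial
  -- behaviour of the curvature.
  refine IsNormalConn.eq_connection hG' ⟨?_, ?_, ?_, ?_, fun x hx => (hcv x hx).col_zero,
    fun x hx => (hcv x hx).ricci⟩ hx w
  · exact pull_linear (connection_linear _)
  · exact fun k => pull_smooth (connection_linear _) (fun k => connection_smooth hG _) hU hF hm hA hdet _
  · intro x hx w a
    obtain ⟨e0, em, -⟩ := gaugeChange_entries γ γ' s x
    -- This says dX' = w^a ∂'_a: the differential of s, created by X' = sX, is the multiple of `X`
    -- contained in the vectors ∂'_a.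
    have hN : (fun a => (matDeriv (gaugeChange γ γ' s) x w + connection γ.metric (coordChange γ γ' x)
        (vel (coordChange γ γ') x w) * gaugeChange γ γ' s x) a 0)
        = gaugeChange γ γ' s x *ᵥ tvec 0 w 0 := by
      ext a
      have hr : (gaugeChange γ γ' s x *ᵥ tvec 0 w 0) a
          = ∑ j, gaugeChange γ γ' s x a (mid j) * w j := by
        rw [Matrix.mulVec, dotProduct, sum_six]; simp
      rw [hr, Matrix.add_apply, mul_six, vel_coordChange]
      clear hr
      revert a
      refine forall_six ?_ (fun i => ?_) ?_ <;>
        simp only [matDeriv, Matrix.of_apply, (gaugeChange_entries γ γ' s _).1, em, tvec_zero,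
          tvec_mid, tvec_five] <;> simp [connection]
      · rw [fderiv_sum_basis]
        exact Finset.sum_congr rfl fun k _ => mul_comm (w k) _
      · rw [Matrix.mulVec, dotProduct, Finset.sum_mul]
        exact Finset.sum_congr rfl fun k _ => by ring
    have h2 : pull (connection γ.metric) (coordChange γ γ') (gaugeChange γ γ' s) x w a 0
        = ((gaugeChange γ γ' s x)⁻¹ *ᵥ (gaugeChange γ γ' s x *ᵥ tvec 0 w 0)) a := by
      rw [← hN]; rfl
    rw [h2, Matrix.mulVec_mulVec, Matrix.nonsing_inv_mul _ (isUnit_iff_ne_zero.2 (hdet x hx)),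
      Matrix.one_mulVec]
  · intro x hx w
    have := pull_metric hG hU hF hm hA hdet hx w
    rw [gaugeChange_gram hγ hγ' hs hx] at this
    rw [this]
    exact matDeriv_congr hU (fun z hz => gaugeChange_gram hγ hγ' hs hz) hx w

end Pair

/-- The isometry L⁻¹R fixes all basis vectors but the last. The image of the last is then determined
by its products with the others and by being isotropic, so comparisons of gauge changes can skip the
complicated last column. -/
theorem eq_of_gram_of_cols {S : Matrix (Fin 6) (Fin 6) ℝ} {g : Matrix (Fin 4) (Fin 4) ℝ}
    (hg : g.det ≠ 0) {L R : Matrix (Fin 6) (Fin 6) ℝ} (hL : Lᵀ * S * L = gramOf g)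
    (hR : Rᵀ * S * R = gramOf g) (h : ∀ a, ∀ b, b ≠ 5 → L a b = R a b) : L = R := by
  have hLd : IsUnit L.det := by
    refine isUnit_iff_ne_zero.2 fun h0 => gramOf_det_ne hg ?_
    rw [← hL, Matrix.det_mul, h0, mul_zero]
  set Q := L⁻¹ * R with hQ
  have hLQ : R = L * Q := by rw [hQ, Matrix.mul_nonsing_inv_cancel_left _ _ hLd]
  have hcol : ∀ a b, b ≠ 5 → Q a b = (1 : Matrix (Fin 6) (Fin 6) ℝ) a b := by
    intro a b hb
    rw [← Matrix.nonsing_inv_mul L hLd, hQ, Matrix.mul_apply, Matrix.mul_apply]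
    exact Finset.sum_congr rfl fun k _ => by rw [h k b hb]
  have hgram : Qᵀ * gramOf g * Q = gramOf g := by
    rw [← hL]
    conv_rhs => rw [hL, ← hR, hLQ]
    simp only [Matrix.transpose_mul, mul_assoc]
  have e := fun a b => (gram_pair g Q Q a b).symm.trans (congrFun (congrFun hgram a) b)
  have h5 : Q 5 5 = 1 := by
    have := e 0 5
    simp only [hcol _ 0 (by decide)] at this
    simp [dotProduct] at this
    linarith
  have hm : (fun i => Q (mid i) 5) = 0 := by
    refine Matrix.eq_zero_of_mulVec_eq_zero hg ?_
    ext i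
    have := e (mid i) 5
    have hc : (fun k => Q (mid k) (mid i)) = Pi.single i 1 := by
      ext k; rw [hcol _ _ (mid_ne_five i)]; simp [Matrix.one_apply, Pi.single_apply]
    rw [hc, single_dotProduct, one_mul, hcol _ _ (mid_ne_five i), hcol _ _ (mid_ne_five i)] at this
    simpa using this
  have h0 : Q 0 5 = 0 := by
    have := e 5 5
    rw [hm, h5] at this
    simp at this
    linarith
  have : Q = 1 := by
    ext a b
    by_cases hb : b = 5
    · subst hb
      revert a
      refine forall_six ?_ (fun i => ?_) ?_
      · rw [h0]; rfl
      · rw [congrFun hm i]; simp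
      · rw [h5]; rfl
    · exact hcol a b hb
  rw [hLQ, this, mul_one]

/-! ### The cocycle relation for changes of gauge -/

section Triple
variable {γ γ' γ'' : Gauge M}

omit [ChartedSpace (Fin 4 → ℝ) M] in
theorem coordChange_mem_overlap {x : Fin 4 → ℝ} (hx : x ∈ overlap γ' γ'') (hx' : x ∈ overlap γ γ'') :
    coordChange γ' γ'' x ∈ overlap γ γ' := by
  rw [mem_overlap] at *
  refine ⟨γ'.chart.map_source hx.2, ?_⟩
  rw [coordChange, γ'.chart.left_inv hx.2]
  exact hx'.2

omit [ChartedSpace (Fin 4 → ℝ) M] in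
theorem coordChange_comp {x : Fin 4 → ℝ} (hx : x ∈ overlap γ' γ'') :
    coordChange γ γ' (coordChange γ' γ'' x) = coordChange γ γ'' x := by
  rw [coordChange, coordChange, coordChange, γ'.chart.left_inv (mem_overlap.1 hx).2]

variable (hγ : γ ∈ c.gauges) (hγ' : γ' ∈ c.gauges) (hγ'' : γ'' ∈ c.gauges)
  {s s' s'' : (Fin 4 → ℝ) → ℝ}
  (hs : IsConformalFactor γ γ' s) (hs' : IsConformalFactor γ' γ'' s')
  (hs'' : IsConformalFactor γ γ'' s'')
  {x : Fin 4 → ℝ} (hx : x ∈ overlap γ' γ'') (hx' : x ∈ overlap γ γ'')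
include hγ hγ' hγ'' hx hx'

omit hγ in
theorem fderiv_comp_coordChange {g : (Fin 4 → ℝ) → ℝ} (hg : ContDiffOn ℝ ∞ g (overlap γ γ'))
    (j : Fin 4) : pd j (fun z => g (coordChange γ' γ'' z)) x
      = ∑ k, jacobian γ' γ'' x k j * pd k g (coordChange γ' γ'' x) := by
  have hU : IsOpen (overlap γ' γ'' ∩ overlap γ γ'') := (overlap_open _ _).inter (overlap_open _ _)
  rw [pd, fderiv_comp_vel hU (overlap_open γ γ') hg
    (fun i => (coordChange_smooth hγ' hγ'' i).mono Set.inter_subset_left)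
    (fun z hz => coordChange_mem_overlap hz.1 hz.2) ⟨hx, hx'⟩, fderiv_sum_basis]
  rfl

theorem jacobian_comp :
    jacobian γ γ'' x = jacobian γ γ' (coordChange γ' γ'' x) * jacobian γ' γ'' x := by
  ext i j
  have := fderiv_comp_coordChange hγ' hγ'' hx hx' (coordChange_smooth hγ hγ' i) j
  rw [Matrix.mul_apply]
  have e : pd j (fun z => coordChange γ γ' (coordChange γ' γ'' z) i) x
      = jacobian γ γ'' x i j := by
    unfold pd
    rw [fderiv_eq_of_eqOn (overlap_open γ' γ'') (fun z hz => by rw [coordChange_comp hz]) hx]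
    rfl
  rw [← e, this]
  exact Finset.sum_congr rfl fun k _ => mul_comm _ _

include hs hs' hs''

/-- The nondegenerate metric of `γ''` is a multiple of one and the same matrix with factors s''² and
(s s')², and positivity of the factors selects the root. -/
theorem conformalFactor_comp : s'' x = s (coordChange γ' γ'' x) * s' x := by
  have hy := coordChange_mem_overlap hx hx'
  have h1 := (hs''.2 x hx').2
  have h2 := (hs'.2 x hx).2
  rw [(hs.2 _ hy).2, coordChange_comp hx] at h2
  rw [jacobian_comp hγ hγ' hγ'' hx hx', Matrix.transpose_mul] at h1
  rw [h1] at h2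
  simp only [Matrix.mul_smul, Matrix.smul_mul, smul_smul, ← mul_assoc] at h2
  have hd : ((jacobian γ' γ'' x)ᵀ * (jacobian γ γ' (coordChange γ' γ'' x))ᵀ
      * γ.metric (coordChange γ γ'' x) * jacobian γ γ' (coordChange γ' γ'' x)
      * jacobian γ' γ'' x).det ≠ 0 := by
    simp only [Matrix.det_mul, Matrix.det_transpose]
    have a1 := (c.oriented γ' hγ' γ'' hγ'' x hx).ne'
    have a2 := (c.oriented γ hγ γ' hγ' _ hy).ne'
    have a3 := (c.isMetricOn hγ).det_ne _ (coordChange_mapsTo γ γ'' hx')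
    positivity
  have h3 : s'' x ^ 2 = s' x ^ 2 * s (coordChange γ' γ'' x) ^ 2 := by
    by_contra hne
    apply hd
    rw [← sub_eq_zero, ← sub_smul, smul_eq_zero, or_iff_right (sub_ne_zero.2 hne)] at h2
    rw [h2]
    exact Matrix.det_zero
  have p1 := (hs''.2 x hx').1
  have p2 := (hs'.2 x hx).1
  have p3 := (hs.2 _ hy).1
  rw [← mul_pow] at h3
  have := (sq_eq_sq₀ p1.le (by positivity)).1 h3
  rw [this, mul_comm]

/-- Both sides are isometries between the same Gram matrices, so only the first five columns have to
be compared; these are the chain rule for the Jacobian and the product rule for the conformal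
factor. -/
theorem gaugeChange_comp : gaugeChange γ γ'' s'' x
    = gaugeChange γ γ' s (coordChange γ' γ'' x) * gaugeChange γ' γ'' s' x := by
  have hy := coordChange_mem_overlap hx hx'
  have hcf := conformalFactor_comp hγ hγ' hγ'' hs hs' hs'' hx hx'
  have hJ := jacobian_comp hγ hγ' hγ'' hx hx'
  obtain ⟨e0, em, -⟩ := gaugeChange_entries γ γ'' s'' x
  obtain ⟨f0, fm, -⟩ := gaugeChange_entries γ γ' s (coordChange γ' γ'' x)
  obtain ⟨g0, gm, -⟩ := gaugeChange_entries γ' γ'' s' x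
  have hpd : ∀ j, pd j s'' x = (∑ k, jacobian γ' γ'' x k j * pd k s (coordChange γ' γ'' x)) * s' x
      + s (coordChange γ' γ'' x) * pd j s' x := by
    intro j
    have hU : IsOpen (overlap γ' γ'' ∩ overlap γ γ'') := (overlap_open _ _).inter (overlap_open _ _)
    have e : pd j s'' x = pd j (fun z => s (coordChange γ' γ'' z) * s' z) x := by
      unfold pd
      rw [fderiv_eq_of_eqOn hU (fun z hz => conformalFactor_comp hγ hγ' hγ'' hs hs' hs'' hz.1 hz.2)
        ⟨hx, hx'⟩]
    have d1 : DifferentiableAt ℝ (fun z => s (coordChange γ' γ'' z)) x :=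
      diffAt_of_smoothOn hU (smoothOn_comp hs.1
        (fun i => (coordChange_smooth hγ' hγ'' i).mono Set.inter_subset_left)
        (fun z hz => coordChange_mem_overlap hz.1 hz.2)) ⟨hx, hx'⟩
    have d2 : DifferentiableAt ℝ s' x := diffAt_of_smoothOn (overlap_open _ _) hs'.1 hx
    rw [e, ← fderiv_comp_coordChange hγ' hγ'' hx hx' hs.1, pd, fderiv_fun_mul d1 d2]
    simp [pd]
    ring
  refine eq_of_gram_of_cols ((c.isMetricOn hγ'').det_ne x (mem_overlap.1 hx').1)
    (gaugeChange_gram hγ hγ'' hs'' hx') ?_ ?_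
  · have h1 := gaugeChange_gram hγ hγ' hs hy
    have h2 := gaugeChange_gram hγ' hγ'' hs' hx
    rw [coordChange_comp hx] at h1
    rw [← h2, ← h1]
    simp only [Matrix.transpose_mul, mul_assoc]
  · intro a b
    revert b
    refine forall_six (fun _ => ?_) (fun j _ => ?_) (fun h => (h rfl).elim)
    · rw [mul_six]
      simp only [g0, e0, f0, tvec_zero, tvec_mid, tvec_five]
      revert a
      refine forall_six ?_ (fun i => ?_) ?_ <;> simp [hcf]
    · rw [mul_six]
      simp only [gm, em, f0, fm, tvec_zero, tvec_mid, tvec_five]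
      revert a
      refine forall_six ?_ (fun i => ?_) ?_ <;> simp
      · rw [hpd, Finset.sum_mul, add_comm]
        congr 1
        exact Finset.sum_congr rfl fun k _ => by ring
      · rw [hJ, hcf, Matrix.mul_apply, Finset.mul_sum]
        exact Finset.sum_congr rfl fun k _ => by ring

end Triple

/-- The cocycle relation makes this matrix idempotent, and it is invertible. -/
theorem gaugeChange_self {γ : Gauge M} (hγ : γ ∈ c.gauges) {s : (Fin 4 → ℝ) → ℝ}
    (hs : IsConformalFactor γ γ s) {x : Fin 4 → ℝ} (hx : x ∈ overlap γ γ) :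
    gaugeChange γ γ s x = 1 := by
  have h := gaugeChange_comp hγ hγ hγ hs hs hs hx hx
  have hxx : coordChange γ γ x = x := γ.chart.right_inv (mem_overlap.1 hx).1
  rw [hxx] at h
  have hu := isUnit_iff_ne_zero.2 (gaugeChange_det hγ hγ hs hx)
  have := congrArg (fun X => (gaugeChange γ γ s x)⁻¹ * X) h
  simpa [Matrix.nonsing_inv_mul_cancel_left _ _ hu, Matrix.nonsing_inv_mul _ hu] using this.symm

end Gauge
end CO22

namespace CO22

/-! ### Hypersurfaces and frames in local coordinates -/

/-- A parametrized lightlike hypersurface in a coordinate domain. -/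
structure LocalSurface (G : (Fin 4 → ℝ) → Matrix (Fin 4) (Fin 4) ℝ) (V : Set (Fin 4 → ℝ))
    (F : (Fin 3 → ℝ) → Fin 4 → ℝ) (U : Set (Fin 3 → ℝ)) : Prop where
  metric : IsMetricOn G V
  isOpen : IsOpen U
  smooth : ∀ i, ContDiffOn ℝ ∞ (fun y => F y i) U
  mapsTo : Set.MapsTo F U V
  immersion : ∀ y ∈ U, ∀ w, vel F y w = 0 → w = 0
  lightlike : ∀ y ∈ U, ∃ w, w ≠ 0 ∧ ∀ w', vel F y w ⬝ᵥ (G (F y) *ᵥ vel F y w') = 0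
  signature : ∀ x ∈ V, ∃ P : Matrix (Fin 4) (Fin 4) ℝ, P.det ≠ 0 ∧ Pᵀ * G x * P = isotropicGram

/-- A smooth field of isotropic frames along a parametrized hypersurface. -/
structure LocalFrame (G : (Fin 4 → ℝ) → Matrix (Fin 4) (Fin 4) ℝ)
    (F : (Fin 3 → ℝ) → Fin 4 → ℝ) (U : Set (Fin 3 → ℝ))
    (B : (Fin 3 → ℝ) → Matrix (Fin 6) (Fin 6) ℝ) : Prop where
  smooth : MatSmoothOn B U
  vertex : ∀ y ∈ U, ∀ a, a ≠ 0 → B y a 0 = 0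
  gram : ∀ y ∈ U, (B y)ᵀ * gramOf (G (F y)) * B y = gramOf isotropicGram
  oriented : ∀ y ∈ U, 0 < (Matrix.of fun i j : Fin 4 => B y (mid i) (mid j)).det

theorem LocalSurface.mono {G V F} {U U' : Set (Fin 3 → ℝ)} (h : LocalSurface G V F U)
    (hU' : IsOpen U') (hs : U' ⊆ U) : LocalSurface G V F U' :=
  ⟨h.metric, hU', fun i => (h.smooth i).mono hs, fun _ hy => h.mapsTo (hs hy),
    fun y hy => h.immersion y (hs hy), fun y hy => h.lightlike y (hs hy), h.signature⟩

theorem LocalFrame.mono {G F B} {U U' : Set (Fin 3 → ℝ)} (h : LocalFrame G F U B)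
    (hs : U' ⊆ U) : LocalFrame G F U' B :=
  ⟨h.smooth.mono hs, fun y hy => h.vertex y (hs hy), fun y hy => h.gram y (hs hy),
    fun y hy => h.oriented y (hs hy)⟩

theorem isotropicGram_det_ne : isotropicGram.det ≠ 0 := by rw [isotropicGram_det]; norm_num

section FrameAlgebra
variable {g : Matrix (Fin 4) (Fin 4) ℝ} {B : Matrix (Fin 6) (Fin 6) ℝ}
  (hv : ∀ a, a ≠ 0 → B a 0 = 0) (hg : Bᵀ * gramOf g * B = gramOf isotropicGram)

include hg in
theorem frame_det_ne : B.det ≠ 0 := by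
  intro h
  have := congrArg Matrix.det hg
  rw [Matrix.det_mul, h, mul_zero] at this
  exact gramOf_det_ne isotropicGram_det_ne this.symm

include hv hg

theorem frame_zero_zero_mul : B 0 0 * B 5 5 = 1 := by
  have := congrFun (congrFun hg 0) 5
  rw [gram_pair] at this
  have hm : (fun i => B (mid i) 0) = 0 := by ext i; exact hv _ (mid_ne_zero i)
  rw [hm, hv 5 (by decide)] at this
  simp at this
  exact this

theorem frame_zero_zero : B 0 0 ≠ 0 := left_ne_zero_of_mul_eq_one (frame_zero_zero_mul hv hg)

theorem frame_row_five (j : Fin 4) : B 5 (mid j) = 0 := by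
  have := congrFun (congrFun hg 0) (mid j)
  rw [gram_pair] at this
  have hm : (fun i => B (mid i) 0) = 0 := by ext i; exact hv _ (mid_ne_zero i)
  rw [hm, hv 5 (by decide)] at this
  simpa [frame_zero_zero hv hg] using this

theorem frame_col_zero (a : Fin 6) : B a 0 = tvec (B 0 0) 0 0 a := by
  revert a
  exact forall_six rfl (fun i => by rw [hv _ (mid_ne_zero i)]; simp) (hv 5 (by decide))

end FrameAlgebra

/-! ### Composition rules for pulled back connection forms -/

section PullPull
variable {n m l : ℕ} {Θ : (Fin l → ℝ) → (Fin l → ℝ) → Matrix (Fin 6) (Fin 6) ℝ}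
  {Φ : (Fin m → ℝ) → Fin l → ℝ} {K : (Fin m → ℝ) → Matrix (Fin 6) (Fin 6) ℝ}
  {F : (Fin n → ℝ) → Fin m → ℝ} {B : (Fin n → ℝ) → Matrix (Fin 6) (Fin 6) ℝ}
  {U : Set (Fin n → ℝ)} {V : Set (Fin m → ℝ)}

theorem vel_congr {F F' : (Fin n → ℝ) → Fin m → ℝ} (hU : IsOpen U) (h : ∀ z ∈ U, F z = F' z)
    {y} (hy : y ∈ U) (w) : vel F y w = vel F' y w := by
  ext i
  simp only [vel]
  rw [fderiv_eq_of_eqOn hU (fun z hz => by rw [h z hz]) hy]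

theorem pull_congr {Θ : (Fin m → ℝ) → (Fin m → ℝ) → Matrix (Fin 6) (Fin 6) ℝ}
    {F F' : (Fin n → ℝ) → Fin m → ℝ} {B B' : (Fin n → ℝ) → Matrix (Fin 6) (Fin 6) ℝ}
    (hU : IsOpen U) (h : ∀ z ∈ U, F z = F' z) (hB : ∀ z ∈ U, B z = B' z)
    {y} (hy : y ∈ U) (w) : pull Θ F B y w = pull Θ F' B' y w := by
  rw [pull, pull, vel_congr hU h hy, h y hy, hB y hy, matDeriv_congr hU hB hy]

theorem vel_comp (hU : IsOpen U) (hV : IsOpen V) (hΦ : ∀ i, ContDiffOn ℝ ∞ (fun z => Φ z i) V)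
    (hF : ∀ i, ContDiffOn ℝ ∞ (fun z => F z i) U) (hm : Set.MapsTo F U V) {y} (hy : y ∈ U) (w) :
    vel (fun z => Φ (F z)) y w = vel Φ (F y) (vel F y w) := by
  ext i
  exact fderiv_comp_vel hU hV (hΦ i) hF hm hy w

/-- Pulling back in two stages, first by a change of gauge and then along the hypersurface, is what
reduces gauge independence of the forms to the covariance of the connection. -/
theorem pull_pull (hU : IsOpen U) (hV : IsOpen V) (hΦ : ∀ i, ContDiffOn ℝ ∞ (fun z => Φ z i) V)
    (hF : ∀ i, ContDiffOn ℝ ∞ (fun z => F z i) U) (hm : Set.MapsTo F U V)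
    (hK : MatSmoothOn K V) (hKd : ∀ x ∈ V, (K x).det ≠ 0) (hB : MatSmoothOn B U)
    {y} (hy : y ∈ U) (w) :
    pull Θ (fun z => Φ (F z)) (fun z => K (F z) * B z) y w = pull (pull Θ Φ K) F B y w := by
  have hKF : MatSmoothOn (fun z => K (F z)) U := fun i j => smoothOn_comp (hK i j) hF hm
  have hd : matDeriv (fun z => K (F z)) y w = matDeriv K (F y) (vel F y w) := by
    ext i j; exact fderiv_comp_vel hU hV (hK i j) hF hm hy w
  have hu := isUnit_iff_ne_zero.2 (hKd _ (hm hy))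
  rw [pull, pull, vel_comp hU hV hΦ hF hm hy, matDeriv_mul hU hKF hB hy, hd, Matrix.mul_inv_rev,
    pull]
  have e1 : K (F y) * ((K (F y))⁻¹ * (matDeriv K (F y) (vel F y w)
      + Θ (Φ (F y)) (vel Φ (F y) (vel F y w)) * K (F y))) = matDeriv K (F y) (vel F y w)
      + Θ (Φ (F y)) (vel Φ (F y) (vel F y w)) * K (F y) :=
    Matrix.mul_nonsing_inv_cancel_left _ _ hu
  rw [mul_assoc]
  congr 1
  simp only [mul_add, add_mul, mul_assoc, Matrix.nonsing_inv_mul_cancel_left _ _ hu]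
  abel

/-- The transformation of the connection form of a moving frame. -/
theorem pull_mul {Θ : (Fin m → ℝ) → (Fin m → ℝ) → Matrix (Fin 6) (Fin 6) ℝ}
    {R : (Fin n → ℝ) → Matrix (Fin 6) (Fin 6) ℝ} (hU : IsOpen U)
    (hB : MatSmoothOn B U) (hR : MatSmoothOn R U) (hBd : ∀ y ∈ U, (B y).det ≠ 0)
    (hRd : ∀ y ∈ U, (R y).det ≠ 0) {y} (hy : y ∈ U) (w) :
    R y * pull Θ F (fun z => B z * R z) y w = matDeriv R y w + pull Θ F B y w * R y := by
  have hu := isUnit_iff_ne_zero.2 (hBd _ hy)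
  have hu' := isUnit_iff_ne_zero.2 (hRd _ hy)
  rw [pull, pull, matDeriv_mul hU hB hR hy, Matrix.mul_inv_rev, mul_assoc (R y)⁻¹,
    Matrix.mul_nonsing_inv_cancel_left _ _ hu']
  simp only [mul_add, add_mul, mul_assoc, Matrix.nonsing_inv_mul_cancel_left _ _ hu]
  abel

end PullPull

/-! ### Transfer between manifolds and coordinates -/

section Transfer
variable {M : Type u} [TopologicalSpace M] [ChartedSpace (Fin 4 → ℝ) M]
  [IsManifold 𝓘(ℝ, Fin 4 → ℝ) ∞ M]
variable {N : Type v} [TopologicalSpace N] [ChartedSpace (Fin 3 → ℝ) N]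
  [IsManifold 𝓘(ℝ, Fin 3 → ℝ) ∞ N]

/-- The differential of a coordinate system. -/
noncomputable def chartDeriv (ψ : OpenPartialHomeomorph N (Fin 3 → ℝ)) (p : N)
    (w : TangentSpace 𝓘(ℝ, Fin 3 → ℝ) p) : Fin 3 → ℝ :=
  mfderiv 𝓘(ℝ, Fin 3 → ℝ) 𝓘(ℝ, Fin 3 → ℝ) ψ p w

omit [IsManifold 𝓘(ℝ, Fin 4 → ℝ) ∞ M] in
theorem chart_mdifferentiable {d : ℕ} {L : Type*} [TopologicalSpace L] [ChartedSpace (Fin d → ℝ) L]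
    [IsManifold 𝓘(ℝ, Fin d → ℝ) ∞ L] {φ : OpenPartialHomeomorph L (Fin d → ℝ)}
    (hφ : φ ∈ IsManifold.maximalAtlas 𝓘(ℝ, Fin d → ℝ) ∞ L) :
    φ.MDifferentiable 𝓘(ℝ, Fin d → ℝ) 𝓘(ℝ, Fin d → ℝ) :=
  ⟨(contMDiffOn_of_mem_maximalAtlas hφ).mdifferentiableOn (by simp),
    (contMDiffOn_symm_of_mem_maximalAtlas hφ).mdifferentiableOn (by simp)⟩

variable {ψ : OpenPartialHomeomorph N (Fin 3 → ℝ)}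
  (hψ : ψ ∈ IsManifold.maximalAtlas 𝓘(ℝ, Fin 3 → ℝ) ∞ N)
include hψ

theorem chartDeriv_bijective {p : N} (hp : p ∈ ψ.source) :
    Function.Bijective (chartDeriv ψ p) :=
  (chart_mdifferentiable hψ).mfderiv_bijective hp

theorem chart_symm_smoothOn {E : Type*} [NormedAddCommGroup E] [NormedSpace ℝ E] {h : N → E}
    {O : Set N} (hh : ContMDiffOn 𝓘(ℝ, Fin 3 → ℝ) 𝓘(ℝ, E) ∞ h O) :
    ContDiffOn ℝ ∞ (fun y => h (ψ.symm y)) (ψ.target ∩ ψ.symm ⁻¹' O) := by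
  rw [← contMDiffOn_iff_contDiffOn]
  exact hh.comp ((contMDiffOn_symm_of_mem_maximalAtlas hψ).mono Set.inter_subset_left)
    fun y hy => hy.2

theorem chart_smoothOn {E : Type*} [NormedAddCommGroup E] [NormedSpace ℝ E]
    {h : (Fin 3 → ℝ) → E} {U : Set (Fin 3 → ℝ)} (hh : ContDiffOn ℝ ∞ h U) :
    ContMDiffOn 𝓘(ℝ, Fin 3 → ℝ) 𝓘(ℝ, E) ∞ (fun q => h (ψ q)) (ψ.source ∩ ψ ⁻¹' U) := by
  rw [← contMDiffOn_iff_contDiffOn] at hh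
  exact hh.comp ((contMDiffOn_of_mem_maximalAtlas hψ).mono Set.inter_subset_left)
    fun y hy => hy.2

theorem differential_eq {h : N → ℝ} {O : Set N} (hO : IsOpen O)
    (hh : ContMDiffOn 𝓘(ℝ, Fin 3 → ℝ) 𝓘(ℝ, ℝ) ∞ h O) {p : N} (hp : p ∈ O) (hp' : p ∈ ψ.source)
    (w : TangentSpace 𝓘(ℝ, Fin 3 → ℝ) p) :
    differential h p w = fderiv ℝ (fun y => h (ψ.symm y)) (ψ p) (chartDeriv ψ p w) := by
  have h1 : MDifferentiableAt 𝓘(ℝ, Fin 3 → ℝ) 𝓘(ℝ, Fin 3 → ℝ) ψ p :=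
    (chart_mdifferentiable hψ).mdifferentiableAt hp'
  have hy : ψ p ∈ ψ.target ∩ ψ.symm ⁻¹' O := ⟨ψ.map_source hp', by
    rwa [Set.mem_preimage, ψ.left_inv hp']⟩
  have h2 : DifferentiableAt ℝ (fun y => h (ψ.symm y)) (ψ p) :=
    diffAt_of_smoothOn (ψ.symm.isOpen_inter_preimage hO) (chart_symm_smoothOn hψ hh) hy
  have h3 : mfderiv 𝓘(ℝ, Fin 3 → ℝ) 𝓘(ℝ, ℝ) h p
      = mfderiv 𝓘(ℝ, Fin 3 → ℝ) 𝓘(ℝ, ℝ) ((fun y => h (ψ.symm y)) ∘ ψ) p := by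
    refine Filter.EventuallyEq.mfderiv_eq ?_
    filter_upwards [ψ.open_source.mem_nhds hp'] with q hq
    simp [ψ.left_inv hq]
  rw [differential, h3, mfderiv_comp p h2.mdifferentiableAt h1, mfderiv_eq_fderiv]
  rfl

variable (c : ConformalStructure M) {f : N → M}
omit hψ

/-- The parametrization of the hypersurface in local coordinates. -/
def localMap (γ : Gauge M) (f : N → M) (ψ : OpenPartialHomeomorph N (Fin 3 → ℝ))
    (y : Fin 3 → ℝ) : Fin 4 → ℝ := γ.chart (f (ψ.symm y))

/-- The part of the coordinate domain mapped to the chart of `γ` and lying in `O`. -/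
def localDom (γ : Gauge M) (f : N → M) (ψ : OpenPartialHomeomorph N (Fin 3 → ℝ)) (O : Set N) :
    Set (Fin 3 → ℝ) := ψ.target ∩ ψ.symm ⁻¹' (O ∩ f ⁻¹' γ.chart.source)

variable {γ : Gauge M}

theorem localDom_open (hf : Continuous f) {O : Set N} (hO : IsOpen O) :
    IsOpen (localDom γ f ψ O) :=
  ψ.symm.isOpen_inter_preimage (hO.inter (γ.chart.open_source.preimage hf))

theorem mem_localDom {O : Set N} {p : N} (hp : p ∈ O) (hp' : p ∈ ψ.source)
    (hγ : f p ∈ γ.chart.source) : ψ p ∈ localDom γ f ψ O :=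
  ⟨ψ.map_source hp', by rw [Set.mem_preimage, ψ.left_inv hp']; exact ⟨hp, hγ⟩⟩

variable {c}
variable (hf : IsLightlikeHypersurface c f) (hγ : γ ∈ c.gauges) {O : Set N} (hO : IsOpen O)
include hψ hf hγ

omit hψ in
theorem chart_comp_smooth : ContMDiffOn 𝓘(ℝ, Fin 3 → ℝ) 𝓘(ℝ, Fin 4 → ℝ) ∞
    (fun q => γ.chart (f q)) (f ⁻¹' γ.chart.source) :=
  (contMDiffOn_of_mem_maximalAtlas (c.chart_mem γ hγ)).comp hf.smooth.contMDiffOn fun _ h => h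

omit hψ in
theorem chart_comp_smooth_apply (i : Fin 4) : ContMDiffOn 𝓘(ℝ, Fin 3 → ℝ) 𝓘(ℝ, ℝ) ∞
    (fun q => γ.chart (f q) i) (f ⁻¹' γ.chart.source) :=
  (ContinuousLinearMap.proj (R := ℝ) (φ := fun _ : Fin 4 => ℝ) i).contMDiff.comp_contMDiffOn
    (chart_comp_smooth hf hγ)

theorem localMap_smooth (i : Fin 4) :
    ContDiffOn ℝ ∞ (fun y => localMap γ f ψ y i) (localDom γ f ψ O) :=
  (chart_symm_smoothOn hψ (chart_comp_smooth_apply hf hγ i)).mono fun _ hy => ⟨hy.1, hy.2.2⟩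

theorem velocity_eq {p : N} (hp' : p ∈ ψ.source)
    (hp : f p ∈ γ.chart.source) (w : TangentSpace 𝓘(ℝ, Fin 3 → ℝ) p) :
    velocity γ f p w = vel (localMap γ f ψ) (ψ p) (chartDeriv ψ p w) := by
  ext i
  exact differential_eq hψ (γ.chart.open_source.preimage hf.smooth.continuous)
    (chart_comp_smooth_apply hf hγ i) hp hp' w

omit hψ in
theorem velocity_injective {p : N} (hp : f p ∈ γ.chart.source)
    (w : TangentSpace 𝓘(ℝ, Fin 3 → ℝ) p) (h : velocity γ f p w = 0) : w = 0 := by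
  have hc : γ.chart.MDifferentiable 𝓘(ℝ, Fin 4 → ℝ) 𝓘(ℝ, Fin 4 → ℝ) :=
    chart_mdifferentiable (c.chart_mem γ hγ)
  have hfd : MDifferentiableAt 𝓘(ℝ, Fin 3 → ℝ) 𝓘(ℝ, Fin 4 → ℝ) f p :=
    hf.smooth.mdifferentiableAt (by simp)
  have hcf : MDifferentiableAt 𝓘(ℝ, Fin 3 → ℝ) 𝓘(ℝ, Fin 4 → ℝ) (γ.chart ∘ f) p :=
    (hc.mdifferentiableAt hp).comp p hfd
  have h1 : mfderiv 𝓘(ℝ, Fin 3 → ℝ) 𝓘(ℝ, Fin 4 → ℝ) (γ.chart ∘ f) p w = 0 := by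
    refine funext fun i => ?_
    have h2 : mfderiv 𝓘(ℝ, Fin 3 → ℝ) 𝓘(ℝ, ℝ)
        ((ContinuousLinearMap.proj (R := ℝ) (φ := fun _ : Fin 4 => ℝ) i) ∘ (γ.chart ∘ f)) p w = 0 :=
      congrFun h i
    rw [mfderiv_comp p (ContinuousLinearMap.mdifferentiableAt _) hcf] at h2
    rw [ContinuousLinearMap.mfderiv_eq] at h2
    exact h2
  rw [mfderiv_comp p (hc.mdifferentiableAt hp) hfd] at h1
  refine hf.immersion p ?_
  rw [map_zero]
  refine (hc.mfderiv_bijective hp).1 ?_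
  rw [map_zero]
  exact h1

include hO in
theorem omega_eq {A : Gauge M → N → Matrix (Fin 6) (Fin 6) ℝ}
    (hA : ∀ a b, ContMDiffOn 𝓘(ℝ, Fin 3 → ℝ) 𝓘(ℝ, ℝ) ∞ (fun p => A γ p a b)
      (O ∩ f ⁻¹' γ.chart.source)) {p : N} (hpO : p ∈ O)
    (hp' : p ∈ ψ.source) (hp : f p ∈ γ.chart.source) (w : TangentSpace 𝓘(ℝ, Fin 3 → ℝ) p)
    (a b : Fin 6) :
    omega γ f A p a b w = pull (connection γ.metric) (localMap γ f ψ)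
      (fun y => A γ (ψ.symm y)) (ψ p) (chartDeriv ψ p w) b a := by
  have e : Matrix.of (fun i j => differential (fun q => A γ q i j) p w)
      = matDeriv (fun y => A γ (ψ.symm y)) (ψ p) (chartDeriv ψ p w) := by
    ext i j
    exact differential_eq hψ (hO.inter (γ.chart.open_source.preimage hf.smooth.continuous))
      (hA i j) ⟨hpO, hp⟩ hp' w
  rw [omega, e, velocity_eq hψ hf hγ hp' hp, pull, localMap, ψ.left_inv hp']

include hO in
theorem localSurface : LocalSurface γ.metric γ.chart.target (localMap γ f ψ) (localDom γ f ψ O) := by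
  have key : ∀ y ∈ localDom γ f ψ O, ψ.symm y ∈ ψ.source ∧ f (ψ.symm y) ∈ γ.chart.source ∧
      ∀ w, vel (localMap γ f ψ) y (chartDeriv ψ (ψ.symm y) w) = velocity γ f (ψ.symm y) w := by
    intro y hy
    refine ⟨ψ.map_target hy.1, hy.2.2, fun w => ?_⟩
    rw [velocity_eq hψ hf hγ (ψ.map_target hy.1) hy.2.2, ψ.right_inv hy.1]
  refine ⟨c.isMetricOn hγ, localDom_open hf.smooth.continuous hO, localMap_smooth hψ hf hγ,
    fun y hy => γ.chart.map_source hy.2.2, fun y hy w hw => ?_, fun y hy => ?_, c.signature γ hγ⟩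
  · obtain ⟨h1, h2, h3⟩ := key y hy
    obtain ⟨v, rfl⟩ := (chartDeriv_bijective hψ h1).2 w
    rw [h3] at hw
    rw [velocity_injective hf hγ h2 v hw]
    exact map_zero (mfderiv 𝓘(ℝ, Fin 3 → ℝ) 𝓘(ℝ, Fin 3 → ℝ) ψ (ψ.symm y))
  · obtain ⟨h1, h2, h3⟩ := key y hy
    obtain ⟨w, hw, hl⟩ := hf.lightlike γ hγ _ h2
    refine ⟨chartDeriv ψ (ψ.symm y) w, fun h => hw ?_, fun w' => ?_⟩
    · refine (chartDeriv_bijective hψ h1).1 (h.trans ?_)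
      exact (map_zero (mfderiv 𝓘(ℝ, Fin 3 → ℝ) 𝓘(ℝ, Fin 3 → ℝ) ψ (ψ.symm y))).symm
    · obtain ⟨v, rfl⟩ := (chartDeriv_bijective hψ h1).2 w'
      rw [h3, h3]
      exact hl v

omit hf in
theorem localFrame {A : Gauge M → N → Matrix (Fin 6) (Fin 6) ℝ} (hA : IsFrameField c f O A) :
    LocalFrame γ.metric (localMap γ f ψ) (localDom γ f ψ O) (fun y => A γ (ψ.symm y)) :=
  ⟨fun a b => chart_symm_smoothOn hψ (hA.smooth γ hγ a b),
    fun y hy => hA.vertex γ hγ _ hy.2.1 hy.2.2, fun y hy => hA.gram γ hγ _ hy.2.1 hy.2.2,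
    fun y hy => hA.oriented γ hγ _ hy.2.1 hy.2.2⟩

omit hψ in
include hO in
/-- The forms of infinitesimal displacement do not depend on the gauge. -/
theorem omega_gauge {A : Gauge M → N → Matrix (Fin 6) (Fin 6) ℝ} (hA : IsFrameField c f O A)
    {γ' : Gauge M} (hγ' : γ' ∈ c.gauges) {p : N} (hpO : p ∈ O) (hp : f p ∈ γ.chart.source)
    (hp' : f p ∈ γ'.chart.source) (a b : Fin 6) (w : TangentSpace 𝓘(ℝ, Fin 3 → ℝ) p) :
    omega γ f A p a b w = omega γ' f A p a b w := by
  set ψ := chartAt (Fin 3 → ℝ) p with hψd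
  have hψ : ψ ∈ IsManifold.maximalAtlas 𝓘(ℝ, Fin 3 → ℝ) ∞ N :=
    IsManifold.chart_mem_maximalAtlas (n := ∞) p
  have hps : p ∈ ψ.source := mem_chart_source _ p
  obtain ⟨s, hs⟩ := c.conformal γ hγ γ' hγ'
  rw [omega_eq hψ hf hγ hO (hA.smooth γ hγ) hpO hps hp,
    omega_eq hψ hf hγ' hO (hA.smooth γ' hγ') hpO hps hp']
  set U := localDom γ f ψ O ∩ localDom γ' f ψ O with hU
  have hUo : IsOpen U := (localDom_open hf.smooth.continuous hO).inter
    (localDom_open hf.smooth.continuous hO)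
  have hy : ψ p ∈ U := ⟨mem_localDom hpO hps hp, mem_localDom hpO hps hp'⟩
  have hmap : Set.MapsTo (localMap γ' f ψ) U (overlap γ γ') := fun y hy =>
    chart_mem_overlap hy.1.2.2 hy.2.2.2
  have h1 : ∀ y ∈ U, localMap γ f ψ y = coordChange γ γ' (localMap γ' f ψ y) := by
    intro y hy
    simp only [localMap, coordChange]
    rw [γ'.chart.left_inv hy.2.2.2]
  have h2 : ∀ y ∈ U, A γ (ψ.symm y)
      = gaugeChange γ γ' s (localMap γ' f ψ y) * A γ' (ψ.symm y) := fun y hy =>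
    hA.gauge_change γ hγ γ' hγ' s hs _ hy.1.2.1 hy.1.2.2 hy.2.2.2
  -- The data in `γ` are rewritten as those in `γ'` followed by the change of gauge; the inner
  -- pullback is then the connection of `γ'`.
  rw [pull_congr hUo h1 h2 hy, pull_pull hUo (overlap_open γ γ') (coordChange_smooth hγ hγ')
    (fun i => (localMap_smooth hψ hf hγ' i).mono Set.inter_subset_right) hmap
    (gaugeChange_smooth hγ hγ' hs) (fun x hx => gaugeChange_det hγ hγ' hs hx)
    ((localFrame hψ hγ' hA).smooth.mono Set.inter_subset_right) hy]
  rw [pull, connection_gaugeChange hγ hγ' hs (hmap hy), pull]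

/-- The frame field, in all gauges, with given components in one gauge. -/
noncomputable def globalFrame (c : ConformalStructure M) (f : N → M) (γ : Gauge M)
    (ψ : OpenPartialHomeomorph N (Fin 3 → ℝ)) (B : (Fin 3 → ℝ) → Matrix (Fin 6) (Fin 6) ℝ)
    (γ' : Gauge M) (q : N) : Matrix (Fin 6) (Fin 6) ℝ :=
  open Classical in
  -- A conformal factor is determined only on the overlap, so one is chosen. The value zero is never
  -- used for gauges of the structure.
  if h : ∃ s, IsConformalFactor γ' γ s then
    gaugeChange γ' γ h.choose (γ.chart (f q)) * B (ψ q) else 0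

omit hψ hf in
theorem globalFrame_apply {B : (Fin 3 → ℝ) → Matrix (Fin 6) (Fin 6) ℝ} {γ' : Gauge M}
    (hγ' : γ' ∈ c.gauges) : ∃ s, IsConformalFactor γ' γ s ∧ ∀ q,
      globalFrame c f γ ψ B γ' q = gaugeChange γ' γ s (γ.chart (f q)) * B (ψ q) := by
  have h := c.conformal γ' hγ' γ hγ
  refine ⟨h.choose, h.choose_spec, fun q => ?_⟩
  rw [globalFrame, dif_pos h]

omit hψ hf in
theorem globalFrame_self {B : (Fin 3 → ℝ) → Matrix (Fin 6) (Fin 6) ℝ} {q : N}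
    (hq : f q ∈ γ.chart.source) : globalFrame c f γ ψ B γ q = B (ψ q) := by
  obtain ⟨s, hs, h⟩ := globalFrame_apply (c := c) (f := f) (ψ := ψ) (B := B) hγ hγ
  rw [h, gaugeChange_self hγ hs (chart_mem_overlap hq hq), one_mul]

/-- Compatibility between two arbitrary gauges is the cocycle relation through the third gauge `γ`.
The other properties pass through `gaugeChange`, which is an isometry, fixes the direction of `X`,
and acts on the middle block with positive determinant. -/
theorem globalFrame_isFrameField {B : (Fin 3 → ℝ) → Matrix (Fin 6) (Fin 6) ℝ}
    {U : Set (Fin 3 → ℝ)} (hU : IsOpen U) (hUs : U ⊆ localDom γ f ψ Set.univ)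
    (hB : LocalFrame γ.metric (localMap γ f ψ) U B) :
    IsFrameField c f (ψ.source ∩ ψ ⁻¹' U) (globalFrame c f γ ψ B) := by
  have hsrc : ∀ q ∈ ψ.source ∩ ψ ⁻¹' U, f q ∈ γ.chart.source := by
    intro q hq
    have := (hUs hq.2).2.2
    rwa [Set.mem_preimage, ψ.left_inv hq.1] at this
  have hloc : ∀ q ∈ ψ.source ∩ ψ ⁻¹' U, localMap γ f ψ (ψ q) = γ.chart (f q) := by
    intro q hq; rw [localMap, ψ.left_inv hq.1]
  refine ⟨fun γ' hγ' a b => ?_, fun γ₁ h₁ γ₂ h₂ s hs q hq hq1 hq2 => ?_,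
    fun γ' hγ' q hq hq' a ha => ?_, fun γ' hγ' q hq hq' => ?_, fun γ' hγ' q hq hq' => ?_⟩
  · obtain ⟨s, hs, h⟩ := globalFrame_apply (c := c) (f := f) (ψ := ψ) (B := B) hγ hγ'
    have hUo : IsOpen (U ∩ localDom γ' f ψ Set.univ) := hU.inter
      (localDom_open hf.smooth.continuous isOpen_univ)
    have hm : Set.MapsTo (localMap γ f ψ) (U ∩ localDom γ' f ψ Set.univ) (overlap γ' γ) :=
      fun y hy => chart_mem_overlap hy.2.2.2 (hUs hy.1).2.2
    have hK : MatSmoothOn (fun y => gaugeChange γ' γ s (localMap γ f ψ y))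
        (U ∩ localDom γ' f ψ Set.univ) := fun i j =>
      smoothOn_comp (gaugeChange_smooth hγ' hγ hs i j) (fun i =>
        (localMap_smooth hψ hf hγ i).mono (Set.inter_subset_left.trans hUs)) hm
    have := chart_smoothOn hψ ((hK.mul (hB.smooth.mono Set.inter_subset_left)) a b)
    refine (this.mono fun q hq => ⟨hq.1.1, hq.1.2, ?_⟩).congr fun q hq => ?_
    · exact mem_localDom (Set.mem_univ _) hq.1.1 hq.2
    · rw [h]
      change _ = (gaugeChange γ' γ s (localMap γ f ψ (ψ q)) * B (ψ q)) a b
      rw [hloc q hq.1]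
  · obtain ⟨s₁, hs₁, e₁⟩ := globalFrame_apply (c := c) (f := f) (ψ := ψ) (B := B) hγ h₁
    obtain ⟨s₂, hs₂, e₂⟩ := globalFrame_apply (c := c) (f := f) (ψ := ψ) (B := B) hγ h₂
    have hx := chart_mem_overlap hq2 (hsrc q hq)
    rw [e₁, e₂, gaugeChange_comp h₁ h₂ hγ hs hs₂ hs₁ hx (chart_mem_overlap hq1 (hsrc q hq)),
      coordChange, γ.chart.left_inv (hsrc q hq), mul_assoc]
  · obtain ⟨s, hs, h⟩ := globalFrame_apply (c := c) (f := f) (ψ := ψ) (B := B) hγ hγ'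
    have hv := hB.vertex _ hq.2
    rw [h, mul_six, (gaugeChange_entries γ' γ s _).1, hv 5 (by decide)]
    simp only [hv _ (mid_ne_zero _), mul_zero, Finset.sum_const_zero, add_zero]
    revert a
    exact forall_six (fun h => (h rfl).elim) (fun i _ => by simp) (fun _ => by simp)
  · obtain ⟨s, hs, h⟩ := globalFrame_apply (c := c) (f := f) (ψ := ψ) (B := B) hγ hγ'
    have hx := chart_mem_overlap hq' (hsrc q hq)
    have hg := gaugeChange_gram hγ' hγ hs hx
    rw [coordChange, γ.chart.left_inv (hsrc q hq)] at hg
    have := hB.gram _ hq.2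
    rw [hloc q hq, ← hg] at this
    rw [h, ← this]
    simp only [Matrix.transpose_mul, mul_assoc]
  · obtain ⟨s, hs, h⟩ := globalFrame_apply (c := c) (f := f) (ψ := ψ) (B := B) hγ hγ'
    have hx := chart_mem_overlap hq' (hsrc q hq)
    have e : (Matrix.of fun i j : Fin 4 => globalFrame c f γ ψ B γ' q (mid i) (mid j))
        = (s (γ.chart (f q)) • jacobian γ' γ (γ.chart (f q)))
          * Matrix.of fun i j : Fin 4 => B (ψ q) (mid i) (mid j) := by
      ext i j
      simp only [Matrix.of_apply, h, Matrix.mul_apply (M := _ • _)]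
      rw [mul_six, (gaugeChange_entries γ' γ s _).1,
        frame_row_five (hB.vertex _ hq.2) (hB.gram _ hq.2)]
      simp [(gaugeChange_entries γ' γ s _).2.1]
    rw [e, Matrix.det_mul, Matrix.det_smul]
    have h1 := (hs.2 _ hx).1
    have h2 := c.oriented γ' hγ' γ hγ _ hx
    have h3 := hB.oriented _ hq.2
    positivity

end Transfer

/-! ### The forms of infinitesimal displacement of a first-order frame -/

/-- The relations between the entries of an infinitesimal isometry, in an isotropic frame. -/
structure SkewForm (Ω : Matrix (Fin 6) (Fin 6) ℝ) : Prop where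
  e05 : Ω 0 5 = 0
  e14 : Ω 1 4 = 0
  e23 : Ω 2 3 = 0
  e32 : Ω 3 2 = 0
  e41 : Ω 4 1 = 0
  e50 : Ω 5 0 = 0
  e51 : Ω 5 1 = -Ω 4 0
  e52 : Ω 5 2 = Ω 3 0
  e53 : Ω 5 3 = Ω 2 0
  e54 : Ω 5 4 = -Ω 1 0
  e55 : Ω 5 5 = -Ω 0 0
  e42 : Ω 4 2 = Ω 3 1
  e43 : Ω 4 3 = Ω 2 1
  e44 : Ω 4 4 = -Ω 1 1
  e45 : Ω 4 5 = -Ω 0 1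
  e33 : Ω 3 3 = -Ω 2 2
  e34 : Ω 3 4 = Ω 1 2
  e35 : Ω 3 5 = Ω 0 2
  e24 : Ω 2 4 = Ω 1 3
  e25 : Ω 2 5 = Ω 0 3
  e15 : Ω 1 5 = -Ω 0 4

theorem gramOf_isotropicGram : gramOf isotropicGram = !![0, 0, 0, 0, 0, -1; 0, 0, 0, 0, -1, 0;
    0, 0, 0, 1, 0, 0; 0, 0, 1, 0, 0, 0; 0, -1, 0, 0, 0, 0; -1, 0, 0, 0, 0, 0] := by
  ext a b
  fin_cases a <;> fin_cases b <;> rfl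

theorem formCurv_apply {n : ℕ} (Ω : (Fin n → ℝ) → (Fin n → ℝ) → Matrix (Fin 6) (Fin 6) ℝ)
    (y w w' : Fin n → ℝ) (a b : Fin 6) : formCurv Ω y w w' a b
      = fderiv ℝ (fun z => Ω z w' a b) y w - fderiv ℝ (fun z => Ω z w a b) y w'
        + ∑ k, (Ω y w a k * Ω y w' k b - Ω y w' a k * Ω y w k b) := by
  simp only [formCurv, matDeriv, Matrix.add_apply, Matrix.sub_apply, Matrix.of_apply,
    Matrix.mul_apply, Finset.sum_sub_distrib]

theorem skewForm_of_gram {Ω : Matrix (Fin 6) (Fin 6) ℝ}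
    (h : Ωᵀ * gramOf isotropicGram + gramOf isotropicGram * Ω = 0) : SkewForm Ω := by
  -- The vertex number a is paired only with the vertex number r(a), with product σ(a).
  have e' : ∀ σ : Fin 6 → ℝ, ∀ r : Fin 6 → Fin 6, σ = ![-1, -1, 1, 1, -1, -1] →
      r = ![5, 4, 3, 2, 1, 0] → ∀ a b, Ω (r b) a * σ b + σ a * Ω (r a) b = 0 := by
    rintro σ r rfl rfl a b
    have := congrFun (congrFun h a) b
    rw [gramOf_isotropicGram, Matrix.add_apply, Matrix.mul_apply, Matrix.mul_apply,
      Fin.sum_univ_six, Fin.sum_univ_six] at this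
    fin_cases a <;> fin_cases b <;> simpa using this
  have k := e' _ _ rfl rfl
  constructor
  · have := k 5 5; simp at this; linarith
  · have := k 4 4; simp at this; linarith
  · have := k 3 3; simp at this; linarith
  · have := k 2 2; simp at this; linarith
  · have := k 1 1; simp at this; linarith
  · have := k 0 0; simp at this; linarith
  · have := k 0 1; simp at this; linarith
  · have := k 0 2; simp at this; linarith
  · have := k 0 3; simp at this; linarith
  · have := k 0 4; simp at this; linarith
  · have := k 0 5; simp at this; linarith
  · have := k 1 2; simp at this; linarith
  · have := k 1 3; simp at this; linarith
  · have := k 1 4; simp at this; linarith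
  · have := k 1 5; simp at this; linarith
  · have := k 2 3; simp at this; linarith
  · have := k 2 4; simp at this; linarith
  · have := k 2 5; simp at this; linarith
  · have := k 3 4; simp at this; linarith
  · have := k 3 5; simp at this; linarith
  · have := k 4 5; simp at this; linarith

/-- The form of a moving frame of first order: `ω^4 = 0`, and `ω^1, ω^2, ω^3` are independent. -/
structure FirstOrderForm (Ω : (Fin 3 → ℝ) → (Fin 3 → ℝ) → Matrix (Fin 6) (Fin 6) ℝ)
    (U : Set (Fin 3 → ℝ)) : Prop where
  isOpen : IsOpen U
  linear : ∀ y w, Ω y w = ∑ k, w k • Ω y (Pi.single k 1)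
  smooth : ∀ w, MatSmoothOn (fun y => Ω y w) U
  skew : ∀ y ∈ U, ∀ w, SkewForm (Ω y w)
  tangent : ∀ y ∈ U, ∀ w, Ω y w 4 0 = 0
  injective : ∀ y ∈ U, ∀ w, Ω y w 1 0 = 0 → Ω y w 2 0 = 0 → Ω y w 3 0 = 0 → w = 0
  cartan : ∀ y ∈ U, ∀ w w', Ω y w 3 1 * Ω y w' 2 0 - Ω y w' 3 1 * Ω y w 2 0
    + (Ω y w 2 1 * Ω y w' 3 0 - Ω y w' 2 1 * Ω y w 3 0) = 0

section Moving
variable {G : (Fin 4 → ℝ) → Matrix (Fin 4) (Fin 4) ℝ} {V : Set (Fin 4 → ℝ)}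
  {F : (Fin 3 → ℝ) → Fin 4 → ℝ} {U : Set (Fin 3 → ℝ)}
  {B : (Fin 3 → ℝ) → Matrix (Fin 6) (Fin 6) ℝ}
  (hS : LocalSurface G V F U) (hB : LocalFrame G F U B)
include hB

theorem LocalFrame.det_ne {y} (hy : y ∈ U) : (B y).det ≠ 0 := frame_det_ne (hB.gram y hy)

include hS

theorem moving_smooth (w) : MatSmoothOn (fun y => pull (connection G) F B y w) U :=
  pull_smooth (connection_linear G) (fun _ => connection_smooth hS.metric _) hS.isOpen hS.smooth
    hS.mapsTo hB.smooth (fun _ => hB.det_ne) w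

theorem moving_skew {y} (hy : y ∈ U) (w) : SkewForm (pull (connection G) F B y w) := by
  refine skewForm_of_gram ?_
  have := pull_metric hS.metric hS.isOpen hS.smooth hS.mapsTo hB.smooth (fun _ => hB.det_ne) hy w
  rw [hB.gram y hy, matDeriv_congr (B := fun _ => gramOf isotropicGram) hS.isOpen hB.gram hy,
    matDeriv_const] at this
  exact this

/-- The vector of the tangent space with given components in the frame. -/
noncomputable def dualMatrix (B : Matrix (Fin 6) (Fin 6) ℝ) : Matrix (Fin 4) (Fin 4) ℝ :=
  Matrix.of fun i k => B (mid i) (mid k) / B 0 0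

/-- Compares the components of dA_0 along the ∂_i: since A_0 is a multiple of `X`, only dX
contributes, so the ω^k are the components of the velocity in the dual basis of the frame. -/
theorem vel_eq {y} (hy : y ∈ U) (w) : vel F y w
    = dualMatrix (B y) *ᵥ fun k => pull (connection G) F B y w (mid k) 0 := by
  have hu := isUnit_iff_ne_zero.2 (hB.det_ne hy)
  have h : B y * pull (connection G) F B y w = matDeriv B y w
      + connection G (F y) (vel F y w) * B y := by
    rw [pull, Matrix.mul_nonsing_inv_cancel_left _ _ hu]
  have h0 := frame_zero_zero (hB.vertex y hy) (hB.gram y hy)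
  ext i
  have := congrFun (congrFun h (mid i)) 0
  rw [mul_six, Matrix.add_apply, mul_six, hB.vertex y hy _ (mid_ne_zero i),
    (moving_skew hS hB hy w).e50, hB.vertex y hy 5 (by decide)] at this
  have hd : matDeriv B y w (mid i) 0 = 0 := by
    have e := fderiv_eq_of_eqOn (u := fun z => B z (mid i) 0) (v := fun _ => (0 : ℝ)) hS.isOpen
      (fun z hz => hB.vertex z hz _ (mid_ne_zero i)) hy
    simp [matDeriv, e]
  have hc : connection G (F y) (vel F y w) (mid i) 0 = vel F y w i := by
    simp [connection]
  rw [hd, hc] at this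
  simp only [hB.vertex y hy _ (mid_ne_zero _), mul_zero, zero_mul, Finset.sum_const_zero, add_zero,
    zero_add] at this
  simp only [Matrix.mulVec, dotProduct, dualMatrix, Matrix.of_apply, div_mul_eq_mul_div,
    ← Finset.sum_div]
  rw [this, mul_div_cancel_right₀ _ h0]

theorem dualMatrix_det_ne {y} (hy : y ∈ U) : (dualMatrix (B y)).det ≠ 0 := by
  have h0 := frame_zero_zero (hB.vertex y hy) (hB.gram y hy)
  have : dualMatrix (B y) = (B y 0 0)⁻¹ • Matrix.of fun i j : Fin 4 => B y (mid i) (mid j) := by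
    ext i j; simp [dualMatrix, div_eq_inv_mul]
  rw [this, Matrix.det_smul]
  exact mul_ne_zero (pow_ne_zero _ (inv_ne_zero h0)) (hB.oriented y hy).ne'

/-- The curvature in the moving frame, on vectors given by their components in the frame. -/
noncomputable def frameCurv (G : (Fin 4 → ℝ) → Matrix (Fin 4) (Fin 4) ℝ) (x : Fin 4 → ℝ)
    (B : Matrix (Fin 6) (Fin 6) ℝ) (u u' : Fin 4 → ℝ) : Matrix (Fin 6) (Fin 6) ℝ :=
  B⁻¹ * curvature G x (dualMatrix B *ᵥ u) (dualMatrix B *ᵥ u') * B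

theorem frameCurv_curvLike {y} (hy : y ∈ U) : CurvLike (frameCurv G (F y) (B y)) := by
  have h0 := frame_zero_zero (hB.vertex y hy) (hB.gram y hy)
  exact (connection_curvLike hS.metric (hS.mapsTo hy)).conj (hB.det_ne hy) h0
    (dualMatrix_det_ne hS hB hy) (frame_col_zero (hB.vertex y hy) (hB.gram y hy))
    (frame_row_five (hB.vertex y hy) (hB.gram y hy))
    (fun i j => by simp only [dualMatrix, Matrix.of_apply]; field_simp)

theorem frameCurv_skew {y} (hy : y ∈ U) (u u') : SkewForm (frameCurv G (F y) (B y) u u') := by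
  refine skewForm_of_gram ?_
  have hu := isUnit_iff_ne_zero.2 (hB.det_ne hy)
  have h := connection_skew hS.metric (hS.mapsTo hy) (dualMatrix (B y) *ᵥ u) (dualMatrix (B y) *ᵥ u')
  set C := curvature G (F y) (dualMatrix (B y) *ᵥ u) (dualMatrix (B y) *ᵥ u') with hC
  have e : B y * frameCurv G (F y) (B y) u u' = C * B y := by
    rw [frameCurv, mul_assoc, Matrix.mul_nonsing_inv_cancel_left _ _ hu]
  rw [← hB.gram y hy]
  have : (frameCurv G (F y) (B y) u u')ᵀ * ((B y)ᵀ * gramOf (G (F y)) * B y)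
      + ((B y)ᵀ * gramOf (G (F y)) * B y) * frameCurv G (F y) (B y) u u'
      = (B y)ᵀ * (Cᵀ * gramOf (G (F y)) + gramOf (G (F y)) * C) * B y := by
    have e2 := congrArg Matrix.transpose e
    rw [Matrix.transpose_mul, Matrix.transpose_mul] at e2
    rw [mul_assoc _ (B y), e, ← mul_assoc, ← mul_assoc, e2]
    simp only [mul_add, add_mul, mul_assoc]
  rw [this, h, mul_zero, zero_mul]

/-- The structure equations. -/
theorem structure_equation {y} (hy : y ∈ U) (w w') :
    formCurv (pull (connection G) F B) y w w' = frameCurv G (F y) (B y)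
      (fun k => pull (connection G) F B y w (mid k) 0)
      (fun k => pull (connection G) F B y w' (mid k) 0) := by
  rw [formCurv_pull (connection_linear G) (fun _ => connection_smooth hS.metric _) hS.isOpen
    hS.metric.isOpen hS.smooth hS.mapsTo hB.smooth (fun _ => hB.det_ne) hy w w', frameCurv,
    ← vel_eq hS hB hy, ← vel_eq hS hB hy]
  rfl

theorem firstOrderForm (h : ∀ y ∈ U, ∀ w, pull (connection G) F B y w 4 0 = 0) :
    FirstOrderForm (pull (connection G) F B) U where
  isOpen := hS.isOpen
  linear := pull_linear (connection_linear G)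
  smooth := moving_smooth hS hB
  skew := fun _ hy => moving_skew hS hB hy
  tangent := h
  injective := by
    intro y hy w h1 h2 h3
    refine hS.immersion y hy w ?_
    rw [vel_eq hS hB hy]
    have : (fun k => pull (connection G) F B y w (mid k) 0) = 0 := by
      ext k
      fin_cases k
      exacts [h1, h2, h3, h y hy w]
    rw [this, Matrix.mulVec_zero]
  cartan := by
    intro y hy w w'
    -- Exterior differentiation of ω^4 = 0. The curvature does not contribute because the connection
    -- has no torsion, and what remains is ω_1^3 ∧ ω^2 + ω_1^2 ∧ ω^3 = 0.
    have e := congrFun (congrFun (structure_equation hS hB hy w w') 4) 0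
    rw [(frameCurv_curvLike hS hB hy).col_zero] at e
    have d : ∀ v v', fderiv ℝ (fun z => pull (connection G) F B z v 4 0) y v' = 0 := by
      intro v v'
      rw [fderiv_eq_of_eqOn (v := fun _ => (0 : ℝ)) hS.isOpen (fun z hz => h z hz v) hy]
      simp
    have s := moving_skew hS hB hy w
    have s' := moving_skew hS hB hy w'
    rw [formCurv_apply, d, d, Fin.sum_univ_six] at e
    simp only [s.e41, s'.e41, s.e42, s'.e42, s.e43, s'.e43, h y hy, s.e50, s'.e50] at e
    linear_combination e

end Moving

/-! ### Second- and third-order coefficients -/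

section Coefficients
variable (Ω : (Fin 3 → ℝ) → (Fin 3 → ℝ) → Matrix (Fin 6) (Fin 6) ℝ)

/-- The matrix of the forms `ω^1, ω^2, ω^3`. -/
noncomputable def coframe (y : Fin 3 → ℝ) : Matrix (Fin 3) (Fin 3) ℝ :=
  Matrix.of fun k j => Ω y (Pi.single j 1) (mid k.castSucc) 0

/-- The tangent vectors dual to the forms `ω^1, ω^2, ω^3`. -/
noncomputable def eps (y : Fin 3 → ℝ) (k : Fin 3) : Fin 3 → ℝ := fun j => (coframe Ω y)⁻¹ j k

/-- Values on dual vectors; that they are all the coefficients of ω_1^3 and ω_1^2, with the mixed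
one shared, is Cartan's lemma in `coefficients`. Here `eps Ω y k` is dual to ω^{k+1}. -/
noncomputable def lam22 (y : Fin 3 → ℝ) : ℝ := Ω y (eps Ω y 1) 3 1
noncomputable def lam23 (y : Fin 3 → ℝ) : ℝ := Ω y (eps Ω y 1) 2 1
noncomputable def lam33 (y : Fin 3 → ℝ) : ℝ := Ω y (eps Ω y 2) 2 1

/-- The form `dh + h (ω_0^0 - 2 ω_2^2 - ω_1^1)`. -/
noncomputable def alpha22 (h : (Fin 3 → ℝ) → ℝ) (y w : Fin 3 → ℝ) : ℝ :=
  fderiv ℝ h y w + h y * (Ω y w 0 0 - 2 * Ω y w 2 2 - Ω y w 1 1)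

/-- The form `dh + h (ω_0^0 + 2 ω_2^2 - ω_1^1)`. -/
noncomputable def alpha33 (h : (Fin 3 → ℝ) → ℝ) (y w : Fin 3 → ℝ) : ℝ :=
  fderiv ℝ h y w + h y * (Ω y w 0 0 + 2 * Ω y w 2 2 - Ω y w 1 1)

/-- The coefficients `h_222, h_223, h_233, h_333`. -/
noncomputable def thirdCoeffs (y : Fin 3 → ℝ) : Fin 4 → ℝ :=
  ![alpha22 Ω (lam22 Ω) y (eps Ω y 1), alpha22 Ω (lam22 Ω) y (eps Ω y 2),
    alpha33 Ω (lam33 Ω) y (eps Ω y 1), alpha33 Ω (lam33 Ω) y (eps Ω y 2)]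

/-- For second-order frames this and `coeffB` are a_0 and b_0 by `third_structure`. Defining them
through derivatives of λ_22, λ_33 makes the transformation laws purely formal and keeps the
curvature out of the count of derivatives. -/
noncomputable def coeffA (y : Fin 3 → ℝ) : ℝ := -(1 / 2) * alpha22 Ω (lam22 Ω) y (eps Ω y 0)
noncomputable def coeffB (y : Fin 3 → ℝ) : ℝ := -(1 / 2) * alpha33 Ω (lam33 Ω) y (eps Ω y 0)

/-- The trace whose vanishing makes the vertex `A_4` harmonic. -/
noncomputable def rayTrace (y : Fin 3 → ℝ) : ℝ := Ω y (eps Ω y 1) 2 4 + Ω y (eps Ω y 2) 3 4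

end Coefficients

section FirstOrder
variable {Ω : (Fin 3 → ℝ) → (Fin 3 → ℝ) → Matrix (Fin 6) (Fin 6) ℝ} {U : Set (Fin 3 → ℝ)}
  (h : FirstOrderForm Ω U)
include h

namespace FirstOrderForm

theorem coframe_mulVec (y w) (k : Fin 3) : (coframe Ω y *ᵥ w) k = Ω y w (mid k.castSucc) 0 := by
  rw [h.linear y w]
  simp [Matrix.mulVec, dotProduct, coframe, Matrix.sum_apply, mul_comm]

theorem coframe_det_ne {y} (hy : y ∈ U) : (coframe Ω y).det ≠ 0 := by
  intro h0
  obtain ⟨w, hw, e⟩ := Matrix.exists_mulVec_eq_zero_iff.2 h0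
  refine hw (h.injective y hy w ?_ ?_ ?_)
  · rw [← show mid (Fin.castSucc 0) = 1 from rfl, ← h.coframe_mulVec, e]; rfl
  · rw [← show mid (Fin.castSucc 1) = 2 from rfl, ← h.coframe_mulVec, e]; rfl
  · rw [← show mid (Fin.castSucc 2) = 3 from rfl, ← h.coframe_mulVec, e]; rfl

theorem coframe_eps {y} (hy : y ∈ U) (k l : Fin 3) :
    Ω y (eps Ω y k) (mid l.castSucc) 0 = if l = k then 1 else 0 := by
  have := congrFun (congrFun (Matrix.mul_nonsing_inv (coframe Ω y)
    (isUnit_iff_ne_zero.2 (h.coframe_det_ne hy))) l) k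
  rw [← h.coframe_mulVec]
  simpa [Matrix.mul_apply, Matrix.mulVec, dotProduct, eps, Matrix.one_apply] using this

theorem eps_values {y} (hy : y ∈ U) :
    Ω y (eps Ω y 0) 1 0 = 1 ∧ Ω y (eps Ω y 0) 2 0 = 0 ∧ Ω y (eps Ω y 0) 3 0 = 0 ∧
    Ω y (eps Ω y 1) 1 0 = 0 ∧ Ω y (eps Ω y 1) 2 0 = 1 ∧ Ω y (eps Ω y 1) 3 0 = 0 ∧
    Ω y (eps Ω y 2) 1 0 = 0 ∧ Ω y (eps Ω y 2) 2 0 = 0 ∧ Ω y (eps Ω y 2) 3 0 = 1 :=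
  ⟨h.coframe_eps hy 0 0, h.coframe_eps hy 0 1, h.coframe_eps hy 0 2, h.coframe_eps hy 1 0,
    h.coframe_eps hy 1 1, h.coframe_eps hy 1 2, h.coframe_eps hy 2 0, h.coframe_eps hy 2 1,
    h.coframe_eps hy 2 2⟩

theorem map_add (y w w') : Ω y (w + w') = Ω y w + Ω y w' := by
  rw [h.linear, h.linear y w, h.linear y w', ← Finset.sum_add_distrib]
  exact Finset.sum_congr rfl fun k _ => by rw [Pi.add_apply, add_smul]

theorem map_smul (y) (r : ℝ) (w) : Ω y (r • w) = r • Ω y w := by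
  rw [h.linear, h.linear y w, Finset.smul_sum]
  exact Finset.sum_congr rfl fun k _ => by rw [Pi.smul_apply, smul_eq_mul, mul_smul]

theorem decompose {y} (hy : y ∈ U) (w) :
    w = Ω y w 1 0 • eps Ω y 0 + Ω y w 2 0 • eps Ω y 1 + Ω y w 3 0 • eps Ω y 2 := by
  obtain ⟨e1, e2, e3, e4, e5, e6, e7, e8, e9⟩ := h.eps_values hy
  rw [← sub_eq_zero, sub_eq_add_neg, ← neg_one_smul ℝ]
  apply h.injective y hy <;>
    simp only [h.map_add, h.map_smul, Matrix.add_apply, Matrix.smul_apply, smul_eq_mul,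
      e1, e2, e3, e4, e5, e6, e7, e8, e9] <;> ring

theorem expand {y} (hy : y ∈ U) (w) (a b) : Ω y w a b = Ω y w 1 0 * Ω y (eps Ω y 0) a b
    + Ω y w 2 0 * Ω y (eps Ω y 1) a b + Ω y w 3 0 * Ω y (eps Ω y 2) a b := by
  conv_lhs => rw [h.decompose hy w]
  simp [h.map_add, h.map_smul]

theorem expand_fderiv {y} (hy : y ∈ U) (g : (Fin 3 → ℝ) → ℝ) (w) : fderiv ℝ g y w
    = Ω y w 1 0 * fderiv ℝ g y (eps Ω y 0) + Ω y w 2 0 * fderiv ℝ g y (eps Ω y 1)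
      + Ω y w 3 0 * fderiv ℝ g y (eps Ω y 2) := by
  conv_lhs => rw [h.decompose hy w]
  simp

theorem expand_alpha22 {y} (hy : y ∈ U) (g : (Fin 3 → ℝ) → ℝ) (w) : alpha22 Ω g y w
    = Ω y w 1 0 * alpha22 Ω g y (eps Ω y 0) + Ω y w 2 0 * alpha22 Ω g y (eps Ω y 1)
      + Ω y w 3 0 * alpha22 Ω g y (eps Ω y 2) := by
  simp only [alpha22]
  rw [h.expand_fderiv hy g w, h.expand hy w 0 0, h.expand hy w 1 1, h.expand hy w 2 2]
  ring

theorem expand_alpha33 {y} (hy : y ∈ U) (g : (Fin 3 → ℝ) → ℝ) (w) : alpha33 Ω g y w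
    = Ω y w 1 0 * alpha33 Ω g y (eps Ω y 0) + Ω y w 2 0 * alpha33 Ω g y (eps Ω y 1)
      + Ω y w 3 0 * alpha33 Ω g y (eps Ω y 2) := by
  simp only [alpha33]
  rw [h.expand_fderiv hy g w, h.expand hy w 0 0, h.expand hy w 1 1, h.expand hy w 2 2]
  ring

/-- Cartan's lemma: the relation `cartan` on the three pairs of dual vectors removes the ω^1
components and equates the two mixed coefficients. -/
theorem coefficients {y} (hy : y ∈ U) (w) :
    Ω y w 3 1 = lam22 Ω y * Ω y w 2 0 + lam23 Ω y * Ω y w 3 0 ∧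
    Ω y w 2 1 = lam23 Ω y * Ω y w 2 0 + lam33 Ω y * Ω y w 3 0 := by
  obtain ⟨e1, e2, e3, e4, e5, e6, e7, e8, e9⟩ := h.eps_values hy
  have c1 := h.cartan y hy (eps Ω y 0) (eps Ω y 1)
  have c2 := h.cartan y hy (eps Ω y 0) (eps Ω y 2)
  have c3 := h.cartan y hy (eps Ω y 1) (eps Ω y 2)
  rw [e2, e3, e5, e6] at c1
  rw [e2, e3, e8, e9] at c2
  rw [e5, e6, e8, e9] at c3
  rw [h.expand hy w 3 1, h.expand hy w 2 1, lam22, lam23, lam33]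
  constructor
  · linear_combination Ω y w 1 0 * c1 - Ω y w 3 0 * c3
  · linear_combination Ω y w 1 0 * c2

theorem lam_unique {y} (hy : y ∈ U) {l22 l23 l33 : ℝ}
    (h1 : ∀ w, Ω y w 3 1 = l22 * Ω y w 2 0 + l23 * Ω y w 3 0)
    (h2 : ∀ w, Ω y w 2 1 = l23 * Ω y w 2 0 + l33 * Ω y w 3 0) :
    lam22 Ω y = l22 ∧ lam23 Ω y = l23 ∧ lam33 Ω y = l33 := by
  obtain ⟨e1, e2, e3, e4, e5, e6, e7, e8, e9⟩ := h.eps_values hy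
  refine ⟨?_, ?_, ?_⟩
  · rw [lam22, h1, e5, e6]; ring
  · rw [lam23, h2, e5, e6]; ring
  · rw [lam33, h2, e8, e9]; ring

theorem eps_smooth (k j) : ContDiffOn ℝ ∞ (fun y => eps Ω y k j) U := by
  have : MatSmoothOn (coframe Ω) U := fun a b => h.smooth (Pi.single b 1) (mid a.castSucc) 0
  exact this.inv (fun _ hy => h.coframe_det_ne hy) j k

theorem eval_eps_smooth (k) (a b) : ContDiffOn ℝ ∞ (fun y => Ω y (eps Ω y k) a b) U := by
  have : ∀ y, Ω y (eps Ω y k) a b = ∑ j, eps Ω y k j * Ω y (Pi.single j 1) a b := by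
    intro y; rw [h.linear]; simp [Matrix.sum_apply]
  simp only [this]
  exact ContDiffOn.sum fun j _ => (h.eps_smooth k j).mul (h.smooth _ a b)

theorem fderiv_eps_smooth {g : (Fin 3 → ℝ) → ℝ} (hg : ContDiffOn ℝ ∞ g U) (k) :
    ContDiffOn ℝ ∞ (fun y => fderiv ℝ g y (eps Ω y k)) U := by
  refine (hg.fderiv_of_isOpen h.isOpen (by simp)).clm_apply (contDiffOn_pi.2 fun j => ?_)
  exact h.eps_smooth k j

theorem lam22_smooth : ContDiffOn ℝ ∞ (lam22 Ω) U := h.eval_eps_smooth 1 3 1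
theorem lam23_smooth : ContDiffOn ℝ ∞ (lam23 Ω) U := h.eval_eps_smooth 1 2 1
theorem lam33_smooth : ContDiffOn ℝ ∞ (lam33 Ω) U := h.eval_eps_smooth 2 2 1

end FirstOrderForm
end FirstOrder

/-! ### The structure equations of second-order frames -/

/-- The classical pair symmetry: the cyclic identities led by the four indices are combined, and the
two skew symmetries cancel everything else. -/
theorem weylSymmetries {R : Fin 4 → Fin 4 → Fin 4 → Fin 4 → ℝ}
    (h1 : ∀ i j k l, R i j k l = -R j i k l) (h2 : ∀ i j k l, R i j k l = -R i j l k)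
    (h3 : ∀ i j k l, R i j k l + R i k l j + R i l j k = 0) (i j k l) : R i j k l = R k l i j := by
  have a1 := h3 i j k l
  have a2 := h3 j k l i
  have a3 := h3 k l i j
  have a4 := h3 l i j k
  have b1 := h1 j k l i; have b2 := h2 i j k l; have b3 := h1 k l i j; have b4 := h1 l i j k
  have c1 := h1 i j k l; have c2 := h2 k l i j; have c3 := h2 l i j k; have c4 := h2 j k l i
  have d1 := h1 j l i k; have d2 := h2 l j i k; have d3 := h1 k i j l; have d4 := h2 i k j l
  have f1 := h1 i l j k; have f2 := h2 l i j k; have f3 := h2 k j l i; have f4 := h1 j k l i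
  have g1 := h1 l j k i; have g2 := h2 l j k i; have g3 := h2 j l k i
  have g4 := h2 i k l j; have g5 := h1 i k l j; have g6 := h2 k i l j; have g7 := h1 k j i l
  have g8 := h1 l k i j; have g9 := h1 l k j i; have g10 := h2 l k i j; have g11 := h2 j i k l
  have g12 := h1 j i k l; have g13 := h2 j i l k; have g14 := h1 j i l k
  linarith

section SecondOrder
variable {G : (Fin 4 → ℝ) → Matrix (Fin 4) (Fin 4) ℝ} {V : Set (Fin 4 → ℝ)}
  {F : (Fin 3 → ℝ) → Fin 4 → ℝ} {U : Set (Fin 3 → ℝ)}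
  {B : (Fin 3 → ℝ) → Matrix (Fin 6) (Fin 6) ℝ}

/-- The components of the tensor of conformal curvature in the frame `B`. -/
noncomputable def frameWeyl (G : (Fin 4 → ℝ) → Matrix (Fin 4) (Fin 4) ℝ) (x : Fin 4 → ℝ)
    (B : Matrix (Fin 6) (Fin 6) ℝ) (i j k l : Fin 4) : ℝ :=
  ∑ m, isotropicGram i m * ((1 / 2) *
    frameCurv G x B (Pi.single k 1) (Pi.single l 1) (mid m) (mid j))

variable (hS : LocalSurface G V F U) (hB : LocalFrame G F U B)
include hS hB

/-- In an isotropic frame the trace condition pairs components related by the symmetries of the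
curvature tensor. Hence C_1213 vanishes, and C_1223, C_1323 are expressed through C_1214, C_1314; no
other curvature enters the equations of the hypersurface. -/
theorem frameCurv_relations {y} (hy : y ∈ U) (Z : Fin 4 → Fin 4 → Matrix (Fin 6) (Fin 6) ℝ)
    (hZ : ∀ k l, Z k l = frameCurv G (F y) (B y) (Pi.single k 1) (Pi.single l 1)) :
    Z 0 2 3 1 = 0 ∧ Z 0 1 2 1 = 0 ∧ Z 1 2 3 1 = -Z 0 3 3 1 ∧ Z 1 2 2 1 = Z 0 3 2 1 := by
  have hC := frameCurv_curvLike hS hB hy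
  have sk : ∀ k l, SkewForm (Z k l) := fun k l => by
    rw [hZ]; exact frameCurv_skew hS hB hy _ _
  have sw : ∀ k l, Z k l = -Z l k := fun k l => by rw [hZ, hZ]; exact hC.swap _ _
  have bi : ∀ k l j i, Z k l (mid i) (mid j) + Z l j (mid i) (mid k) + Z j k (mid i) (mid l) = 0 := by
    intro k l j i
    have := hC.bianchi (Pi.single k 1) (Pi.single l 1) (Pi.single j 1) i
    simpa [← hZ, Pi.single_apply] using this
  have ric : ∀ l j, ∑ i, Z i l (mid i) (mid j) = 0 := by
    intro l j
    have := hC.ricci (Pi.single l 1) j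
    simpa only [← hZ] using this
  -- The index is lowered so that the full symmetries of a curvature tensor become available.
  obtain ⟨R, hR⟩ : ∃ R : Fin 4 → Fin 4 → Fin 4 → Fin 4 → ℝ,
      ∀ i j k l, R i j k l = ∑ m, isotropicGram i m * Z k l (mid m) (mid j) := ⟨_, fun _ _ _ _ => rfl⟩
  have r0 : ∀ j k l, R 0 j k l = -Z k l 4 (mid j) := fun j k l => by
    rw [hR, Fin.sum_univ_four]; simp [isotropicGram]; rfl
  have r1 : ∀ j k l, R 1 j k l = Z k l 3 (mid j) := fun j k l => by
    rw [hR, Fin.sum_univ_four]; simp [isotropicGram]; rfl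
  have r2 : ∀ j k l, R 2 j k l = Z k l 2 (mid j) := fun j k l => by
    rw [hR, Fin.sum_univ_four]; simp [isotropicGram]; rfl
  have r3 : ∀ j k l, R 3 j k l = -Z k l 1 (mid j) := fun j k l => by
    rw [hR, Fin.sum_univ_four]; simp [isotropicGram]; rfl
  have m0 : mid 0 = 1 := rfl
  have m1 : mid 1 = 2 := rfl
  have m2 : mid 2 = 3 := rfl
  have m3 : mid 3 = 4 := rfl
  have h1 : ∀ i j k l, R i j k l = -R j i k l := by
    intro i j k l
    have s := sk k l
    fin_cases i <;> fin_cases j <;>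
      simp [r0, r1, r2, r3, m0, m1, m2, m3, s.e41, s.e42, s.e43, s.e44, s.e14, s.e23, s.e32, s.e33,
        s.e34, s.e24]
  have h2 : ∀ i j k l, R i j k l = -R i j l k := by
    intro i j k l
    rw [hR, hR, sw k l, ← Finset.sum_neg_distrib]
    exact Finset.sum_congr rfl fun m _ => by rw [Matrix.neg_apply, mul_neg]
  have h3 : ∀ i j k l, R i j k l + R i k l j + R i l j k = 0 := by
    intro i j k l
    rw [hR, hR, hR, ← Finset.sum_add_distrib, ← Finset.sum_add_distrib]
    refine Finset.sum_eq_zero fun m _ => ?_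
    rw [← mul_add, ← mul_add, bi, mul_zero]
  have hs := weylSymmetries h1 h2 h3
  have ric' : ∀ l j, -R 3 j 0 l + R 2 j 1 l + R 1 j 2 l - R 0 j 3 l = 0 := by
    intro l j
    have := ric l j
    rw [Fin.sum_univ_four, m0, m1, m2, m3] at this
    rw [r0, r1, r2, r3]
    linarith
  have z1 : ∀ k l, Z k l 3 1 = R 1 0 k l := fun k l => (r1 0 k l).symm
  have z2 : ∀ k l, Z k l 2 1 = R 2 0 k l := fun k l => (r2 0 k l).symm
  rw [z1, z1, z1, z2, z2, z2]
  refine ⟨?_, ?_, ?_, ?_⟩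
  · linarith [ric' 0 0, h2 3 0 0 0, h1 0 0 3 0, h1 2 0 1 0, h2 0 2 1 0, hs 0 2 0 1, h1 1 0 0 2,
      h2 1 0 2 0]
  · linarith [ric' 0 0, h2 3 0 0 0, h1 0 0 3 0, h1 2 0 1 0, h2 2 0 1 0, hs 0 2 0 1, h1 1 0 0 2,
      h2 1 0 2 0, h1 2 0 0 1]
  · linarith [ric' 1 0, h1 3 0 0 1, hs 0 3 0 1, h1 1 0 0 3, h2 2 0 1 1, h1 0 0 3 1, h2 1 0 2 1]
  · linarith [ric' 2 0, h1 3 0 0 2, hs 0 3 0 2, h1 2 0 0 3, h2 1 0 2 2, h1 0 0 3 2]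

variable {Ω : (Fin 3 → ℝ) → (Fin 3 → ℝ) → Matrix (Fin 6) (Fin 6) ℝ}
  (hΩ : pull (connection G) F B = Ω)
  (h1 : ∀ y ∈ U, ∀ w, Ω y w 4 0 = 0) (h2 : ∀ y ∈ U, lam23 Ω y = 0)
include hΩ h1 h2

/-- Exterior derivatives of ω_1^3 = λ_22 ω^2 and ω_1^2 = λ_33 ω^3, with dω^2 and dω^3 eliminated by
the torsion equations. The form `β` absorbs ω_1^0 together with the quadratic term λ_22 λ_33 ω^1. -/
theorem second_structure {y} (hy : y ∈ U) (w w') {β : (Fin 3 → ℝ) → ℝ}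
    (hβ : ∀ w, β w = Ω y w 0 1 - lam22 Ω y * lam33 Ω y * Ω y w 1 0) {Z}
    (hZ : frameCurv G (F y) (B y) (fun k => Ω y w (mid k) 0) (fun k => Ω y w' (mid k) 0) = Z) :
    alpha22 Ω (lam22 Ω) y w * Ω y w' 2 0 - alpha22 Ω (lam22 Ω) y w' * Ω y w 2 0
      + (Ω y w 3 0 * β w' - Ω y w' 3 0 * β w) = Z 3 1 ∧
    alpha33 Ω (lam33 Ω) y w * Ω y w' 3 0 - alpha33 Ω (lam33 Ω) y w' * Ω y w 3 0
      + (Ω y w 2 0 * β w' - Ω y w' 2 0 * β w) = Z 2 1 := by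
  have h : FirstOrderForm Ω U := by
    subst hΩ; exact firstOrderForm hS hB h1
  have e := structure_equation hS hB hy w w'
  rw [hΩ, hZ] at e
  have s : SkewForm (Ω y w) := h.skew y hy w
  have s' : SkewForm (Ω y w') := h.skew y hy w'
  have c22 : ∀ z ∈ U, ∀ v, Ω z v 3 1 = lam22 Ω z * Ω z v 2 0 := by
    intro z hz v
    rw [(h.coefficients hz v).1, h2 z hz]; ring
  have c33 : ∀ z ∈ U, ∀ v, Ω z v 2 1 = lam33 Ω z * Ω z v 3 0 := by
    intro z hz v
    rw [(h.coefficients hz v).2, h2 z hz]; ring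
  have d22 : ∀ v v', fderiv ℝ (fun z => Ω z v 3 1) y v' = fderiv ℝ (lam22 Ω) y v' * Ω y v 2 0
      + lam22 Ω y * fderiv ℝ (fun z => Ω z v 2 0) y v' := by
    intro v v'
    rw [fderiv_eq_of_eqOn h.isOpen (fun z hz => c22 z hz v) hy,
      fderiv_fun_mul (diffAt_of_smoothOn h.isOpen h.lam22_smooth hy)
        (diffAt_of_smoothOn h.isOpen (h.smooth v 2 0) hy)]
    simp; ring
  have d33 : ∀ v v', fderiv ℝ (fun z => Ω z v 2 1) y v' = fderiv ℝ (lam33 Ω) y v' * Ω y v 3 0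
      + lam33 Ω y * fderiv ℝ (fun z => Ω z v 3 0) y v' := by
    intro v v'
    rw [fderiv_eq_of_eqOn h.isOpen (fun z hz => c33 z hz v) hy,
      fderiv_fun_mul (diffAt_of_smoothOn h.isOpen h.lam33_smooth hy)
        (diffAt_of_smoothOn h.isOpen (h.smooth v 3 0) hy)]
    simp; ring
  have z0 : ∀ a, Z a 0 = 0 := hZ ▸ (frameCurv_curvLike hS hB hy).col_zero _ _
  have e20 := congrFun (congrFun e 2) 0
  have e30 := congrFun (congrFun e 3) 0
  have e31 := congrFun (congrFun e 3) 1
  have e21 := congrFun (congrFun e 2) 1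
  have t : Ω y w 4 0 = 0 := h1 y hy w
  have t' : Ω y w' 4 0 = 0 := h1 y hy w'
  rw [formCurv_apply, Fin.sum_univ_six] at e20 e30 e31 e21
  rw [z0] at e20 e30
  rw [d22, d22] at e31
  rw [d33, d33] at e21
  simp only [s.e23, s'.e23, s.e32, s'.e32, s.e50, s'.e50, s.e51, s'.e51, s.e41, s'.e41, t, t',
    s.e33, s'.e33, c22 y hy, c33 y hy] at e20 e30 e31 e21
  constructor
  · simp only [alpha22, hβ]
    linear_combination e31 - lam22 Ω y * e20
  · simp only [alpha33, hβ]
    linear_combination e21 - lam33 Ω y * e30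

/-- Cartan's lemma with curvature: the two second-order equations are evaluated on the three pairs
of dual vectors. They leave the four third-order coefficients free and determine the components of
ω_1^0 and the ω^1 components of the differentials of λ_22, λ_33. -/
theorem third_structure {y} (hy : y ∈ U) (w) :
    let C := frameWeyl G (F y) (B y)
    coeffA Ω y = C 0 1 0 1 ∧ coeffB Ω y = C 0 2 0 2 ∧
    alpha22 Ω (lam22 Ω) y w + 2 * C 0 1 0 1 * Ω y w 1 0
      = thirdCoeffs Ω y 0 * Ω y w 2 0 + thirdCoeffs Ω y 1 * Ω y w 3 0 ∧
    Ω y w 0 1 = lam22 Ω y * lam33 Ω y * Ω y w 1 0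
      - (thirdCoeffs Ω y 1 + 2 * C 0 1 0 3) * Ω y w 2 0
      - (thirdCoeffs Ω y 2 + 2 * C 0 2 0 3) * Ω y w 3 0 ∧
    alpha33 Ω (lam33 Ω) y w + 2 * C 0 2 0 2 * Ω y w 1 0
      = thirdCoeffs Ω y 2 * Ω y w 2 0 + thirdCoeffs Ω y 3 * Ω y w 3 0 := by
  intro C
  have h : FirstOrderForm Ω U := by
    subst hΩ; exact firstOrderForm hS hB h1
  obtain ⟨Z, hZ⟩ : ∃ Z : Fin 4 → Fin 4 → Matrix (Fin 6) (Fin 6) ℝ,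
    ∀ k l, Z k l = frameCurv G (F y) (B y) (Pi.single k 1) (Pi.single l 1) := ⟨_, fun _ _ => rfl⟩
  obtain ⟨z1, z2, z3, z4⟩ := frameCurv_relations hS hB hy Z hZ
  have sk : ∀ k l, SkewForm (Z k l) := fun k l => by
    rw [hZ]; exact frameCurv_skew hS hB hy _ _
  -- The half comes from summing the curvature form over all ordered pairs (k, l), and the sign from
  -- (A_1, A_4) = -1.
  have hC1 : ∀ k l, C 0 1 k l = -(1 / 2) * Z k l 3 1 := by
    intro k l
    simp only [C, frameWeyl, ← hZ]
    rw [Fin.sum_univ_four, ← (sk k l).e42]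
    simp [isotropicGram]; rfl
  have hC2 : ∀ k l, C 0 2 k l = -(1 / 2) * Z k l 2 1 := by
    intro k l
    simp only [C, frameWeyl, ← hZ]
    rw [Fin.sum_univ_four, ← (sk k l).e43]
    simp [isotropicGram]; rfl
  have he : ∀ k : Fin 3, (fun j => Ω y (eps Ω y k) (mid j) 0) = Pi.single k.castSucc (1 : ℝ) := by
    intro k
    ext j
    refine Fin.lastCases ?_ (fun j => ?_) j
    · rw [Pi.single_apply, if_neg (Fin.castSucc_lt_last k).ne']
      exact h1 y hy _
    · rw [h.coframe_eps hy, Pi.single_apply]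
      simp
  obtain ⟨e1, e2, e3, e4, e5, e6, e7, e8, e9⟩ := h.eps_values hy
  obtain ⟨β, hβ⟩ : ∃ β : (Fin 3 → ℝ) → ℝ,
    ∀ w, β w = Ω y w 0 1 - lam22 Ω y * lam33 Ω y * Ω y w 1 0 := ⟨_, fun _ => rfl⟩
  obtain ⟨p1, q1⟩ := second_structure hS hB hΩ h1 h2 hy (eps Ω y 0) (eps Ω y 1) hβ
    (Z := Z 0 1) (by rw [he, he, hZ]; rfl)
  obtain ⟨p2, q2⟩ := second_structure hS hB hΩ h1 h2 hy (eps Ω y 0) (eps Ω y 2) hβ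
    (Z := Z 0 2) (by rw [he, he, hZ]; rfl)
  obtain ⟨p3, q3⟩ := second_structure hS hB hΩ h1 h2 hy (eps Ω y 1) (eps Ω y 2) hβ
    (Z := Z 1 2) (by rw [he, he, hZ]; rfl)
  simp only [e1, e2, e3, e4, e5, e6, e7, e8, e9, z1, z2, z3, z4] at p1 p2 p3 q1 q2 q3
  have hβw : β w = Ω y w 1 0 * β (eps Ω y 0) + Ω y w 2 0 * β (eps Ω y 1)
      + Ω y w 3 0 * β (eps Ω y 2) := by
    simp only [hβ]
    rw [h.expand hy w 0 1, e1, e4, e7]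
    ring
  have t0 : thirdCoeffs Ω y 0 = alpha22 Ω (lam22 Ω) y (eps Ω y 1) := rfl
  have t1 : thirdCoeffs Ω y 1 = alpha22 Ω (lam22 Ω) y (eps Ω y 2) := rfl
  have t2 : thirdCoeffs Ω y 2 = alpha33 Ω (lam33 Ω) y (eps Ω y 1) := rfl
  have t3 : thirdCoeffs Ω y 3 = alpha33 Ω (lam33 Ω) y (eps Ω y 2) := rfl
  rw [hC1, hC2, hC1, hC2, t0, t1, t2, t3, h.expand_alpha22 hy _ w, h.expand_alpha33 hy _ w,
    coeffA, coeffB]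
  refine ⟨?_, ?_, ?_, ?_, ?_⟩
  · linear_combination -(1 / 2) * p1
  · linear_combination -(1 / 2) * q2
  · linear_combination Ω y w 1 0 * p1
  -- The vanishing components of the curvature leave ω_1^0 with ω^1 coefficient exactly λ_22 λ_33.
  · have b1 : β (eps Ω y 0) = 0 := by linarith
    have b2 : β (eps Ω y 1) = -alpha22 Ω (lam22 Ω) y (eps Ω y 2) + Z 0 3 3 1 := by linarith
    have b3 : β (eps Ω y 2) = -alpha33 Ω (lam33 Ω) y (eps Ω y 1) + Z 0 3 2 1 := by linarith
    rw [b1, b2, b3, hβ] at hβw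
    linear_combination hβw
  · linear_combination Ω y w 1 0 * q2

end SecondOrder
end CO22

namespace CO22

/-! ### Changes of frames -/

/-- The isometry of the isotropic frame that fixes `A_0` and adds to each of the vertices
`A_1, …, A_5` a combination of the preceding ones, without `A_2` entering into the third one. -/
def unipotent (p x₀ x₁ y₀ y₁ t : ℝ) : Matrix (Fin 6) (Fin 6) ℝ :=
  !![1, p, x₀, y₀, t, x₀ * y₀ - p * t;
     0, 1, x₁, y₁, x₁ * y₁, x₁ * y₀ + x₀ * y₁ - p * x₁ * y₁ - t;
     0, 0, 1, 0, y₁, y₀ - p * y₁;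
     0, 0, 0, 1, x₁, x₀ - p * x₁;
     0, 0, 0, 0, 1, -p;
     0, 0, 0, 0, 0, 1]

theorem unipotent_gram (p x₀ x₁ y₀ y₁ t : ℝ) : (unipotent p x₀ x₁ y₀ y₁ t)ᵀ * gramOf isotropicGram
    * unipotent p x₀ x₁ y₀ y₁ t = gramOf isotropicGram := by
  rw [gramOf_isotropicGram]
  ext a b
  fin_cases a <;> fin_cases b <;>
    simp [Matrix.mul_apply, Fin.sum_univ_six, unipotent] <;> ring

theorem rescaling_gram {k a b : ℝ} (hk : k ≠ 0) (ha : a ≠ 0) (hb : b ≠ 0) :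
    (rescaling k a b)ᵀ * gramOf isotropicGram * rescaling k a b = gramOf isotropicGram := by
  rw [gramOf_isotropicGram, rescaling, Matrix.diagonal_transpose]
  ext i j
  rw [Matrix.mul_diagonal, Matrix.diagonal_mul]
  fin_cases i <;> fin_cases j <;> simp [hk, ha, hb]

theorem unipotent_mid_det (p x₀ x₁ y₀ y₁ t : ℝ) :
    (Matrix.of fun i j : Fin 4 => unipotent p x₀ x₁ y₀ y₁ t (mid i) (mid j)).det = 1 := by
  rw [Matrix.det_of_isUpperTriangular, Fin.prod_univ_four]
  · simp [unipotent, mid]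
  · intro i j hij
    fin_cases i <;> fin_cases j <;> simp [unipotent, mid] at hij ⊢

theorem rescaling_mid_det {k a b : ℝ} (ha : a ≠ 0) (hb : b ≠ 0) :
    (Matrix.of fun i j : Fin 4 => rescaling k a b (mid i) (mid j)).det = 1 := by
  have : (Matrix.of fun i j : Fin 4 => rescaling k a b (mid i) (mid j))
      = Matrix.diagonal ![a, b, b⁻¹, a⁻¹] := by
    ext i j
    fin_cases i <;> fin_cases j <;> simp [rescaling, mid]
  rw [this, Matrix.det_diagonal, Fin.prod_univ_four]
  simp
  field_simp

section FrameChange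
variable {G : (Fin 4 → ℝ) → Matrix (Fin 4) (Fin 4) ℝ} {F : (Fin 3 → ℝ) → Fin 4 → ℝ}
  {U : Set (Fin 3 → ℝ)} {B R : (Fin 3 → ℝ) → Matrix (Fin 6) (Fin 6) ℝ}

theorem LocalFrame.mul (hB : LocalFrame G F U B) (hR : MatSmoothOn R U)
    (h0 : ∀ y ∈ U, ∀ a, a ≠ 0 → R y a 0 = 0) (h5 : ∀ y ∈ U, ∀ j, R y 5 (mid j) = 0)
    (hg : ∀ y ∈ U, (R y)ᵀ * gramOf isotropicGram * R y = gramOf isotropicGram)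
    (hd : ∀ y ∈ U, 0 < (Matrix.of fun i j : Fin 4 => R y (mid i) (mid j)).det) :
    LocalFrame G F U (fun y => B y * R y) := by
  refine ⟨hB.smooth.mul hR, fun y hy a ha => ?_, fun y hy => ?_, fun y hy => ?_⟩
  · rw [mul_six, hB.vertex y hy a ha, h0 y hy 5 (by decide)]
    simp [h0 y hy _ (mid_ne_zero _)]
  · have := hg y hy
    rw [← hB.gram y hy] at this ⊢
    rw [← this, hB.gram y hy, ← hB.gram y hy]
    simp only [Matrix.transpose_mul, mul_assoc]
  · have e : (Matrix.of fun i j : Fin 4 => (B y * R y) (mid i) (mid j))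
        = (Matrix.of fun i j : Fin 4 => B y (mid i) (mid j))
          * Matrix.of fun i j : Fin 4 => R y (mid i) (mid j) := by
      ext i j
      rw [Matrix.of_apply, mul_six, hB.vertex y hy _ (mid_ne_zero i), h5 y hy, Matrix.mul_apply]
      simp
    rw [e, Matrix.det_mul]
    exact mul_pos (hB.oriented y hy) (hd y hy)

theorem unipotent_smooth {p x₀ x₁ y₀ y₁ t : (Fin 3 → ℝ) → ℝ} (hp : ContDiffOn ℝ ∞ p U)
    (hx₀ : ContDiffOn ℝ ∞ x₀ U) (hx₁ : ContDiffOn ℝ ∞ x₁ U) (hy₀ : ContDiffOn ℝ ∞ y₀ U)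
    (hy₁ : ContDiffOn ℝ ∞ y₁ U) (ht : ContDiffOn ℝ ∞ t U) :
    MatSmoothOn (fun z => unipotent (p z) (x₀ z) (x₁ z) (y₀ z) (y₁ z) (t z)) U := by
  intro a b
  fin_cases a <;> fin_cases b <;> simp [unipotent] <;> fun_prop

theorem rescaling_smooth {k a b : (Fin 3 → ℝ) → ℝ} (hk : ContDiffOn ℝ ∞ k U)
    (ha : ContDiffOn ℝ ∞ a U) (hb : ContDiffOn ℝ ∞ b U) (hk0 : ∀ y ∈ U, k y ≠ 0)
    (ha0 : ∀ y ∈ U, a y ≠ 0) (hb0 : ∀ y ∈ U, b y ≠ 0) :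
    MatSmoothOn (fun z => rescaling (k z) (a z) (b z)) U := by
  intro i j
  have hk' := hk.inv hk0
  have ha' := ha.inv ha0
  have hb' := hb.inv hb0
  fin_cases i <;> fin_cases j <;> simp [rescaling] <;> first | assumption | exact contDiffOn_const

theorem LocalFrame.mul_unipotent (hB : LocalFrame G F U B) {p x₀ x₁ y₀ y₁ t : (Fin 3 → ℝ) → ℝ}
    (hp : ContDiffOn ℝ ∞ p U)
    (hx₀ : ContDiffOn ℝ ∞ x₀ U) (hx₁ : ContDiffOn ℝ ∞ x₁ U) (hy₀ : ContDiffOn ℝ ∞ y₀ U)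
    (hy₁ : ContDiffOn ℝ ∞ y₁ U) (ht : ContDiffOn ℝ ∞ t U) : LocalFrame G F U
    (fun z => B z * unipotent (p z) (x₀ z) (x₁ z) (y₀ z) (y₁ z) (t z)) := by
  refine hB.mul (unipotent_smooth hp hx₀ hx₁ hy₀ hy₁ ht) (fun y _ a => ?_) (fun y _ j => ?_)
    (fun y _ => unipotent_gram _ _ _ _ _ _) fun y _ => by rw [unipotent_mid_det]; exact one_pos
  · fin_cases a <;> simp [unipotent]
  · fin_cases j <;> simp [unipotent, mid]

theorem LocalFrame.mul_rescaling (hB : LocalFrame G F U B) {k a b : (Fin 3 → ℝ) → ℝ}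
    (hk : ContDiffOn ℝ ∞ k U)
    (ha : ContDiffOn ℝ ∞ a U) (hb : ContDiffOn ℝ ∞ b U) (hk0 : ∀ y ∈ U, k y ≠ 0)
    (ha0 : ∀ y ∈ U, a y ≠ 0) (hb0 : ∀ y ∈ U, b y ≠ 0) : LocalFrame G F U
    (fun z => B z * rescaling (k z) (a z) (b z)) := by
  refine hB.mul (rescaling_smooth hk ha hb hk0 ha0 hb0) (fun y _ i hi => ?_) (fun y _ j => ?_)
    (fun y hy => rescaling_gram (hk0 y hy) (ha0 y hy) (hb0 y hy)) fun y hy => by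
      rw [rescaling_mid_det (ha0 y hy) (hb0 y hy)]; exact one_pos
  · rw [rescaling, Matrix.diagonal_apply_ne _ hi]
  · rw [rescaling, Matrix.diagonal_apply_ne _ (five_ne_mid j)]

end FrameChange

/-! ### Transformation laws of the coefficients under unipotent changes of frame and rescalings -/

section Laws
variable {Ω Ω' : (Fin 3 → ℝ) → (Fin 3 → ℝ) → Matrix (Fin 6) (Fin 6) ℝ} {U : Set (Fin 3 → ℝ)}

theorem FirstOrderForm.eps_unique (h : FirstOrderForm Ω U) {y} (hy : y ∈ U) {v} {k : Fin 3}
    (hv : ∀ l, Ω y v (mid (Fin.castSucc l)) 0 = if l = k then 1 else 0) : eps Ω y k = v := by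
  rw [h.decompose hy v]
  have h0 : Ω y v 1 0 = _ := hv 0
  have h1 : Ω y v 2 0 = _ := hv 1
  have h2 : Ω y v 3 0 = _ := hv 2
  rw [h0, h1, h2]
  fin_cases k <;> simp

/-- The matrix of the linear system for the fiber parameters of second-order frames. -/
def fiberMatrix (h22 h33 a0 b0 : ℝ) : Matrix (Fin 4) (Fin 4) ℝ :=
  !![3 * h22, 2 * a0, 0, -3 * h22 ^ 2;
     0, h22 * h33, -h22, 2 * a0;
     -h33, 2 * b0, 0, h22 * h33;
     0, -3 * h33 ^ 2, 3 * h33, 2 * b0]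

section Unipotent
variable (h : FirstOrderForm Ω U) (h' : FirstOrderForm Ω' U) {p x₀ x₁ y₀ y₁ t : (Fin 3 → ℝ) → ℝ}
  (hlaw : ∀ y ∈ U, ∀ w, unipotent (p y) (x₀ y) (x₁ y) (y₀ y) (y₁ y) (t y) * Ω' y w
    = matDeriv (fun z => unipotent (p z) (x₀ z) (x₁ z) (y₀ z) (y₁ z) (t z)) y w
      + Ω y w * unipotent (p y) (x₀ y) (x₁ y) (y₀ y) (y₁ y) (t y))
include h h' hlaw

/-- These entries lie below the diagonal, where the derivative of the triangular matrix vanishes, so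
the change is algebraic. -/
theorem unipotent_coframe {y} (hy : y ∈ U) (w) :
    Ω' y w 1 0 = Ω y w 1 0 - x₁ y * Ω y w 2 0 - y₁ y * Ω y w 3 0 ∧
    Ω' y w 2 0 = Ω y w 2 0 ∧ Ω' y w 3 0 = Ω y w 3 0 ∧
    Ω' y w 3 1 = Ω y w 3 1 + p y * Ω y w 3 0 ∧
    Ω' y w 2 1 = Ω y w 2 1 + p y * Ω y w 2 0 := by
  have e : ∀ a b, _ := fun a b => congrFun (congrFun (hlaw y hy w) a) b
  simp only [Matrix.add_apply, Matrix.mul_apply, Fin.sum_univ_six, matDeriv, Matrix.of_apply] at e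
  have s := h.skew y hy w
  have s' := h'.skew y hy w
  have t0 := h.tangent y hy w
  have t' := h'.tangent y hy w
  have e10 := e 1 0
  have e20 := e 2 0
  have e30 := e 3 0
  have e31 := e 3 1
  have e21 := e 2 1
  simp [unipotent, s.e50, s'.e50, t0, t', s.e51, s'.e51, s.e41, s'.e41] at e10 e20 e30 e31 e21
  rw [e20, e30] at e10
  refine ⟨?_, e20, e30, ?_, ?_⟩ <;> linarith

/-- Adding p A_0 to A_1 adds p ω^3 to ω_1^3 and p ω^2 to ω_1^2, which affects the mixed coefficient
only. -/
theorem unipotent_lam {y} (hy : y ∈ U) :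
    lam22 Ω' y = lam22 Ω y ∧ lam23 Ω' y = lam23 Ω y + p y ∧ lam33 Ω' y = lam33 Ω y := by
  refine h'.lam_unique hy (fun w => ?_) (fun w => ?_) <;>
    obtain ⟨-, e2, e3, e4, e5⟩ := unipotent_coframe h h' hlaw hy w
  · rw [e4, e2, e3, (h.coefficients hy w).1]; ring
  · rw [e5, e2, e3, (h.coefficients hy w).2]; ring

theorem unipotent_eps {y} (hy : y ∈ U) : eps Ω' y 0 = eps Ω y 0 ∧
    eps Ω' y 1 = eps Ω y 1 + x₁ y • eps Ω y 0 ∧ eps Ω' y 2 = eps Ω y 2 + y₁ y • eps Ω y 0 := by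
  obtain ⟨e1, e2, e3, e4, e5, e6, e7, e8, e9⟩ := h.eps_values hy
  refine ⟨h'.eps_unique hy fun l => ?_, h'.eps_unique hy fun l => ?_,
    h'.eps_unique hy fun l => ?_⟩
  all_goals
    fin_cases l
    · refine (unipotent_coframe h h' hlaw hy _).1.trans ?_
      simp [h.map_add, h.map_smul, e1, e2, e3, e4, e5, e6, e7, e8, e9]
    · refine (unipotent_coframe h h' hlaw hy _).2.1.trans ?_
      simp [h.map_add, h.map_smul, e1, e2, e3, e4, e5, e6, e7, e8, e9]
    · refine (unipotent_coframe h h' hlaw hy _).2.2.1.trans ?_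
      simp [h.map_add, h.map_smul, e1, e2, e3, e4, e5, e6, e7, e8, e9]

/-- The differentials of λ_22 and λ_33 are unchanged, and the diagonal forms change without
derivatives of the parameters because the diagonal of the change of frame is constant. -/
theorem unipotent_alpha (h23 : ∀ y ∈ U, lam23 Ω y = 0) (hp : ∀ y ∈ U, p y = 0) {y} (hy : y ∈ U)
    (w) :
    alpha22 Ω' (lam22 Ω') y w = alpha22 Ω (lam22 Ω) y w
      + lam22 Ω y * ((3 * y₁ y * lam22 Ω y - 3 * x₀ y) * Ω y w 2 0
        + (y₀ y - x₁ y * lam33 Ω y) * Ω y w 3 0) ∧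
    alpha33 Ω' (lam33 Ω') y w = alpha33 Ω (lam33 Ω) y w
      + lam33 Ω y * ((x₀ y - y₁ y * lam22 Ω y) * Ω y w 2 0
        + (3 * x₁ y * lam33 Ω y - 3 * y₀ y) * Ω y w 3 0) := by
  have e : ∀ a b, _ := fun a b => congrFun (congrFun (hlaw y hy w) a) b
  simp only [Matrix.add_apply, Matrix.mul_apply, Fin.sum_univ_six, matDeriv, Matrix.of_apply] at e
  have s := h.skew y hy w
  have s' := h'.skew y hy w
  have t0 := h.tangent y hy w
  have t' := h'.tangent y hy w
  obtain ⟨c1, c2, c3, c4, c5⟩ := unipotent_coframe h h' hlaw hy w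
  have d31 := (h.coefficients hy w).1
  have d21 := (h.coefficients hy w).2
  rw [h23 y hy] at d31 d21
  have e00 := e 0 0
  have e11 := e 1 1
  have e22 := e 2 2
  simp [unipotent, s.e50, s'.e50, t0, t', s.e51, s'.e51, s.e41, s'.e41, s.e52, s'.e52, s.e42,
    s'.e42, s'.e32, hp y hy, c2, c3, c4, c5] at e00 e11 e22
  have f22 := fderiv_eq_of_eqOn h.isOpen (fun z hz => (unipotent_lam h h' hlaw hz).1) hy
  have f33 := fderiv_eq_of_eqOn h.isOpen (fun z hz => (unipotent_lam h h' hlaw hz).2.2) hy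
  simp only [alpha22, alpha33, f22, f33, (unipotent_lam h h' hlaw hy).1,
    (unipotent_lam h h' hlaw hy).2.2]
  rw [d31, d21] at e11 e22
  constructor
  · linear_combination lam22 Ω y * (e00 - 2 * e22 - e11)
  · linear_combination lam33 Ω y * (e00 + 2 * e22 - e11)

/-- Besides the change of the two forms, the dual vectors tilt by x₁ and y₁ multiples of the
isotropic one. The values of the forms there are -2a_0 and -2b_0, which is how the curvature enters
the matrix. -/
theorem unipotent_third (h23 : ∀ y ∈ U, lam23 Ω y = 0) (hp : ∀ y ∈ U, p y = 0) {y} (hy : y ∈ U) :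
    coeffA Ω' y = coeffA Ω y ∧ coeffB Ω' y = coeffB Ω y ∧
    thirdCoeffs Ω' y = thirdCoeffs Ω y
      - fiberMatrix (lam22 Ω y) (lam33 Ω y) (coeffA Ω y) (coeffB Ω y) *ᵥ
        ![x₀ y, x₁ y, y₀ y, y₁ y] := by
  obtain ⟨e1, e2, e3, e4, e5, e6, e7, e8, e9⟩ := h.eps_values hy
  obtain ⟨p0, p1, p2⟩ := unipotent_eps h h' hlaw hy
  have ha := fun w => unipotent_alpha h h' hlaw h23 hp hy w
  have hx := h.expand_alpha22 hy (lam22 Ω)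
  have hx' := h.expand_alpha33 hy (lam33 Ω)
  refine ⟨?_, ?_, ?_⟩
  · rw [coeffA, coeffA, (ha _).1, p0, e2, e3]; ring
  · rw [coeffB, coeffB, (ha _).2, p0, e2, e3]; ring
  · ext i
    simp only [thirdCoeffs, (ha _).1, (ha _).2, p1, p2, Pi.sub_apply]
    rw [hx (_ + _), hx (_ + _), hx' (_ + _), hx' (_ + _)]
    fin_cases i <;>
      simp [fiberMatrix, Matrix.mulVec, dotProduct, Fin.sum_univ_four, h.map_add, h.map_smul,
        e1, e2, e3, e4, e5, e6, e7, e8, e9, coeffA, coeffB] <;> ring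

/-- When t is the only parameter left, A_4 is shifted by t A_0, which adds tω^2 and tω^3 to ω_4^2
and ω_4^3. -/
theorem unipotent_trace (hp : ∀ y ∈ U, p y = 0) (hx₀ : ∀ y ∈ U, x₀ y = 0)
    (hx₁ : ∀ y ∈ U, x₁ y = 0) (hy₀ : ∀ y ∈ U, y₀ y = 0) (hy₁ : ∀ y ∈ U, y₁ y = 0) {y} (hy : y ∈ U) :
    rayTrace Ω' y = rayTrace Ω y + 2 * t y := by
  have key : ∀ w, Ω' y w 2 4 = Ω y w 2 4 + t y * Ω y w 2 0 ∧
      Ω' y w 3 4 = Ω y w 3 4 + t y * Ω y w 3 0 := by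
    intro w
    have e : ∀ a b, _ := fun a b => congrFun (congrFun (hlaw y hy w) a) b
    simp only [Matrix.add_apply, Matrix.mul_apply, Fin.sum_univ_six, matDeriv, Matrix.of_apply] at e
    have d : fderiv ℝ y₁ y = 0 := by
      rw [fderiv_eq_of_eqOn h.isOpen hy₁ hy]; simp
    have d' : fderiv ℝ x₁ y = 0 := by
      rw [fderiv_eq_of_eqOn h.isOpen hx₁ hy]; simp
    have e24 := e 2 4
    have e34 := e 3 4
    simp [unipotent, hp y hy, hx₀ y hy, hx₁ y hy, hy₀ y hy, hy₁ y hy, d, d'] at e24 e34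
    constructor <;> linarith
  obtain ⟨p0, p1, p2⟩ := unipotent_eps h h' hlaw hy
  obtain ⟨e1, e2, e3, e4, e5, e6, e7, e8, e9⟩ := h.eps_values hy
  rw [rayTrace, rayTrace, (key _).1, (key _).2, p1, p2, hx₁ y hy, hy₁ y hy]
  simp only [zero_smul, add_zero, e5, e9]
  ring

end Unipotent

section Rescaling
variable (h : FirstOrderForm Ω U) (h' : FirstOrderForm Ω' U) {k a b : (Fin 3 → ℝ) → ℝ}
  (hk : ContDiffOn ℝ ∞ k U)
  (ha : ContDiffOn ℝ ∞ a U) (hb : ContDiffOn ℝ ∞ b U) (hk0 : ∀ y ∈ U, k y ≠ 0)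
  (ha0 : ∀ y ∈ U, a y ≠ 0) (hb0 : ∀ y ∈ U, b y ≠ 0)
  (hlaw : ∀ y ∈ U, ∀ w, rescaling (k y) (a y) (b y) * Ω' y w
    = matDeriv (fun z => rescaling (k z) (a z) (b z)) y w + Ω y w * rescaling (k y) (a y) (b y))
include h h' hk ha hb hk0 ha0 hb0 hlaw

theorem rescaling_entries {y} (hy : y ∈ U) (w) :
    Ω' y w 1 0 = k y / a y * Ω y w 1 0 ∧ Ω' y w 2 0 = k y / b y * Ω y w 2 0 ∧
    Ω' y w 3 0 = k y * b y * Ω y w 3 0 ∧ Ω' y w 3 1 = a y * b y * Ω y w 3 1 ∧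
    Ω' y w 2 1 = a y / b y * Ω y w 2 1 ∧ Ω' y w 2 4 = Ω y w 2 4 / (a y * b y) ∧
    Ω' y w 3 4 = b y / a y * Ω y w 3 4 ∧
    k y * Ω' y w 0 0 = fderiv ℝ k y w + k y * Ω y w 0 0 ∧
    a y * Ω' y w 1 1 = fderiv ℝ a y w + a y * Ω y w 1 1 ∧
    b y * Ω' y w 2 2 = fderiv ℝ b y w + b y * Ω y w 2 2 := by
  have hk1 := hk0 y hy
  have ha1 := ha0 y hy
  have hb1 := hb0 y hy
  have e : ∀ i j, (![k y, a y, b y, (b y)⁻¹, (a y)⁻¹, (k y)⁻¹] : Fin 6 → ℝ) i * Ω' y w i j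
      = matDeriv (fun z => rescaling (k z) (a z) (b z)) y w i j
        + Ω y w i j * (![k y, a y, b y, (b y)⁻¹, (a y)⁻¹, (k y)⁻¹] : Fin 6 → ℝ) j := by
    intro i j
    have := congrFun (congrFun (hlaw y hy w) i) j
    rw [Matrix.add_apply, rescaling, Matrix.mul_diagonal, Matrix.diagonal_mul] at this
    exact this
  simp only [matDeriv, Matrix.of_apply] at e
  have e10 := e 1 0
  have e20 := e 2 0
  have e30 := e 3 0
  have e31 := e 3 1
  have e21 := e 2 1
  have e24 := e 2 4
  have e34 := e 3 4
  have e00 := e 0 0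
  have e11 := e 1 1
  have e22 := e 2 2
  simp [rescaling] at e10 e20 e30 e31 e21 e24 e34 e00 e11 e22
  refine ⟨?_, ?_, ?_, ?_, ?_, ?_, ?_, ?_, ?_, ?_⟩
  · field_simp; linarith
  · field_simp; linarith
  · field_simp at e30; linarith
  · field_simp at e31; linarith
  · field_simp; linarith
  · field_simp at e24 ⊢; linarith
  · field_simp at e34 ⊢; linarith
  · linarith
  · linarith
  · linarith

theorem rescaling_lam {y} (hy : y ∈ U) :
    lam22 Ω' y = a y * b y ^ 2 / k y * lam22 Ω y ∧ lam23 Ω' y = a y / k y * lam23 Ω y ∧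
    lam33 Ω' y = a y / (b y ^ 2 * k y) * lam33 Ω y := by
  have hk1 := hk0 y hy
  have ha1 := ha0 y hy
  have hb1 := hb0 y hy
  refine h'.lam_unique hy (fun w => ?_) (fun w => ?_) <;>
    obtain ⟨-, e2, e3, e4, e5, -⟩ := rescaling_entries h h' hk ha hb hk0 ha0 hb0 hlaw hy w
  · rw [e4, e2, e3, (h.coefficients hy w).1]; field_simp
  · rw [e5, e2, e3, (h.coefficients hy w).2]; field_simp

theorem rescaling_eps {y} (hy : y ∈ U) :
    eps Ω' y 1 = (b y / k y) • eps Ω y 1 ∧ eps Ω' y 2 = (b y * k y)⁻¹ • eps Ω y 2 := by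
  have hk1 := hk0 y hy
  have ha1 := ha0 y hy
  have hb1 := hb0 y hy
  obtain ⟨e1, e2, e3, e4, e5, e6, e7, e8, e9⟩ := h.eps_values hy
  refine ⟨h'.eps_unique hy fun l => ?_, h'.eps_unique hy fun l => ?_⟩
  all_goals
    fin_cases l
    · refine (rescaling_entries h h' hk ha hb hk0 ha0 hb0 hlaw hy _).1.trans ?_
      simp [h.map_smul, e4, e5, e6, e7, e8, e9]
    · refine (rescaling_entries h h' hk ha hb hk0 ha0 hb0 hlaw hy _).2.1.trans ?_
      simp [h.map_smul, e4, e5, e6, e7, e8, e9] <;> field_simp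
    · refine (rescaling_entries h h' hk ha hb hk0 ha0 hb0 hlaw hy _).2.2.1.trans ?_
      simp [h.map_smul, e4, e5, e6, e7, e8, e9] <;> field_simp

theorem rescaling_trace {y} (hy : y ∈ U) : rayTrace Ω' y = rayTrace Ω y / (a y * k y) := by
  have hk1 := hk0 y hy
  have ha1 := ha0 y hy
  have hb1 := hb0 y hy
  obtain ⟨p1, p2⟩ := rescaling_eps h h' hk ha hb hk0 ha0 hb0 hlaw hy
  have e := fun w => rescaling_entries h h' hk ha hb hk0 ha0 hb0 hlaw hy w
  rw [rayTrace, rayTrace, (e _).2.2.2.2.2.1, (e _).2.2.2.2.2.2.1, p1, p2, h.map_smul, h.map_smul]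
  simp only [Matrix.smul_apply, smul_eq_mul]
  field_simp

/-- The forms are covariant differentials: the logarithmic derivatives of k, a, b in the diagonal
forms exactly compensate the derivative of the weight of λ_22 or λ_33. -/
theorem rescaling_alpha {y} (hy : y ∈ U) (w) :
    alpha22 Ω' (lam22 Ω') y w = a y * b y ^ 2 / k y * alpha22 Ω (lam22 Ω) y w ∧
    alpha33 Ω' (lam33 Ω') y w = a y / (b y ^ 2 * k y) * alpha33 Ω (lam33 Ω) y w := by
  have hk1 := hk0 y hy
  have ha1 := ha0 y hy
  have hb1 := hb0 y hy
  obtain ⟨-, -, -, -, -, -, -, e00, e11, e22⟩ :=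
    rescaling_entries h h' hk ha hb hk0 ha0 hb0 hlaw hy w
  have l := fun {z} (hz : z ∈ U) => rescaling_lam h h' hk ha hb hk0 ha0 hb0 hlaw hz
  have dk := diffAt_of_smoothOn h.isOpen hk hy
  have da := diffAt_of_smoothOn h.isOpen ha hy
  have db := diffAt_of_smoothOn h.isOpen hb hy
  have d22 := diffAt_of_smoothOn h.isOpen h.lam22_smooth hy
  have d33 := diffAt_of_smoothOn h.isOpen h.lam33_smooth hy
  have d22' := diffAt_of_smoothOn h.isOpen h'.lam22_smooth hy
  have d33' := diffAt_of_smoothOn h.isOpen h'.lam33_smooth hy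
  -- The transformation law is cleared of denominators before differentiation, so that only product
  -- rules are needed.
  have f22 := congrArg (fun L => L w) (fderiv_eq_of_eqOn h.isOpen
    (u := fun z => k z * lam22 Ω' z) (v := fun z => a z * (b z * b z) * lam22 Ω z)
    (fun z hz => by rw [(l hz).1]; have := hk0 z hz; field_simp) hy)
  have f33 := congrArg (fun L => L w) (fderiv_eq_of_eqOn h.isOpen
    (u := fun z => k z * (b z * b z) * lam33 Ω' z) (v := fun z => a z * lam33 Ω z)
    (fun z hz => by rw [(l hz).2.2]; have := hk0 z hz; have := hb0 z hz; field_simp) hy)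
  rw [fderiv_fun_mul dk d22', fderiv_fun_mul (da.fun_mul (db.fun_mul db)) d22,
    fderiv_fun_mul da (db.fun_mul db), fderiv_fun_mul db db] at f22
  rw [fderiv_fun_mul (dk.fun_mul (db.fun_mul db)) d33', fderiv_fun_mul da d33,
    fderiv_fun_mul dk (db.fun_mul db), fderiv_fun_mul db db] at f33
  simp at f22 f33
  rw [(l hy).1] at f22
  rw [(l hy).2.2] at f33
  have g0 : Ω' y w 0 0 = fderiv ℝ k y w / k y + Ω y w 0 0 := by field_simp; linarith
  have g1 : Ω' y w 1 1 = fderiv ℝ a y w / a y + Ω y w 1 1 := by field_simp; linarith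
  have g2 : Ω' y w 2 2 = fderiv ℝ b y w / b y + Ω y w 2 2 := by field_simp; linarith
  simp only [alpha22, alpha33, (l hy).1, (l hy).2.2, g0, g1, g2]
  constructor
  · field_simp at f22 ⊢
    linear_combination f22
  · field_simp at f33 ⊢
    linear_combination f33

theorem rescaling_third {y} (hy : y ∈ U) (h0 : thirdCoeffs Ω y = 0) : thirdCoeffs Ω' y = 0 := by
  have t0 : alpha22 Ω (lam22 Ω) y (eps Ω y 1) = 0 := congrFun h0 0
  have t1 : alpha22 Ω (lam22 Ω) y (eps Ω y 2) = 0 := congrFun h0 1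
  have t2 : alpha33 Ω (lam33 Ω) y (eps Ω y 1) = 0 := congrFun h0 2
  have t3 : alpha33 Ω (lam33 Ω) y (eps Ω y 2) = 0 := congrFun h0 3
  obtain ⟨p1, p2⟩ := rescaling_eps h h' hk ha hb hk0 ha0 hb0 hlaw hy
  have e := fun w => rescaling_alpha h h' hk ha hb hk0 ha0 hb0 hlaw hy w
  obtain ⟨e1, e2, e3, e4, e5, e6, e7, e8, e9⟩ := h.eps_values hy
  ext i
  simp only [thirdCoeffs, (e _).1, (e _).2, p1, p2]
  rw [h.expand_alpha22 hy _ (_ • eps Ω y 1), h.expand_alpha22 hy _ (_ • eps Ω y 2),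
    h.expand_alpha33 hy _ (_ • eps Ω y 1), h.expand_alpha33 hy _ (_ • eps Ω y 2)]
  fin_cases i <;> simp [h.map_smul, e4, e5, e6, e7, e8, e9, t0, t1, t2, t3]

end Rescaling
end Laws

/-! ### Uniqueness of canonical frames in local coordinates -/

theorem gram_col {m : Matrix (Fin 6) (Fin 6) ℝ}
    (hg : mᵀ * gramOf isotropicGram * m = gramOf isotropicGram) (a b : Fin 6) :
    -(m 0 a * m 5 b) - m 5 a * m 0 b - m 1 a * m 4 b - m 4 a * m 1 b + m 2 a * m 3 b
      + m 3 a * m 2 b = !![0, 0, 0, 0, 0, -1; 0, 0, 0, 0, -1, 0; 0, 0, 0, 1, 0, 0;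
        0, 0, 1, 0, 0, 0; 0, -1, 0, 0, 0, 0; -1, 0, 0, 0, 0, 0] a b := by
  have := congrFun (congrFun hg a) b
  rw [gram_pair] at this
  rw [← gramOf_isotropicGram, ← this]
  simp [Matrix.mulVec, dotProduct, Fin.sum_univ_four, isotropicGram, mid]
  ring

/-- The products of the columns determine the remaining entries one after another from the six
listed ones, each equation being linear in a single new entry. -/
theorem eq_unipotent {n : Matrix (Fin 6) (Fin 6) ℝ}
    (hg : nᵀ * gramOf isotropicGram * n = gramOf isotropicGram)
    (hu : ∀ a b, b < a → n a b = 0) (hd : ∀ a, n a a = 1) (h23 : n 2 3 = 0) :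
    n = unipotent (n 0 1) (n 0 2) (n 1 2) (n 0 3) (n 1 3) (n 0 4) := by
  have g := gram_col hg
  have g24 := g 2 4
  have g34 := g 3 4
  have g44 := g 4 4
  have g15 := g 1 5
  have g25 := g 2 5
  have g35 := g 3 5
  have g45 := g 4 5
  have g55 := g 5 5
  have d0 := hd 0
  have d1 := hd 1
  have d2 := hd 2
  have d3 := hd 3
  have d4 := hd 4
  have d5 := hd 5
  have z : ∀ a b, b < a → n a b = 0 := hu
  simp [d1, d2, d3, d4, d5, h23, hu 3 2 (by decide), hu 4 2 (by decide),
    hu 5 2 (by decide), hu 4 3 (by decide), hu 5 3 (by decide), hu 5 4 (by decide),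
    hu 2 1 (by decide), hu 3 1 (by decide), hu 4 1 (by decide), hu 5 1 (by decide)]
    at g24 g34 g44 g15 g25 g35 g45 g55
  have n34 : n 3 4 = n 1 2 := by linarith
  have n24 : n 2 4 = n 1 3 := by linarith
  have n45 : n 4 5 = -n 0 1 := by linarith
  rw [n34, n24] at g44 g45
  have n14 : n 1 4 = n 1 2 * n 1 3 := by linarith
  rw [n45] at g25 g35 g45 g55
  have n35 : n 3 5 = n 0 2 - n 0 1 * n 1 2 := by linarith
  have n25 : n 2 5 = n 0 3 - n 0 1 * n 1 3 := by linarith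
  rw [n35, n25] at g45 g55
  rw [n14] at g45
  have n15 : n 1 5 = n 1 2 * n 0 3 + n 0 2 * n 1 3 - n 0 1 * n 1 2 * n 1 3 - n 0 4 := by linarith
  rw [n15] at g55
  have n05 : n 0 5 = n 0 2 * n 0 3 - n 0 1 * n 0 4 := by linarith
  ext a b
  fin_cases a <;> fin_cases b <;>
    simp [unipotent, d0, d1, d2, d3, d4, d5, h23, n34, n24, n45, n14, n35, n25, n15, n05] <;>
    exact hu _ _ (by decide)

theorem rescaling_mul_inv {k a b : ℝ} (hk : k ≠ 0) (ha : a ≠ 0) (hb : b ≠ 0) :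
    rescaling k a b * rescaling k⁻¹ a⁻¹ b⁻¹ = 1 := by
  rw [rescaling, rescaling, Matrix.diagonal_mul_diagonal, ← Matrix.diagonal_one]
  congr 1
  ext i
  fin_cases i <;> simp [hk, ha, hb]

theorem rescaling_inv_mul {k a b : ℝ} (hk : k ≠ 0) (ha : a ≠ 0) (hb : b ≠ 0) :
    rescaling k⁻¹ a⁻¹ b⁻¹ * rescaling k a b = 1 := by
  have := rescaling_mul_inv (inv_ne_zero hk) (inv_ne_zero ha) (inv_ne_zero hb)
  simpa using this

/-- An isometry of the isotropic frame preserving the flag of a hypersurface and the orientation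
is triangular. -/
theorem triangular_of_gram {m : Matrix (Fin 6) (Fin 6) ℝ}
    (hg : mᵀ * gramOf isotropicGram * m = gramOf isotropicGram)
    (h0 : ∀ a, a ≠ 0 → m a 0 = 0) (h5 : ∀ j, m 5 (mid j) = 0)
    (h41 : m 4 1 = 0) (h42 : m 4 2 = 0) (h43 : m 4 3 = 0)
    (hd : 0 < (Matrix.of fun i j : Fin 4 => m (mid i) (mid j)).det) :
    (∀ a b, b < a → m a b = 0) ∧ m 2 3 = 0 ∧ m 0 0 * m 5 5 = 1 ∧ m 1 1 * m 4 4 = 1 ∧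
      m 2 2 * m 3 3 = 1 := by
  have g := gram_col hg
  have h51 : m 5 1 = 0 := h5 0
  have h52 : m 5 2 = 0 := h5 1
  have h53 : m 5 3 = 0 := h5 2
  have h54 : m 5 4 = 0 := h5 3
  have g11 := g 1 1
  have g12 := g 1 2
  have g13 := g 1 3
  have g14 := g 1 4
  have g22 := g 2 2
  have g33 := g 3 3
  have g23 := g 2 3
  have g05 := g 0 5
  simp [h51, h52, h53, h54, h41, h42, h43, h0]
    at g11 g12 g13 g14 g22 g33 g23 g05
  -- Modulo A_0 and A_1 the new second and third vertices are isotropic in a hyperbolic plane, so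
  -- each lies on one of its two isotropic lines.
  replace g22 : m 2 2 = 0 ∨ m 3 2 = 0 := mul_eq_zero.1 (by linarith)
  replace g33 : m 2 3 = 0 ∨ m 3 3 = 0 := mul_eq_zero.1 (by linarith)
  have hdet : (Matrix.of fun i j : Fin 4 => m (mid i) (mid j)).det
      = m 4 4 * (m 1 1 * (m 2 2 * m 3 3 - m 2 3 * m 3 2) - m 1 2 * (m 2 1 * m 3 3 - m 2 3 * m 3 1)
        + m 1 3 * (m 2 1 * m 3 2 - m 2 2 * m 3 1)) := by
    rw [Matrix.det_succ_row _ 3]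
    simp [Fin.sum_univ_four, Matrix.det_fin_three, mid, Fin.succAbove, h41, h42, h43]
    ring
  have e21 : m 2 1 = 0 := by
    have : m 2 1 * ((m 2 2 * m 3 3 - m 3 2 * m 2 3)
        * (m 2 2 * m 3 3 - m 3 2 * m 2 3)) = 0 := by
      linear_combination (m 2 2 * m 3 3 - m 3 2 * m 2 3) * (m 2 2 * g13 - m 2 3 * g12)
    -- The sum of the two products is 1 by `g23`. If their difference were zero, both would be 1/2,
    -- whereas one of them vanishes by `g22`.
    have hne : m 2 2 * m 3 3 - m 3 2 * m 2 3 ≠ 0 := by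
      intro hz
      have h1 : m 2 2 * m 3 3 = 1 / 2 := by linarith
      have h2 : m 3 2 * m 2 3 = 1 / 2 := by linarith
      have h3 : m 2 2 * m 3 3 * (m 3 2 * m 2 3) = 0 := by
        rcases g22 with h | h <;> simp [h]
      rw [h1, h2] at h3
      norm_num at h3
    simpa [hne] using this
  have e31 : m 3 1 = 0 := by
    have hne : m 2 2 * m 3 3 - m 3 2 * m 2 3 ≠ 0 := by
      intro hz
      have h1 : m 2 2 * m 3 3 = 1 / 2 := by linarith
      have h2 : m 3 2 * m 2 3 = 1 / 2 := by linarith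
      have h3 : m 2 2 * m 3 3 * (m 3 2 * m 2 3) = 0 := by
        rcases g22 with h | h <;> simp [h]
      rw [h1, h2] at h3
      norm_num at h3
    rw [e21] at g12 g13
    have : m 3 1 * (m 2 2 * m 3 3 - m 3 2 * m 2 3) = 0 := by
      linear_combination m 3 3 * g12 - m 3 2 * g13
    simpa [hne] using this
  rw [hdet, e21, e31] at hd
  rw [e21, e31, zero_mul, zero_mul, add_zero, add_zero] at g14
  have hd' : 0 < m 2 2 * m 3 3 - m 2 3 * m 3 2 := by
    have : m 4 4 * (m 1 1 * (m 2 2 * m 3 3 - m 2 3 * m 3 2) - m 1 2 * (0 * m 3 3 - m 2 3 * 0)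
        + m 1 3 * (0 * m 3 2 - m 2 2 * 0)) = m 2 2 * m 3 3 - m 2 3 * m 3 2 := by
      linear_combination (m 2 2 * m 3 3 - m 2 3 * m 3 2) * (-g14)
    rwa [this] at hd
  -- Without orientation the two isotropic lines could still be exchanged; the positive determinant
  -- excludes it.
  have e32 : m 3 2 = 0 := by
    rcases g22 with h | h
    · rw [h] at g23 hd'; linarith
    · exact h
  have e23 : m 2 3 = 0 := by
    rcases g33 with h | h
    · exact h
    · rw [e32, h] at g23; simp at g23
  rw [e32] at g23
  refine ⟨?_, e23, by linarith, by linarith, by linarith⟩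
  intro a b hab
  fin_cases a <;> fin_cases b <;> simp at hab ⊢ <;>
    first | assumption | exact h0 _ (by decide)

/-- The conditions on a canonical frame, in local coordinates. -/
structure LocalCanonical (Ω : (Fin 3 → ℝ) → (Fin 3 → ℝ) → Matrix (Fin 6) (Fin 6) ℝ)
    (U : Set (Fin 3 → ℝ)) : Prop where
  tangent : ∀ y ∈ U, ∀ w, Ω y w 4 0 = 0
  second : ∀ y ∈ U, lam23 Ω y = 0
  third : ∀ y ∈ U, thirdCoeffs Ω y = 0
  trace : ∀ y ∈ U, rayTrace Ω y = 0

section Congr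
variable {Ω Ω' : (Fin 3 → ℝ) → (Fin 3 → ℝ) → Matrix (Fin 6) (Fin 6) ℝ} {U : Set (Fin 3 → ℝ)}

theorem eps_congr {y} (h : Ω' y = Ω y) : eps Ω' y = eps Ω y := by
  have : coframe Ω' y = coframe Ω y := by ext i j; simp only [coframe, h]
  ext k j
  rw [eps, eps, this]

theorem lam_congr {y} (h : Ω' y = Ω y) :
    lam22 Ω' y = lam22 Ω y ∧ lam23 Ω' y = lam23 Ω y ∧ lam33 Ω' y = lam33 Ω y := by
  simp only [lam22, lam23, lam33, eps_congr h, h, and_self]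

theorem alpha_congr (hU : IsOpen U) (h : ∀ y ∈ U, Ω' y = Ω y) {y} (hy : y ∈ U) (w) :
    alpha22 Ω' (lam22 Ω') y w = alpha22 Ω (lam22 Ω) y w ∧
    alpha33 Ω' (lam33 Ω') y w = alpha33 Ω (lam33 Ω) y w := by
  simp only [alpha22, alpha33, h y hy, (lam_congr (h y hy)).1, (lam_congr (h y hy)).2.2,
    fderiv_eq_of_eqOn hU (fun z hz => (lam_congr (h z hz)).1) hy,
    fderiv_eq_of_eqOn hU (fun z hz => (lam_congr (h z hz)).2.2) hy, and_self]

theorem thirdCoeffs_congr (hU : IsOpen U) (h : ∀ y ∈ U, Ω' y = Ω y) {y} (hy : y ∈ U) :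
    thirdCoeffs Ω' y = thirdCoeffs Ω y ∧ coeffA Ω' y = coeffA Ω y ∧ coeffB Ω' y = coeffB Ω y := by
  have a := fun w => alpha_congr hU h hy w
  simp only [thirdCoeffs, coeffA, coeffB, (a _).1, (a _).2, eps_congr (h y hy), and_self]

theorem LocalCanonical.congr (hc : LocalCanonical Ω U) (hU : IsOpen U)
    (h : ∀ y ∈ U, Ω' y = Ω y) : LocalCanonical Ω' U where
  tangent y hy w := by rw [h y hy, hc.tangent y hy]
  second y hy := by rw [(lam_congr (h y hy)).2.1, hc.second y hy]
  third y hy := by rw [(thirdCoeffs_congr hU h hy).1, hc.third y hy]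
  trace y hy := by rw [rayTrace, h y hy, eps_congr (h y hy), ← rayTrace, hc.trace y hy]

theorem LocalCanonical.mono (hc : LocalCanonical Ω U) {U' : Set (Fin 3 → ℝ)} (h : U' ⊆ U) :
    LocalCanonical Ω U' :=
  ⟨fun y hy => hc.tangent y (h hy), fun y hy => hc.second y (h hy), fun y hy => hc.third y (h hy),
    fun y hy => hc.trace y (h hy)⟩

end Congr

/-- The determinant condition of a second-order frame, in local coordinates. -/
noncomputable def localD (Ω : (Fin 3 → ℝ) → (Fin 3 → ℝ) → Matrix (Fin 6) (Fin 6) ℝ) (y : Fin 3 → ℝ) : ℝ :=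
  detD (lam22 Ω y) (lam33 Ω y) (coeffA Ω y) (coeffB Ω y)

section Uniqueness
variable {G : (Fin 4 → ℝ) → Matrix (Fin 4) (Fin 4) ℝ} {V : Set (Fin 4 → ℝ)}
  {F : (Fin 3 → ℝ) → Fin 4 → ℝ} {U : Set (Fin 3 → ℝ)}
  {B B' : (Fin 3 → ℝ) → Matrix (Fin 6) (Fin 6) ℝ}
  (hS : LocalSurface G V F U) (hB : LocalFrame G F U B)
include hS hB

section
variable {p x₀ x₁ y₀ y₁ t : (Fin 3 → ℝ) → ℝ} (hp : ContDiffOn ℝ ∞ p U)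
  (hx₀ : ContDiffOn ℝ ∞ x₀ U) (hx₁ : ContDiffOn ℝ ∞ x₁ U) (hy₀ : ContDiffOn ℝ ∞ y₀ U)
  (hy₁ : ContDiffOn ℝ ∞ y₁ U) (ht : ContDiffOn ℝ ∞ t U)
include hp hx₀ hx₁ hy₀ hy₁ ht

theorem pull_unipotent {y} (hy : y ∈ U) (w) :
    unipotent (p y) (x₀ y) (x₁ y) (y₀ y) (y₁ y) (t y) * pull (connection G) F
      (fun z => B z * unipotent (p z) (x₀ z) (x₁ z) (y₀ z) (y₁ z) (t z)) y w
    = matDeriv (fun z => unipotent (p z) (x₀ z) (x₁ z) (y₀ z) (y₁ z) (t z)) y w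
      + pull (connection G) F B y w * unipotent (p y) (x₀ y) (x₁ y) (y₀ y) (y₁ y) (t y) :=
  pull_mul hS.isOpen hB.smooth (unipotent_smooth hp hx₀ hx₁ hy₀ hy₁ ht) (fun _ => hB.det_ne)
    (fun _ _ h => by
      have := congrArg Matrix.det (unipotent_gram (p ‹_›) (x₀ ‹_›) (x₁ ‹_›) (y₀ ‹_›) (y₁ ‹_›) (t ‹_›))
      rw [Matrix.det_mul, h, mul_zero] at this
      exact gramOf_det_ne isotropicGram_det_ne this.symm) hy w

theorem unipotent_tangent (h : ∀ y ∈ U, ∀ w, pull (connection G) F B y w 4 0 = 0) {y} (hy : y ∈ U)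
    (w) : pull (connection G) F
      (fun z => B z * unipotent (p z) (x₀ z) (x₁ z) (y₀ z) (y₁ z) (t z)) y w 4 0 = 0 := by
  have e := congrFun (congrFun (pull_unipotent hS hB hp hx₀ hx₁ hy₀ hy₁ ht hy w) 4) 0
  have s := moving_skew hS (hB.mul_unipotent hp hx₀ hx₁ hy₀ hy₁ ht) hy w
  have s50 := s.e50
  generalize pull (connection G) F
    (fun z => B z * unipotent (p z) (x₀ z) (x₁ z) (y₀ z) (y₁ z) (t z)) y w = Ω' at e s50 ⊢
  simp only [Matrix.add_apply, Matrix.mul_apply, Fin.sum_univ_six, matDeriv, Matrix.of_apply] at e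
  simpa [unipotent, s50, h y hy] using e

/-- The normalizations fix the parameters in turn: λ_23 fixes p, the third-order coefficients fix
the four middle parameters, and the trace fixes t. Each law is applied after the preceding
parameters are known to vanish on all of `U`. -/
theorem unipotent_eq_zero (hc : LocalCanonical (pull (connection G) F B) U)
    (hc' : LocalCanonical (pull (connection G) F
      fun z => B z * unipotent (p z) (x₀ z) (x₁ z) (y₀ z) (y₁ z) (t z)) U)
    (hD : ∀ y ∈ U, localD (pull (connection G) F B) y ≠ 0) {y} (hy : y ∈ U) :
    p y = 0 ∧ x₀ y = 0 ∧ x₁ y = 0 ∧ y₀ y = 0 ∧ y₁ y = 0 ∧ t y = 0 := by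
  have h := firstOrderForm hS hB hc.tangent
  have h' := firstOrderForm hS (hB.mul_unipotent hp hx₀ hx₁ hy₀ hy₁ ht) hc'.tangent
  have law := fun {y} (hy : y ∈ U) w => pull_unipotent hS hB hp hx₀ hx₁ hy₀ hy₁ ht hy w
  have p0 : ∀ y ∈ U, p y = 0 := by
    intro y hy
    have := (unipotent_lam h h' (fun y hy w => law hy w) hy).2.1
    rw [hc'.second y hy, hc.second y hy] at this
    linarith
  have v0 : ∀ y ∈ U, ![x₀ y, x₁ y, y₀ y, y₁ y] = 0 := by
    intro y hy
    have := (unipotent_third h h' (fun y hy w => law hy w) hc.second p0 hy).2.2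
    rw [hc'.third y hy, hc.third y hy, eq_comm, zero_sub, neg_eq_zero] at this
    -- The matrix in `detD` is `fiberMatrix`, so `hD` is literally the invertibility of the linear
    -- system.
    exact Matrix.eq_zero_of_mulVec_eq_zero (hD y hy) this
  have a0 : ∀ y ∈ U, x₀ y = 0 := fun y hy => congrFun (v0 y hy) 0
  have a1 : ∀ y ∈ U, x₁ y = 0 := fun y hy => congrFun (v0 y hy) 1
  have b0 : ∀ y ∈ U, y₀ y = 0 := fun y hy => congrFun (v0 y hy) 2
  have b1 : ∀ y ∈ U, y₁ y = 0 := fun y hy => congrFun (v0 y hy) 3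
  refine ⟨p0 y hy, a0 y hy, a1 y hy, b0 y hy, b1 y hy, ?_⟩
  have := unipotent_trace h h' (fun y hy w => law hy w) p0 a0 a1 b0 b1 hy
  rw [hc'.trace y hy, hc.trace y hy] at this
  linarith

end

theorem pull_rescaling {k a b : (Fin 3 → ℝ) → ℝ} (hk : ContDiffOn ℝ ∞ k U)
    (ha : ContDiffOn ℝ ∞ a U) (hb : ContDiffOn ℝ ∞ b U) (hk0 : ∀ y ∈ U, k y ≠ 0)
    (ha0 : ∀ y ∈ U, a y ≠ 0) (hb0 : ∀ y ∈ U, b y ≠ 0) {y} (hy : y ∈ U) (w) :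
    rescaling (k y) (a y) (b y)
      * pull (connection G) F (fun z => B z * rescaling (k z) (a z) (b z)) y w
    = matDeriv (fun z => rescaling (k z) (a z) (b z)) y w
      + pull (connection G) F B y w * rescaling (k y) (a y) (b y) :=
  pull_mul hS.isOpen hB.smooth (rescaling_smooth hk ha hb hk0 ha0 hb0) (fun _ => hB.det_ne)
    (fun z hz h => by
      have := congrArg Matrix.det (rescaling_mul_inv (hk0 z hz) (ha0 z hz) (hb0 z hz))
      rw [Matrix.det_mul, h, zero_mul, Matrix.det_one] at this
      exact zero_ne_one this) hy w

theorem LocalCanonical.rescale {k a b : (Fin 3 → ℝ) → ℝ} (hk : ContDiffOn ℝ ∞ k U)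
    (ha : ContDiffOn ℝ ∞ a U) (hb : ContDiffOn ℝ ∞ b U) (hk0 : ∀ y ∈ U, k y ≠ 0)
    (ha0 : ∀ y ∈ U, a y ≠ 0) (hb0 : ∀ y ∈ U, b y ≠ 0)
    (hc : LocalCanonical (pull (connection G) F B) U) :
    LocalCanonical (pull (connection G) F fun z => B z * rescaling (k z) (a z) (b z)) U := by
  have law := fun {y} (hy : y ∈ U) w => pull_rescaling hS hB hk ha hb hk0 ha0 hb0 hy w
  have ht : ∀ y ∈ U, ∀ w,
      pull (connection G) F (fun z => B z * rescaling (k z) (a z) (b z)) y w 4 0 = 0 := by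
    intro y hy w
    have e := congrFun (congrFun (law hy w) 4) 0
    rw [Matrix.add_apply, rescaling, Matrix.mul_diagonal, Matrix.diagonal_mul,
      hc.tangent y hy] at e
    simpa [matDeriv, rescaling, ha0 y hy] using e
  have h := firstOrderForm hS hB hc.tangent
  have h' := firstOrderForm hS (hB.mul_rescaling hk ha hb hk0 ha0 hb0) ht
  have law' := fun y hy w => @law y hy w
  refine ⟨ht, fun y hy => ?_, fun y hy => ?_, fun y hy => ?_⟩
  · rw [(rescaling_lam h h' hk ha hb hk0 ha0 hb0 law' hy).2.1, hc.second y hy, mul_zero]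
  · exact rescaling_third h h' hk ha hb hk0 ha0 hb0 law' hy (hc.third y hy)
  · rw [rescaling_trace h h' hk ha hb hk0 ha0 hb0 law' hy, hc.trace y hy, zero_div]

variable (hB' : LocalFrame G F U B')
include hB'

/-- Both frames have A_0 at the same point and A_1, A_2, A_3 in the same tangent subspace, and both
are isotropic and positively oriented; the rest is the algebra of `triangular_of_gram`. -/
theorem transition {y} (hy : y ∈ U) (ht : ∀ y ∈ U, ∀ w, pull (connection G) F B y w 4 0 = 0)
    (ht' : ∀ y ∈ U, ∀ w, pull (connection G) F B' y w 4 0 = 0) {m : Matrix (Fin 6) (Fin 6) ℝ}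
    (hm : m = (B y)⁻¹ * B' y) :
    mᵀ * gramOf isotropicGram * m = gramOf isotropicGram ∧
    (∀ a b, b < a → m a b = 0) ∧ m 2 3 = 0 ∧ m 0 0 * m 5 5 = 1 ∧ m 1 1 * m 4 4 = 1 ∧
      m 2 2 * m 3 3 = 1 := by
  have hu := isUnit_iff_ne_zero.2 (hB.det_ne hy)
  have e : B' y = B y * m := by rw [hm, Matrix.mul_nonsing_inv_cancel_left _ _ hu]
  have hg : mᵀ * gramOf isotropicGram * m = gramOf isotropicGram := by
    have := hB'.gram y hy
    rw [e, Matrix.transpose_mul] at this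
    rw [← hB.gram y hy]
    refine Eq.trans ?_ (this.trans (hB.gram y hy).symm)
    simp only [mul_assoc]
  have b0 := frame_zero_zero (hB.vertex y hy) (hB.gram y hy)
  have hc := frame_col_zero (hB.vertex y hy) (hB.gram y hy)
  have hc' := frame_col_zero (hB'.vertex y hy) (hB'.gram y hy)
  have h0 : ∀ a, a ≠ 0 → m a 0 = 0 := by
    have : (fun a => m a 0) = (B' y 0 0 / B y 0 0) • Pi.single 0 1 := by
      have e1 : (fun a => m a 0) = (B y)⁻¹ *ᵥ fun a => B' y a 0 := by
        ext a; rw [hm]; rfl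
      have e2 : (fun a => B' y a 0) = (B' y 0 0 / B y 0 0) • (B y *ᵥ Pi.single 0 1) := by
        ext a
        rw [hc' a, Pi.smul_apply, Matrix.mulVec_single_one, Matrix.col_apply, hc a]
        revert a
        exact forall_six (by simp; field_simp) (fun i => by simp) (by simp)
      rw [e1, e2, Matrix.mulVec_smul, Matrix.mulVec_mulVec, Matrix.nonsing_inv_mul _ hu,
        Matrix.one_mulVec]
    intro a ha
    have := congrFun this a
    simpa [ha] using this
  have h5 : ∀ j, m 5 (mid j) = 0 := by
    intro j
    have g := gram_col hg 0 (mid j)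
    rw [← gramOf_isotropicGram, gramOf_mid_right, tvec_zero] at g
    simp [h0] at g
    have h00 : m 0 0 ≠ 0 := by
      intro h
      have g05 := gram_col hg 0 5
      simp [h0, h] at g05
    simpa [h00] using g
  have hd : 0 < (Matrix.of fun i j : Fin 4 => m (mid i) (mid j)).det := by
    have e1 : (Matrix.of fun i j : Fin 4 => B' y (mid i) (mid j))
        = (Matrix.of fun i j : Fin 4 => B y (mid i) (mid j))
          * Matrix.of fun i j : Fin 4 => m (mid i) (mid j) := by
      ext i j
      rw [Matrix.of_apply, e, mul_six, hB.vertex y hy _ (mid_ne_zero i), h5, Matrix.mul_apply]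
      simp
    have := hB'.oriented y hy
    rw [e1, Matrix.det_mul] at this
    exact (pos_iff_pos_of_mul_pos this).1 (hB.oriented y hy)
  -- the tangent subspace is spanned by the same vertices
  have h4 : ∀ w, m 4 1 * pull (connection G) F B' y w 1 0 + m 4 2 * pull (connection G) F B' y w 2 0
      + m 4 3 * pull (connection G) F B' y w 3 0 = 0 := by
    intro w
    have h00 : m 0 0 = B' y 0 0 / B y 0 0 := by
      have : B' y 0 0 = B y 0 0 * m 0 0 := by
        rw [e, mul_six]; simp [h0]
      rw [this]; field_simp
    have v := vel_eq hS hB hy w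
    have v' := vel_eq hS hB' hy w
    have b0' := frame_zero_zero (hB'.vertex y hy) (hB'.gram y hy)
    have hJ : dualMatrix (B' y) = (B y 0 0 / B' y 0 0) • (dualMatrix (B y)
        * Matrix.of fun i j : Fin 4 => m (mid i) (mid j)) := by
      ext i j
      simp only [dualMatrix, Matrix.smul_apply, Matrix.mul_apply, Matrix.of_apply, smul_eq_mul]
      have : B' y (mid i) (mid j) = ∑ k, B y (mid i) (mid k) * m (mid k) (mid j) := by
        rw [e, mul_six, hB.vertex y hy _ (mid_ne_zero i), h5]; simp
      simp only [this, div_mul_eq_mul_div, ← Finset.sum_div]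
      field_simp
    rw [v, hJ, Matrix.smul_mulVec, ← Matrix.mulVec_mulVec, ← Matrix.mulVec_smul] at v'
    have inj := Matrix.mulVec_injective_iff_isUnit.2
      ((Matrix.isUnit_iff_isUnit_det _).2 (isUnit_iff_ne_zero.2 (dualMatrix_det_ne hS hB hy)))
    have := congrFun (inj v') 3
    have t := ht y hy w
    have t' := ht' y hy w
    simp only [Pi.smul_apply, Matrix.mulVec, dotProduct, Fin.sum_univ_four, Matrix.of_apply] at this
    change pull (connection G) F B y w 4 0 = (B y 0 0 / B' y 0 0) •
      (m 4 1 * pull (connection G) F B' y w 1 0 + m 4 2 * pull (connection G) F B' y w 2 0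
      + m 4 3 * pull (connection G) F B' y w 3 0 + m 4 4 * pull (connection G) F B' y w 4 0) at this
    rw [t, t', mul_zero, add_zero, smul_eq_mul, eq_comm, mul_eq_zero] at this
    exact this.resolve_left (div_ne_zero b0 b0')
  obtain ⟨e1, e2, e3, e4, e5, e6, e7, e8, e9⟩ := (firstOrderForm hS hB' ht').eps_values hy
  have h41 := h4 (eps (pull (connection G) F B') y 0)
  have h42 := h4 (eps (pull (connection G) F B') y 1)
  have h43 := h4 (eps (pull (connection G) F B') y 2)
  rw [e1, e2, e3] at h41
  rw [e4, e5, e6] at h42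
  rw [e7, e8, e9] at h43
  simp at h41 h42 h43
  exact ⟨hg, triangular_of_gram hg h0 h5 h41 h42 h43 hd⟩

/-- Canonical frames are unique up to rescalings. -/
theorem LocalCanonical.unique (hc : LocalCanonical (pull (connection G) F B) U)
    (hc' : LocalCanonical (pull (connection G) F B') U)
    (hD : ∀ y ∈ U, localD (pull (connection G) F B) y ≠ 0) {y} (hy : y ∈ U)
    {m : Matrix (Fin 6) (Fin 6) ℝ} (hm : m = (B y)⁻¹ * B' y) :
    m 0 0 ≠ 0 ∧ m 1 1 ≠ 0 ∧ m 2 2 ≠ 0 ∧ B' y = B y * rescaling (m 0 0) (m 1 1) (m 2 2) := by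
  set μ : (Fin 3 → ℝ) → Matrix (Fin 6) (Fin 6) ℝ := fun z => (B z)⁻¹ * B' z with hμ
  have hμs : MatSmoothOn μ U := (hB.smooth.inv fun _ => hB.det_ne).mul hB'.smooth
  have tr := fun {z} (hz : z ∈ U) => transition hS hB hB' hz hc.tangent hc'.tangent (m := μ z) rfl
  have k0 : ∀ z ∈ U, μ z 0 0 ≠ 0 := fun z hz => left_ne_zero_of_mul_eq_one (tr hz).2.2.2.1
  have a0 : ∀ z ∈ U, μ z 1 1 ≠ 0 := fun z hz => left_ne_zero_of_mul_eq_one (tr hz).2.2.2.2.1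
  have b0 : ∀ z ∈ U, μ z 2 2 ≠ 0 := fun z hz => left_ne_zero_of_mul_eq_one (tr hz).2.2.2.2.2
  have ks := (hμs 0 0).inv k0
  have as := (hμs 1 1).inv a0
  have bs := (hμs 2 2).inv b0
  have k0' : ∀ z ∈ U, (μ z 0 0)⁻¹ ≠ 0 := fun z hz => inv_ne_zero (k0 z hz)
  have a0' : ∀ z ∈ U, (μ z 1 1)⁻¹ ≠ 0 := fun z hz => inv_ne_zero (a0 z hz)
  have b0' : ∀ z ∈ U, (μ z 2 2)⁻¹ ≠ 0 := fun z hz => inv_ne_zero (b0 z hz)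
  -- The second frame is first rescaled so that the transition matrix gets a unit diagonal;
  -- canonicity is not affected.
  set r : (Fin 3 → ℝ) → Matrix (Fin 6) (Fin 6) ℝ :=
    fun z => rescaling (μ z 0 0)⁻¹ (μ z 1 1)⁻¹ (μ z 2 2)⁻¹ with hr
  set n : (Fin 3 → ℝ) → Matrix (Fin 6) (Fin 6) ℝ := fun z => μ z * r z with hn
  have hBn : ∀ z ∈ U, B' z * r z = B z * n z := by
    intro z hz
    rw [hn, ← mul_assoc, hμ, Matrix.mul_nonsing_inv_cancel_left _ _
      (isUnit_iff_ne_zero.2 (hB.det_ne hz))]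
  have hns : MatSmoothOn n U := hμs.mul (rescaling_smooth ks as bs k0' a0' b0')
  have hnu : ∀ z ∈ U, n z = unipotent (n z 0 1) (n z 0 2) (n z 1 2) (n z 0 3) (n z 1 3) (n z 0 4) := by
    intro z hz
    obtain ⟨t1, t2, t3, t4, t5, t6⟩ := tr hz
    have ent : ∀ i j, n z i j = μ z i j * (![(μ z 0 0)⁻¹, (μ z 1 1)⁻¹, (μ z 2 2)⁻¹,
        (μ z 2 2)⁻¹⁻¹, (μ z 1 1)⁻¹⁻¹, (μ z 0 0)⁻¹⁻¹] : Fin 6 → ℝ) j := by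
      intro i j; simp only [hn, hr, rescaling]; rw [Matrix.mul_diagonal]
    refine eq_unipotent ?_ (fun a b hab => ?_) (fun a => ?_) ?_
    · have := rescaling_gram (k0' z hz) (a0' z hz) (b0' z hz)
      rw [← t1] at this
      rw [hn, Matrix.transpose_mul]
      refine Eq.trans ?_ (this.trans t1)
      simp only [mul_assoc]
      rfl
    · rw [ent, t2 a b hab, zero_mul]
    · rw [ent]
      have := k0 z hz
      have := a0 z hz
      have := b0 z hz
      fin_cases a <;> simp <;> first | linarith | field_simp
    · rw [ent, t3, zero_mul]
  have hcan : LocalCanonical (pull (connection G) F fun z =>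
      B z * unipotent (n z 0 1) (n z 0 2) (n z 1 2) (n z 0 3) (n z 1 3) (n z 0 4)) U := by
    refine (hc'.rescale hS hB' ks as bs k0' a0' b0').congr hS.isOpen fun z hz => funext fun w => ?_
    refine pull_congr hS.isOpen (fun _ _ => rfl) (fun z hz => ?_) hz w
    rw [← hnu z hz]
    exact (hBn z hz).symm
  have key := unipotent_eq_zero hS hB (hns 0 1) (hns 0 2) (hns 1 2) (hns 0 3) (hns 1 3) (hns 0 4)
    hc hcan hD hy
  have hn1 : n y = 1 := by
    rw [hnu y hy, key.1, key.2.1, key.2.2.1, key.2.2.2.1, key.2.2.2.2.1, key.2.2.2.2.2]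
    ext a b
    fin_cases a <;> fin_cases b <;> simp [unipotent]
  have e := hBn y hy
  rw [hn1, mul_one] at e
  have hm' : m = μ y := hm
  rw [hm']
  refine ⟨k0 y hy, a0 y hy, b0 y hy, ?_⟩
  calc B' y = B' y * (r y * rescaling (μ y 0 0) (μ y 1 1) (μ y 2 2)) := by
        rw [hr, rescaling_inv_mul (k0 y hy) (a0 y hy) (b0 y hy), mul_one]
    _ = B y * rescaling (μ y 0 0) (μ y 1 1) (μ y 2 2) := by rw [← mul_assoc, e]

end Uniqueness

/-! ### Harmonic vertices -/

/-- The left side is the characteristic equation of a 2×2 matrix, and the harmonic pole sits at the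
arithmetic mean of the roots, so the pole is at zero exactly when the trace vanishes. -/
theorem harmonic_roots {a b c d : ℝ} : (∃ s₁ s₂ : ℂ,
    (∀ s : ℂ, ((a : ℂ) - s) * (d - s) - b * c = 0 ↔ s = s₁ ∨ s = s₂) ∧ IsFourthHarmonic 0 s₁ s₂)
      ↔ a + d = 0 := by
  constructor
  · rintro ⟨s₁, s₂, h, hs⟩
    rw [IsFourthHarmonic] at hs
    have h1 := (h s₁).2 (Or.inl rfl)
    have h2 := (h s₂).2 (Or.inr rfl)
    have e : s₂ = -s₁ := by linear_combination -hs
    have key : ((a : ℂ) + d) = 0 := by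
      -- The hypothesis gives the set of roots without multiplicities. If zero is the only root, the
      -- determinant vanishes and the trace itself is a root, hence zero.
      by_cases h0 : s₁ = 0
      · have h3 : (a : ℂ) + d = s₁ ∨ (a : ℂ) + d = s₂ :=
          (h (a + d)).1 (by rw [h0] at h1; linear_combination h1)
        rcases h3 with h3 | h3 <;> simp [h3, e, h0]
      · rw [e] at h2
        have : (a + d : ℂ) * s₁ = 0 := by linear_combination (h2 - h1) / 2
        simpa [h0] using this
    exact_mod_cast key
  · intro h
    obtain ⟨r, hr⟩ := IsAlgClosed.exists_pow_nat_eq ((b : ℂ) * c - a * d) two_pos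
    have hd : (d : ℂ) = -a := by
      have : ((a + d : ℝ) : ℂ) = 0 := by rw [h]; simp
      push_cast at this
      linear_combination this
    refine ⟨r, -r, fun s => ?_, by simp [IsFourthHarmonic]⟩
    rw [hd] at hr ⊢
    have : ((a : ℂ) - s) * (-a - s) - b * c = (s - r) * (s + r) := by linear_combination hr
    rw [this, mul_eq_zero, sub_eq_zero, add_eq_zero_iff_eq_neg]

theorem finrank_span_lt_iff {m : ℕ} (v : Fin m → Fin 6 → ℂ) :
    Module.finrank ℂ (Submodule.span ℂ (Set.range v)) < m ↔ ∃ g : Fin m → ℂ, g ≠ 0 ∧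
      ∑ i, g i • v i = 0 := by
  have h1 := linearIndependent_iff_card_eq_finrank_span (R := ℂ) (b := v)
  have h2 := finrank_range_le_card (R := ℂ) (b := v)
  rw [Fintype.card_fin] at h1 h2
  rw [Set.finrank] at h1 h2
  have : Module.finrank ℂ (Submodule.span ℂ (Set.range v)) < m ↔ ¬LinearIndependent ℂ v := by
    rw [h1]; omega
  rw [this, Fintype.linearIndependent_iff]
  push Not
  constructor
  · rintro ⟨g, h, i, hi⟩
    exact ⟨g, fun h0 => hi (congrFun h0 i), h⟩
  · rintro ⟨g, h, hg⟩
    obtain ⟨i, hi⟩ := Function.ne_iff.1 h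
    exact ⟨g, hg, i, hi⟩

theorem exists_left_kernel {a b c d : ℂ} (h : a * d - b * c = 0) :
    ∃ x y : ℂ, (x ≠ 0 ∨ y ≠ 0) ∧ x * a + y * c = 0 ∧ x * b + y * d = 0 := by
  by_cases h0 : c = 0 ∧ d = 0
  · exact ⟨0, 1, Or.inr one_ne_zero, by simp [h0.1], by simp [h0.2]⟩
  · by_cases hc : c = 0
    · refine ⟨d, -b, Or.inl fun hd => h0 ⟨hc, hd⟩, ?_, by ring⟩
      linear_combination h
    · exact ⟨c, -a, Or.inl hc, by ring, by linear_combination -h⟩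

theorem left_kernel_trivial {a b c d x y : ℂ} (h : a * d - b * c ≠ 0) (h1 : x * a + y * c = 0)
    (h2 : x * b + y * d = 0) : x = 0 ∧ y = 0 := by
  constructor
  · have : x * (a * d - b * c) = 0 := by linear_combination d * h1 - c * h2
    simpa [h] using this
  · have : y * (a * d - b * c) = 0 := by linear_combination a * h2 - b * h1
    simpa [h] using this

/-- The tangent subspace at the point `A_B - s A_0` of the line `A_0 A_B`. -/
noncomputable def tangentSpan (Ω : (Fin 3 → ℝ) → (Fin 3 → ℝ) → Matrix (Fin 6) (Fin 6) ℝ)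
    (y : Fin 3 → ℝ) (B : Fin 6) (s : ℂ) : Submodule ℂ (Fin 6 → ℂ) :=
  Submodule.span ℂ (({Pi.single 0 1, Pi.single B 1} : Set (Fin 6 → ℂ)) ∪
      Set.range fun (v : Fin 3 → ℝ) (a : Fin 6) => (Ω y v a B : ℂ) - s * (Ω y v a 0 : ℂ))

section Harmonic
variable {Ω : (Fin 3 → ℝ) → (Fin 3 → ℝ) → Matrix (Fin 6) (Fin 6) ℝ} {U : Set (Fin 3 → ℝ)}
  (h : FirstOrderForm Ω U) {y : Fin 3 → ℝ} (hy : y ∈ U) (s : ℂ)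
include h hy

theorem tangentSpan_eq (B : Fin 6) : tangentSpan Ω y B s = Submodule.span ℂ (Set.range
    ![Pi.single 0 1, Pi.single B 1,
      fun a => (Ω y (eps Ω y 0) a B : ℂ) - s * (Ω y (eps Ω y 0) a 0 : ℂ),
      fun a => (Ω y (eps Ω y 1) a B : ℂ) - s * (Ω y (eps Ω y 1) a 0 : ℂ),
      fun a => (Ω y (eps Ω y 2) a B : ℂ) - s * (Ω y (eps Ω y 2) a 0 : ℂ)]) := by
  apply le_antisymm
  · rw [tangentSpan, Submodule.span_le]
    rintro x ((rfl | rfl) | ⟨v, rfl⟩)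
    · exact Submodule.subset_span ⟨0, rfl⟩
    · exact Submodule.subset_span ⟨1, rfl⟩
    · have e : (fun a => (Ω y v a B : ℂ) - s * (Ω y v a 0 : ℂ))
          = (Ω y v 1 0 : ℂ) • (fun a => (Ω y (eps Ω y 0) a B : ℂ) - s * (Ω y (eps Ω y 0) a 0 : ℂ))
          + (Ω y v 2 0 : ℂ) • (fun a => (Ω y (eps Ω y 1) a B : ℂ) - s * (Ω y (eps Ω y 1) a 0 : ℂ))
          + (Ω y v 3 0 : ℂ) • (fun a => (Ω y (eps Ω y 2) a B : ℂ) - s * (Ω y (eps Ω y 2) a 0 : ℂ)) := by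
        ext a
        rw [h.expand hy v a B, h.expand hy v a 0]
        simp only [Pi.add_apply, Pi.smul_apply, smul_eq_mul]
        push_cast
        ring
      change (fun a => (Ω y v a B : ℂ) - s * (Ω y v a 0 : ℂ)) ∈ _
      rw [e]
      exact add_mem (add_mem (Submodule.smul_mem _ _ (Submodule.subset_span ⟨2, rfl⟩))
        (Submodule.smul_mem _ _ (Submodule.subset_span ⟨3, rfl⟩)))
        (Submodule.smul_mem _ _ (Submodule.subset_span ⟨4, rfl⟩))
  · rw [Submodule.span_le]
    rintro x ⟨i, rfl⟩
    fin_cases i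
    · exact Submodule.subset_span (Or.inl (Or.inl rfl))
    · exact Submodule.subset_span (Or.inl (Or.inr rfl))
    · exact Submodule.subset_span (Or.inr ⟨_, rfl⟩)
    · exact Submodule.subset_span (Or.inr ⟨_, rfl⟩)
    · exact Submodule.subset_span (Or.inr ⟨_, rfl⟩)

/-- The derivative along the vector dual to ω^1 is the only generator with an A_5 component, which
is -1, so it is independent of the others. The dimension therefore drops exactly when the A_2, A_3
components of the two remaining derivatives are dependent. -/
theorem tangentSpan_four : Module.finrank ℂ (tangentSpan Ω y 4 s) < 5 ↔
    ((Ω y (eps Ω y 1) 2 4 : ℂ) - s) * ((Ω y (eps Ω y 2) 3 4 : ℂ) - s)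
      - (Ω y (eps Ω y 1) 3 4 : ℂ) * (Ω y (eps Ω y 2) 2 4 : ℂ) = 0 := by
  rw [tangentSpan_eq h hy, finrank_span_lt_iff]
  obtain ⟨e1, e2, e3, e4, e5, e6, e7, e8, e9⟩ := h.eps_values hy
  have s0 := h.skew y hy (eps Ω y 0)
  have s1 := h.skew y hy (eps Ω y 1)
  have s2 := h.skew y hy (eps Ω y 2)
  constructor
  · rintro ⟨g, hg, hs⟩
    by_contra hne
    simp only [Fin.sum_univ_five] at hs
    have c := fun a => congrFun hs a
    have c5 := c 5
    have c4 := c 4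
    have c0 := c 0
    have c2 := c 2
    have c3 := c 3
    simp [s0.e54, s1.e54, s2.e54, s0.e50, s1.e50, s2.e50, e1, e4, e7] at c5
    simp [c5, e5, e6, e8, e9] at c2 c3
    obtain ⟨g3, g4⟩ := left_kernel_trivial hne c2 c3
    simp [c5, g3, g4] at c0 c4
    apply hg
    ext i
    fin_cases i
    exacts [c0, c4, c5, g3, g4]
  · intro h0
    obtain ⟨x, z, hxz, k1, k2⟩ := exists_left_kernel h0
    refine ⟨![-(x * ((Ω y (eps Ω y 1) 0 4 : ℂ) - s * Ω y (eps Ω y 1) 0 0)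
        + z * ((Ω y (eps Ω y 2) 0 4 : ℂ) - s * Ω y (eps Ω y 2) 0 0)),
      -(x * ((Ω y (eps Ω y 1) 4 4 : ℂ) - s * Ω y (eps Ω y 1) 4 0)
        + z * ((Ω y (eps Ω y 2) 4 4 : ℂ) - s * Ω y (eps Ω y 2) 4 0)), 0, x, z], ?_, ?_⟩
    · intro hg
      have h3 := congrFun hg 3
      have h4 := congrFun hg 4
      simp at h3 h4
      simp [h3, h4] at hxz
    · rw [Fin.sum_univ_five]
      ext a
      fin_cases a
      · simp
      · simp [e4, e7, s1.e14, s2.e14]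
      · simpa [e5, e8] using k1
      · simpa [e6, e9] using k2
      · simp
      · simp [s1.e54, s2.e54, s1.e50, s2.e50, e4, e7]

/-- Along the vector dual to ω^1 the line A_0A_1 moves within itself, so that derivative adds
nothing to the span. The other two have A_2, A_3 components given by the λ's. -/
theorem tangentSpan_one : Module.finrank ℂ (tangentSpan Ω y 1 s) < 4 ↔
    ((lam23 Ω y : ℂ) - s) * ((lam23 Ω y : ℂ) - s) - (lam22 Ω y : ℂ) * (lam33 Ω y : ℂ) = 0 := by
  obtain ⟨e1, e2, e3, e4, e5, e6, e7, e8, e9⟩ := h.eps_values hy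
  have s0 := h.skew y hy (eps Ω y 0)
  have s1 := h.skew y hy (eps Ω y 1)
  have s2 := h.skew y hy (eps Ω y 2)
  have t0 := h.tangent y hy (eps Ω y 0)
  have t1 := h.tangent y hy (eps Ω y 1)
  have t2 := h.tangent y hy (eps Ω y 2)
  have k0 := h.coefficients hy (eps Ω y 0)
  have k1 := h.coefficients hy (eps Ω y 1)
  have k2 := h.coefficients hy (eps Ω y 2)
  simp only [e2, e3, mul_zero, add_zero] at k0
  simp only [e5, e6, mul_zero, mul_one, add_zero] at k1
  simp only [e8, e9, mul_zero, mul_one, zero_add] at k2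
  have red : tangentSpan Ω y 1 s = Submodule.span ℂ (Set.range
    ![Pi.single 0 1, Pi.single 1 1,
      fun a => (Ω y (eps Ω y 1) a 1 : ℂ) - s * (Ω y (eps Ω y 1) a 0 : ℂ),
      fun a => (Ω y (eps Ω y 2) a 1 : ℂ) - s * (Ω y (eps Ω y 2) a 0 : ℂ)]) := by
    rw [tangentSpan_eq h hy]
    apply le_antisymm
    · rw [Submodule.span_le]
      rintro x ⟨i, rfl⟩
      fin_cases i
      · exact Submodule.subset_span ⟨0, rfl⟩
      · exact Submodule.subset_span ⟨1, rfl⟩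
      · have e : (fun a => (Ω y (eps Ω y 0) a 1 : ℂ) - s * (Ω y (eps Ω y 0) a 0 : ℂ))
            = ((Ω y (eps Ω y 0) 0 1 : ℂ) - s * (Ω y (eps Ω y 0) 0 0 : ℂ)) • Pi.single 0 1
            + ((Ω y (eps Ω y 0) 1 1 : ℂ) - s * (Ω y (eps Ω y 0) 1 0 : ℂ)) • Pi.single 1 1 := by
          ext a
          fin_cases a <;> simp [e1, e2, e3, t0, s0.e41, s0.e50, s0.e51, k0.1, k0.2]
        change (fun a => (Ω y (eps Ω y 0) a 1 : ℂ) - s * (Ω y (eps Ω y 0) a 0 : ℂ)) ∈ _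
        rw [e]
        exact add_mem (Submodule.smul_mem _ _ (Submodule.subset_span ⟨0, rfl⟩))
          (Submodule.smul_mem _ _ (Submodule.subset_span ⟨1, rfl⟩))
      · exact Submodule.subset_span ⟨2, rfl⟩
      · exact Submodule.subset_span ⟨3, rfl⟩
    · rw [Submodule.span_le]
      rintro x ⟨i, rfl⟩
      fin_cases i
      · exact Submodule.subset_span ⟨0, rfl⟩
      · exact Submodule.subset_span ⟨1, rfl⟩
      · exact Submodule.subset_span ⟨3, rfl⟩
      · exact Submodule.subset_span ⟨4, rfl⟩
  rw [red, finrank_span_lt_iff]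
  constructor
  · rintro ⟨g, hg, hs⟩
    by_contra hne
    simp only [Fin.sum_univ_four] at hs
    have c := fun a => congrFun hs a
    have c1 := c 1
    have c0 := c 0
    have c2 := c 2
    have c3 := c 3
    simp [e5, e6, e8, e9, k1.1, k1.2, k2.1, k2.2] at c2 c3
    obtain ⟨g3, g4⟩ := left_kernel_trivial hne c2 c3
    simp [g3, g4] at c0 c1
    apply hg
    ext i
    fin_cases i
    exacts [c0, c1, g3, g4]
  · intro h0
    obtain ⟨x, z, hxz, q1, q2⟩ := exists_left_kernel h0
    refine ⟨![-(x * ((Ω y (eps Ω y 1) 0 1 : ℂ) - s * Ω y (eps Ω y 1) 0 0)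
        + z * ((Ω y (eps Ω y 2) 0 1 : ℂ) - s * Ω y (eps Ω y 2) 0 0)),
      -(x * ((Ω y (eps Ω y 1) 1 1 : ℂ) - s * Ω y (eps Ω y 1) 1 0)
        + z * ((Ω y (eps Ω y 2) 1 1 : ℂ) - s * Ω y (eps Ω y 2) 1 0)), x, z], ?_, ?_⟩
    · intro hg
      have h3 := congrFun hg 2
      have h4 := congrFun hg 3
      simp at h3 h4
      simp [h3, h4] at hxz
    · rw [Fin.sum_univ_four]
      ext a
      fin_cases a
      · simp
      · simp
      · simpa [e5, e8, k1.2, k2.2] using q1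
      · simpa [e6, e9, k1.1, k2.1] using q2
      · simp [s1.e41, s2.e41, t1, t2]
      · simp [s1.e51, s2.e51, s1.e50, s2.e50, t1, t2]

end Harmonic

/-! ### Frame fields and their forms in local coordinates -/

section Transfer
variable {M : Type u} [TopologicalSpace M] [ChartedSpace (Fin 4 → ℝ) M]
  [IsManifold 𝓘(ℝ, Fin 4 → ℝ) ∞ M]
variable {N : Type v} [TopologicalSpace N] [ChartedSpace (Fin 3 → ℝ) N]
  [IsManifold 𝓘(ℝ, Fin 3 → ℝ) ∞ N]
variable {c : ConformalStructure M} {f : N → M} {O : Set N}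
  {A : Gauge M → N → Matrix (Fin 6) (Fin 6) ℝ}

omit [ChartedSpace (Fin 4 → ℝ) M] [IsManifold 𝓘(ℝ, Fin 4 → ℝ) ∞ M]
  [ChartedSpace (Fin 3 → ℝ) N] [IsManifold 𝓘(ℝ, Fin 3 → ℝ) ∞ N] in
/-- The form of a frame field in local coordinates. -/
noncomputable def localForm (γ : Gauge M) (f : N → M) (ψ : OpenPartialHomeomorph N (Fin 3 → ℝ))
    (A : Gauge M → N → Matrix (Fin 6) (Fin 6) ℝ) :
    (Fin 3 → ℝ) → (Fin 3 → ℝ) → Matrix (Fin 6) (Fin 6) ℝ :=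
  pull (connection γ.metric) (localMap γ f ψ) (fun y => A γ (ψ.symm y))

theorem exists_chart (p : N) : ∃ ψ ∈ IsManifold.maximalAtlas 𝓘(ℝ, Fin 3 → ℝ) ∞ N, p ∈ ψ.source :=
  ⟨chartAt (Fin 3 → ℝ) p, IsManifold.chart_mem_maximalAtlas (n := ∞) p, mem_chart_source _ p⟩

variable (hf : IsLightlikeHypersurface c f) (hO : IsOpen O)
include hf hO

section Point
variable {γ : Gauge M} {ψ : OpenPartialHomeomorph N (Fin 3 → ℝ)} (hγ : γ ∈ c.gauges)
  (hψ : ψ ∈ IsManifold.maximalAtlas 𝓘(ℝ, Fin 3 → ℝ) ∞ N)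
include hγ hψ

theorem omega_localForm (hA : IsFrameField c f O A) {p : N} (hpO : p ∈ O)
    (hp' : p ∈ ψ.source) (hp : f p ∈ γ.chart.source) (w : TangentSpace 𝓘(ℝ, Fin 3 → ℝ) p)
    (a b : Fin 6) :
    omega γ f A p a b w = localForm γ f ψ A (ψ p) (chartDeriv ψ p w) b a :=
  omega_eq hψ hf hγ hO (hA.smooth γ hγ) hpO hp' hp w a b

theorem IsFirstOrder.localForm (hA : IsFirstOrder c f O A) :
    FirstOrderForm (localForm γ f ψ A) (localDom γ f ψ O) := by
  refine firstOrderForm (localSurface hψ hf hγ hO) (localFrame hψ hγ hA.1) fun y hy w => ?_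
  have hs := ψ.map_target hy.1
  obtain ⟨v, rfl⟩ := (chartDeriv_bijective hψ hs).2 w
  have := omega_localForm hf hO hγ hψ hA.1 hy.2.1 hs hy.2.2 v 0 4
  rw [hA.2 γ hγ _ hy.2.1 hy.2.2, ψ.right_inv hy.1] at this
  exact this.symm

theorem HasSecondCoeffs.lam_eq (hA : IsFirstOrder c f O A) {l22 l23 l33 : N → ℝ}
    (hl : HasSecondCoeffs c f O A l22 l23 l33) {y} (hy : y ∈ localDom γ f ψ O) :
    lam22 (CO22.localForm γ f ψ A) y = l22 (ψ.symm y) ∧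
    lam23 (CO22.localForm γ f ψ A) y = l23 (ψ.symm y) ∧
    lam33 (CO22.localForm γ f ψ A) y = l33 (ψ.symm y) := by
  have hs := ψ.map_target hy.1
  have e : ∀ v a b, omega γ f A (ψ.symm y) a b v
      = CO22.localForm γ f ψ A y (chartDeriv ψ (ψ.symm y) v) b a := by
    intro v a b
    rw [omega_localForm hf hO hγ hψ hA.1 hy.2.1 hs hy.2.2, ψ.right_inv hy.1]
  refine (hA.localForm hf hO hγ hψ).lam_unique hy (fun w => ?_) (fun w => ?_) <;>
    obtain ⟨v, rfl⟩ := (chartDeriv_bijective hψ hs).2 w <;>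
    rw [← e, ← e, ← e]
  · exact (hl γ hγ _ hy.2.1 hy.2.2 v).1
  · exact (hl γ hγ _ hy.2.1 hy.2.2 v).2

theorem HasSecondCoeffs.smooth (hA : IsFirstOrder c f O A) {l22 l23 l33 : N → ℝ}
    (hl : HasSecondCoeffs c f O A l22 l23 l33) :
    ContMDiffOn 𝓘(ℝ, Fin 3 → ℝ) 𝓘(ℝ, ℝ) ∞ l22 (ψ.source ∩ (O ∩ f ⁻¹' γ.chart.source)) ∧
    ContMDiffOn 𝓘(ℝ, Fin 3 → ℝ) 𝓘(ℝ, ℝ) ∞ l33 (ψ.source ∩ (O ∩ f ⁻¹' γ.chart.source)) := by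
  have h := hA.localForm hf hO hγ hψ
  constructor
  · refine ((chart_smoothOn hψ h.lam22_smooth).mono fun q hq => ⟨hq.1, mem_localDom hq.2.1 hq.1
      hq.2.2⟩).congr fun q hq => ?_
    rw [(hl.lam_eq hf hO hγ hψ hA (mem_localDom hq.2.1 hq.1 hq.2.2)).1, ψ.left_inv hq.1]
  · refine ((chart_smoothOn hψ h.lam33_smooth).mono fun q hq => ⟨hq.1, mem_localDom hq.2.1 hq.1
      hq.2.2⟩).congr fun q hq => ?_
    rw [(hl.lam_eq hf hO hγ hψ hA (mem_localDom hq.2.1 hq.1 hq.2.2)).2.2, ψ.left_inv hq.1]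

theorem HasSecondCoeffs.alpha_eq (hA : IsFirstOrder c f O A) {l22 l23 l33 : N → ℝ}
    (hl : HasSecondCoeffs c f O A l22 l23 l33) {p : N} (hpO : p ∈ O)
    (hp' : p ∈ ψ.source) (hp : f p ∈ γ.chart.source) (w : TangentSpace 𝓘(ℝ, Fin 3 → ℝ) p) :
    differential l22 p w + l22 p * (omega γ f A p 0 0 w - 2 * omega γ f A p 2 2 w
      - omega γ f A p 1 1 w) = alpha22 (CO22.localForm γ f ψ A)
        (lam22 (CO22.localForm γ f ψ A)) (ψ p) (chartDeriv ψ p w) ∧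
    differential l33 p w + l33 p * (omega γ f A p 0 0 w + 2 * omega γ f A p 2 2 w
      - omega γ f A p 1 1 w) = alpha33 (CO22.localForm γ f ψ A)
        (lam33 (CO22.localForm γ f ψ A)) (ψ p) (chartDeriv ψ p w) := by
  have hW : IsOpen (ψ.source ∩ (O ∩ f ⁻¹' γ.chart.source)) :=
    ψ.open_source.inter (hO.inter (γ.chart.open_source.preimage hf.smooth.continuous))
  have hy := mem_localDom (ψ := ψ) hpO hp' hp
  have hlam := fun {z} (hz : z ∈ localDom γ f ψ O) => hl.lam_eq hf hO hγ hψ hA hz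
  have hU : IsOpen (localDom γ f ψ O) := localDom_open hf.smooth.continuous hO
  simp only [omega_localForm hf hO hγ hψ hA.1 hpO hp' hp]
  rw [differential_eq hψ hW (hl.smooth hf hO hγ hψ hA).1 ⟨hp', hpO, hp⟩ hp',
    differential_eq hψ hW (hl.smooth hf hO hγ hψ hA).2 ⟨hp', hpO, hp⟩ hp',
    ← fderiv_eq_of_eqOn hU (fun z hz => (hlam hz).1) hy,
    ← fderiv_eq_of_eqOn hU (fun z hz => (hlam hz).2.2) hy, alpha22, alpha33,
    (hlam hy).1, (hlam hy).2.2, ψ.left_inv hp']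
  exact ⟨rfl, rfl⟩

theorem singular_iff (hA : IsFrameField c f O A) {p : N} (hpO : p ∈ O)
    (hp' : p ∈ ψ.source) (hp : f p ∈ γ.chart.source) (B : Fin 6) (d : ℕ) (s : ℂ) :
    IsSingularPoint γ f A p B d s ↔
      Module.finrank ℂ (tangentSpan (localForm γ f ψ A) (ψ p) B s) < d := by
  rw [IsSingularPoint, tangentSpan]
  have : (Set.range fun (w : TangentSpace 𝓘(ℝ, Fin 3 → ℝ) p) (a : Fin 6) =>
        (omega γ f A p B a w : ℂ) - s * (omega γ f A p 0 a w : ℂ))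
      = Set.range fun (v : Fin 3 → ℝ) (a : Fin 6) => (localForm γ f ψ A (ψ p) v a B : ℂ)
        - s * (localForm γ f ψ A (ψ p) v a 0 : ℂ) := by
    simp only [omega_localForm hf hO hγ hψ hA hpO hp' hp]
    exact (chartDeriv_bijective hψ hp').2.range_comp (fun (v : Fin 3 → ℝ) (a : Fin 6) =>
      (localForm γ f ψ A (ψ p) v a B : ℂ) - s * (localForm γ f ψ A (ψ p) v a 0 : ℂ))
  rw [this]

theorem harmonic_one_iff (hA : IsFirstOrder c f O A) {p : N} (hpO : p ∈ O)
    (hp' : p ∈ ψ.source) (hp : f p ∈ γ.chart.source) :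
    IsHarmonicVertex γ f A p 1 4 ↔ lam23 (CO22.localForm γ f ψ A) (ψ p) = 0 := by
  have h := hA.localForm hf hO hγ hψ
  simp only [IsHarmonicVertex, singular_iff hf hO hγ hψ hA.1 hpO hp' hp,
    tangentSpan_one h (mem_localDom hpO hp' hp)]
  rw [harmonic_roots]
  constructor <;> intro h <;> linarith

theorem harmonic_four_iff (hA : IsFirstOrder c f O A) {p : N} (hpO : p ∈ O)
    (hp' : p ∈ ψ.source) (hp : f p ∈ γ.chart.source) :
    IsHarmonicVertex γ f A p 4 5 ↔ rayTrace (CO22.localForm γ f ψ A) (ψ p) = 0 := by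
  have h := hA.localForm hf hO hγ hψ
  simp only [IsHarmonicVertex, singular_iff hf hO hγ hψ hA.1 hpO hp' hp,
    tangentSpan_four h (mem_localDom hpO hp' hp)]
  rw [harmonic_roots, rayTrace]

theorem weyl_eq (p : N) (hp' : p ∈ ψ.source) (i j k l : Fin 4) : weyl γ f A p i j k l
    = frameWeyl γ.metric (localMap γ f ψ (ψ p)) (A γ (ψ.symm (ψ p))) i j k l := by
  have e : ∀ k, dualVector γ A p k = dualMatrix (A γ p) *ᵥ Pi.single k 1 := by
    intro k
    ext i
    simp [dualMatrix, dualVector]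
  rw [localMap, ψ.left_inv hp', weyl, frameWeyl]
  simp only [frameCurv, e]

/-- Canonical frame fields satisfy the local conditions. -/
theorem IsCanonical.localCanonical (hA : IsCanonical c f O A) :
    LocalCanonical (localForm γ f ψ A) (localDom γ f ψ O) := by
  obtain ⟨⟨⟨h1, hh⟩, l22, l23, l33, hl, ht⟩, hr⟩ := hA
  have h := h1.localForm hf hO hγ hψ
  refine ⟨h.tangent, fun y hy => ?_, fun y hy => ?_, fun y hy => ?_⟩ <;>
    have hs := ψ.map_target hy.1
  · have := (harmonic_one_iff hf hO hγ hψ h1 hy.2.1 hs hy.2.2).1 (hh γ hγ _ hy.2.1 hy.2.2)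
    rwa [ψ.right_inv hy.1] at this
  · have key : ∀ v, localForm γ f ψ A y v 1 0 = 0 →
        alpha22 (localForm γ f ψ A) (lam22 (localForm γ f ψ A)) y v = 0 ∧
        alpha33 (localForm γ f ψ A) (lam33 (localForm γ f ψ A)) y v = 0 := by
      intro v hv
      obtain ⟨w, rfl⟩ := (chartDeriv_bijective hψ hs).2 v
      have a := hl.alpha_eq hf hO hγ hψ h1 hy.2.1 hs hy.2.2 w
      have t := ht γ hγ _ hy.2.1 hy.2.2 w
      have o := omega_localForm hf hO hγ hψ h1.1 hy.2.1 hs hy.2.2 w 0 1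
      rw [ψ.right_inv hy.1] at a o
      rw [hv] at o
      rw [← a.1, ← a.2]
      simp only [o, Pi.zero_apply, mul_zero, zero_mul, add_zero] at t
      exact ⟨t.1, t.2.2⟩
    obtain ⟨e1, e2, e3, e4, e5, e6, e7, e8, e9⟩ := h.eps_values hy
    have k1 := key _ e4
    have k2 := key _ e7
    ext i
    fin_cases i
    exacts [k1.1, k2.1, k1.2, k2.2]
  · have := (harmonic_four_iff hf hO hγ hψ h1 hy.2.1 hs hy.2.2).1 (hr γ hγ _ hy.2.1 hy.2.2)
    rwa [ψ.right_inv hy.1] at this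

end Point

/-- At each point the coefficients are computed in one gauge and one chart; gauge independence of
the forms makes them valid in all. -/
theorem IsFirstOrder.exists_secondCoeffs (hA : IsFirstOrder c f O A) :
    ∃ l22 l23 l33 : N → ℝ, HasSecondCoeffs c f O A l22 l23 l33 := by
  have key : ∀ p, ∃ l : ℝ × ℝ × ℝ, ∀ γ ∈ c.gauges, p ∈ O → f p ∈ γ.chart.source → ∀ w,
      omega γ f A p 1 3 w = l.1 * omega γ f A p 0 2 w + l.2.1 * omega γ f A p 0 3 w ∧
      omega γ f A p 1 2 w = l.2.1 * omega γ f A p 0 2 w + l.2.2 * omega γ f A p 0 3 w := by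
    intro p
    obtain ⟨γ₀, h₀, hp₀⟩ := c.cover (f p)
    obtain ⟨ψ, hψ, hpψ⟩ := exists_chart p
    refine ⟨(lam22 (CO22.localForm γ₀ f ψ A) (ψ p), lam23 (CO22.localForm γ₀ f ψ A) (ψ p),
      lam33 (CO22.localForm γ₀ f ψ A) (ψ p)), fun γ hγ hpO hp w => ?_⟩
    have e := fun a b => omega_gauge hf hγ hO hA.1 h₀ hpO hp hp₀ a b w
    simp only [e, omega_localForm hf hO h₀ hψ hA.1 hpO hpψ hp₀]
    exact (hA.localForm hf hO h₀ hψ).coefficients (mem_localDom hpO hpψ hp₀) _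
  choose l hl using key
  exact ⟨fun p => (l p).1, fun p => (l p).2.1, fun p => (l p).2.2,
    fun γ hγ p hpO hp w => hl p γ hγ hpO hp w⟩

theorem harmonic_gauge (hA : IsFrameField c f O A) {γ γ' : Gauge M} (hγ : γ ∈ c.gauges)
    (hγ' : γ' ∈ c.gauges) {p : N} (hpO : p ∈ O) (hp : f p ∈ γ.chart.source)
    (hp' : f p ∈ γ'.chart.source) (B d) (h : IsHarmonicVertex γ f A p B d) :
    IsHarmonicVertex γ' f A p B d := by
  have e : omega γ f A p = omega γ' f A p :=
    funext fun a => funext fun b => funext fun w => omega_gauge hf hγ hO hA hγ' hpO hp hp' a b w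
  rw [IsHarmonicVertex] at h ⊢
  simp only [IsSingularPoint] at h ⊢
  rwa [e] at h

/-- The conditions on a frame field may be verified in one gauge near every point. -/
theorem isSecondOrder_of_local (hA : IsFrameField c f O A)
    (h : ∀ p ∈ O, ∃ γ ∈ c.gauges, ∃ ψ ∈ IsManifold.maximalAtlas 𝓘(ℝ, Fin 3 → ℝ) ∞ N,
      p ∈ ψ.source ∧ f p ∈ γ.chart.source ∧ (∀ w, localForm γ f ψ A (ψ p) w 4 0 = 0) ∧
        lam23 (localForm γ f ψ A) (ψ p) = 0) : IsSecondOrder c f O A := by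
  have h1 : IsFirstOrder c f O A := by
    refine ⟨hA, fun γ' hγ' p hpO hp' w => ?_⟩
    obtain ⟨γ, hγ, ψ, hψ, hpψ, hp, ht, -⟩ := h p hpO
    rw [omega_gauge hf hγ' hO hA hγ hpO hp' hp, omega_localForm hf hO hγ hψ hA hpO hpψ hp]
    exact ht _
  refine ⟨h1, fun γ' hγ' p hpO hp' => ?_⟩
  obtain ⟨γ, hγ, ψ, hψ, hpψ, hp, ht, h2⟩ := h p hpO
  exact harmonic_gauge hf hO hA hγ hγ' hpO hp hp' 1 4
    ((harmonic_one_iff hf hO hγ hψ h1 hpO hpψ hp).2 h2)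

/-- The forms and the functions λ do not depend on the gauge, hence neither do the third-order
coefficients and the singular points. -/
theorem isCanonical_of_local (hA : IsFrameField c f O A)
    (h : ∀ p ∈ O, ∃ γ ∈ c.gauges, ∃ ψ ∈ IsManifold.maximalAtlas 𝓘(ℝ, Fin 3 → ℝ) ∞ N,
      p ∈ ψ.source ∧ f p ∈ γ.chart.source ∧ (∀ w, localForm γ f ψ A (ψ p) w 4 0 = 0) ∧
        lam23 (localForm γ f ψ A) (ψ p) = 0 ∧ thirdCoeffs (localForm γ f ψ A) (ψ p) = 0 ∧
        rayTrace (localForm γ f ψ A) (ψ p) = 0) : IsCanonical c f O A := by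
  have h2 : IsSecondOrder c f O A := isSecondOrder_of_local hf hO hA fun p hp => by
    obtain ⟨γ, hγ, ψ, hψ, a, b, d, e, -⟩ := h p hp
    exact ⟨γ, hγ, ψ, hψ, a, b, d, e⟩
  obtain ⟨l22, l23, l33, hl⟩ := h2.1.exists_secondCoeffs hf hO
  refine ⟨⟨h2, l22, l23, l33, hl, fun γ' hγ' p hpO hp' w => ?_⟩, fun γ' hγ' p hpO hp' => ?_⟩
  · obtain ⟨γ, hγ, ψ, hψ, hpψ, hp, -, -, h3, -⟩ := h p hpO
    have hy := mem_localDom (ψ := ψ) hpO hpψ hp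
    have hy' := mem_localDom (ψ := ψ) hpO hpψ hp'
    have F := h2.1.localForm hf hO hγ hψ
    have F' := h2.1.localForm hf hO hγ' hψ
    have a := fun w => hl.alpha_eq hf hO hγ hψ h2.1 hpO hpψ hp w
    have a' := fun w => hl.alpha_eq hf hO hγ' hψ h2.1 hpO hpψ hp' w
    -- the form of the connection is the same in both gauges
    have e : ∀ v, localForm γ' f ψ A (ψ p) v = localForm γ f ψ A (ψ p) v := by
      intro v
      obtain ⟨w, rfl⟩ := (chartDeriv_bijective hψ hpψ).2 v
      ext i j
      rw [← omega_localForm hf hO hγ' hψ hA hpO hpψ hp', ← omega_localForm hf hO hγ hψ hA hpO hpψ hp,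
        omega_gauge hf hγ' hO hA hγ hpO hp' hp]
    have ae : ∀ v, alpha22 (localForm γ' f ψ A) (lam22 (localForm γ' f ψ A)) (ψ p) v
        = alpha22 (localForm γ f ψ A) (lam22 (localForm γ f ψ A)) (ψ p) v ∧
        alpha33 (localForm γ' f ψ A) (lam33 (localForm γ' f ψ A)) (ψ p) v
        = alpha33 (localForm γ f ψ A) (lam33 (localForm γ f ψ A)) (ψ p) v := by
      intro v
      obtain ⟨w, rfl⟩ := (chartDeriv_bijective hψ hpψ).2 v
      rw [← (a w).1, ← (a w).2, ← (a' w).1, ← (a' w).2]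
      simp only [omega_gauge hf hγ' hO hA hγ hpO hp' hp, and_self]
    have h3' : thirdCoeffs (localForm γ' f ψ A) (ψ p) = 0 := by
      rw [← h3]
      simp only [thirdCoeffs, (ae _).1, (ae _).2, eps_congr (funext e)]
    have l0 : ∀ y ∈ localDom γ' f ψ O, lam23 (localForm γ' f ψ A) y = 0 := by
      intro y hy
      have := (harmonic_one_iff hf hO hγ' hψ h2.1 hy.2.1 (ψ.map_target hy.1) hy.2.2).1
        (h2.2 γ' hγ' _ hy.2.1 hy.2.2)
      rwa [ψ.right_inv hy.1] at this
    -- The curvature terms and the formula for ω_1^0 are not extra conditions: the structure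
    -- equations in the gauge `γ'` supply them.
    obtain ⟨-, -, t1, t2, t3⟩ := third_structure (localSurface hψ hf hγ' hO)
      (localFrame hψ hγ' hA) (Ω := localForm γ' f ψ A) rfl F'.tangent l0 hy' (chartDeriv ψ p w)
    have hlam := hl.lam_eq hf hO hγ' hψ h2.1 hy'
    rw [ψ.left_inv hpψ] at hlam
    dsimp only
    simp only [weyl_eq hf hO hγ' hψ p hpψ]
    rw [(a' w).1, (a' w).2]
    simp only [omega_localForm hf hO hγ' hψ hA hpO hpψ hp', ← hlam.1, ← hlam.2.2]
    simp only [h3', Pi.zero_apply] at t1 t2 t3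
    exact ⟨t1, t2, t3⟩
  · obtain ⟨γ, hγ, ψ, hψ, hpψ, hp, -, -, -, h4⟩ := h p hpO
    exact harmonic_gauge hf hO hA hγ hγ' hpO hp hp' 4 5
      ((harmonic_four_iff hf hO hγ hψ h2.1 hpO hpψ hp).2 h4)

end Transfer

/-! ### Normalization of a first-order frame -/

section Smooth
variable {Ω : (Fin 3 → ℝ) → (Fin 3 → ℝ) → Matrix (Fin 6) (Fin 6) ℝ} {U : Set (Fin 3 → ℝ)}
  (h : FirstOrderForm Ω U)
include h

theorem FirstOrderForm.alpha22_smooth (k) :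
    ContDiffOn ℝ ∞ (fun y => alpha22 Ω (lam22 Ω) y (eps Ω y k)) U :=
  (h.fderiv_eps_smooth h.lam22_smooth k).add (h.lam22_smooth.mul
    (((h.eval_eps_smooth k 0 0).sub (contDiffOn_const.mul (h.eval_eps_smooth k 2 2))).sub
      (h.eval_eps_smooth k 1 1)))

theorem FirstOrderForm.alpha33_smooth (k) :
    ContDiffOn ℝ ∞ (fun y => alpha33 Ω (lam33 Ω) y (eps Ω y k)) U :=
  (h.fderiv_eps_smooth h.lam33_smooth k).add (h.lam33_smooth.mul
    (((h.eval_eps_smooth k 0 0).add (contDiffOn_const.mul (h.eval_eps_smooth k 2 2))).sub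
      (h.eval_eps_smooth k 1 1)))

end Smooth

/-- The fiber parameters that make the third-order coefficients vanish. -/
noncomputable def fiberParams (Ω : (Fin 3 → ℝ) → (Fin 3 → ℝ) → Matrix (Fin 6) (Fin 6) ℝ)
    (y : Fin 3 → ℝ) : Fin 4 → ℝ :=
  (fiberMatrix (lam22 Ω y) (lam33 Ω y) (coeffA Ω y) (coeffB Ω y))⁻¹ *ᵥ thirdCoeffs Ω y

theorem FirstOrderForm.fiberParams_smooth
    {Ω : (Fin 3 → ℝ) → (Fin 3 → ℝ) → Matrix (Fin 6) (Fin 6) ℝ} {U : Set (Fin 3 → ℝ)}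
    (h : FirstOrderForm Ω U) (hD : ∀ y ∈ U, localD Ω y ≠ 0) (i) :
    ContDiffOn ℝ ∞ (fun y => fiberParams Ω y i) U := by
  have h22 := h.lam22_smooth
  have h33 := h.lam33_smooth
  have hA : ContDiffOn ℝ ∞ (coeffA Ω) U := contDiffOn_const.mul (h.alpha22_smooth 0)
  have hB : ContDiffOn ℝ ∞ (coeffB Ω) U := contDiffOn_const.mul (h.alpha33_smooth 0)
  have hM : MatSmoothOn (fun y => fiberMatrix (lam22 Ω y) (lam33 Ω y) (coeffA Ω y) (coeffB Ω y)) U := by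
    intro i j
    fin_cases i <;> fin_cases j <;> simp [fiberMatrix] <;> fun_prop
  have ht : ∀ j, ContDiffOn ℝ ∞ (fun y => thirdCoeffs Ω y j) U := by
    intro j
    fin_cases j
    exacts [h.alpha22_smooth 1, h.alpha22_smooth 2, h.alpha33_smooth 1, h.alpha33_smooth 2]
  simp only [fiberParams, Matrix.mulVec, dotProduct]
  exact ContDiffOn.sum fun j _ => ((hM.inv hD) i j).mul (ht j)

section Stages
variable (G : (Fin 4 → ℝ) → Matrix (Fin 4) (Fin 4) ℝ) (F : (Fin 3 → ℝ) → Fin 4 → ℝ)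
  (B : (Fin 3 → ℝ) → Matrix (Fin 6) (Fin 6) ℝ)

/-- The second-order frame with the same isotropic flag. -/
noncomputable def secondFrame (y : Fin 3 → ℝ) : Matrix (Fin 6) (Fin 6) ℝ :=
  B y * unipotent (-lam23 (pull (connection G) F B) y) 0 0 0 0 0

/-- The third-order frame obtained from a second-order frame. -/
noncomputable def thirdFrame (y : Fin 3 → ℝ) : Matrix (Fin 6) (Fin 6) ℝ :=
  B y * unipotent 0 (fiberParams (pull (connection G) F B) y 0)
    (fiberParams (pull (connection G) F B) y 1) (fiberParams (pull (connection G) F B) y 2)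
    (fiberParams (pull (connection G) F B) y 3) 0

/-- The canonical frame obtained from a third-order frame. -/
noncomputable def rayFrame (y : Fin 3 → ℝ) : Matrix (Fin 6) (Fin 6) ℝ :=
  B y * unipotent 0 0 0 0 0 (-(1 / 2) * rayTrace (pull (connection G) F B) y)

/-- The canonical frame obtained from a first-order frame. -/
noncomputable def canonicalFrame : (Fin 3 → ℝ) → Matrix (Fin 6) (Fin 6) ℝ :=
  rayFrame G F (thirdFrame G F (secondFrame G F B))

end Stages

section Normalize
variable {G : (Fin 4 → ℝ) → Matrix (Fin 4) (Fin 4) ℝ} {V : Set (Fin 4 → ℝ)}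
  {F : (Fin 3 → ℝ) → Fin 4 → ℝ} {U : Set (Fin 3 → ℝ)}
  {B : (Fin 3 → ℝ) → Matrix (Fin 6) (Fin 6) ℝ}
  (hS : LocalSurface G V F U) (hB : LocalFrame G F U B)
  (ht : ∀ y ∈ U, ∀ w, pull (connection G) F B y w 4 0 = 0)
include hS hB ht

theorem secondFrame_spec : LocalFrame G F U (secondFrame G F B) ∧
    (∀ y ∈ U, ∀ w, pull (connection G) F (secondFrame G F B) y w 4 0 = 0) ∧
    (∀ y ∈ U, lam23 (pull (connection G) F (secondFrame G F B)) y = 0) ∧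
    (∀ y ∈ U, lam22 (pull (connection G) F (secondFrame G F B)) y
      = lam22 (pull (connection G) F B) y) ∧
    (∀ y ∈ U, lam33 (pull (connection G) F (secondFrame G F B)) y
      = lam33 (pull (connection G) F B) y) := by
  have h := firstOrderForm hS hB ht
  have hp : ContDiffOn ℝ ∞ (fun y => -lam23 (pull (connection G) F B) y) U := h.lam23_smooth.neg
  have z : ContDiffOn ℝ ∞ (fun _ : Fin 3 → ℝ => (0 : ℝ)) U := contDiffOn_const
  have hB1 : LocalFrame G F U (secondFrame G F B) := hB.mul_unipotent hp z z z z z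
  have ht1 := fun y hy w => unipotent_tangent hS hB hp z z z z z ht (y := y) hy w
  have h1 := firstOrderForm hS hB1 ht1
  have law := fun y hy => unipotent_lam h h1 (fun y hy w =>
    pull_unipotent hS hB hp z z z z z (y := y) hy w) (y := y) hy
  refine ⟨hB1, ht1, fun y hy => ?_, fun y hy => (law y hy).1, fun y hy => (law y hy).2.2⟩
  rw [(law y hy).2.1]
  ring

theorem thirdFrame_spec (h2 : ∀ y ∈ U, lam23 (pull (connection G) F B) y = 0)
    (hD : ∀ y ∈ U, localD (pull (connection G) F B) y ≠ 0) :
    LocalFrame G F U (thirdFrame G F B) ∧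
    (∀ y ∈ U, ∀ w, pull (connection G) F (thirdFrame G F B) y w 4 0 = 0) ∧
    (∀ y ∈ U, lam23 (pull (connection G) F (thirdFrame G F B)) y = 0) ∧
    (∀ y ∈ U, thirdCoeffs (pull (connection G) F (thirdFrame G F B)) y = 0) := by
  have h := firstOrderForm hS hB ht
  have s := h.fiberParams_smooth hD
  have z : ContDiffOn ℝ ∞ (fun _ : Fin 3 → ℝ => (0 : ℝ)) U := contDiffOn_const
  have hB1 : LocalFrame G F U (thirdFrame G F B) := hB.mul_unipotent z (s 0) (s 1) (s 2) (s 3) z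
  have ht1 := fun y hy w => unipotent_tangent hS hB z (s 0) (s 1) (s 2) (s 3) z ht (y := y) hy w
  have h1 := firstOrderForm hS hB1 ht1
  have law := fun y hy w => pull_unipotent hS hB z (s 0) (s 1) (s 2) (s 3) z (y := y) hy w
  refine ⟨hB1, ht1, fun y hy => ?_, fun y hy => ?_⟩
  · exact (unipotent_lam h h1 law hy).2.1.trans (by rw [h2 y hy, add_zero])
  · refine (unipotent_third h h1 law h2 (fun _ _ => rfl) hy).2.2.trans ?_
    have e : ![fiberParams (pull (connection G) F B) y 0, fiberParams (pull (connection G) F B) y 1,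
        fiberParams (pull (connection G) F B) y 2, fiberParams (pull (connection G) F B) y 3]
        = fiberParams (pull (connection G) F B) y := by
      ext i; fin_cases i <;> rfl
    have hu : IsUnit (fiberMatrix (lam22 (pull (connection G) F B) y)
        (lam33 (pull (connection G) F B) y) (coeffA (pull (connection G) F B) y)
        (coeffB (pull (connection G) F B) y)).det := isUnit_iff_ne_zero.2 (hD y hy)
    rw [e, fiberParams, Matrix.mulVec_mulVec, Matrix.mul_nonsing_inv _ hu, Matrix.one_mulVec,
      sub_self]

theorem rayFrame_spec (h2 : ∀ y ∈ U, lam23 (pull (connection G) F B) y = 0)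
    (h3 : ∀ y ∈ U, thirdCoeffs (pull (connection G) F B) y = 0) :
    LocalFrame G F U (rayFrame G F B) ∧
    LocalCanonical (pull (connection G) F (rayFrame G F B)) U := by
  have h := firstOrderForm hS hB ht
  have s : ContDiffOn ℝ ∞ (fun y => -(1 / 2) * rayTrace (pull (connection G) F B) y) U :=
    contDiffOn_const.mul ((h.eval_eps_smooth 1 2 4).add (h.eval_eps_smooth 2 3 4))
  have z : ContDiffOn ℝ ∞ (fun _ : Fin 3 → ℝ => (0 : ℝ)) U := contDiffOn_const
  have hB1 : LocalFrame G F U (rayFrame G F B) := hB.mul_unipotent z z z z z s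
  have ht1 := fun y hy w => unipotent_tangent hS hB z z z z z s ht (y := y) hy w
  have h1 := firstOrderForm hS hB1 ht1
  have law := fun y hy w => pull_unipotent hS hB z z z z z s (y := y) hy w
  have zz : ∀ y ∈ U, (fun _ : Fin 3 → ℝ => (0 : ℝ)) y = 0 := fun _ _ => rfl
  refine ⟨hB1, ht1, fun y hy => ?_, fun y hy => ?_, fun y hy => ?_⟩
  · exact (unipotent_lam h h1 law hy).2.1.trans (by rw [h2 y hy, add_zero])
  · refine (unipotent_third h h1 law h2 zz hy).2.2.trans ?_
    have e : ![(0 : ℝ), 0, 0, 0] = 0 := by ext i; fin_cases i <;> rfl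
    rw [h3 y hy, e, Matrix.mulVec_zero, sub_zero]
  · refine (unipotent_trace h h1 law zz zz zz zz zz hy).trans ?_
    ring

/-- The stages do not disturb each other: the second uses p = 0 and keeps λ_23 = 0, and the third
uses only t and keeps the third-order coefficients. -/
theorem canonicalFrame_spec
    (hD : ∀ y ∈ U, localD (pull (connection G) F (secondFrame G F B)) y ≠ 0) :
    LocalFrame G F U (canonicalFrame G F B) ∧
    LocalCanonical (pull (connection G) F (canonicalFrame G F B)) U := by
  obtain ⟨a1, a2, a3, -⟩ := secondFrame_spec hS hB ht
  obtain ⟨b1, b2, b3, b4⟩ := thirdFrame_spec hS a1 a2 a3 hD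
  exact rayFrame_spec hS b1 b2 b3 b4

end Normalize

/-! ### The determinant condition, and the global canonical frame -/

section Global
variable {M : Type u} [TopologicalSpace M] [ChartedSpace (Fin 4 → ℝ) M]
  [IsManifold 𝓘(ℝ, Fin 4 → ℝ) ∞ M]
variable {N : Type v} [TopologicalSpace N] [ChartedSpace (Fin 3 → ℝ) N]
  [IsManifold 𝓘(ℝ, Fin 3 → ℝ) ∞ N]
variable {c : ConformalStructure M} {f : N → M} {O : Set N}
  {A : Gauge M → N → Matrix (Fin 6) (Fin 6) ℝ}
  (hf : IsLightlikeHypersurface c f) (hD : DNonvanishing c f)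
  {γ : Gauge M} {ψ : OpenPartialHomeomorph N (Fin 3 → ℝ)} (hγ : γ ∈ c.gauges)
  (hψ : ψ ∈ IsManifold.maximalAtlas 𝓘(ℝ, Fin 3 → ℝ) ∞ N)
include hf hD hγ hψ

/-- The hypothesis on D is stated with curvature components, while the linear system uses
derivatives of λ_22, λ_33; the structure equations identify them. -/
theorem localD_ne (hO : IsOpen O) (hA : IsSecondOrder c f O A) {y} (hy : y ∈ localDom γ f ψ O) :
    localD (localForm γ f ψ A) y ≠ 0 := by
  obtain ⟨l22, l23, l33, hl⟩ := hA.1.exists_secondCoeffs hf hO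
  have hs := ψ.map_target hy.1
  have key := hD O A l22 l23 l33 hO hA hl γ hγ _ hy.2.1 hy.2.2
  have hlam := hl.lam_eq hf hO hγ hψ hA.1 hy
  have F := hA.1.localForm hf hO hγ hψ
  have l0 : ∀ y ∈ localDom γ f ψ O, lam23 (localForm γ f ψ A) y = 0 := by
    intro y hy
    have := (harmonic_one_iff hf hO hγ hψ hA.1 hy.2.1 (ψ.map_target hy.1) hy.2.2).1
      (hA.2 γ hγ _ hy.2.1 hy.2.2)
    rwa [ψ.right_inv hy.1] at this
  obtain ⟨t1, t2, -⟩ := third_structure (localSurface hψ hf hγ hO)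
    (localFrame hψ hγ hA.1.1) (Ω := localForm γ f ψ A) rfl F.tangent l0 hy 0
  rw [localD, hlam.1, hlam.2.2, t1, t2]
  rwa [weyl_eq hf hO hγ hψ _ hs, weyl_eq hf hO hγ hψ _ hs, ψ.right_inv hy.1] at key

/-- The form of a frame field given by its components in local coordinates. -/
theorem localForm_globalFrame {B : (Fin 3 → ℝ) → Matrix (Fin 6) (Fin 6) ℝ}
    {U : Set (Fin 3 → ℝ)} (hU : IsOpen U) (hUs : U ⊆ localDom γ f ψ Set.univ) {y} (hy : y ∈ U) (w) :
    localForm γ f ψ (globalFrame c f γ ψ B) y w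
      = pull (connection γ.metric) (localMap γ f ψ) B y w := by
  refine pull_congr hU (fun _ _ => rfl) (fun z hz => ?_) hy w
  rw [globalFrame_self hγ (hUs hz).2.2, ψ.right_inv (hUs hz).1]

/-- The hypothesis on D concerns frame fields given in all gauges, so the local second-order frame
has to be extended to such a field before it applies. -/
theorem secondFrame_localD {B : (Fin 3 → ℝ) → Matrix (Fin 6) (Fin 6) ℝ}
    {U : Set (Fin 3 → ℝ)} (hU : IsOpen U) (hUs : U ⊆ localDom γ f ψ Set.univ)
    (hB : LocalFrame γ.metric (localMap γ f ψ) U B)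
    (ht : ∀ y ∈ U, ∀ w, pull (connection γ.metric) (localMap γ f ψ) B y w 4 0 = 0) {y} (hy : y ∈ U) :
    localD (pull (connection γ.metric) (localMap γ f ψ)
      (secondFrame γ.metric (localMap γ f ψ) B)) y ≠ 0 := by
  have hS := (localSurface hψ hf hγ isOpen_univ).mono hU hUs
  obtain ⟨a1, a2, a3, -⟩ := secondFrame_spec hS hB ht
  set B₁ := secondFrame γ.metric (localMap γ f ψ) B with hB₁
  have hO : IsOpen (ψ.source ∩ ψ ⁻¹' U) := ψ.isOpen_inter_preimage hU
  have hA := globalFrame_isFrameField hψ hf hγ hU hUs a1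
  have e : ∀ z ∈ U, localForm γ f ψ (globalFrame c f γ ψ B₁) z
      = pull (connection γ.metric) (localMap γ f ψ) B₁ z := fun z hz => funext fun w =>
    localForm_globalFrame hf hD hγ hψ hU hUs hz w
  have h2 : IsSecondOrder c f (ψ.source ∩ ψ ⁻¹' U) (globalFrame c f γ ψ B₁) := by
    refine isSecondOrder_of_local hf hO hA fun p hp => ⟨γ, hγ, ψ, hψ, hp.1, ?_, fun w => ?_, ?_⟩
    · have := (hUs hp.2).2.2
      rwa [Set.mem_preimage, ψ.left_inv hp.1] at this
    · rw [e _ hp.2]; exact a2 _ hp.2 w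
    · rw [(lam_congr (e _ hp.2)).2.1]; exact a3 _ hp.2
  have hy' : y ∈ localDom γ f ψ (ψ.source ∩ ψ ⁻¹' U) := by
    refine ⟨(hUs hy).1, ⟨ψ.map_target (hUs hy).1, ?_⟩, (hUs hy).2.2⟩
    rw [Set.mem_preimage, ψ.right_inv (hUs hy).1]
    exact hy
  have := localD_ne hf hD hγ hψ hO h2 hy'
  rw [localD, (lam_congr (e y hy)).1, (lam_congr (e y hy)).2.2, (thirdCoeffs_congr hU e hy).2.1,
    (thirdCoeffs_congr hU e hy).2.2] at this
  exact this

theorem canonical_globalFrame {B : (Fin 3 → ℝ) → Matrix (Fin 6) (Fin 6) ℝ}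
    {U : Set (Fin 3 → ℝ)} (hU : IsOpen U) (hUs : U ⊆ localDom γ f ψ Set.univ)
    (hB : LocalFrame γ.metric (localMap γ f ψ) U B)
    (hc : LocalCanonical (pull (connection γ.metric) (localMap γ f ψ) B) U) :
    IsCanonical c f (ψ.source ∩ ψ ⁻¹' U) (globalFrame c f γ ψ B) := by
  have hO : IsOpen (ψ.source ∩ ψ ⁻¹' U) := ψ.isOpen_inter_preimage hU
  have hA := globalFrame_isFrameField hψ hf hγ hU hUs hB
  have e : ∀ z ∈ U, localForm γ f ψ (globalFrame c f γ ψ B) z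
      = pull (connection γ.metric) (localMap γ f ψ) B z := fun z hz => funext fun w =>
    localForm_globalFrame hf hD hγ hψ hU hUs hz w
  have hc' := hc.congr hU e
  refine isCanonical_of_local hf hO hA fun p hp => ⟨γ, hγ, ψ, hψ, hp.1, ?_, hc'.tangent _ hp.2,
    hc'.second _ hp.2, hc'.third _ hp.2, hc'.trace _ hp.2⟩
  have := (hUs hp.2).2.2
  rwa [Set.mem_preimage, ψ.left_inv hp.1] at this

end Global

/-! ### Jets -/

section Jets
open Filter Topology
variable {n m : ℕ}

/-- The partial derivatives of orders at most `k` of two functions agree at a point. -/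
def JetAgree (y₀ : Fin n → ℝ) : ℕ → ((Fin n → ℝ) → ℝ) → ((Fin n → ℝ) → ℝ) → Prop
  | 0, f, g => f y₀ = g y₀
  | k + 1, f, g => f y₀ = g y₀ ∧
      ∀ w, JetAgree y₀ k (fun y => fderiv ℝ f y w) (fun y => fderiv ℝ g y w)

/-- Two functions, smooth at a point, have the same jet of order `k` there. -/
structure JetEq (y₀ : Fin n → ℝ) (k : ℕ) (f g : (Fin n → ℝ) → ℝ) : Prop where
  left : ContDiffAt ℝ ∞ f y₀
  right : ContDiffAt ℝ ∞ g y₀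
  agree : JetAgree y₀ k f g

theorem JetAgree.congr {y₀ : Fin n → ℝ} {k : ℕ} {f g f' g' : (Fin n → ℝ) → ℝ}
    (h : JetAgree y₀ k f g) (hf : f' =ᶠ[𝓝 y₀] f) (hg : g' =ᶠ[𝓝 y₀] g) : JetAgree y₀ k f' g' := by
  induction k generalizing f g f' g' with
  | zero => exact (hf.eq_of_nhds.trans h).trans hg.eq_of_nhds.symm
  | succ k ih =>
    refine ⟨(hf.eq_of_nhds.trans h.1).trans hg.eq_of_nhds.symm, fun w => ih (h.2 w) ?_ ?_⟩
    · filter_upwards [hf.fderiv (𝕜 := ℝ)] with y hy; rw [hy]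
    · filter_upwards [hg.fderiv (𝕜 := ℝ)] with y hy; rw [hy]

theorem contDiffAt_fderiv_apply {f : (Fin n → ℝ) → ℝ} {y₀ : Fin n → ℝ} (h : ContDiffAt ℝ ∞ f y₀)
    (w : Fin n → ℝ) : ContDiffAt ℝ ∞ (fun y => fderiv ℝ f y w) y₀ :=
  (h.fderiv_right (m := ∞) (by simp)).clm_apply contDiffAt_const

theorem eventually_differentiableAt {f : (Fin n → ℝ) → ℝ} {y₀ : Fin n → ℝ}
    (h : ContDiffAt ℝ ∞ f y₀) : ∀ᶠ y in 𝓝 y₀, DifferentiableAt ℝ f y := by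
  have h1 : ContDiffAt ℝ 1 f y₀ := h.of_le (by simp)
  filter_upwards [h1.eventually (by simp)] with y hy
  exact hy.differentiableAt (by simp)

namespace JetEq
variable {y₀ : Fin n → ℝ} {k : ℕ} {f g f' g' : (Fin n → ℝ) → ℝ}

theorem congr (h : JetEq y₀ k f g) (hf : f' =ᶠ[𝓝 y₀] f) (hg : g' =ᶠ[𝓝 y₀] g) :
    JetEq y₀ k f' g' :=
  ⟨h.left.congr_of_eventuallyEq hf, h.right.congr_of_eventuallyEq hg, h.agree.congr hf hg⟩

theorem value (h : JetEq y₀ k f g) : f y₀ = g y₀ := by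
  obtain ⟨-, -, h⟩ := h
  cases k
  exacts [h, h.1]

theorem deriv (h : JetEq y₀ (k + 1) f g) (w) :
    JetEq y₀ k (fun y => fderiv ℝ f y w) (fun y => fderiv ℝ g y w) :=
  ⟨contDiffAt_fderiv_apply h.left w, contDiffAt_fderiv_apply h.right w, h.agree.2 w⟩

theorem succ (hf : ContDiffAt ℝ ∞ f y₀) (hg : ContDiffAt ℝ ∞ g y₀) (h0 : f y₀ = g y₀)
    (h : ∀ w, JetEq y₀ k (fun y => fderiv ℝ f y w) (fun y => fderiv ℝ g y w)) :
    JetEq y₀ (k + 1) f g :=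
  ⟨hf, hg, h0, fun w => (h w).agree⟩

theorem pred (h : JetEq y₀ (k + 1) f g) : JetEq y₀ k f g := by
  induction k generalizing f g with
  | zero => exact ⟨h.left, h.right, h.value⟩
  | succ k ih => exact succ h.left h.right h.value fun w => ih (h.deriv w)

theorem refl (hf : ContDiffAt ℝ ∞ f y₀) : JetEq y₀ k f f := by
  induction k generalizing f with
  | zero => exact ⟨hf, hf, rfl⟩
  | succ k ih => exact succ hf hf rfl fun w => ih (contDiffAt_fderiv_apply hf w)

theorem const (c : ℝ) : JetEq y₀ k (fun _ => c) (fun _ => c) := refl contDiffAt_const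

theorem add (h : JetEq y₀ k f f') (h' : JetEq y₀ k g g') :
    JetEq y₀ k (fun y => f y + g y) (fun y => f' y + g' y) := by
  have key : ∀ {u v : (Fin n → ℝ) → ℝ}, ContDiffAt ℝ ∞ u y₀ → ContDiffAt ℝ ∞ v y₀ → ∀ w,
      (fun y => fderiv ℝ (fun y => u y + v y) y w) =ᶠ[𝓝 y₀] fun y =>
        fderiv ℝ u y w + fderiv ℝ v y w := by
    intro u v hu hv w
    filter_upwards [eventually_differentiableAt hu, eventually_differentiableAt hv] with y h1 h2
    rw [fderiv_fun_add h1 h2]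
    rfl
  induction k generalizing f g f' g' with
  | zero => exact ⟨h.left.add h'.left, h.right.add h'.right, congrArg₂ _ h.value h'.value⟩
  | succ k ih =>
    exact succ (h.left.add h'.left) (h.right.add h'.right) (congrArg₂ _ h.value h'.value) fun w =>
      (ih (h.deriv w) (h'.deriv w)).congr (key h.left h'.left w) (key h.right h'.right w)

theorem mul (h : JetEq y₀ k f f') (h' : JetEq y₀ k g g') :
    JetEq y₀ k (fun y => f y * g y) (fun y => f' y * g' y) := by
  have key : ∀ {u v : (Fin n → ℝ) → ℝ}, ContDiffAt ℝ ∞ u y₀ → ContDiffAt ℝ ∞ v y₀ → ∀ w,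
      (fun y => fderiv ℝ (fun y => u y * v y) y w) =ᶠ[𝓝 y₀] fun y =>
        u y * fderiv ℝ v y w + v y * fderiv ℝ u y w := by
    intro u v hu hv w
    filter_upwards [eventually_differentiableAt hu, eventually_differentiableAt hv] with y h1 h2
    rw [fderiv_fun_mul h1 h2]
    rfl
  induction k generalizing f g f' g' with
  | zero => exact ⟨h.left.mul h'.left, h.right.mul h'.right, congrArg₂ _ h.value h'.value⟩
  | succ k ih =>
    exact succ (h.left.mul h'.left) (h.right.mul h'.right) (congrArg₂ _ h.value h'.value) fun w =>
      ((ih h.pred (h'.deriv w)).add (ih h'.pred (h.deriv w))).congr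
        (key h.left h'.left w) (key h.right h'.right w)

theorem neg (h : JetEq y₀ k f f') : JetEq y₀ k (fun y => -f y) (fun y => -f' y) := by
  simpa using (const (y₀ := y₀) (k := k) (-1)).mul h

theorem sub (h : JetEq y₀ k f f') (h' : JetEq y₀ k g g') :
    JetEq y₀ k (fun y => f y - g y) (fun y => f' y - g' y) := by
  simpa [sub_eq_add_neg] using h.add h'.neg

theorem sum {ι : Type*} (s : Finset ι) {f g : ι → (Fin n → ℝ) → ℝ}
    (h : ∀ i ∈ s, JetEq y₀ k (f i) (g i)) :
    JetEq y₀ k (fun y => ∑ i ∈ s, f i y) (fun y => ∑ i ∈ s, g i y) := by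
  classical
  induction s using Finset.induction_on with
  | empty => simpa using const (y₀ := y₀) (k := k) 0
  | insert i s hi ih =>
    simp only [Finset.sum_insert hi]
    exact (h i (Finset.mem_insert_self i s)).add (ih fun j hj => h j (Finset.mem_insert_of_mem hj))

theorem prod {ι : Type*} (s : Finset ι) {f g : ι → (Fin n → ℝ) → ℝ}
    (h : ∀ i ∈ s, JetEq y₀ k (f i) (g i)) :
    JetEq y₀ k (fun y => ∏ i ∈ s, f i y) (fun y => ∏ i ∈ s, g i y) := by
  classical
  induction s using Finset.induction_on with
  | empty => simpa using const (y₀ := y₀) (k := k) 1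
  | insert i s hi ih =>
    simp only [Finset.prod_insert hi]
    exact (h i (Finset.mem_insert_self i s)).mul (ih fun j hj => h j (Finset.mem_insert_of_mem hj))

/-- The derivative of the reciprocal contains the reciprocal itself only to one order less, so
induction on the order closes; the square root is handled in the same way. -/
theorem inv (h : JetEq y₀ k f f') (h0 : f y₀ ≠ 0) :
    JetEq y₀ k (fun y => (f y)⁻¹) (fun y => (f' y)⁻¹) := by
  have h0' : f' y₀ ≠ 0 := h.value ▸ h0
  have key : ∀ {u : (Fin n → ℝ) → ℝ}, ContDiffAt ℝ ∞ u y₀ → u y₀ ≠ 0 → ∀ w,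
      (fun y => fderiv ℝ (fun y => (u y)⁻¹) y w) =ᶠ[𝓝 y₀] fun y =>
        -((u y)⁻¹ * (u y)⁻¹) * fderiv ℝ u y w := by
    intro u hu hu0 w
    filter_upwards [eventually_differentiableAt hu, hu.continuousAt.eventually_ne hu0] with y h1 h2
    have e := ((hasDerivAt_inv h2).comp_hasFDerivAt y h1.hasFDerivAt).fderiv
    change fderiv ℝ (fun y => (u y)⁻¹) y = _ at e
    rw [e]
    simp [pow_two]
  induction k generalizing f f' with
  | zero => exact ⟨h.left.inv h0, h.right.inv h0', congrArg _ h.value⟩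
  | succ k ih =>
    have i := ih h.pred h0 h0'
    exact succ (h.left.inv h0) (h.right.inv h0') (congrArg _ h.value) fun w =>
      ((i.mul i).neg.mul (h.deriv w)).congr (key h.left h0 w) (key h.right h0' w)

theorem div (h : JetEq y₀ k f f') (h' : JetEq y₀ k g g') (h0 : g y₀ ≠ 0) :
    JetEq y₀ k (fun y => f y / g y) (fun y => f' y / g' y) := by
  simpa only [div_eq_mul_inv] using h.mul (h'.inv h0)

theorem sqrt (h : JetEq y₀ k f f') (h0 : 0 < f y₀) :
    JetEq y₀ k (fun y => √(f y)) (fun y => √(f' y)) := by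
  have h0' : 0 < f' y₀ := h.value ▸ h0
  have key : ∀ {u : (Fin n → ℝ) → ℝ}, ContDiffAt ℝ ∞ u y₀ → u y₀ ≠ 0 → ∀ w,
      (fun y => fderiv ℝ (fun y => √(u y)) y w) =ᶠ[𝓝 y₀] fun y =>
        (2 * √(u y))⁻¹ * fderiv ℝ u y w := by
    intro u hu hu0 w
    filter_upwards [eventually_differentiableAt hu, hu.continuousAt.eventually_ne hu0] with y h1 h2
    rw [(h1.hasFDerivAt.sqrt h2).fderiv]
    simp
  induction k generalizing f f' with
  | zero => exact ⟨h.left.sqrt h0.ne', h.right.sqrt h0'.ne', congrArg _ h.value⟩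
  | succ k ih =>
    have i := ih h.pred h0 h0'
    exact succ (h.left.sqrt h0.ne') (h.right.sqrt h0'.ne') (congrArg _ h.value) fun w =>
      ((((const 2).mul i).inv (by positivity)).mul (h.deriv w)).congr (key h.left h0.ne' w)
        (key h.right h0'.ne' w)

/-- By the chain rule the derivative is a sum of partial derivatives of `f` composed with `F`, to
which the induction hypothesis applies, times derivatives of `F`. -/
theorem comp {F F' : (Fin n → ℝ) → Fin m → ℝ} {f f' : (Fin m → ℝ) → ℝ}
    (h : JetEq (F y₀) k f f') (hF : ∀ i, JetEq y₀ k (fun y => F y i) (fun y => F' y i)) :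
    JetEq y₀ k (fun y => f (F y)) (fun y => f' (F' y)) := by
  have e : F' y₀ = F y₀ := funext fun i => (hF i).value.symm
  have smooth : ∀ {u : (Fin m → ℝ) → ℝ} {Φ : (Fin n → ℝ) → Fin m → ℝ}, ContDiffAt ℝ ∞ u (Φ y₀) →
      (∀ i, ContDiffAt ℝ ∞ (fun y => Φ y i) y₀) → ContDiffAt ℝ ∞ (fun y => u (Φ y)) y₀ :=
    fun hu hΦ => hu.comp _ (contDiffAt_pi.2 hΦ)
  have key : ∀ {u : (Fin m → ℝ) → ℝ} {Φ : (Fin n → ℝ) → Fin m → ℝ}, ContDiffAt ℝ ∞ u (Φ y₀) →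
      (∀ i, ContDiffAt ℝ ∞ (fun y => Φ y i) y₀) → ∀ w,
      (fun y => fderiv ℝ (fun y => u (Φ y)) y w) =ᶠ[𝓝 y₀] fun y =>
        ∑ i, fderiv ℝ u (Φ y) (Pi.single i 1) * fderiv ℝ (fun y => Φ y i) y w := by
    intro u Φ hu hΦ w
    have hc : ContinuousAt Φ y₀ := (contDiffAt_pi.2 hΦ).continuousAt
    filter_upwards [hc.eventually (eventually_differentiableAt hu),
      eventually_all.2 fun i => eventually_differentiableAt (hΦ i)] with y h1 h2
    have hd : DifferentiableAt ℝ Φ y := differentiableAt_pi.2 h2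
    rw [fderiv_fun_comp y h1 hd, ContinuousLinearMap.comp_apply, fderiv_sum_basis]
    refine Finset.sum_congr rfl fun i _ => ?_
    rw [fderiv_apply (hd) i, mul_comm]
    rfl
  have hl := smooth h.left fun i => (hF i).left
  have hr := smooth (e ▸ h.right) fun i => (hF i).right
  have hv : f (F y₀) = f' (F' y₀) := by rw [e, h.value]
  induction k generalizing f f' with
  | zero => exact ⟨hl, hr, hv⟩
  | succ k ih =>
    refine succ hl hr hv fun w => (sum Finset.univ fun i _ => ?_).congr
      (key h.left (fun i => (hF i).left) w) (key (e ▸ h.right) (fun i => (hF i).right) w)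
    refine (ih (h.deriv _) (fun i => (hF i).pred) ?_ ?_ ?_).mul ((hF i).deriv w)
    · exact smooth (contDiffAt_fderiv_apply h.left _) fun i => (hF i).left
    · exact smooth (contDiffAt_fderiv_apply (e ▸ h.right) _) fun i => (hF i).right
    · rw [e, (h.deriv _).value]

/-- Fixing the last argument of an iterated derivative gives an iterated derivative of a directional
derivative, which matches the recursive definition of jets. -/
theorem of_iteratedFDeriv (hf : ContDiffAt ℝ ∞ f y₀) (hg : ContDiffAt ℝ ∞ g y₀)
    (h : ∀ j ≤ k, iteratedFDeriv ℝ j f y₀ = iteratedFDeriv ℝ j g y₀) : JetEq y₀ k f g := by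
  have h0 : f y₀ = g y₀ := by
    have := congrArg (fun T => T 0) (h 0 (Nat.zero_le _))
    simpa using this
  induction k generalizing f g with
  | zero => exact ⟨hf, hg, h0⟩
  | succ k ih =>
    have key : ∀ {u : (Fin n → ℝ) → ℝ}, ContDiffAt ℝ ∞ u y₀ → ∀ w j,
        ∀ v, iteratedFDeriv ℝ j (fun y => fderiv ℝ u y w) y₀ v
          = iteratedFDeriv ℝ (j + 1) u y₀ (Fin.snoc v w) := by
      intro u hu w j v
      have hd : ContDiffAt ℝ j (fderiv ℝ u) y₀ := (hu.fderiv_right (m := ∞) (by simp)).of_le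
        (by exact_mod_cast le_top)
      have := (ContinuousLinearMap.apply ℝ ℝ w).iteratedFDeriv_comp_left hd (i := j) le_rfl
      rw [iteratedFDeriv_succ_apply_right]
      have e : (fun y => fderiv ℝ u y w) = (ContinuousLinearMap.apply ℝ ℝ w) ∘ fderiv ℝ u := rfl
      rw [e, this]
      simp [Fin.init_snoc]
    refine succ hf hg h0 fun w => ?_
    have hj : ∀ j ≤ k, iteratedFDeriv ℝ j (fun y => fderiv ℝ f y w) y₀
        = iteratedFDeriv ℝ j (fun y => fderiv ℝ g y w) y₀ := by
      intro j hj
      ext v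
      rw [key hf, key hg, h (j + 1) (by omega)]
    refine ih (contDiffAt_fderiv_apply hf w) (contDiffAt_fderiv_apply hg w) hj ?_
    have := congrArg (fun T => T 0) (hj 0 (Nat.zero_le _))
    simpa using this

end JetEq

/-- The entries of two matrix-valued functions have the same jets. -/
def MatJetEq {ι κ : Type*} (y₀ : Fin n → ℝ) (k : ℕ) (A B : (Fin n → ℝ) → Matrix ι κ ℝ) : Prop :=
  ∀ i j, JetEq y₀ k (fun y => A y i j) (fun y => B y i j)

namespace MatJetEq
variable {ι κ μ : Type*} {y₀ : Fin n → ℝ} {k : ℕ}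

theorem mul [Fintype κ] {A A' : (Fin n → ℝ) → Matrix ι κ ℝ} {B B' : (Fin n → ℝ) → Matrix κ μ ℝ}
    (h : MatJetEq y₀ k A A') (h' : MatJetEq y₀ k B B') :
    MatJetEq y₀ k (fun y => A y * B y) (fun y => A' y * B' y) := fun i j => by
  simpa only [Matrix.mul_apply] using JetEq.sum _ fun l _ => (h i l).mul (h' l j)

theorem add {A A' B B' : (Fin n → ℝ) → Matrix ι κ ℝ}
    (h : MatJetEq y₀ k A A') (h' : MatJetEq y₀ k B B') :
    MatJetEq y₀ k (fun y => A y + B y) (fun y => A' y + B' y) := fun i j => (h i j).add (h' i j)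

theorem mulVec [Fintype κ] {A A' : (Fin n → ℝ) → Matrix ι κ ℝ} {u u' : (Fin n → ℝ) → κ → ℝ}
    (h : MatJetEq y₀ k A A') (h' : ∀ j, JetEq y₀ k (fun y => u y j) (fun y => u' y j)) (i) :
    JetEq y₀ k (fun y => (A y *ᵥ u y) i) (fun y => (A' y *ᵥ u' y) i) := by
  simpa only [Matrix.mulVec, dotProduct] using JetEq.sum _ fun l _ => (h i l).mul (h' l)

theorem transpose {A A' : (Fin n → ℝ) → Matrix ι κ ℝ} (h : MatJetEq y₀ k A A') :
    MatJetEq y₀ k (fun y => (A y)ᵀ) (fun y => (A' y)ᵀ) := fun i j => h j i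

theorem pred {A A' : (Fin n → ℝ) → Matrix ι κ ℝ} (h : MatJetEq y₀ (k + 1) A A') :
    MatJetEq y₀ k A A' := fun i j => (h i j).pred

theorem det [Fintype ι] [DecidableEq ι] {A A' : (Fin n → ℝ) → Matrix ι ι ℝ}
    (h : MatJetEq y₀ k A A') : JetEq y₀ k (fun y => (A y).det) (fun y => (A' y).det) := by
  simp only [Matrix.det_apply']
  exact JetEq.sum _ fun σ _ => (JetEq.const _).mul (JetEq.prod _ fun i _ => h _ _)

theorem adjugate [Fintype ι] [DecidableEq ι] {A A' : (Fin n → ℝ) → Matrix ι ι ℝ}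
    (h : MatJetEq y₀ k A A') : MatJetEq y₀ k (fun y => (A y).adjugate) (fun y => (A' y).adjugate) := by
  intro i j
  simp only [Matrix.adjugate_apply]
  refine det fun a b => ?_
  simp only [Matrix.updateRow_apply]
  split_ifs
  exacts [JetEq.const _, h _ _]

theorem inv [Fintype ι] [DecidableEq ι] {A A' : (Fin n → ℝ) → Matrix ι ι ℝ}
    (h : MatJetEq y₀ k A A') (h0 : (A y₀).det ≠ 0) :
    MatJetEq y₀ k (fun y => (A y)⁻¹) (fun y => (A' y)⁻¹) := by
  intro i j
  simp only [Matrix.inv_def, Ring.inverse_eq_inv', Matrix.smul_apply, smul_eq_mul]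
  exact (h.det.inv h0).mul (h.adjugate i j)

theorem value {A A' : (Fin n → ℝ) → Matrix ι κ ℝ} (h : MatJetEq y₀ k A A') : A y₀ = A' y₀ := by
  ext i j; exact (h i j).value

theorem matDeriv {A A' : (Fin n → ℝ) → Matrix ι κ ℝ} (h : MatJetEq y₀ (k + 1) A A') (w) :
    MatJetEq y₀ k (fun y => matDeriv A y w) (fun y => matDeriv A' y w) :=
  fun i j => (h i j).deriv w

end MatJetEq
end Jets

/-! ### First-order frames with prescribed jets -/

/-- The scalar product of two vectors. -/
def pairing (g : Matrix (Fin 4) (Fin 4) ℝ) (x y : Fin 4 → ℝ) : ℝ := x ⬝ᵥ (g *ᵥ y)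

section Pairing
variable (g : Matrix (Fin 4) (Fin 4) ℝ)

theorem pairing_comm (hg : gᵀ = g) (x y) : pairing g x y = pairing g y x := by
  rw [pairing, pairing, Matrix.dotProduct_mulVec, ← Matrix.mulVec_transpose, hg, dotProduct_comm]

theorem pairing_add_right (x y y') : pairing g x (y + y') = pairing g x y + pairing g x y' := by
  simp [pairing, Matrix.mulVec_add]
theorem pairing_sub_right (x y y') : pairing g x (y - y') = pairing g x y - pairing g x y' := by
  simp [pairing, Matrix.mulVec_sub]
theorem pairing_smul_right (r : ℝ) (x y) : pairing g x (r • y) = r * pairing g x y := by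
  simp [pairing, Matrix.mulVec_smul]

/-- The square root of the discriminant of the restriction of a quadratic form to a plane. -/
noncomputable def discRoot (u v : Fin 4 → ℝ) : ℝ :=
  √(pairing g u v ^ 2 - pairing g u u * pairing g v v)

/-- Two isotropic vectors in the plane spanned by `u` and `v`. -/
noncomputable def isotropicLeft (u v : Fin 4 → ℝ) : Fin 4 → ℝ :=
  (1 / 2 : ℝ) • ((pairing g u v + discRoot g u v) • u - pairing g u u • v)
noncomputable def isotropicRight (u v : Fin 4 → ℝ) : Fin 4 → ℝ :=
  (1 / (discRoot g u v ^ 2 * (pairing g u v + discRoot g u v))) •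
    ((pairing g u v + discRoot g u v) • v - pairing g v v • u)

/-- The isotropic vector completing a frame. -/
noncomputable def isotropicTransversal (n z e f : Fin 4 → ℝ) : Fin 4 → ℝ :=
  (-(1 / pairing g n z)) • z + (pairing g z f / pairing g n z) • e
    + (pairing g z e / pairing g n z) • f
    + ((1 / 2 * pairing g z z - pairing g z f * pairing g z e) / pairing g n z ^ 2) • n

/-- An isotropic frame with first vector `n`, whose second and third vectors span the plane of `u`
and `v`. -/
noncomputable def isotropicBasis (n u v z : Fin 4 → ℝ) : Matrix (Fin 4) (Fin 4) ℝ :=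
  Matrix.of fun i j => ![n, isotropicLeft g u v, isotropicRight g u v,
    isotropicTransversal g n z (isotropicLeft g u v) (isotropicRight g u v)] j i

theorem transpose_mul_mul_apply (E : Matrix (Fin 4) (Fin 4) ℝ) (i j) :
    (Eᵀ * g * E) i j = pairing g (fun a => E a i) (fun a => E a j) := by
  rw [mul_assoc, Matrix.mul_apply]
  rfl

variable {g}

/-- The plane of u and v has a form with positive discriminant, whose two isotropic lines are given
by the roots of a quadratic equation; z is then corrected to be isotropic and orthogonal to both.
The formulas use only arithmetic and one square root, so that they respect smoothness and jets. -/
theorem isotropicBasis_gram (hg : gᵀ = g) {n u v z : Fin 4 → ℝ} (hnn : pairing g n n = 0)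
    (hnu : pairing g n u = 0) (hnv : pairing g n v = 0) (hnz : pairing g n z ≠ 0)
    (hd : 0 < pairing g u v ^ 2 - pairing g u u * pairing g v v)
    (hb : pairing g u v + discRoot g u v ≠ 0) :
    (isotropicBasis g n u v z)ᵀ * g * isotropicBasis g n u v z = isotropicGram := by
  have hs : discRoot g u v ^ 2 = pairing g u v ^ 2 - pairing g u u * pairing g v v :=
    Real.sq_sqrt hd.le
  have hs0 : discRoot g u v ≠ 0 := (Real.sqrt_pos.2 hd).ne'
  set e := isotropicLeft g u v with he
  set f := isotropicRight g u v with hf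
  set w := isotropicTransversal g n z e f with hw
  have c := pairing_comm g hg
  have cvu := c v u
  have l : ∀ x, pairing g x e = 1 / 2 * ((pairing g u v + discRoot g u v) * pairing g x u
      - pairing g u u * pairing g x v) := by
    intro x
    simp only [he, isotropicLeft, pairing_sub_right, pairing_smul_right]
  have r : ∀ x, pairing g x f = (1 / (discRoot g u v ^ 2 * (pairing g u v + discRoot g u v))) *
      ((pairing g u v + discRoot g u v) * pairing g x v - pairing g v v * pairing g x u) := by
    intro x
    simp only [hf, isotropicRight, pairing_sub_right, pairing_smul_right]
  have ne : pairing g n e = 0 := by rw [l, hnu, hnv]; ring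
  have nf : pairing g n f = 0 := by rw [r, hnu, hnv]; ring
  have ee : pairing g e e = 0 := by
    rw [l, c e u, c e v, l, l, cvu]
    linear_combination (1 / 4) * pairing g u u * hs
  have ff : pairing g f f = 0 := by
    rw [r, c f u, c f v, r, r, cvu]
    have : (pairing g u v + discRoot g u v) * ((pairing g u v + discRoot g u v) * pairing g v v
        - pairing g v v * pairing g u v) - pairing g v v * ((pairing g u v + discRoot g u v)
        * pairing g u v - pairing g v v * pairing g u u) = 0 := by
      linear_combination pairing g v v * hs
    linear_combination (1 / (discRoot g u v ^ 2 * (pairing g u v + discRoot g u v))) ^ 2 * this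
  have ef : pairing g e f = 1 := by
    rw [c, l, c f u, c f v, r, r, cvu]
    field_simp
    linear_combination (-pairing g u v - 2 * discRoot g u v) * hs
  have t : ∀ x, pairing g x w = (-(1 / pairing g n z)) * pairing g x z
      + (pairing g z f / pairing g n z) * pairing g x e
      + (pairing g z e / pairing g n z) * pairing g x f
      + ((1 / 2 * pairing g z z - pairing g z f * pairing g z e) / pairing g n z ^ 2)
        * pairing g x n := by
    intro x
    simp only [hw, isotropicTransversal, pairing_add_right, pairing_smul_right]
  have en : pairing g e n = 0 := by rw [c, ne]
  have fn : pairing g f n = 0 := by rw [c, nf]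
  have fe : pairing g f e = 1 := by rw [c, ef]
  have nw : pairing g n w = -1 := by
    rw [t, ne, nf, hnn]; field_simp; ring
  have ew : pairing g e w = 0 := by
    rw [t, ee, ef, en, c e z]; ring
  have fw : pairing g f w = 0 := by
    rw [t, ff, fe, fn, c f z]; ring
  have zw := t z
  have ww : pairing g w w = 0 := by
    rw [t w, c w z, c w e, c w f, c w n, zw, ew, fw, nw, c z n]
    field_simp
    ring
  have wn : pairing g w n = -1 := by rw [c, nw]
  have we : pairing g w e = 0 := by rw [c, ew]
  have wf : pairing g w f = 0 := by rw [c, fw]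
  ext i j
  rw [transpose_mul_mul_apply]
  have col : ∀ j, (fun a => isotropicBasis g n u v z a j) = ![n, e, f, w] j := fun j => rfl
  rw [col, col]
  fin_cases i <;> fin_cases j <;> simp [isotropicGram] <;> assumption

/-- A basis isotropic from the start is not changed. -/
theorem isotropicBasis_self {P : Matrix (Fin 4) (Fin 4) ℝ}
    (h : Pᵀ * g * P = isotropicGram) :
    isotropicBasis g (fun a => P a 0) (fun a => P a 1) (fun a => P a 2) (fun a => P a 3) = P := by
  have p : ∀ i j, pairing g (fun a => P a i) (fun a => P a j) = isotropicGram i j := fun i j => by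
    rw [← transpose_mul_mul_apply, h]
  have hs : discRoot g (fun a => P a 1) (fun a => P a 2) = 1 := by
    simp [discRoot, p, isotropicGram]
  have e : isotropicLeft g (fun a => P a 1) (fun a => P a 2) = fun a => P a 1 := by
    simp [isotropicLeft, hs, p, isotropicGram, smul_smul]; norm_num
  have f : isotropicRight g (fun a => P a 1) (fun a => P a 2) = fun a => P a 2 := by
    simp [isotropicRight, hs, p, isotropicGram, smul_smul]
  have w : isotropicTransversal g (fun a => P a 0) (fun a => P a 3) (fun a => P a 1)
      (fun a => P a 2) = fun a => P a 3 := by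
    simp [isotropicTransversal, p, isotropicGram]
  ext i j
  rw [isotropicBasis, e, f, w]
  fin_cases j <;> rfl

/-- The frame of the six-dimensional space extending a frame of the tangent space. -/
noncomputable def extendBasis (E : Matrix (Fin 4) (Fin 4) ℝ) : Matrix (Fin 6) (Fin 6) ℝ :=
  ofCols (tvec 1 0 0) (fun j => tvec 0 (fun i => E i j) 0) (tvec 0 0 1)

theorem extendBasis_gram {E : Matrix (Fin 4) (Fin 4) ℝ} (h : Eᵀ * g * E = isotropicGram) :
    (extendBasis E)ᵀ * gramOf g * extendBasis E = gramOf isotropicGram := by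
  have p : ∀ i j, (fun a => E a i) ⬝ᵥ (g *ᵥ fun a => E a j) = isotropicGram i j := fun i j => by
    rw [← h, transpose_mul_mul_apply]; rfl
  have z : (fun _ : Fin 4 => (0 : ℝ)) = 0 := rfl
  ext a b
  rw [gram_pair]
  revert a b
  refine forall_six (forall_six ?_ (fun j => ?_) ?_) (fun i => forall_six ?_ (fun j => ?_) ?_)
    (forall_six ?_ (fun j => ?_) ?_) <;> simp [extendBasis, p, z, gramOf]

end Pairing

/-- An isotropic vector is the first vector of a positively oriented isotropic frame. -/
theorem exists_isotropic_completion {g P : Matrix (Fin 4) (Fin 4) ℝ} (hP : P.det ≠ 0)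
    (h : Pᵀ * g * P = isotropicGram) {n : Fin 4 → ℝ} (hn : n ≠ 0) (hnn : pairing g n n = 0) :
    ∃ E : Matrix (Fin 4) (Fin 4) ℝ, 0 < E.det ∧ Eᵀ * g * E = isotropicGram ∧
      ∀ i, E i 0 = n i := by
  wlog hpos : 0 < P.det generalizing P
  -- Exchanging the second and third vectors preserves the Gram matrix and reverses the orientation.
  · let S : Matrix (Fin 4) (Fin 4) ℝ := !![1, 0, 0, 0; 0, 0, 1, 0; 0, 1, 0, 0; 0, 0, 0, 1]
    have hS : S.det = -1 := by
      simp [S, Matrix.det_succ_row_zero, Fin.sum_univ_succ, Fin.succAbove]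
    have hSg : Sᵀ * isotropicGram * S = isotropicGram := by
      ext i j
      fin_cases i <;> fin_cases j <;>
        simp [S, isotropicGram, Matrix.mul_apply, Fin.sum_univ_four]
    refine this (P := P * S) ?_ ?_ ?_
    · rw [Matrix.det_mul, hS]; simpa using hP
    · rw [Matrix.transpose_mul, ← hSg, ← h]; simp only [mul_assoc]
    · rw [Matrix.det_mul, hS]
      have := lt_of_le_of_ne (not_lt.1 hpos) hP
      linarith
  have hu := isUnit_iff_ne_zero.2 hP
  obtain ⟨ν, rfl⟩ : ∃ ν, P *ᵥ ν = n := ⟨P⁻¹ *ᵥ n, by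
    rw [Matrix.mulVec_mulVec, Matrix.mul_nonsing_inv _ hu, Matrix.one_mulVec]⟩
  have hν : ν ≠ 0 := by rintro rfl; simp at hn
  have hq : ν 1 * ν 2 = ν 0 * ν 3 := by
    have e : pairing g (P *ᵥ ν) (P *ᵥ ν) = pairing isotropicGram ν ν := by
      rw [← h, pairing, pairing, Matrix.mulVec_mulVec, ← Matrix.mulVec_mulVec, ← Matrix.mulVec_mulVec,
        ← Matrix.mulVec_mulVec, Matrix.dotProduct_mulVec ν, Matrix.vecMul_transpose]
    rw [e] at hnn
    simp [pairing, isotropicGram, Matrix.mulVec, dotProduct, Fin.sum_univ_four] at hnn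
    linarith
  -- Up to a factor the quadratic form is the determinant of a 2×2 matrix with entries ν, so an
  -- isotropic vector is a matrix of rank at most one, that is, a tensor product.
  obtain ⟨a, b, c, d, h0, h1, h2, h3⟩ : ∃ a b c d : ℝ,
      ν 0 = a * c ∧ ν 1 = a * d ∧ ν 2 = b * c ∧ ν 3 = b * d := by
    by_cases z0 : ν 0 = 0
    · by_cases z1 : ν 1 = 0
      · exact ⟨0, 1, ν 2, ν 3, by simp [z0], by simp [z1], by simp, by simp⟩
      · refine ⟨1, ν 3 / ν 1, ν 0, ν 1, by simp, by simp, ?_, by field_simp⟩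
        field_simp; linear_combination hq
    · refine ⟨1, ν 2 / ν 0, ν 0, ν 1, by simp, by simp, by field_simp, ?_⟩
      field_simp; linear_combination -hq
  have hab : a ^ 2 + b ^ 2 ≠ 0 := by
    intro hz
    have ha : a = 0 := by nlinarith [sq_nonneg a, sq_nonneg b]
    have hb : b = 0 := by nlinarith [sq_nonneg a, sq_nonneg b]
    exact hν (by ext i; fin_cases i <;> simp [h0, h1, h2, h3, ha, hb])
  have hcd : c ^ 2 + d ^ 2 ≠ 0 := by
    intro hz
    have ha : c = 0 := by nlinarith [sq_nonneg c, sq_nonneg d]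
    have hb : d = 0 := by nlinarith [sq_nonneg c, sq_nonneg d]
    exact hν (by ext i; fin_cases i <;> simp [h0, h1, h2, h3, ha, hb])
  obtain ⟨a', b', hab'⟩ : ∃ a' b', a * b' - b * a' = 1 :=
    ⟨-b / (a ^ 2 + b ^ 2), a / (a ^ 2 + b ^ 2), by field_simp; ring⟩
  obtain ⟨c', d', hcd'⟩ : ∃ c' d', c * d' - d * c' = 1 :=
    ⟨-d / (c ^ 2 + d ^ 2), c / (c ^ 2 + d ^ 2), by field_simp; ring⟩
  -- The Kronecker product of two matrices of determinant one, whose first columns are (a, b) and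
  -- (c, d). Such products preserve the form and have determinant one.
  let S : Matrix (Fin 4) (Fin 4) ℝ := !![a * c, a * c', a' * c, a' * c';
    a * d, a * d', a' * d, a' * d'; b * c, b * c', b' * c, b' * c'; b * d, b * d', b' * d, b' * d']
  have hS : S.det = 1 := by
    have : S.det = (a * b' - b * a') ^ 2 * (c * d' - d * c') ^ 2 := by
      simp [S, Matrix.det_succ_row_zero, Fin.sum_univ_succ, Fin.succAbove]
      ring
    rw [this, hab', hcd']; norm_num
  have hSg : Sᵀ * isotropicGram * S = isotropicGram := by
    have k : (a * b' - b * a') * (c * d' - d * c') = 1 := by rw [hab', hcd', one_mul]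
    ext i j
    fin_cases i <;> fin_cases j <;>
      simp [S, isotropicGram, Matrix.mul_apply, Fin.sum_univ_four] <;>
      first | ring1 | linear_combination k | linear_combination -k
  refine ⟨P * S, ?_, ?_, fun i => ?_⟩
  · rw [Matrix.det_mul, hS, mul_one]; exact hpos
  · rw [Matrix.transpose_mul, ← hSg, ← h]; simp only [mul_assoc]
  · rw [Matrix.mul_apply]
    change ∑ k, P i k * S k 0 = ∑ k, P i k * ν k
    refine Finset.sum_congr rfl fun k _ => ?_
    congr 1
    fin_cases k <;> simp [S, h0, h1, h2, h3]

section Jets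
variable {n : ℕ} {y₀ : Fin n → ℝ} {k : ℕ} {g g' : (Fin n → ℝ) → Matrix (Fin 4) (Fin 4) ℝ}

/-- The components of two vector-valued functions have the same jets. -/
def VecJetEq (y₀ : Fin n → ℝ) (k : ℕ) (x x' : (Fin n → ℝ) → Fin 4 → ℝ) : Prop :=
  ∀ i, JetEq y₀ k (fun y => x y i) (fun y => x' y i)

theorem VecJetEq.value {x x' : (Fin n → ℝ) → Fin 4 → ℝ} (h : VecJetEq y₀ k x x') :
    x y₀ = x' y₀ := funext fun i => (h i).value

theorem VecJetEq.add {x x' y y' : (Fin n → ℝ) → Fin 4 → ℝ} (h : VecJetEq y₀ k x x')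
    (h' : VecJetEq y₀ k y y') : VecJetEq y₀ k (fun t => x t + y t) (fun t => x' t + y' t) :=
  fun i => (h i).add (h' i)

theorem VecJetEq.sub {x x' y y' : (Fin n → ℝ) → Fin 4 → ℝ} (h : VecJetEq y₀ k x x')
    (h' : VecJetEq y₀ k y y') : VecJetEq y₀ k (fun t => x t - y t) (fun t => x' t - y' t) :=
  fun i => (h i).sub (h' i)

theorem VecJetEq.smul {r r' : (Fin n → ℝ) → ℝ} {x x' : (Fin n → ℝ) → Fin 4 → ℝ}
    (hr : JetEq y₀ k r r') (h : VecJetEq y₀ k x x') :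
    VecJetEq y₀ k (fun t => r t • x t) (fun t => r' t • x' t) :=
  fun i => hr.mul (h i)

theorem JetEq.pairing (hg : MatJetEq y₀ k g g') {x x' y y' : (Fin n → ℝ) → Fin 4 → ℝ}
    (hx : VecJetEq y₀ k x x') (hy : VecJetEq y₀ k y y') :
    JetEq y₀ k (fun t => pairing (g t) (x t) (y t)) (fun t => pairing (g' t) (x' t) (y' t)) := by
  simp only [CO22.pairing, dotProduct]
  exact JetEq.sum _ fun i _ => (hx i).mul (hg.mulVec hy i)

/-- The conditions under which `isotropicBasis` is a positively oriented isotropic frame. -/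
structure ValidSeed (g : Matrix (Fin 4) (Fin 4) ℝ) (n u v z : Fin 4 → ℝ) : Prop where
  disc : 0 < pairing g u v ^ 2 - pairing g u u * pairing g v v
  sum : pairing g u v + discRoot g u v ≠ 0
  transversal : pairing g n z ≠ 0
  pos : 0 < (isotropicBasis g n u v z).det

variable {a a' u u' v v' z z' : (Fin n → ℝ) → Fin 4 → ℝ}
  (hg : MatJetEq y₀ k g g') (ha : VecJetEq y₀ k a a') (hu : VecJetEq y₀ k u u')
  (hv : VecJetEq y₀ k v v') (hz : VecJetEq y₀ k z z')
  (h : ValidSeed (g y₀) (a y₀) (u y₀) (v y₀) (z y₀))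
include hg hu hv h

theorem JetEq.discRoot : JetEq y₀ k (fun y => discRoot (g y) (u y) (v y))
    (fun y => discRoot (g' y) (u' y) (v' y)) := by
  simp only [CO22.discRoot, pow_two]
  exact (((JetEq.pairing hg hu hv).mul (JetEq.pairing hg hu hv)).sub
    ((JetEq.pairing hg hu hu).mul (JetEq.pairing hg hv hv))).sqrt
    (by simpa only [pow_two] using h.disc)

theorem VecJetEq.isotropicLeft : VecJetEq y₀ k (fun y => isotropicLeft (g y) (u y) (v y))
    (fun y => isotropicLeft (g' y) (u' y) (v' y)) :=
  .smul (JetEq.const _) (.sub (.smul ((JetEq.pairing hg hu hv).add (JetEq.discRoot hg hu hv h)) hu)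
    (.smul (JetEq.pairing hg hu hu) hv))

theorem VecJetEq.isotropicRight : VecJetEq y₀ k (fun y => isotropicRight (g y) (u y) (v y))
    (fun y => isotropicRight (g' y) (u' y) (v' y)) := by
  have hs := JetEq.discRoot hg hu hv h
  have hp := (JetEq.pairing hg hu hv).add hs
  have h0 : CO22.discRoot (g y₀) (u y₀) (v y₀) ≠ 0 := (Real.sqrt_pos.2 h.disc).ne'
  refine .smul ?_ (.sub (.smul hp hv) (.smul (JetEq.pairing hg hv hv) hu))
  simp only [pow_two]
  exact (JetEq.const 1).div ((hs.mul hs).mul hp) (mul_ne_zero (mul_ne_zero h0 h0) h.sum)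

include ha hz in
theorem MatJetEq.isotropicBasis :
    MatJetEq y₀ k (fun y => isotropicBasis (g y) (a y) (u y) (v y) (z y))
      (fun y => isotropicBasis (g' y) (a' y) (u' y) (v' y) (z' y)) := by
  have he := VecJetEq.isotropicLeft hg hu hv h
  have hf := VecJetEq.isotropicRight hg hu hv h
  have p := JetEq.pairing hg ha hz
  have hw : VecJetEq y₀ k
      (fun y => isotropicTransversal (g y) (a y) (z y) (CO22.isotropicLeft (g y) (u y) (v y))
        (CO22.isotropicRight (g y) (u y) (v y)))
      (fun y => isotropicTransversal (g' y) (a' y) (z' y) (CO22.isotropicLeft (g' y) (u' y) (v' y))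
        (CO22.isotropicRight (g' y) (u' y) (v' y))) := by
    have ze := JetEq.pairing hg hz he
    have zf := JetEq.pairing hg hz hf
    refine .add (.add (.add (.smul ((JetEq.const 1).div p h.transversal).neg hz)
      (.smul (zf.div p h.transversal) he)) (.smul (ze.div p h.transversal) hf)) (.smul ?_ ha)
    simp only [pow_two]
    exact (((JetEq.const _).mul (JetEq.pairing hg hz hz)).sub (zf.mul ze)).div (p.mul p)
      (mul_ne_zero h.transversal h.transversal)
  intro i j
  fin_cases j
  exacts [ha i, he i, hf i, hw i]

include ha hz in
theorem ValidSeed.congr : ValidSeed (g' y₀) (a' y₀) (u' y₀) (v' y₀) (z' y₀) := by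
  rw [← hg.value, ← ha.value, ← hu.value, ← hv.value, ← hz.value]
  exact h

end Jets

/-- Validity of seeds depending smoothly on a point is an open condition. -/
theorem ValidSeed.eventually {n : ℕ} {y₀ : Fin n → ℝ} {g : (Fin n → ℝ) → Matrix (Fin 4) (Fin 4) ℝ}
    {a u v z : (Fin n → ℝ) → Fin 4 → ℝ} (hg : MatJetEq y₀ 0 g g) (ha : VecJetEq y₀ 0 a a)
    (hu : VecJetEq y₀ 0 u u) (hv : VecJetEq y₀ 0 v v) (hz : VecJetEq y₀ 0 z z)
    (h : ValidSeed (g y₀) (a y₀) (u y₀) (v y₀) (z y₀)) :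
    ∀ᶠ y in nhds y₀, ValidSeed (g y) (a y) (u y) (v y) (z y) := by
  have c1 := (((JetEq.pairing hg hu hv).mul (JetEq.pairing hg hu hv)).sub
    ((JetEq.pairing hg hu hu).mul (JetEq.pairing hg hv hv))).left.continuousAt
  have c2 := ((JetEq.pairing hg hu hv).add (JetEq.discRoot hg hu hv h)).left.continuousAt
  have c3 := (JetEq.pairing hg ha hz).left.continuousAt
  have c4 := (MatJetEq.isotropicBasis hg ha hu hv hz h).det.left.continuousAt
  have hd := h.disc
  rw [pow_two] at hd
  filter_upwards [c1.eventually (lt_mem_nhds hd), c2.eventually_ne h.sum,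
    c3.eventually_ne h.transversal, c4.eventually (lt_mem_nhds h.pos)] with y h1 h2 h3 h4
  exact ⟨by rw [pow_two]; exact h1, h2, h3, h4⟩

/-! ### Frames adapted to a lightlike hypersurface -/

/-- The Jacobian matrix of a parametrization. -/
noncomputable def jac (F : (Fin 3 → ℝ) → Fin 4 → ℝ) (y : Fin 3 → ℝ) : Matrix (Fin 4) (Fin 3) ℝ :=
  Matrix.of fun i j => fderiv ℝ (fun z => F z i) y (Pi.single j 1)

theorem jac_mulVec (F : (Fin 3 → ℝ) → Fin 4 → ℝ) (y w : Fin 3 → ℝ) : jac F y *ᵥ w = vel F y w := by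
  ext i
  rw [vel, fderiv_sum_basis]
  simp [Matrix.mulVec, dotProduct, jac, mul_comm]

/-- A field of isotropic directions of a lightlike hypersurface. -/
noncomputable def nullField (G : (Fin 4 → ℝ) → Matrix (Fin 4) (Fin 4) ℝ)
    (F : (Fin 3 → ℝ) → Fin 4 → ℝ) (c y : Fin 3 → ℝ) : Fin 4 → ℝ :=
  jac F y *ᵥ (((jac F y)ᵀ * G (F y) * jac F y).adjugate *ᵥ c)

/-- A field of first-order frames constructed from constant vectors. -/
noncomputable def seedBasis (G : (Fin 4 → ℝ) → Matrix (Fin 4) (Fin 4) ℝ)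
    (F : (Fin 3 → ℝ) → Fin 4 → ℝ) (c u v : Fin 3 → ℝ) (z : Fin 4 → ℝ) (y : Fin 3 → ℝ) :
    Matrix (Fin 4) (Fin 4) ℝ :=
  isotropicBasis (G (F y)) (nullField G F c y) (jac F y *ᵥ u) (jac F y *ᵥ v) z

/-- The conditions under which the seeds define an isotropic frame at a point. -/
def SeedAt (G : (Fin 4 → ℝ) → Matrix (Fin 4) (Fin 4) ℝ)
    (F : (Fin 3 → ℝ) → Fin 4 → ℝ) (c u v : Fin 3 → ℝ) (z : Fin 4 → ℝ) (y : Fin 3 → ℝ) : Prop :=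
  ValidSeed (G (F y)) (nullField G F c y) (jac F y *ᵥ u) (jac F y *ᵥ v) z

section SeedJets
variable {G G' : (Fin 4 → ℝ) → Matrix (Fin 4) (Fin 4) ℝ} {F F' : (Fin 3 → ℝ) → Fin 4 → ℝ}
  {y₀ : Fin 3 → ℝ} {k : ℕ} (hG : MatJetEq (F y₀) k G G')
  (hF : ∀ i, JetEq y₀ (k + 1) (fun y => F y i) (fun y => F' y i))
include hF

theorem jac_jet : MatJetEq y₀ k (jac F) (jac F') := fun i j => (hF i).deriv _

include hG

theorem metric_jet : MatJetEq y₀ k (fun y => G (F y)) (fun y => G' (F' y)) :=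
  fun i j => (hG i j).comp fun l => (hF l).pred

theorem nullField_jet (c) : VecJetEq y₀ k (nullField G F c) (nullField G' F' c) :=
  (jac_jet hF).mulVec (MatJetEq.mulVec (((jac_jet hF).transpose.mul (metric_jet hG hF)).mul
    (jac_jet hF)).adjugate fun _ => JetEq.const _)

theorem SeedAt.congr {c u v : Fin 3 → ℝ} {z : Fin 4 → ℝ} (h : SeedAt G F c u v z y₀) :
    SeedAt G' F' c u v z y₀ :=
  ValidSeed.congr (metric_jet hG hF) (nullField_jet hG hF c)
    ((jac_jet hF).mulVec fun _ => JetEq.const (u _)) ((jac_jet hF).mulVec fun _ => JetEq.const (v _))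
    (z := fun _ => z) (z' := fun _ => z) (fun _ => JetEq.const _) h

theorem seedBasis_jet {c u v : Fin 3 → ℝ} {z : Fin 4 → ℝ} (h : SeedAt G F c u v z y₀) :
    MatJetEq y₀ k (seedBasis G F c u v z) (seedBasis G' F' c u v z) :=
  MatJetEq.isotropicBasis (metric_jet hG hF) (nullField_jet hG hF c)
    ((jac_jet hF).mulVec fun _ => JetEq.const _) ((jac_jet hF).mulVec fun _ => JetEq.const _)
    (z := fun _ => z) (z' := fun _ => z) (fun _ => JetEq.const _) h

end SeedJets

theorem MatJetEq.extendBasis {n : ℕ} {y₀ : Fin n → ℝ} {k : ℕ}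
    {E E' : (Fin n → ℝ) → Matrix (Fin 4) (Fin 4) ℝ} (h : MatJetEq y₀ k E E') :
    MatJetEq y₀ k (fun y => extendBasis (E y)) (fun y => extendBasis (E' y)) := by
  refine forall_six (forall_six ?_ (fun j => ?_) ?_) (fun i => forall_six ?_ (fun j => ?_) ?_)
    (forall_six ?_ (fun j => ?_) ?_) <;> simp only [CO22.extendBasis, ofCols_zero, ofCols_mid,
      ofCols_five, tvec_zero, tvec_mid, tvec_five]
  all_goals first | exact h i j | exact JetEq.const _

theorem pairing_mulVec {κ : Type*} [Fintype κ] (g : Matrix (Fin 4) (Fin 4) ℝ)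
    (J : Matrix (Fin 4) κ ℝ) (a b : κ → ℝ) :
    pairing g (J *ᵥ a) (J *ᵥ b) = a ⬝ᵥ ((Jᵀ * g * J) *ᵥ b) := by
  rw [pairing, ← Matrix.mulVec_mulVec, ← Matrix.mulVec_mulVec, Matrix.dotProduct_mulVec a,
    Matrix.vecMul_transpose]

section Existence
variable {G : (Fin 4 → ℝ) → Matrix (Fin 4) (Fin 4) ℝ} {V : Set (Fin 4 → ℝ)}
  {F : (Fin 3 → ℝ) → Fin 4 → ℝ} {U : Set (Fin 3 → ℝ)} (hS : LocalSurface G V F U)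
include hS

theorem LocalSurface.contDiffAt {y} (hy : y ∈ U) (i) : ContDiffAt ℝ ∞ (fun y => F y i) y :=
  (hS.smooth i).contDiffAt (hS.isOpen.mem_nhds hy)

theorem LocalSurface.metric_contDiffAt {y} (hy : y ∈ U) (i j) :
    ContDiffAt ℝ ∞ (fun x => G x i j) (F y) :=
  (hS.metric.smooth i j).contDiffAt (hS.metric.isOpen.mem_nhds (hS.mapsTo hy))

theorem LocalSurface.gram_det {y} (hy : y ∈ U) : ((jac F y)ᵀ * G (F y) * jac F y).det = 0 := by
  obtain ⟨w, hw, h⟩ := hS.lightlike y hy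
  refine Matrix.exists_mulVec_eq_zero_iff.1 ⟨w, hw, ?_⟩
  refine dotProduct_eq_zero _ fun w' => ?_
  rw [dotProduct_comm, ← pairing_mulVec,
    pairing_comm _ (hS.metric.transpose (hS.mapsTo hy)), jac_mulVec, jac_mulVec]
  exact h w'

/-- The induced metric K has determinant zero, so K · adj K = 0: every column of the adjugate lies
in the kernel of K. This gives the isotropic direction by a polynomial formula. -/
theorem LocalSurface.nullField_pairing {y} (hy : y ∈ U) (c w) :
    pairing (G (F y)) (nullField G F c y) (vel F y w) = 0 := by
  rw [pairing_comm _ (hS.metric.transpose (hS.mapsTo hy)), ← jac_mulVec, nullField, pairing_mulVec,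
    Matrix.mulVec_mulVec, Matrix.mul_adjugate, hS.gram_det hy]
  simp

theorem SeedAt.gram {c u v : Fin 3 → ℝ} {z : Fin 4 → ℝ} {y} (hy : y ∈ U)
    (h : SeedAt G F c u v z y) :
    (seedBasis G F c u v z y)ᵀ * G (F y) * seedBasis G F c u v z y = isotropicGram := by
  have p := hS.nullField_pairing hy c
  simp only [← jac_mulVec] at p
  exact isotropicBasis_gram (hS.metric.transpose (hS.mapsTo hy)) (p _) (p _) (p _) h.transversal
    h.disc h.sum

theorem seedBasis_localFrame {W : Set (Fin 3 → ℝ)} (hWU : W ⊆ U) {c u v : Fin 3 → ℝ}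
    {z : Fin 4 → ℝ} (h : ∀ y ∈ W, SeedAt G F c u v z y) :
    LocalFrame G F W (fun y => extendBasis (seedBasis G F c u v z y)) where
  smooth := fun i j y hy => (((seedBasis_jet (k := 0)
    (fun a b => JetEq.refl (hS.metric_contDiffAt (hWU hy) a b))
    (fun a => JetEq.refl (hS.contDiffAt (hWU hy) a)) (h y hy)).extendBasis i j).left).contDiffWithinAt
  vertex := fun y _ => by
    refine forall_six (fun h => absurd rfl h) (fun i _ => ?_) (fun _ => ?_) <;> simp [extendBasis]
  gram := fun y hy => extendBasis_gram (SeedAt.gram hS (hWU hy) (h y hy))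
  oriented := fun y hy => by
    have : (Matrix.of fun i j : Fin 4 => extendBasis (seedBasis G F c u v z y) (mid i) (mid j))
        = seedBasis G F c u v z y := by ext i j; simp [extendBasis]
    rw [this]
    exact (h y hy).pos

/-- Velocities are orthogonal to the isotropic direction n, and in the isotropic frame the product
with n reads off the fourth component up to sign. -/
theorem seedBasis_tangent {c u v : Fin 3 → ℝ} {z : Fin 4 → ℝ} (h : ∀ y ∈ U, SeedAt G F c u v z y)
    {y} (hy : y ∈ U) (w) :
    pull (connection G) F (fun y => extendBasis (seedBasis G F c u v z y)) y w 4 0 = 0 := by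
  have e := vel_eq hS (seedBasis_localFrame hS subset_rfl h) hy w
  have p := hS.nullField_pairing hy c w
  set W := fun k => pull (connection G) F (fun y => extendBasis (seedBasis G F c u v z y)) y w (mid k) 0
    with hW
  have d : dualMatrix (extendBasis (seedBasis G F c u v z y)) = seedBasis G F c u v z y := by
    ext i j; simp [dualMatrix, extendBasis]
  have g := SeedAt.gram hS hy (h y hy)
  have q : ∀ j, pairing (G (F y)) (nullField G F c y) (fun a => seedBasis G F c u v z y a j)
      = isotropicGram 0 j := fun j => by
    rw [← g, transpose_mul_mul_apply]; rfl
  have s : seedBasis G F c u v z y *ᵥ W = ∑ j, W j • fun a => seedBasis G F c u v z y a j := by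
    ext i
    simp [Matrix.mulVec, dotProduct, mul_comm]
  rw [e, d, s, Fin.sum_univ_four] at p
  simp only [pairing_add_right, pairing_smul_right, q] at p
  simp [isotropicGram] at p
  exact p

/-- The tangent subspace is contained in the orthogonal complement of n, and both have dimension
three. -/
theorem exists_vel_eq {y} (hy : y ∈ U) {n x : Fin 4 → ℝ} (hn : n ≠ 0)
    (h : ∀ w, pairing (G (F y)) n (vel F y w) = 0) (hx : pairing (G (F y)) n x = 0) :
    ∃ w, vel F y w = x := by
  let φ : (Fin 4 → ℝ) →ₗ[ℝ] ℝ :=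
    { toFun := pairing (G (F y)) n
      map_add' := pairing_add_right _ n
      map_smul' := fun r x => pairing_smul_right _ r n x }
  have hφ : φ ≠ 0 := by
    intro h0
    refine hn (dotProduct_eq_zero _ fun x => ?_)
    have := LinearMap.congr_fun h0 ((G (F y))⁻¹ *ᵥ x)
    change n ⬝ᵥ (G (F y) *ᵥ ((G (F y))⁻¹ *ᵥ x)) = 0 at this
    rwa [Matrix.mulVec_mulVec, hS.metric.mul_inv (hS.mapsTo hy), Matrix.one_mulVec] at this
  have hinj : Function.Injective (jac F y).mulVecLin := by
    refine (injective_iff_map_eq_zero _).2 fun w hw => hS.immersion y hy w ?_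
    rw [← jac_mulVec]
    exact hw
  have hle : LinearMap.range (jac F y).mulVecLin ≤ LinearMap.ker φ := by
    rintro _ ⟨w, rfl⟩
    rw [LinearMap.mem_ker, Matrix.mulVecLin_apply, jac_mulVec]
    exact h w
  have e := Submodule.eq_of_le_of_finrank_eq hle (by
    have h1 := LinearMap.finrank_range_of_inj hinj
    have h2 := Module.Dual.finrank_ker_add_one_of_ne_zero hφ
    rw [Module.finrank_fin_fun] at h1 h2
    omega)
  have : x ∈ LinearMap.range (jac F y).mulVecLin := by rw [e]; exact hx
  obtain ⟨w, hw⟩ := this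
  exact ⟨w, by rw [← jac_mulVec]; exact hw⟩

/-- At one point the seeds are read off from an isotropic frame E that starts with the isotropic
tangent vector: its second and third vectors are tangent, and the fourth serves as transversal. The
construction then reproduces E, whose orientation is positive. -/
theorem exists_seedAt {y₀} (hy : y₀ ∈ U) : ∃ c u v z, SeedAt G F c u v z y₀ := by
  obtain ⟨w, hw, h⟩ := hS.lightlike y₀ hy
  obtain ⟨P, hP, hPg⟩ := hS.signature _ (hS.mapsTo hy)
  have hn : vel F y₀ w ≠ 0 := fun e => hw (hS.immersion y₀ hy w e)
  obtain ⟨E, hE, hEg, hE0⟩ := exists_isotropic_completion hP hPg hn (h w)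
  have p : ∀ i j, pairing (G (F y₀)) (fun a => E a i) (fun a => E a j) = isotropicGram i j :=
    fun i j => by rw [← transpose_mul_mul_apply, hEg]
  have e0 : (fun a => E a 0) = vel F y₀ w := funext hE0
  obtain ⟨u, hu⟩ := exists_vel_eq hS hy hn h (x := fun a => E a 1) (by rw [← e0, p]; rfl)
  obtain ⟨v, hv⟩ := exists_vel_eq hS hy hn h (x := fun a => E a 2) (by rw [← e0, p]; rfl)
  let R : Matrix (Fin 3) (Fin 3) ℝ := Matrix.of fun i j => ![w, u, v] j i
  have hR0 : R *ᵥ Pi.single 0 1 = w := by ext i; simp [R]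
  have hJR : jac F y₀ * R = Matrix.of fun a (j : Fin 3) => E a j.castSucc := by
    ext a j
    have : (jac F y₀ * R) a j = (jac F y₀ *ᵥ ![w, u, v] j) a := rfl
    rw [this, jac_mulVec]
    fin_cases j
    exacts [(hE0 a).symm, congrFun hu a, congrFun hv a]
  have hR : R.det ≠ 0 := by
    intro h0
    obtain ⟨x, hx, hx0⟩ := Matrix.exists_mulVec_eq_zero_iff.2 h0
    have h1 : E *ᵥ ![x 0, x 1, x 2, 0] = 0 := by
      have : (jac F y₀ * R) *ᵥ x = 0 := by rw [← Matrix.mulVec_mulVec, hx0, Matrix.mulVec_zero]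
      rw [hJR] at this
      ext a
      have := congrFun this a
      simp [Matrix.mulVec, dotProduct, Fin.sum_univ_succ] at this ⊢
      exact this
    have h2 := Matrix.eq_zero_of_mulVec_eq_zero hE.ne' h1
    refine hx ?_
    ext i
    fin_cases i
    exacts [congrFun h2 0, congrFun h2 1, congrFun h2 2]
  have hK : Rᵀ * ((jac F y₀)ᵀ * G (F y₀) * jac F y₀) * R = !![0, 0, 0; 0, 0, 1; 0, 1, 0] := by
    have : Rᵀ * ((jac F y₀)ᵀ * G (F y₀) * jac F y₀) * R
        = (jac F y₀ * R)ᵀ * G (F y₀) * (jac F y₀ * R) := by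
      rw [Matrix.transpose_mul]; simp only [Matrix.mul_assoc]
    rw [this, hJR]
    ext i j
    have q : ((Matrix.of fun a (j : Fin 3) => E a j.castSucc)ᵀ * G (F y₀)
        * Matrix.of fun a (j : Fin 3) => E a j.castSucc) i j = isotropicGram i.castSucc j.castSucc := by
      rw [← p, Matrix.mul_assoc, Matrix.mul_apply]
      rfl
    rw [q]
    fin_cases i <;> fin_cases j <;> rfl
  -- In the basis w, u, v the induced metric is a hyperbolic plane plus a zero line, and its
  -- adjugate maps the first basis vector to its negative. Multiplicativity of the adjugate and R ·
  -- adj R = det R turn this into a constant vector that the original adjugate maps to w.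
  have hadj := congrArg (fun K => R *ᵥ (Matrix.adjugate K *ᵥ Pi.single 0 1)) hK
  have hK0 : (!![0, 0, 0; 0, 0, 1; 0, 1, 0] : Matrix (Fin 3) (Fin 3) ℝ).adjugate *ᵥ Pi.single 0 1
      = -Pi.single 0 1 := by
    ext i
    fin_cases i <;> simp [Matrix.adjugate_fin_three]
  simp only [hK0, Matrix.adjugate_mul_distrib, Matrix.mulVec_mulVec, Matrix.mulVec_neg, hR0] at hadj
  rw [← Matrix.mul_assoc, Matrix.mul_adjugate, Matrix.smul_mul, Matrix.one_mul] at hadj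
  have hc : ((jac F y₀)ᵀ * G (F y₀) * jac F y₀).adjugate *ᵥ
      ((-R.det) • (Rᵀ.adjugate *ᵥ Pi.single 0 1)) = w := by
    rw [Matrix.mulVec_smul, Matrix.mulVec_mulVec, neg_smul, ← Matrix.smul_mulVec, hadj, neg_neg]
  refine ⟨(-R.det) • (Rᵀ.adjugate *ᵥ Pi.single 0 1), u, v, fun a => E a 3, ?_⟩
  rw [SeedAt, nullField, hc, jac_mulVec, jac_mulVec, jac_mulVec, hu, hv, ← e0]
  refine ⟨?_, ?_, ?_, ?_⟩
  · simp [p, isotropicGram]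
  · simp [p, isotropicGram, discRoot]
  · simp [p, isotropicGram]
  · rw [isotropicBasis_self hEg]
    exact hE

theorem exists_seed_domain {y₀} (hy : y₀ ∈ U) {c u v z} (h : SeedAt G F c u v z y₀) :
    ∃ W ⊆ U, IsOpen W ∧ y₀ ∈ W ∧ ∀ y ∈ W, SeedAt G F c u v z y := by
  have hG : MatJetEq (F y₀) 0 G G := fun a b => JetEq.refl (hS.metric_contDiffAt hy a b)
  have hF : ∀ i, JetEq y₀ (0 + 1) (fun y => F y i) (fun y => F y i) := fun a =>
    JetEq.refl (hS.contDiffAt hy a)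
  have ev := ValidSeed.eventually (metric_jet hG hF) (nullField_jet hG hF c)
    ((jac_jet hF).mulVec fun _ => JetEq.const (u _)) ((jac_jet hF).mulVec fun _ => JetEq.const (v _))
    (z := fun _ => z) (fun _ => JetEq.const _) h
  obtain ⟨W, hW, hWo, hyW⟩ := eventually_nhds_iff.1 (ev.and (hS.isOpen.mem_nhds hy))
  exact ⟨W, fun y hy => (hW y hy).2, hWo, hyW, fun y hy => (hW y hy).1⟩

end Existence

/-! ### Jets of the forms of a moving frame

The tensor `P` contributes only to the entries of the connection form in the row `0` or the
column `5`, which do not enter the normalization; hence one derivative of the metric suffices. -/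

section LeviCivita
variable {G : (Fin 4 → ℝ) → Matrix (Fin 4) (Fin 4) ℝ} {F : (Fin 3 → ℝ) → Fin 4 → ℝ}
  {B : (Fin 3 → ℝ) → Matrix (Fin 6) (Fin 6) ℝ} {U : Set (Fin 3 → ℝ)}

theorem connection_sub_mul {g : Matrix (Fin 4) (Fin 4) ℝ} {b : Matrix (Fin 6) (Fin 6) ℝ}
    (hv : ∀ a, a ≠ 0 → b a 0 = 0) (hg : bᵀ * gramOf g * b = gramOf isotropicGram)
    (x w : Fin 4 → ℝ) : ∀ i j : Fin 6, j ≠ 5 → (i ≠ 0 ∨ j = 0) →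
    (connection G x w * b) i j = (connWith G (christoffel G) (fun _ => 0) x w * b) i j := by
  have h5 := frame_row_five hv hg
  simp only [mul_six]
  refine forall_six (forall_six ?_ (fun j => ?_) ?_) (fun i => forall_six ?_ (fun j => ?_) ?_)
    (forall_six ?_ (fun j => ?_) ?_) <;> intro hj hi <;>
    simp_all [connection, connWith]

theorem inv_col_zero {b : Matrix (Fin 6) (Fin 6) ℝ} (hv : ∀ a, a ≠ 0 → b a 0 = 0)
    (h0 : b 0 0 ≠ 0) (hd : b.det ≠ 0) {a : Fin 6} (ha : a ≠ 0) : b⁻¹ a 0 = 0 := by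
  have h := congrFun (congrFun (Matrix.nonsing_inv_mul b (isUnit_iff_ne_zero.2 hd)) a) 0
  rw [mul_six, hv 5 (by decide), Matrix.one_apply_ne ha] at h
  simpa [hv _ (mid_ne_zero _), h0] using h

/-- The frame matrix is block triangular, so multiplication by it and by its inverse keeps the
contribution of the Schouten tensor in the first row and the last column, and out of the first
column. -/
theorem LocalFrame.pull_eq (hB : LocalFrame G F U B) {y} (hy : y ∈ U) (w) {i j : Fin 6}
    (hj : j ≠ 5) (hi : i ≠ 0 ∨ j = 0) : pull (connection G) F B y w i j
      = pull (connWith G (christoffel G) fun _ => 0) F B y w i j := by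
  have hv := hB.vertex y hy
  have hg := hB.gram y hy
  have e := fun i => connection_sub_mul (G := G) hv hg (F y) (vel F y w) i j hj
  have z := fun {a} => inv_col_zero (a := a) hv (frame_zero_zero hv hg) (hB.det_ne hy)
  rw [pull, pull, mul_six, mul_six]
  simp only [Matrix.add_apply, e _ (Or.inl (mid_ne_zero _)), e 5 (Or.inl (by decide))]
  congr 2
  rcases hi with hi | hi
  · rw [z hi, zero_mul, zero_mul]
  · rw [e _ (Or.inr hi)]

end LeviCivita

section Jets
variable {G G' : (Fin 4 → ℝ) → Matrix (Fin 4) (Fin 4) ℝ} {F F' : (Fin 3 → ℝ) → Fin 4 → ℝ}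
  {B B' : (Fin 3 → ℝ) → Matrix (Fin 6) (Fin 6) ℝ} {y₀ : Fin 3 → ℝ} {k : ℕ}

theorem christoffel_jet {x : Fin 4 → ℝ} (hG : MatJetEq x (k + 1) G G') (h0 : (G x).det ≠ 0)
    (i j l) : JetEq x k (fun x => christoffel G x i j l) (fun x => christoffel G' x i j l) := by
  have p : ∀ m a b, JetEq x k (fun x => pd m (fun y => G y a b) x)
      (fun x => pd m (fun y => G' y a b) x) := fun m a b => (hG a b).deriv _
  exact (JetEq.const _).mul (JetEq.sum _ fun m _ => (hG.pred.inv h0 i m).mul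
    (((p _ _ _).add (p _ _ _)).sub (p _ _ _)))

theorem connWith_jet {m : ℕ} {y₀ : Fin m → ℝ} {g g' : (Fin m → ℝ) → Fin 4 → ℝ}
    {u u' : (Fin m → ℝ) → Fin 4 → ℝ}
    (hG : MatJetEq y₀ k (fun y => G (g y)) (fun y => G' (g' y)))
    (hΓ : ∀ i j l, JetEq y₀ k (fun y => christoffel G (g y) i j l)
      (fun y => christoffel G' (g' y) i j l)) (hu : VecJetEq y₀ k u u') :
    MatJetEq y₀ k (fun y => connWith G (christoffel G) (fun _ => 0) (g y) (u y))
      (fun y => connWith G' (christoffel G') (fun _ => 0) (g' y) (u' y)) := by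
  refine forall_six (forall_six ?_ (fun j => ?_) ?_) (fun i => forall_six ?_ (fun j => ?_) ?_)
    (forall_six ?_ (fun j => ?_) ?_) <;>
    simp only [connWith, ofCols_zero, ofCols_mid, ofCols_five, tvec_zero, tvec_mid, tvec_five,
      Matrix.zero_mulVec, Matrix.mulVec_zero, Pi.neg_apply, Pi.zero_apply, neg_zero]
  all_goals try exact JetEq.const _
  · exact hu i
  · exact JetEq.sum _ fun l _ => (hΓ i j l).mul (hu l)
  · exact hG.mulVec hu j

/-- The forms have the same jets, except for the entries involving the tensor `P`. -/
def FormJetEq (y₀ : Fin 3 → ℝ) (k : ℕ)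
    (Ω Ω' : (Fin 3 → ℝ) → (Fin 3 → ℝ) → Matrix (Fin 6) (Fin 6) ℝ) : Prop :=
  ∀ w i j, j ≠ 5 → (i ≠ 0 ∨ j = 0) → JetEq y₀ k (fun y => Ω y w i j) (fun y => Ω' y w i j)

/-- The connection form contains first derivatives of the metric, the immersion and the frame, so
exactly one order is lost. -/
theorem formJetEq_pull {U U' : Set (Fin 3 → ℝ)} (hU : IsOpen U) (hU' : IsOpen U') (hy : y₀ ∈ U)
    (hy' : y₀ ∈ U') (hBf : LocalFrame G F U B) (hBf' : LocalFrame G' F' U' B')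
    (h0 : (G (F y₀)).det ≠ 0) (hG : MatJetEq (F y₀) (k + 1) G G')
    (hF : ∀ i, JetEq y₀ (k + 1) (fun y => F y i) (fun y => F' y i))
    (hB : MatJetEq y₀ (k + 1) B B') :
    FormJetEq y₀ k (pull (connection G) F B) (pull (connection G') F' B') := by
  intro w i j hj hi
  have hv : VecJetEq y₀ k (fun y => vel F y w) (fun y => vel F' y w) := fun i => (hF i).deriv w
  have hg : MatJetEq y₀ k (fun y => G (F y)) (fun y => G' (F' y)) := fun a b =>
    (hG a b).pred.comp fun l => (hF l).pred
  have hΓ := fun i j l => (christoffel_jet hG h0 i j l).comp fun l => (hF l).pred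
  have := (hB.pred.inv (hBf.det_ne hy)).mul ((hB.matDeriv w).add
    ((connWith_jet hg hΓ hv).mul hB.pred))
  refine (this i j).congr ?_ ?_
  · filter_upwards [hU.mem_nhds hy] with y hy
    exact hBf.pull_eq hy w hj hi
  · filter_upwards [hU'.mem_nhds hy'] with y hy
    exact hBf'.pull_eq hy w hj hi

section Form
variable {Ω Ω' : (Fin 3 → ℝ) → (Fin 3 → ℝ) → Matrix (Fin 6) (Fin 6) ℝ} {U U' : Set (Fin 3 → ℝ)}
  (h : FirstOrderForm Ω U) (h' : FirstOrderForm Ω' U') (hy : y₀ ∈ U)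
  (hj : FormJetEq y₀ k Ω Ω')
include h hy hj

theorem eps_jet (l i) : JetEq y₀ k (fun y => eps Ω y l i) (fun y => eps Ω' y l i) := by
  have : MatJetEq y₀ k (coframe Ω) (coframe Ω') := fun a b =>
    hj _ _ 0 (by decide) (Or.inr rfl)
  exact this.inv (h.coframe_det_ne hy) i l

theorem fderiv_eps_jet {g g' : (Fin 3 → ℝ) → ℝ} (hg : JetEq y₀ (k + 1) g g') (l) :
    JetEq y₀ k (fun y => fderiv ℝ g y (eps Ω y l)) (fun y => fderiv ℝ g' y (eps Ω' y l)) := by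
  have e : ∀ (g : (Fin 3 → ℝ) → ℝ) y w, fderiv ℝ g y w = ∑ i, w i * fderiv ℝ g y (Pi.single i 1) :=
    fun g y w => fderiv_sum_basis _ _
  simp only [e g _ (eps Ω _ l), e g' _ (eps Ω' _ l)]
  exact JetEq.sum _ fun i _ => (eps_jet h hy hj l i).mul (hg.deriv _)

include h'

theorem eval_eps_jet (l) {a b : Fin 6} (hb : b ≠ 5) (ha : a ≠ 0 ∨ b = 0) :
    JetEq y₀ k (fun y => Ω y (eps Ω y l) a b) (fun y => Ω' y (eps Ω' y l) a b) := by
  have e : ∀ y, Ω y (eps Ω y l) a b = ∑ j, eps Ω y l j * Ω y (Pi.single j 1) a b := by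
    intro y; rw [h.linear]; simp [Matrix.sum_apply]
  have e' : ∀ y, Ω' y (eps Ω' y l) a b = ∑ j, eps Ω' y l j * Ω' y (Pi.single j 1) a b := by
    intro y; rw [h'.linear]; simp [Matrix.sum_apply]
  simp only [e, e']
  exact JetEq.sum _ fun j _ => (eps_jet h hy hj l j).mul (hj _ a b hb ha)

theorem lam_jet : JetEq y₀ k (lam22 Ω) (lam22 Ω') ∧ JetEq y₀ k (lam23 Ω) (lam23 Ω') ∧
    JetEq y₀ k (lam33 Ω) (lam33 Ω') :=
  ⟨eval_eps_jet h h' hy hj 1 (by decide) (Or.inl (by decide)),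
    eval_eps_jet h h' hy hj 1 (by decide) (Or.inl (by decide)),
    eval_eps_jet h h' hy hj 2 (by decide) (Or.inl (by decide))⟩

theorem rayTrace_jet : JetEq y₀ k (rayTrace Ω) (rayTrace Ω') :=
  (eval_eps_jet h h' hy hj 1 (by decide) (Or.inl (by decide))).add
    (eval_eps_jet h h' hy hj 2 (by decide) (Or.inl (by decide)))

theorem alpha22_jet (hl : JetEq y₀ (k + 1) (lam22 Ω) (lam22 Ω')) (l) :
    JetEq y₀ k (fun y => alpha22 Ω (lam22 Ω) y (eps Ω y l))
      (fun y => alpha22 Ω' (lam22 Ω') y (eps Ω' y l)) :=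
  (fderiv_eps_jet h hy hj hl l).add (hl.pred.mul
    (((eval_eps_jet h h' hy hj l (by decide) (Or.inr rfl)).sub ((JetEq.const 2).mul
      (eval_eps_jet h h' hy hj l (by decide) (Or.inl (by decide))))).sub
      (eval_eps_jet h h' hy hj l (by decide) (Or.inl (by decide)))))

theorem alpha33_jet (hl : JetEq y₀ (k + 1) (lam33 Ω) (lam33 Ω')) (l) :
    JetEq y₀ k (fun y => alpha33 Ω (lam33 Ω) y (eps Ω y l))
      (fun y => alpha33 Ω' (lam33 Ω') y (eps Ω' y l)) :=
  (fderiv_eps_jet h hy hj hl l).add (hl.pred.mul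
    (((eval_eps_jet h h' hy hj l (by decide) (Or.inr rfl)).add ((JetEq.const 2).mul
      (eval_eps_jet h h' hy hj l (by decide) (Or.inl (by decide))))).sub
      (eval_eps_jet h h' hy hj l (by decide) (Or.inl (by decide)))))

theorem fiberParams_jet (hl2 : JetEq y₀ (k + 1) (lam22 Ω) (lam22 Ω'))
    (hl3 : JetEq y₀ (k + 1) (lam33 Ω) (lam33 Ω')) (hD : localD Ω y₀ ≠ 0) (i) :
    JetEq y₀ k (fun y => fiberParams Ω y i) (fun y => fiberParams Ω' y i) := by
  have a2 := alpha22_jet h h' hy hj hl2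
  have a3 := alpha33_jet h h' hy hj hl3
  have h2 := hl2.pred
  have h3 := hl3.pred
  have hA : JetEq y₀ k (coeffA Ω) (coeffA Ω') := (JetEq.const _).mul (a2 0)
  have hB : JetEq y₀ k (coeffB Ω) (coeffB Ω') := (JetEq.const _).mul (a3 0)
  have hM : MatJetEq y₀ k
      (fun y => fiberMatrix (lam22 Ω y) (lam33 Ω y) (coeffA Ω y) (coeffB Ω y))
      (fun y => fiberMatrix (lam22 Ω' y) (lam33 Ω' y) (coeffA Ω' y) (coeffB Ω' y)) := by
    have c := fun r => JetEq.const (y₀ := y₀) (k := k) r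
    have s2 : JetEq y₀ k (fun y => -3 * lam22 Ω y ^ 2) (fun y => -3 * lam22 Ω' y ^ 2) := by
      simpa only [pow_two] using (c (-3)).mul (h2.mul h2)
    have s3 : JetEq y₀ k (fun y => -3 * lam33 Ω y ^ 2) (fun y => -3 * lam33 Ω' y ^ 2) := by
      simpa only [pow_two] using (c (-3)).mul (h3.mul h3)
    intro i j
    fin_cases i <;> fin_cases j
    exacts [(c 3).mul h2, (c 2).mul hA, c 0, s2, c 0, h2.mul h3, h2.neg, (c 2).mul hA, h3.neg,
      (c 2).mul hB, c 0, h2.mul h3, c 0, s3, (c 3).mul h3, (c 2).mul hB]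
  refine (hM.inv hD).mulVec (fun j => ?_) i
  fin_cases j
  exacts [a2 1, a2 2, a3 1, a3 2]

end Form

theorem unipotent_jet {p p' x₀ x₀' x₁ x₁' z₀ z₀' z₁ z₁' t t' : (Fin 3 → ℝ) → ℝ}
    (hp : JetEq y₀ k p p') (h1 : JetEq y₀ k x₀ x₀') (h2 : JetEq y₀ k x₁ x₁')
    (h3 : JetEq y₀ k z₀ z₀') (h4 : JetEq y₀ k z₁ z₁') (ht : JetEq y₀ k t t') :
    MatJetEq y₀ k (fun y => unipotent (p y) (x₀ y) (x₁ y) (z₀ y) (z₁ y) (t y))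
      (fun y => unipotent (p' y) (x₀' y) (x₁' y) (z₀' y) (z₁' y) (t' y)) := by
  have c := fun r => JetEq.const (y₀ := y₀) (k := k) r
  intro i j
  fin_cases i <;> fin_cases j
  exacts [c 1, hp, h1, h3, ht, (h1.mul h3).sub (hp.mul ht),
    c 0, c 1, h2, h4, h2.mul h4, (((h2.mul h3).add (h1.mul h4)).sub ((hp.mul h2).mul h4)).sub ht,
    c 0, c 0, c 1, c 0, h4, h3.sub (hp.mul h4),
    c 0, c 0, c 0, c 1, h2, h1.sub (hp.mul h2),
    c 0, c 0, c 0, c 0, c 1, hp.neg,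
    c 0, c 0, c 0, c 0, c 0, c 1]

/-- The canonical frame depends only on the data of fourth order. -/
theorem canonicalFrame_eq {V V' : Set (Fin 4 → ℝ)} {U U' : Set (Fin 3 → ℝ)}
    (hS : LocalSurface G V F U) (hS' : LocalSurface G' V' F' U') (hy : y₀ ∈ U) (hy' : y₀ ∈ U')
    (hB : LocalFrame G F U B) (hB' : LocalFrame G' F' U' B')
    (ht : ∀ y ∈ U, ∀ w, pull (connection G) F B y w 4 0 = 0)
    (ht' : ∀ y ∈ U', ∀ w, pull (connection G') F' B' y w 4 0 = 0)
    (hD : ∀ y ∈ U, localD (pull (connection G) F (secondFrame G F B)) y ≠ 0)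
    (hD' : ∀ y ∈ U', localD (pull (connection G') F' (secondFrame G' F' B')) y ≠ 0)
    (jG : MatJetEq (F y₀) 3 G G') (jF : ∀ i, JetEq y₀ 4 (fun y => F y i) (fun y => F' y i))
    (jB : MatJetEq y₀ 3 B B') : canonicalFrame G F B y₀ = canonicalFrame G' F' B' y₀ := by
  obtain ⟨a1, a2, a3, a4, a5⟩ := secondFrame_spec hS hB ht
  obtain ⟨a1', a2', a3', a4', a5'⟩ := secondFrame_spec hS' hB' ht'
  obtain ⟨b1, b2, -, -⟩ := thirdFrame_spec hS a1 a2 a3 hD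
  obtain ⟨b1', b2', -, -⟩ := thirdFrame_spec hS' a1' a2' a3' hD'
  have h0 : (G (F y₀)).det ≠ 0 := hS.metric.det_ne _ (hS.mapsTo hy)
  have c := fun k => JetEq.const (y₀ := y₀) (k := k) 0
  -- Orders along the stages: the frames have equal jets of orders 3, 2, 1, 0, and their forms of
  -- orders 2, 1, 0.
  have j0 := formJetEq_pull (k := 2) hS.isOpen hS'.isOpen hy hy' hB hB' h0 jG
    (fun i => (jF i).pred) jB
  obtain ⟨l1, l2, l3⟩ := lam_jet (firstOrderForm hS hB ht) (firstOrderForm hS' hB' ht') hy j0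
  have j1 : MatJetEq y₀ 2 (secondFrame G F B) (secondFrame G' F' B') :=
    jB.pred.mul (unipotent_jet l2.neg (c 2) (c 2) (c 2) (c 2) (c 2))
  have k1 := formJetEq_pull (k := 1) hS.isOpen hS'.isOpen hy hy' a1 a1' h0 jG.pred
    (fun i => (jF i).pred.pred) j1
  -- The fiber parameters to order 1 need λ_22 and λ_33 to order 2, one more than the form of the
  -- second-order frame provides. These functions coincide with those of the first-order frame, for
  -- which the order is available.
  have m1 : JetEq y₀ 2 (lam22 (pull (connection G) F (secondFrame G F B)))
      (lam22 (pull (connection G') F' (secondFrame G' F' B'))) := by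
    refine l1.congr ?_ ?_
    · filter_upwards [hS.isOpen.mem_nhds hy] with y hy using a4 y hy
    · filter_upwards [hS'.isOpen.mem_nhds hy'] with y hy using a4' y hy
  have m3 : JetEq y₀ 2 (lam33 (pull (connection G) F (secondFrame G F B)))
      (lam33 (pull (connection G') F' (secondFrame G' F' B'))) := by
    refine l3.congr ?_ ?_
    · filter_upwards [hS.isOpen.mem_nhds hy] with y hy using a5 y hy
    · filter_upwards [hS'.isOpen.mem_nhds hy'] with y hy using a5' y hy
  have q := fiberParams_jet (firstOrderForm hS a1 a2) (firstOrderForm hS' a1' a2') hy k1 m1 m3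
    (hD y₀ hy)
  have j2 : MatJetEq y₀ 1 (thirdFrame G F (secondFrame G F B))
      (thirdFrame G' F' (secondFrame G' F' B')) :=
    j1.pred.mul (unipotent_jet (c 1) (q 0) (q 1) (q 2) (q 3) (c 1))
  have k2 := formJetEq_pull (k := 0) hS.isOpen hS'.isOpen hy hy' b1 b1' h0 jG.pred.pred
    (fun i => (jF i).pred.pred.pred) j2
  have r := rayTrace_jet (firstOrderForm hS b1 b2) (firstOrderForm hS' b1' b2') hy k2
  have j3 : MatJetEq y₀ 0 (canonicalFrame G F B) (canonicalFrame G' F' B') :=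
    j2.pred.mul (unipotent_jet (c 0) (c 0) (c 0) (c 0) (c 0) ((JetEq.const _).mul r))
  exact j3.value

end Jets

/-! ### Canonical frame fields on the hypersurface -/

theorem localDom_mono {M : Type u} [TopologicalSpace M] {N : Type v} [TopologicalSpace N]
    {γ : Gauge M} {f : N → M} {ψ : OpenPartialHomeomorph N (Fin 3 → ℝ)} {O O' : Set N}
    (h : O ⊆ O') : localDom γ f ψ O ⊆ localDom γ f ψ O' :=
  fun _ hy => ⟨hy.1, h hy.2.1, hy.2.2⟩

theorem rescaling_mul (k a b k' a' b' : ℝ) :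
    rescaling k a b * rescaling k' a' b' = rescaling (k * k') (a * a') (b * b') := by
  rw [rescaling, rescaling, Matrix.diagonal_mul_diagonal, rescaling]
  congr 1
  ext i
  fin_cases i <;> simp [mul_comm]

section Global
variable {M : Type u} [TopologicalSpace M] [ChartedSpace (Fin 4 → ℝ) M]
  [IsManifold 𝓘(ℝ, Fin 4 → ℝ) ∞ M]
variable {N : Type v} [TopologicalSpace N] [ChartedSpace (Fin 3 → ℝ) N]
  [IsManifold 𝓘(ℝ, Fin 3 → ℝ) ∞ N]
variable {c : ConformalStructure M} {f : N → M}

/-- The canonical frame, in local coordinates, constructed from seeds. -/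
noncomputable def seededFrame (G : (Fin 4 → ℝ) → Matrix (Fin 4) (Fin 4) ℝ)
    (F : (Fin 3 → ℝ) → Fin 4 → ℝ) (s u v : Fin 3 → ℝ) (z : Fin 4 → ℝ) :
    (Fin 3 → ℝ) → Matrix (Fin 6) (Fin 6) ℝ :=
  canonicalFrame G F fun y => extendBasis (seedBasis G F s u v z y)

section Seeded
variable (hf : IsLightlikeHypersurface c f) (hD : DNonvanishing c f)
  {γ : Gauge M} {ψ : OpenPartialHomeomorph N (Fin 3 → ℝ)} (hγ : γ ∈ c.gauges)
  (hψ : ψ ∈ IsManifold.maximalAtlas 𝓘(ℝ, Fin 3 → ℝ) ∞ N)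
  {W : Set (Fin 3 → ℝ)} (hW : IsOpen W) (hWs : W ⊆ localDom γ f ψ Set.univ)
  {s u v : Fin 3 → ℝ} {z : Fin 4 → ℝ}
  (hs : ∀ y ∈ W, SeedAt γ.metric (localMap γ f ψ) s u v z y)
include hf hD hγ hψ hW hWs hs

theorem seeded_localD : ∀ y ∈ W, localD (pull (connection γ.metric) (localMap γ f ψ)
    (secondFrame γ.metric (localMap γ f ψ) fun y =>
      extendBasis (seedBasis γ.metric (localMap γ f ψ) s u v z y))) y ≠ 0 := by
  have hS := (localSurface hψ hf hγ isOpen_univ).mono hW hWs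
  exact fun y hy => secondFrame_localD hf hD hγ hψ hW hWs
    (seedBasis_localFrame hS subset_rfl hs) (fun y hy w => seedBasis_tangent hS hs hy w) hy

theorem seededFrame_spec :
    LocalFrame γ.metric (localMap γ f ψ) W (seededFrame γ.metric (localMap γ f ψ) s u v z) ∧
    LocalCanonical (pull (connection γ.metric) (localMap γ f ψ)
      (seededFrame γ.metric (localMap γ f ψ) s u v z)) W := by
  have hS := (localSurface hψ hf hγ isOpen_univ).mono hW hWs
  exact canonicalFrame_spec hS (seedBasis_localFrame hS subset_rfl hs)
    (fun y hy w => seedBasis_tangent hS hs hy w) (seeded_localD hf hD hγ hψ hW hWs hs)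

/-- A canonical frame field differs from the constructed one by a rescaling. -/
theorem IsCanonical.eq_seededFrame {O : Set N} (hO : IsOpen O) (hWO : W ⊆ localDom γ f ψ O)
    {A : Gauge M → N → Matrix (Fin 6) (Fin 6) ℝ} (hA : IsCanonical c f O A) {y} (hy : y ∈ W) :
    ∃ k a b : ℝ, k ≠ 0 ∧ a ≠ 0 ∧ b ≠ 0 ∧
      seededFrame γ.metric (localMap γ f ψ) s u v z y = A γ (ψ.symm y) * rescaling k a b := by
  obtain ⟨h1, h2⟩ := seededFrame_spec hf hD hγ hψ hW hWs hs
  obtain ⟨hk, ha, hb, e⟩ := LocalCanonical.unique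
    ((localSurface hψ hf hγ isOpen_univ).mono hW hWs)
    ((localFrame hψ hγ hA.1.1.1.1).mono hWO) h1 ((hA.localCanonical hf hO hγ hψ).mono hWO) h2
    (fun y hy => localD_ne hf hD hγ hψ hO hA.1.1 (hWO hy)) hy rfl
  exact ⟨_, _, _, hk, ha, hb, e⟩

end Seeded

theorem exists_isCanonical (hf : IsLightlikeHypersurface c f) (hD : DNonvanishing c f) (p : N) :
    ∃ O : Set N, IsOpen O ∧ p ∈ O ∧ ∃ A, IsCanonical c f O A := by
  obtain ⟨γ, hγ, hp⟩ := c.cover (f p)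
  obtain ⟨ψ, hψ, hpψ⟩ := exists_chart p
  have hS := localSurface hψ hf hγ (isOpen_univ (X := N))
  have hy : ψ p ∈ localDom γ f ψ Set.univ := mem_localDom (Set.mem_univ p) hpψ hp
  obtain ⟨s, u, v, z, h⟩ := exists_seedAt hS hy
  obtain ⟨W, hWs, hW, hyW, hs⟩ := exists_seed_domain hS hy h
  obtain ⟨h1, h2⟩ := seededFrame_spec hf hD hγ hψ hW hWs hs
  exact ⟨_, ψ.isOpen_inter_preimage hW, ⟨hpψ, hyW⟩, _,
    canonical_globalFrame hf hD hγ hψ hW hWs h1 h2⟩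

theorem IsCanonical.rescale (hf : IsLightlikeHypersurface c f) {O : Set N} (hO : IsOpen O)
    {A : Gauge M → N → Matrix (Fin 6) (Fin 6) ℝ} (hA : IsCanonical c f O A) {k a b : N → ℝ}
    (hk : IsScale O k) (ha : IsScale O a) (hb : IsScale O b) :
    IsCanonical c f O (fun γ p => A γ p * rescaling (k p) (a p) (b p)) := by
  have hF := hA.1.1.1.1
  have loc : ∀ γ ∈ c.gauges, ∀ ψ ∈ IsManifold.maximalAtlas 𝓘(ℝ, Fin 3 → ℝ) ∞ N,
      LocalFrame γ.metric (localMap γ f ψ) (localDom γ f ψ O) (fun y => A γ (ψ.symm y)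
        * rescaling (k (ψ.symm y)) (a (ψ.symm y)) (b (ψ.symm y))) ∧
      LocalCanonical (pull (connection γ.metric) (localMap γ f ψ) fun y => A γ (ψ.symm y)
        * rescaling (k (ψ.symm y)) (a (ψ.symm y)) (b (ψ.symm y))) (localDom γ f ψ O) := by
    intro γ hγ ψ hψ
    have sm : ∀ {k : N → ℝ}, IsScale O k → ContDiffOn ℝ ∞ (fun y => k (ψ.symm y))
        (localDom γ f ψ O) := fun hk =>
      chart_symm_smoothOn hψ (hk.1.mono Set.inter_subset_left)
    have nz : ∀ {k : N → ℝ}, IsScale O k → ∀ y ∈ localDom γ f ψ O, k (ψ.symm y) ≠ 0 :=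
      fun hk y hy => hk.2 _ hy.2.1
    exact ⟨(localFrame hψ hγ hF).mul_rescaling (sm hk) (sm ha) (sm hb) (nz hk) (nz ha) (nz hb),
      LocalCanonical.rescale (localSurface hψ hf hγ hO) (localFrame hψ hγ hF) (sm hk) (sm ha)
        (sm hb) (nz hk) (nz ha) (nz hb) (hA.localCanonical hf hO hγ hψ)⟩
  have hF' : IsFrameField c f O (fun γ p => A γ p * rescaling (k p) (a p) (b p)) := by
    refine ⟨fun γ hγ i j => ?_, fun γ hγ γ' hγ' s hs p hp h1 h2 => ?_, fun γ hγ p hp h1 i hi => ?_,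
      fun γ hγ p hp h1 => ?_, fun γ hγ p hp h1 => ?_⟩
    · intro p hp
      obtain ⟨ψ, hψ, hpψ⟩ := exists_chart p
      have h := chart_smoothOn hψ ((loc γ hγ ψ hψ).1.smooth i j)
      have ho : IsOpen (ψ.source ∩ ψ ⁻¹' localDom γ f ψ O) :=
        ψ.isOpen_inter_preimage (localDom_open hf.smooth.continuous hO)
      have hm : ψ.source ∩ ψ ⁻¹' localDom γ f ψ O ∈ nhds p :=
        ho.mem_nhds ⟨hpψ, mem_localDom hp.1 hpψ hp.2⟩
      refine ((h.contMDiffAt hm).congr_of_eventuallyEq ?_).contMDiffWithinAt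
      filter_upwards [hm] with q hq
      rw [ψ.left_inv hq.1]
    · simp only [hF.gauge_change γ hγ γ' hγ' s hs p hp h1 h2, mul_assoc]
    all_goals
      obtain ⟨ψ, hψ, hpψ⟩ := exists_chart p
      have h := (loc γ hγ ψ hψ).1
      have hy := mem_localDom hp hpψ h1
    · have := h.vertex _ hy i hi
      rwa [ψ.left_inv hpψ] at this
    · have := h.gram _ hy
      rwa [localMap, ψ.left_inv hpψ] at this
    · have := h.oriented _ hy
      rwa [ψ.left_inv hpψ] at this
  refine isCanonical_of_local hf hO hF' fun p hp => ?_
  obtain ⟨γ, hγ, h1⟩ := c.cover (f p)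
  obtain ⟨ψ, hψ, hpψ⟩ := exists_chart p
  have h := (loc γ hγ ψ hψ).2
  have hy := mem_localDom hp hpψ h1
  exact ⟨γ, hγ, ψ, hψ, hpψ, h1, h.tangent _ hy, h.second _ hy, h.third _ hy, h.trace _ hy⟩

theorem IsCanonical.exists_rescaling (hf : IsLightlikeHypersurface c f) (hD : DNonvanishing c f)
    {O : Set N} (hO : IsOpen O) {A A' : Gauge M → N → Matrix (Fin 6) (Fin 6) ℝ}
    (hA : IsCanonical c f O A) (hA' : IsCanonical c f O A') :
    ∃ k a b : N → ℝ, IsScale O k ∧ IsScale O a ∧ IsScale O b ∧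
      ∀ γ ∈ c.gauges, ∀ p ∈ O, f p ∈ γ.chart.source →
        A' γ p = A γ p * rescaling (k p) (a p) (b p) := by
  have hF := hA.1.1.1.1
  have hF' := hA'.1.1.1.1
  choose γ₀ hγ₀ hp₀ using fun p => c.cover (f p)
  let m : N → Matrix (Fin 6) (Fin 6) ℝ := fun p => (A (γ₀ p) p)⁻¹ * A' (γ₀ p) p
  -- The change of gauge multiplies both frames on the left and cancels in the transition matrix.
  have hm : ∀ γ ∈ c.gauges, ∀ p ∈ O, f p ∈ γ.chart.source → m p = (A γ p)⁻¹ * A' γ p := by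
    intro γ hγ p hp h1
    obtain ⟨s, hs⟩ := c.conformal γ hγ (γ₀ p) (hγ₀ p)
    have hd := gaugeChange_det hγ (hγ₀ p) hs (chart_mem_overlap h1 (hp₀ p))
    rw [hF.gauge_change γ hγ _ (hγ₀ p) s hs p hp h1 (hp₀ p),
      hF'.gauge_change γ hγ _ (hγ₀ p) s hs p hp h1 (hp₀ p), Matrix.mul_inv_rev, mul_assoc,
      Matrix.nonsing_inv_mul_cancel_left _ _ (isUnit_iff_ne_zero.2 hd)]
  have key : ∀ γ ∈ c.gauges, ∀ p ∈ O, f p ∈ γ.chart.source → m p 0 0 ≠ 0 ∧ m p 1 1 ≠ 0 ∧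
      m p 2 2 ≠ 0 ∧ A' γ p = A γ p * rescaling (m p 0 0) (m p 1 1) (m p 2 2) := by
    intro γ hγ p hp h1
    obtain ⟨ψ, hψ, hpψ⟩ := exists_chart p
    have := LocalCanonical.unique (localSurface hψ hf hγ hO) (localFrame hψ hγ hF)
      (localFrame hψ hγ hF') (hA.localCanonical hf hO hγ hψ) (hA'.localCanonical hf hO hγ hψ)
      (fun y hy => localD_ne hf hD hγ hψ hO hA.1.1 hy) (mem_localDom hp hpψ h1) rfl
    rw [ψ.left_inv hpψ, ← hm γ hγ p hp h1] at this
    exact this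
  -- Smoothness is local: near each point the transition matrix is computed in the one gauge chosen
  -- at that point.
  have sm : ∀ i j, ContMDiffOn 𝓘(ℝ, Fin 3 → ℝ) 𝓘(ℝ, ℝ) ∞ (fun p => m p i j) O := by
    intro i j p hp
    obtain ⟨ψ, hψ, hpψ⟩ := exists_chart p
    have l := localFrame hψ (hγ₀ p) hF (f := f)
    have h := chart_smoothOn hψ
      (((l.smooth.inv fun _ => l.det_ne).mul (localFrame hψ (hγ₀ p) hF').smooth) i j)
    have ho : IsOpen (ψ.source ∩ ψ ⁻¹' localDom (γ₀ p) f ψ O) :=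
      ψ.isOpen_inter_preimage (localDom_open hf.smooth.continuous hO)
    have hn : ψ.source ∩ ψ ⁻¹' localDom (γ₀ p) f ψ O ∈ nhds p :=
      ho.mem_nhds ⟨hpψ, mem_localDom hp hpψ (hp₀ p)⟩
    refine ((h.contMDiffAt hn).congr_of_eventuallyEq ?_).contMDiffWithinAt
    filter_upwards [hn] with q hq
    have hq2 := hq.2.2
    rw [Set.mem_preimage, ψ.left_inv hq.1] at hq2
    rw [hm (γ₀ p) (hγ₀ p) q hq2.1 hq2.2, ψ.left_inv hq.1]
  refine ⟨fun p => m p 0 0, fun p => m p 1 1, fun p => m p 2 2,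
    ⟨sm 0 0, fun p hp => ?_⟩, ⟨sm 1 1, fun p hp => ?_⟩, ⟨sm 2 2, fun p hp => ?_⟩,
    fun γ hγ p hp h1 => (key γ hγ p hp h1).2.2.2⟩
  · exact (key _ (hγ₀ p) p hp (hp₀ p)).1
  · exact (key _ (hγ₀ p) p hp (hp₀ p)).2.1
  · exact (key _ (hγ₀ p) p hp (hp₀ p)).2.2.1

end Global

theorem jetEq_apply {n m k : ℕ} {F F' : (Fin n → ℝ) → Fin m → ℝ} {y₀ : Fin n → ℝ}
    (hF : ∀ i, ContDiffAt ℝ ∞ (fun y => F y i) y₀) (hF' : ∀ i, ContDiffAt ℝ ∞ (fun y => F' y i) y₀)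
    (h : ∀ j ≤ k, iteratedFDeriv ℝ j F y₀ = iteratedFDeriv ℝ j F' y₀) (i) :
    JetEq y₀ k (fun y => F y i) (fun y => F' y i) := by
  refine JetEq.of_iteratedFDeriv (hF i) (hF' i) fun j hj => ?_
  have key : ∀ {Φ : (Fin n → ℝ) → Fin m → ℝ}, (∀ i, ContDiffAt ℝ ∞ (fun y => Φ y i) y₀) →
      iteratedFDeriv ℝ j (fun y => Φ y i) y₀
        = (ContinuousLinearMap.proj (R := ℝ) i).compContinuousMultilinearMap
          (iteratedFDeriv ℝ j Φ y₀) := by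
    intro Φ hΦ
    have hd : ContDiffAt ℝ j Φ y₀ := (contDiffAt_pi.2 hΦ).of_le (by exact_mod_cast le_top)
    exact (ContinuousLinearMap.proj (R := ℝ) (φ := fun _ : Fin m => ℝ) i).iteratedFDeriv_comp_left hd
      le_rfl
  rw [key hF, key hF', h j hj]

/-! ### Two hypersurfaces with the same data of fourth order -/

section Comparison
variable {M : Type u} [TopologicalSpace M] [ChartedSpace (Fin 4 → ℝ) M]
  [IsManifold 𝓘(ℝ, Fin 4 → ℝ) ∞ M]
variable {N : Type v} [TopologicalSpace N] [ChartedSpace (Fin 3 → ℝ) N]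
  [IsManifold 𝓘(ℝ, Fin 3 → ℝ) ∞ N]
variable {M' : Type u} [TopologicalSpace M'] [ChartedSpace (Fin 4 → ℝ) M']
  [IsManifold 𝓘(ℝ, Fin 4 → ℝ) ∞ M']
variable {N' : Type v} [TopologicalSpace N'] [ChartedSpace (Fin 3 → ℝ) N']
  [IsManifold 𝓘(ℝ, Fin 3 → ℝ) ∞ N']

/-- The canonical frames constructed from the same seeds coincide at the point, and by uniqueness
each given canonical frame is a rescaling of the constructed one. -/
theorem IsCanonical.eq_of_sameFourthOrder {c : ConformalStructure M} {f : N → M}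
    {c' : ConformalStructure M'} {f' : N' → M'}
    (hf : IsLightlikeHypersurface c f) (hD : DNonvanishing c f)
    (hf' : IsLightlikeHypersurface c' f') (hD' : DNonvanishing c' f') {O : Set N} {O' : Set N'}
    {A : Gauge M → N → Matrix (Fin 6) (Fin 6) ℝ} {A' : Gauge M' → N' → Matrix (Fin 6) (Fin 6) ℝ}
    (hO : IsOpen O) (hO' : IsOpen O') (hA : IsCanonical c f O A) (hA' : IsCanonical c' f' O' A')
    {p : N} (hp : p ∈ O) {p' : N'} (hp' : p' ∈ O') {γ : Gauge M} (hγ : γ ∈ c.gauges)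
    {γ' : Gauge M'} (hγ' : γ' ∈ c'.gauges) (hpγ : f p ∈ γ.chart.source)
    (hpγ' : f' p' ∈ γ'.chart.source) (h : SameFourthOrder γ f p γ' f' p') :
    ∃ k a b : ℝ, k ≠ 0 ∧ a ≠ 0 ∧ b ≠ 0 ∧ A' γ' p' = A γ p * rescaling k a b := by
  obtain ⟨⟨ψ, hψ, ψ', hψ', hpψ, hpψ', hpp, jF⟩, jG⟩ := h
  have hy := mem_localDom (ψ := ψ) hp hpψ hpγ
  have hy' := mem_localDom (ψ := ψ') hp' hpψ' hpγ'
  have e0 : localMap γ f ψ (ψ p) = γ.chart (f p) := by rw [localMap, ψ.left_inv hpψ]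
  have e0' : localMap γ' f' ψ' (ψ' p') = γ'.chart (f' p') := by rw [localMap, ψ'.left_inv hpψ']
  have hS := localSurface hψ hf hγ hO
  have hS' := localSurface hψ' hf' hγ' hO'
  have eA : A γ p = A γ (ψ.symm (ψ p)) := by rw [ψ.left_inv hpψ]
  have eA' : A' γ' p' = A' γ' (ψ'.symm (ψ' p')) := by rw [ψ'.left_inv hpψ']
  rw [eA, eA']
  rw [← hpp] at hy' jF e0' ⊢
  have kF := jetEq_apply (hS.contDiffAt hy) (hS'.contDiffAt hy') jF
  have e1 : localMap γ' f' ψ' (ψ p) = localMap γ f ψ (ψ p) := funext fun i => (kF i).value.symm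
  rw [← e0, ← e0', e1] at jG
  have kG : MatJetEq (localMap γ f ψ (ψ p)) 3 γ.metric γ'.metric := fun i j =>
    JetEq.of_iteratedFDeriv (hS.metric_contDiffAt hy i j) (e1 ▸ hS'.metric_contDiffAt hy' i j)
      (jG i j)
  obtain ⟨s, u, v, z, hs⟩ := exists_seedAt hS hy
  -- Validity of seeds depends only on the jets, so seeds found for one hypersurface also serve the
  -- other.
  have hs' := SeedAt.congr kG kF hs
  have kB := (seedBasis_jet kG kF hs).extendBasis
  obtain ⟨W, hWs, hW, hyW, hs⟩ := exists_seed_domain hS hy hs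
  obtain ⟨W', hWs', hW', hyW', hs'⟩ := exists_seed_domain hS' hy' hs'
  have hWu := hWs.trans (localDom_mono (Set.subset_univ O))
  have hWu' := hWs'.trans (localDom_mono (Set.subset_univ O'))
  have hSW := hS.mono hW hWs
  have hSW' := hS'.mono hW' hWs'
  have e : seededFrame γ.metric (localMap γ f ψ) s u v z (ψ p)
      = seededFrame γ'.metric (localMap γ' f' ψ') s u v z (ψ p) :=
    canonicalFrame_eq hSW hSW' hyW hyW' (seedBasis_localFrame hSW subset_rfl hs)
      (seedBasis_localFrame hSW' subset_rfl hs') (fun y hy w => seedBasis_tangent hSW hs hy w)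
      (fun y hy w => seedBasis_tangent hSW' hs' hy w) (seeded_localD hf hD hγ hψ hW hWu hs)
      (seeded_localD hf' hD' hγ' hψ' hW' hWu' hs') kG kF kB
  obtain ⟨k, a, b, hk, ha, hb, h1⟩ := hA.eq_seededFrame hf hD hγ hψ hW hWu hs hO hWs hyW
  obtain ⟨k', a', b', hk', ha', hb', h2⟩ :=
    hA'.eq_seededFrame hf' hD' hγ' hψ' hW' hWu' hs' hO' hWs' hyW'
  refine ⟨k * k'⁻¹, a * a'⁻¹, b * b'⁻¹, mul_ne_zero hk (inv_ne_zero hk'),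
    mul_ne_zero ha (inv_ne_zero ha'), mul_ne_zero hb (inv_ne_zero hb'), ?_⟩
  rw [← rescaling_mul, ← mul_assoc, ← h1, e, h2, mul_assoc, rescaling_mul_inv hk' ha' hb', mul_one]

end Comparison
end CO22

theorem theorem6
    {M : Type u} [TopologicalSpace M] [ChartedSpace (Fin 4 → ℝ) M]
    [IsManifold 𝓘(ℝ, Fin 4 → ℝ) ∞ M]
    {N : Type v} [TopologicalSpace N] [ChartedSpace (Fin 3 → ℝ) N]
    [IsManifold 𝓘(ℝ, Fin 3 → ℝ) ∞ N]
    (c : ConformalStructure M) (f : N → M)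
    (hf : IsLightlikeHypersurface c f) (hD : DNonvanishing c f) :
    -- canonical frames exist, in smooth fields, near every point of the hypersurface
    (∀ p : N, ∃ O : Set N, IsOpen O ∧ p ∈ O ∧ ∃ A, IsCanonical c f O A) ∧
    -- the group of rescalings acts on the canonical frames
    (∀ (O : Set N) (A : Gauge M → N → Matrix (Fin 6) (Fin 6) ℝ) (k a b : N → ℝ),
      IsOpen O → IsCanonical c f O A → IsScale O k → IsScale O a → IsScale O b →
        IsCanonical c f O (fun γ p => A γ p * rescaling (k p) (a p) (b p))) ∧
    -- and is transitive: all the vertices are uniquely determined points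
    (∀ (O : Set N) (A A' : Gauge M → N → Matrix (Fin 6) (Fin 6) ℝ),
      IsOpen O → IsCanonical c f O A → IsCanonical c f O A' →
        ∃ k a b : N → ℝ, IsScale O k ∧ IsScale O a ∧ IsScale O b ∧
          ∀ γ ∈ c.gauges, ∀ p ∈ O, f p ∈ γ.chart.source →
            A' γ p = A γ p * rescaling (k p) (a p) (b p)) ∧
    -- the canonical frames at a point depend only on the data of fourth order at this point
    (∀ (M' : Type u) [TopologicalSpace M'] [ChartedSpace (Fin 4 → ℝ) M']
      [IsManifold 𝓘(ℝ, Fin 4 → ℝ) ∞ M']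
      (N' : Type v) [TopologicalSpace N'] [ChartedSpace (Fin 3 → ℝ) N']
      [IsManifold 𝓘(ℝ, Fin 3 → ℝ) ∞ N']
      (c' : ConformalStructure M') (f' : N' → M'),
      IsLightlikeHypersurface c' f' → DNonvanishing c' f' →
      ∀ (O : Set N) (O' : Set N') (A : Gauge M → N → Matrix (Fin 6) (Fin 6) ℝ)
        (A' : Gauge M' → N' → Matrix (Fin 6) (Fin 6) ℝ),
        IsOpen O → IsOpen O' → IsCanonical c f O A → IsCanonical c' f' O' A' →
        ∀ p ∈ O, ∀ p' ∈ O', ∀ γ ∈ c.gauges, ∀ γ' ∈ c'.gauges,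
          f p ∈ γ.chart.source → f' p' ∈ γ'.chart.source →
          SameFourthOrder γ f p γ' f' p' →
            ∃ k a b : ℝ, k ≠ 0 ∧ a ≠ 0 ∧ b ≠ 0 ∧ A' γ' p' = A γ p * rescaling k a b) :=
  ⟨exists_isCanonical hf hD, fun _ _ _ _ _ hO hA hk ha hb => hA.rescale hf hO hk ha hb,
    fun _ _ _ hO hA hA' => hA.exists_rescaling hf hD hO hA',
    fun _ _ _ _ _ _ _ _ _ _ hf' hD' _ _ _ _ hO hO' hA hA' _ hp _ hp' _ hγ _ hγ' h h' hj =>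
      IsCanonical.eq_of_sameFourthOrder hf hD hf' hD' hO hO' hA hA' hp hp' hγ hγ' h h' hj⟩
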